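/- **Setting.** Write points and vectors of the plane as complex numbers, $I=[-1,1]$, $P^-=\{x+iy: |x|\le 1,\ y\le 0\}$. Consider on a time interval $[0,T]$, $T>0$, a classical solution of the two-dimensional, inviscid, incompressible, irrotational water wave equations with gravity $-i$, density $1$, no surface tension and zero air pressure, in infinite depth between the vertical walls $x=\pm1$, symmetric under $x\mapsto -x$: in the fluid region $\Omega(t)$ one has $v_t+v\cdot\nabla v=-i-\nabla P$, $\operatorname{div}v=\operatorname{curl}v=0$; $\Omega(t)$ is the open connected region between the walls and below the free surface $\Sigma(t)$; $P=0$ on $\Sigma(t)$; $v$ is tangent to the walls; $v\to0$ as $y\to-\infty$. The surface is a simple arc $\Sigma(t)=\{z(\alpha,t):\alpha\in I\}$, $z$ continuous, going from the wall $x=-1$ to the wall $x=1$, parametrized by the Lagrangian variable, $z_t=v(z,t)$, with a nonzero derivative $z_\alpha$ at almost every $\alpha$; angled crests and arbitrary angles at the walls are allowed. The functions $v,v_t,\nabla v,P,\nabla P$ extend continuously to the closed fluid region. Fix $t\in[0,T]$. Let $\Phi:\overline{\Omega(t)}\to P^-$ be the Riemann mapping, symmetric under $x\mapsto-x$, taking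 $z(\pm1,t)$ to $\pm1$, $\infty$ to $\infty$ and $\Sigma(t)$ to $I\times\{0\}$; assume that $\Phi_z$ extends continuously to $\overline{\Omega(t)}$. Put $h(\alpha)=\Phi(z(\alpha,t))$, $Z=z\circ h^{-1}$, $Z_t=z_t\circ h^{-1}$, and write $_{,\alpha'}$ for the derivative in $\alpha'\in I$; assume that $Z$ is absolutely continuous. Call $\alpha\in I$ regular if $z_\alpha(\alpha)$ exists and is nonzero (one-sided at $\alpha=\pm1$); there let $\vec n=iz_\alpha/|z_\alpha|$ be the outward unit normal and $$\frac{\partial P}{\partial\vec n}=\vec n\cdot\nabla P,\quad \mathfrak a=-\frac{\partial P}{\partial \vec n}\frac1{|z_\alpha|},\quad \mathcal A=(\mathfrak a h_\alpha)\circ h^{-1},\quad A_1=\mathcal A|Z_{,\alpha'}|^2 .$$ Let $\mathbb Hf(\alpha')=\frac1{2i}\,\mathrm{pv}\!\int_I\cot\big(\tfrac\pi2(\alpha'-\beta')\big)f(\beta')\,d\beta'$ (the principal value taken symmetrically for the $2$-periodic kernel) and $[f,\mathbb H]g=f\,\mathbb Hg-\mathbb H(fg)$. The Riemann mapping is called degenerate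 at $\alpha$ if $\Phi_z(z(\alpha,t))=0$. **Theorem.** 1. Let $\alpha'\in I$ be such that $h^{-1}(\alpha')$ is regular and $\Phi_z(Z(\alpha'))\ne0$. Then $Z_{,\alpha'}(\alpha')=1/\Phi_z(Z(\alpha'))$, the principal values $\mathbb H\bar Z_{t,\alpha'}$ and $\mathbb H(Z_t\bar Z_{t,\alpha'})$ exist at $\alpha'$, the integral below converges, and $$A_1=1+\operatorname{Im}\big(-[Z_t,\mathbb H]\bar Z_{t,\alpha'}\big)=1+\frac\pi8\int_I\frac{|Z_t(\alpha')-Z_t(\beta')|^2}{\sin^2(\frac\pi2(\alpha'-\beta'))}\,d\beta'\ \ge 1 .$$ 2. At every regular $\alpha$, $\nabla P=\frac{\partial P}{\partial\vec n}\vec n$ and $-\frac{\partial P}{\partial\vec n}=|z_\alpha|\mathfrak a\ge0$. If moreover $\Phi_z(z(\alpha,t))\ne0$, then $$-\frac{\partial P}{\partial \vec n}=\frac{A_1\circ h}{|Z_{,\alpha'}\circ h|}>0 .$$ 3. If $A_1$ is bounded above on the set of $\alpha'$ described in 1, then for every $\alpha\in I$: $\nabla P(z(\alpha,t),t)=0$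 if and only if $\Phi_z(z(\alpha,t))=0$. 4. (Corners.) Let $\alpha=\pm1$ be regular and let $\nu$ be the angle between the surface and the wall below it. If $\nu\neq\frac\pi2$, then $\Phi_z=0$, $\nabla P=0$ and $-\frac{\partial P}{\partial\vec n}=0$ at $z(\alpha,t)$. If $\nu=\frac\pi2$ and $z(\cdot,t)$ is $C^{1,\gamma}$ with nonvanishing derivative near $\alpha$ in $I$ for some $\gamma>0$, then $\Phi_z\neq0$, $\nabla P\ne0$ and $-\frac{\partial P}{\partial\vec n}>0$ there. 5. (Angled crests.) Let $\alpha\in(-1,1)$ and let $z(\cdot,t)$ have nonzero one-sided derivatives at $\alpha$. If the two branches of the surface meet at $z(\alpha,t)$ at an angle other than $\pi$, then $\Phi_z=0$ and $\nabla P=0$ at $z(\alpha,t)$. If the angle is $\pi$ and, for some $\gamma>0$, $z(\cdot,t)$ is $C^{1,\gamma}$ with nonvanishing derivative on a closed one-sided neighbourhood of $\alpha$ on either side, then $\Phi_z\ne0$ and $\nabla P\neq0$ there. -/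

import Mathlib

open Set Filter Topology MeasureTheory

noncomputable section

namespace CornerWave

/-- The parameter interval `I = [-1, 1]`. -/
abbrev I : Set ℝ := Icc (-1) 1

/-- The closed half strip `P⁻ = [-1, 1] × (-∞, 0]`. -/
def closedHalfStrip : Set ℂ := {w | |w.re| ≤ 1 ∧ w.im ≤ 0}

/-- The open half strip `(-1, 1) × (-∞, 0)`. -/
def openHalfStrip : Set ℂ := {w | |w.re| < 1 ∧ w.im < 0}

/-- The reflection `(x, y) ↦ (-x, y)` of the plane across the `y`-axis. -/
def refl (w : ℂ) : ℂ := -(starRingEnd ℂ) w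

/-- A classical solution on the time interval `[0, T]` of the two-dimensional irrotational water
wave equations with gravity `-j`, fluid density `1`, no surface tension and air pressure `0`, in
infinite depth between the vertical walls `x = -1` and `x = 1`, symmetric in the `y`-axis.
Points and vectors of the plane are complex numbers.

The surface may have angled crests and may meet the walls at any angle: the curve `z t` is only
required to be a simple continuous arc that has a nonzero derivative at almost every parameter. The
velocity and its first derivatives extend continuously to the surface and to the walls; `vt`, `Dv`
and `gradP` denote the time derivative and the space derivative of the velocity and the gradient of
the pressure, together with their continuous extensions to the closed fluid region. -/
structure WaterWave (T : ℝ) where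
  /-- the fluid region -/
  Ω : ℝ → Set ℂ
  /-- the free surface in the Lagrangian variable, `z t α` with `α ∈ I` -/
  z : ℝ → ℝ → ℂ
  /-- the velocity -/
  v : ℝ → ℂ → ℂ
  /-- the time derivative of the velocity -/
  vt : ℝ → ℂ → ℂ
  /-- the space derivative of the velocity -/
  Dv : ℝ → ℂ → (ℂ →L[ℝ] ℂ)
  /-- the pressure -/
  P : ℝ → ℂ → ℝ
  /-- the gradient of the pressure -/
  gradP : ℝ → ℂ → ℂ
  T_pos : 0 < T
  -- the free surface
  z_cont : ContinuousOn (fun p : ℝ × ℝ => z p.1 p.2) (Icc 0 T ×ˢ I)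
  z_inj : ∀ t ∈ Icc 0 T, InjOn (z t) I
  z_left : ∀ t ∈ Icc 0 T, (z t (-1)).re = -1
  z_right : ∀ t ∈ Icc 0 T, (z t 1).re = 1
  z_mid : ∀ t ∈ Icc 0 T, ∀ α ∈ Ioo (-1 : ℝ) 1, |(z t α).re| < 1
  z_symm : ∀ t ∈ Icc 0 T, ∀ α ∈ I, z t (-α) = refl (z t α)
  z_regular : ∀ t ∈ Icc 0 T, ∀ᵐ α ∂(volume.restrict I), ∃ d : ℂ, d ≠ 0 ∧ HasDerivAt (z t) d α
  -- the fluid region, which lies between the walls and below the free surface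
  Ω_open : ∀ t ∈ Icc 0 T, IsOpen (Ω t)
  Ω_conn : ∀ t ∈ Icc 0 T, IsConnected (Ω t)
  Ω_bdd : ∀ t ∈ Icc 0 T, ∃ c : ℝ, ∀ w ∈ Ω t, |w.re| < 1 ∧ w.im < c
  Ω_deep : ∀ t ∈ Icc 0 T, ∃ c : ℝ, ∀ w : ℂ, |w.re| < 1 → w.im < c → w ∈ Ω t
  Ω_frontier : ∀ t ∈ Icc 0 T, frontier (Ω t) =
    z t '' I ∪ {w | (w.re = -1 ∧ w.im ≤ (z t (-1)).im) ∨ (w.re = 1 ∧ w.im ≤ (z t 1).im)}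
  Ω_symm : ∀ t ∈ Icc 0 T, ∀ w ∈ Ω t, refl w ∈ Ω t
  -- regularity of the velocity up to the boundary
  v_cont : ContinuousOn (fun p : ℝ × ℂ => v p.1 p.2) {p | p.1 ∈ Icc 0 T ∧ p.2 ∈ closure (Ω p.1)}
  vt_cont : ContinuousOn (fun p : ℝ × ℂ => vt p.1 p.2) {p | p.1 ∈ Icc 0 T ∧ p.2 ∈ closure (Ω p.1)}
  Dv_cont : ∀ t ∈ Icc 0 T, ContinuousOn (Dv t) (closure (Ω t))
  v_deriv_time : ∀ t ∈ Icc 0 T, ∀ w ∈ Ω t,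
    HasDerivWithinAt (fun s => v s w) (vt t w) (Icc 0 T) t
  v_deriv_space : ∀ t ∈ Icc 0 T, ∀ w ∈ Ω t, HasFDerivAt (v t) (Dv t w) w
  v_symm : ∀ t ∈ Icc 0 T, ∀ w ∈ closure (Ω t), v t (refl w) = refl (v t w)
  -- the pressure
  P_cont : ∀ t ∈ Icc 0 T, ContinuousOn (P t) (closure (Ω t))
  gradP_cont : ∀ t ∈ Icc 0 T, ContinuousOn (gradP t) (closure (Ω t))
  P_deriv : ∀ t ∈ Icc 0 T, ∀ w ∈ Ω t, HasGradientAt (P t) (gradP t w) w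
  P_symm : ∀ t ∈ Icc 0 T, ∀ w ∈ closure (Ω t), P t (refl w) = P t w
  /-- the Euler equation `v_t + v · ∇v = -j - ∇P` -/
  euler : ∀ t ∈ Icc 0 T, ∀ w ∈ Ω t, vt t w + Dv t w (v t w) = -Complex.I - gradP t w
  /-- `div v = 0` -/
  div_free : ∀ t ∈ Icc 0 T, ∀ w ∈ Ω t, (Dv t w 1).re + (Dv t w Complex.I).im = 0
  /-- `curl v = 0` -/
  curl_free : ∀ t ∈ Icc 0 T, ∀ w ∈ Ω t, (Dv t w 1).im - (Dv t w Complex.I).re = 0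
  /-- `P = 0` on the free surface -/
  P_surface : ∀ t ∈ Icc 0 T, ∀ α ∈ I, P t (z t α) = 0
  /-- the free surface moves with the fluid: `z_t = v(z, t)` -/
  kinematic : ∀ t ∈ Icc 0 T, ∀ α ∈ I,
    HasDerivWithinAt (fun s => z s α) (v t (z t α)) (Icc 0 T) t
  /-- the velocity is tangent to the walls -/
  wall : ∀ t ∈ Icc 0 T, ∀ w ∈ closure (Ω t), |w.re| = 1 → (v t w).re = 0
  /-- `v → 0` as `y → -∞` -/
  decay : ∀ t ∈ Icc 0 T, ∀ ε > 0, ∃ R : ℝ, ∀ w ∈ Ω t, w.im < R → ‖v t w‖ < ε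

/-- `Φ` is the Riemann mapping of the region `Ω` below the arc `z` onto the half strip, extended to
the closures: it is biholomorphic inside, takes the upper corners to `-1` and `1` and `∞` to `∞`,
takes the surface to `I × {0}`, and is symmetric in the `y`-axis. -/
structure IsRiemannMap (Ω : Set ℂ) (z : ℝ → ℂ) (Φ : ℂ → ℂ) : Prop where
  holo : DifferentiableOn ℂ Φ Ω
  bij_inside : BijOn Φ Ω openHalfStrip
  cont : ContinuousOn Φ (closure Ω)
  bij : BijOn Φ (closure Ω) closedHalfStrip
  left : Φ (z (-1)) = -1
  right : Φ (z 1) = 1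
  infty : Tendsto Φ (cocompact ℂ ⊓ 𝓟 (closure Ω)) (cocompact ℂ)
  surface : ∀ α ∈ I, (Φ (z α)).im = 0
  symm : ∀ w ∈ closure Ω, Φ (refl w) = refl (Φ w)

/-! ### The periodic Hilbert transform -/

/-- The truncated periodic Hilbert transform: the part of `I` near the singularities of the
`2`-periodic kernel (those of `β` with `|sin (π (x - β) / 2)| ≤ ε`) is removed. -/
def truncHilbert (ε : ℝ) (f : ℝ → ℂ) (x : ℝ) : ℂ :=
  1 / (2 * Complex.I) *
    ∫ β in I ∩ {β | ε < |Real.sin (Real.pi / 2 * (x - β))|},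
      (Real.cot (Real.pi / 2 * (x - β)) : ℂ) * f β

/-- The principal value that defines `ℍ f (x)` exists. -/
def HilbertExists (f : ℝ → ℂ) (x : ℝ) : Prop :=
  IntegrableOn f I ∧ ∃ L : ℂ, Tendsto (fun ε => truncHilbert ε f x) (𝓝[>] 0) (𝓝 L)

/-- `ℍ f (x) = (1 / 2i) pv ∫_I cot (π (x - β) / 2) f(β) dβ`. -/
def hilbert (f : ℝ → ℂ) (x : ℝ) : ℂ :=
  limUnder (𝓝[>] (0 : ℝ)) (fun ε => truncHilbert ε f x)

/-- The commutator `[f, ℍ] g = f ℍ g - ℍ (f g)`. -/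
def hilbertComm (f g : ℝ → ℂ) (x : ℝ) : ℂ :=
  f x * hilbert g x - hilbert (fun β => f β * g β) x

/-- `f` is a `C^{1,γ}` arc on the interval `s` for some `γ > 0`, with nowhere vanishing
derivative. -/
def IsC1HolderArc (f : ℝ → ℂ) (s : Set ℝ) : Prop :=
  ∃ d : ℝ → ℂ, (∀ α ∈ s, HasDerivWithinAt f (d α) s α ∧ d α ≠ 0) ∧
    ∃ C γ : NNReal, 0 < γ ∧ HolderOnWith C γ d s

namespace WaterWave

variable {T : ℝ} (W : WaterWave T) (t : ℝ) (Φ : ℂ → ℂ)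

/-! ### Quantities in the Lagrangian variable -/

/-- `z_α`, one-sided at the corners `α = ±1`. -/
def zα (α : ℝ) : ℂ := derivWithin (W.z t) I α

/-- The surface has a nonzero derivative `z_α` at `α`, so that the tangent and the normal to the
surface exist there. -/
def IsRegularPoint (α : ℝ) : Prop :=
  α ∈ I ∧ DifferentiableWithinAt ℝ (W.z t) I α ∧ W.zα t α ≠ 0

/-- The outward unit normal `i z_α / |z_α|`. (The surface is traversed from the left wall to the
right one, with the fluid on its right-hand side.) -/
def normal (α : ℝ) : ℂ := Complex.I * W.zα t α / ‖W.zα t α‖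

/-- The outward normal derivative `∂P/∂n = n · ∇P` at `z(α, t)`. -/
def dPdn (α : ℝ) : ℝ := inner ℝ (W.normal t α) (W.gradP t (W.z t α))

/-- `𝔞 = -(∂P/∂n) / |z_α|`. -/
def a (α : ℝ) : ℝ := -W.dPdn t α / ‖W.zα t α‖

/-- The change of coordinates `h(α) = Φ(z(α, t))`, a map from `I` to `I`. -/
def h (α : ℝ) : ℝ := (Φ (W.z t α)).re

/-- `h_α`. -/
def hα (α : ℝ) : ℝ := derivWithin (W.h t Φ) I α

/-- The inverse `h⁻¹ : I → I`. -/
def hinv : ℝ → ℝ := Function.invFunOn (W.h t Φ) I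

/-! ### Quantities in the Riemannian variable -/

/-- `Z = z ∘ h⁻¹`. -/
def Z (x : ℝ) : ℂ := W.z t (W.hinv t Φ x)

/-- `Z_{,α'}`. -/
def Zα (x : ℝ) : ℂ := derivWithin (W.Z t Φ) I x

/-- `Z_t = z_t ∘ h⁻¹`, where `z_t(α, t) = v(z(α, t), t)`. -/
def Zt (x : ℝ) : ℂ := W.v t (W.z t (W.hinv t Φ x))

/-- `\bar Z_{t,α'}`, the derivative of the complex conjugate of `Z_t`. -/
def ZtbarDeriv (x : ℝ) : ℂ := derivWithin (fun y => (starRingEnd ℂ) (W.Zt t Φ y)) I x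

/-- `𝒜 = (𝔞 h_α) ∘ h⁻¹`. -/
def calA (x : ℝ) : ℝ := W.a t (W.hinv t Φ x) * W.hα t Φ (W.hinv t Φ x)

/-- `A₁ = 𝒜 |Z_{,α'}|²`. -/
def A₁ (x : ℝ) : ℝ := W.calA t Φ x * ‖W.Zα t Φ x‖ ^ 2

end WaterWave

end CornerWave

end

/-! Periodicity replaces the walls. By symmetry and tangency, velocity, acceleration and pressure
take equal values at mirror points of the two walls. Composed with the inverse Riemann mapping they
extend with period 2 from the half strip to the lower half plane, and Morera's theorem makes the
conjugate velocity and acceleration holomorphic across the walls. The outcome is recorded in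
`StripData`: the extended inverse mapping Ψ, the function φ = Φ_z∘Ψ with Ψ' = 1/φ, the conjugate
velocity G with G' = D/φ, the conjugate acceleration B, and a holomorphic S with S' = (i - B)/φ,
whose real part is P + |v|²/2 by Bernoulli's law.

Put N = i - B - conj(G) D, the conjugate of ∇P. On the real line P = 0, so Re S = |G|²/2, and
differentiation along the line gives Re(N/φ) = 0 wherever φ ≠ 0. For the imaginary part fix such an
x, let c = G(x) and take f(w) = S(w + x) - iw - conj(c) G(w + x). This function is 2-periodic, and
its real part on the line is |G(x + w) - c|²/2 up to a constant. For periodic holomorphic f of at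
most linear growth the integral of (Re f(β) - Re f(0))/sin²(πβ/2) over a period equals (4/π) Im
f'(0) (`tendsto_singular_integral`). Hence N = A₁ i φ, where A₁ is 1 plus a nonnegative quadratic
integral (`conjGrad_eq`). Integration by parts turns that integral into the commutator with the
Hilbert transform (`hilbert_formula`), and the change of variables h identifies this A₁ with the
defined one (`A₁_eq`).

To pass to degenerate points one needs φ ≠ 0 almost everywhere. Since Z is absolutely continuous,
1/φ is the Poisson integral of the boundary derivative of Ψ, so the curves Ψ(· - iε) have bounded
length over a period; by Fatou's lemma 1/φ cannot blow up on a set of positive measure. By density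
|Φ_z| ≤ |∇P| on the whole surface (`norm_φ_le`), and Ψ' = A₁ i/N almost everywhere is a positive
multiple of i∇P. Near a point with ∇P ≠ 0 the surface therefore has the continuous direction
i∇P/|∇P| (`direction`), shared by all one-sided tangents (`eq_of_hasDerivWithinAt`). An angle other
than π thus forces ∇P = 0 and then Φ_z = 0. At the wall, symmetry makes ∇P vertical, so a nonzero ∇P
requires a horizontal tangent. If A₁ is bounded, |∇P| = A₁|Φ_z| on a dense set gives the converse
implication in part 3.

Nondegeneracy at C^{1,γ} points is a local Kellogg theorem (`ne_zero_of_holder`). If φ(x₀) = 0, then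
1/φ blows up at x₀, and because the boundary direction is continuous there, a constant multiple of
1/φ takes its values in narrow sectors. Borel–Carathéodory applied to its logarithm bounds the
logarithmic derivative by (sector width)/(distance to the boundary). A first crude use shows that Ψ
is Hölder with exponent 1/2 at x₀; with that, the Hölder continuity of the direction makes the
sector width a power of the distance, the logarithmic derivative becomes integrable down to the
boundary, and 1/φ stays bounded on the vertical line through x₀, a contradiction. At a corner the
surface is first continued by reflection in the wall. -/

namespace StripWave

/-- The open lower half plane. -/
def lowerPlane : Set ℂ := {w | w.im < 0}

/-- The closed lower half plane. -/
def closedLowerPlane : Set ℂ := {w | w.im ≤ 0}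

theorem isOpen_lowerPlane : IsOpen lowerPlane := isOpen_lt Complex.continuous_im continuous_const

theorem lowerPlane_subset_closedLowerPlane : lowerPlane ⊆ closedLowerPlane :=
  fun w hw => (show w.im < 0 from hw).le

theorem convex_lowerPlane : Convex ℝ lowerPlane :=
  convex_halfSpace_im_lt 0

/-! ### Holomorphy across a vertical line, primitives -/

-- Morera's theorem. A rectangle that straddles the line is cut along it into two rectangles that
-- meet the line only in their boundary, where Cauchy's theorem needs no more than continuity. This
-- is what carries the extended functions across the walls.
open Complex in
theorem differentiableOn_of_off_vertical_line {U : Set ℂ} (hU : IsOpen U) {f : ℂ → ℂ}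
    (hf : ContinuousOn f U) (a : ℝ) (hd : ∀ w ∈ U, w.re ≠ a → DifferentiableAt ℂ f w) :
    DifferentiableOn ℂ f U := by
  refine (isConservativeOn_and_continuousOn_iff_isDifferentiableOn hU).1 ⟨fun z w hzw => ?_, hf⟩
  rw [← add_eq_zero_iff_eq_neg, wedgeIntegral_add_wedgeIntegral_eq]
  have key : ∀ z w : ℂ, Rectangle z w ⊆ U → a ∉ Ioo (min z.re w.re) (max z.re w.re) →
      (∫ x : ℝ in z.re..w.re, f (x + z.im * I)) - (∫ x : ℝ in z.re..w.re, f (x + w.im * I)) +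
      I • (∫ y : ℝ in z.im..w.im, f (w.re + y * I)) -
      I • (∫ y : ℝ in z.im..w.im, f (z.re + y * I)) = 0 := by
    intro z w hzw ha
    refine integral_boundary_rect_eq_zero_of_continuousOn_of_differentiableOn f z w
      (hf.mono hzw) fun p hp => (hd p (hzw ?_) ?_).differentiableWithinAt
    · exact ⟨Ioo_subset_Icc_self hp.1, Ioo_subset_Icc_self hp.2⟩
    · rintro rfl
      exact ha hp.1
  by_cases ha : a ∈ Ioo (min z.re w.re) (max z.re w.re)
  · have ha' : a ∈ uIcc (z.re) (w.re) := Ioo_subset_Icc_self ha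
    have hsub1 : Rectangle z (a + w.im * I) ⊆ Rectangle z w := by
      intro p hp
      rw [Rectangle, mem_reProdIm] at hp ⊢
      simp only [add_re, ofReal_re, mul_re, I_re, mul_zero, ofReal_im, I_im, mul_one, sub_self,
        add_zero, add_im, mul_im, zero_add] at hp
      exact ⟨uIcc_subset_uIcc left_mem_uIcc ha' hp.1, hp.2⟩
    have hsub2 : Rectangle (a + z.im * I) w ⊆ Rectangle z w := by
      intro p hp
      rw [Rectangle, mem_reProdIm] at hp ⊢
      simp only [add_re, ofReal_re, mul_re, I_re, mul_zero, ofReal_im, I_im, mul_one, sub_self,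
        add_zero, add_im, mul_im, zero_add] at hp
      exact ⟨uIcc_subset_uIcc ha' right_mem_uIcc hp.1, hp.2⟩
    have h1 := key z (a + w.im * I) (hsub1.trans hzw) (by simpa using fun h => h.le)
    have h2 := key (a + z.im * I) w (hsub2.trans hzw) (by simpa using fun h => h.le)
    simp only [add_re, ofReal_re, mul_re, I_re, mul_zero, ofReal_im, I_im, mul_one, sub_self,
        add_zero, add_im, mul_im, zero_add] at h1 h2
    have hint : ∀ (y : ℝ), y ∈ uIcc (z.im) (w.im) → ∀ x1 x2 : ℝ, x1 ∈ uIcc (z.re) (w.re) →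
        x2 ∈ uIcc (z.re) (w.re) → IntervalIntegrable (fun x : ℝ => f (x + y * I)) volume x1 x2 := by
      intro y hy x1 x2 h1 h2
      refine ContinuousOn.intervalIntegrable ((hf.mono hzw).comp (by fun_prop) fun x hx => ?_)
      rw [Rectangle, mem_reProdIm]
      simpa using ⟨uIcc_subset_uIcc h1 h2 hx, hy⟩
    have e1 := intervalIntegral.integral_add_adjacent_intervals
      (hint z.im left_mem_uIcc z.re a left_mem_uIcc ha') (hint z.im left_mem_uIcc a w.re ha' right_mem_uIcc)
    have e2 := intervalIntegral.integral_add_adjacent_intervals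
      (hint w.im right_mem_uIcc z.re a left_mem_uIcc ha')
      (hint w.im right_mem_uIcc a w.re ha' right_mem_uIcc)
    rw [← e1, ← e2]
    linear_combination h1 + h2
  · exact key z w hzw ha

-- The Cayley transform moves the problem to the unit disc, where holomorphic functions have
-- primitives.
open Complex in
theorem exists_primitive_lowerPlane {f : ℂ → ℂ} (hf : DifferentiableOn ℂ f lowerPlane) :
    ∃ g : ℂ → ℂ, ∀ w ∈ lowerPlane, HasDerivAt g (f w) w := by
  set C : ℂ → ℂ := fun ζ => -I * (1 + ζ) / (1 - ζ) with hC
  set K : ℂ → ℂ := fun w => (w + I) / (w - I) with hK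
  have hKne : ∀ w ∈ lowerPlane, w - I ≠ 0 := by
    intro w hw h
    have : w = I := by linear_combination h
    simp [this, lowerPlane] at hw
    linarith
  have hKd : ∀ w ∈ lowerPlane, HasDerivAt K (-2 * I / (w - I) ^ 2) w := by
    intro w hw
    have := ((hasDerivAt_id w).add_const I).div ((hasDerivAt_id w).sub_const I) (hKne w hw)
    exact this.congr_deriv (by simp only [id_eq]; ring)
  have hKball : ∀ w ∈ lowerPlane, K w ∈ Metric.ball (0 : ℂ) 1 := by
    intro w hw
    have hw' : w.im < 0 := hw
    rw [mem_ball_zero_iff, hK, norm_div, div_lt_one (norm_pos_iff.2 (hKne w hw))]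
    rw [← sq_lt_sq₀ (norm_nonneg _) (norm_nonneg _), ← normSq_eq_norm_sq, ← normSq_eq_norm_sq,
      normSq_apply, normSq_apply]
    simp
    nlinarith
  have hone : ∀ ζ ∈ Metric.ball (0 : ℂ) 1, (1 : ℂ) - ζ ≠ 0 := by
    intro ζ hζ h
    have : ζ = 1 := by linear_combination -h
    simp [this] at hζ
  have hCim : ∀ ζ ∈ Metric.ball (0 : ℂ) 1, C ζ ∈ lowerPlane := by
    intro ζ hζ
    have h1 := hone ζ hζ
    have h2 : ‖ζ‖ < 1 := by simpa using hζ
    have h3 : C ζ = -I * (1 + ζ) * (starRingEnd ℂ) (1 - ζ) / (normSq (1 - ζ) : ℂ) := by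
      rw [normSq_eq_conj_mul_self, hC]
      have : (starRingEnd ℂ) (1 - ζ) ≠ 0 := (map_ne_zero _).2 h1
      field_simp
    show (C ζ).im < 0
    rw [h3, div_ofReal_im]
    apply div_neg_of_neg_of_pos _ (normSq_pos.2 h1)
    have h4 : normSq ζ < 1 := by
      rw [normSq_eq_norm_sq]; nlinarith [norm_nonneg ζ]
    rw [normSq_apply] at h4
    simp
    nlinarith
  have hCK : ∀ w ∈ lowerPlane, C (K w) = w := by
    intro w hw
    have h1 := hKne w hw
    have h2 : (1 : ℂ) - K w ≠ 0 := hone _ (hKball w hw)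
    have h3 : (w - I) - (w + I) ≠ 0 := by
      intro h; have : (2:ℂ) * I = 0 := by linear_combination -h
      simp at this
    simp only [hC, hK]
    field_simp
    have h5 : w - I - (w + I) = -2 * I := by ring
    rw [h5, show w - I + (w+I) = 2 * w by ring]
    field_simp
  have hCd : DifferentiableOn ℂ C (Metric.ball 0 1) := by
    intro ζ hζ
    refine DifferentiableAt.differentiableWithinAt ?_
    refine DifferentiableAt.div (by fun_prop) (by fun_prop) (hone ζ hζ)
  -- The weight is 1/K' at the point C ζ, so that the factor K' from the chain rule cancels.
  have hd : DifferentiableOn ℂ (fun ζ => f (C ζ) * ((C ζ - I) ^ 2 / (-2 * I))) (Metric.ball 0 1) := by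
    refine (hf.comp hCd hCim).mul ?_
    exact ((hCd.sub_const I).pow 2).div_const _
  obtain ⟨F, hF⟩ := hd.isExactOn_ball
  refine ⟨F ∘ K, fun w hw => ?_⟩
  have := (hF (K w) (hKball w hw)).comp w (hKd w hw)
  simp only [hCK w hw] at this
  refine this.congr_deriv ?_
  have := hKne w hw
  have hI := I_ne_zero
  field_simp

/-! ### The Poisson integral of a periodic holomorphic function -/

/-- The Poisson kernel of the lower half plane for functions of period `2`. -/
noncomputable def stripKernel (w : ℂ) : ℝ :=
  1 / 2 * ((1 - ‖Complex.exp (-Complex.I * Real.pi * w)‖ ^ 2) /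
    ‖1 - Complex.exp (-Complex.I * Real.pi * w)‖ ^ 2)

-- In the variable q = exp(-iπw) a function of period 2 becomes holomorphic near the closed unit
-- disc; boundedness deep down removes the singularity at q = 0. The formula is then the Poisson
-- formula of the disc.
open Complex in
theorem poisson_periodic {f : ℂ → ℂ} {η C : ℝ} (hη : 0 < η)
    (hf : ∀ w : ℂ, w.im < η → DifferentiableAt ℂ f w) (hper : ∀ w, f (w + 2) = f w)
    (hC : ∀ w : ℂ, w.im ≤ -1 → ‖f w‖ ≤ C) {w : ℂ} (hw : w ∈ lowerPlane) :
    f w = ∫ s in (-1 : ℝ)..1, stripKernel (w - s) • f s := by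
  -- Cusp functions are set up for the upper half plane, hence the rotation by π.
  set g : ℂ → ℂ := fun z => f (-z) with hg
  have hgper : Function.Periodic g (2 : ℝ) := by
    intro z
    have := hper (-(z + 2))
    simp only [hg]
    push_cast
    rw [← this]; congr 1; ring
  set F := Function.Periodic.cuspFunction 2 g
  have hgd : ∀ z : ℂ, -η < z.im → DifferentiableAt ℂ g z := by
    intro z hz
    have h1 : DifferentiableAt ℂ f (-z) := hf _ (by simp; linarith)
    exact h1.comp z differentiable_neg.differentiableAt
  have hF0 : DifferentiableAt ℂ F 0 := by
    refine Function.Periodic.differentiableAt_cuspFunction_zero (by norm_num) hgper ?_ ?_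
    · have : ∀ᶠ z in comap Complex.im atTop, 0 < z.im := tendsto_comap.eventually (eventually_gt_atTop 0)
      filter_upwards [this] with z hz
      exact hgd z (by linarith)
    · refine Asymptotics.IsBigO.of_bound C ?_
      have : ∀ᶠ z in comap Complex.im atTop, 1 ≤ z.im := tendsto_comap.eventually (eventually_ge_atTop 1)
      filter_upwards [this] with z hz
      simpa [hg] using hC (-z) (by simpa using hz)
  have hFq : ∀ z : ℂ, F (exp (-I * Real.pi * z)) = f z := by
    intro z
    have := Function.Periodic.eq_cuspFunction (h := 2) (by norm_num) hgper (-z)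
    simp only [hg, neg_neg] at this
    rw [← this]
    congr 1
    simp only [Function.Periodic.qParam]
    congr 1
    push_cast
    ring
  have hFd : ∀ q : ℂ, ‖q‖ ≤ 1 → DifferentiableAt ℂ F q := by
    intro q hq
    by_cases hq0 : q = 0
    · rw [hq0]; exact hF0
    · have := Function.Periodic.qParam_right_inv (h := 2) (by norm_num) hq0
      rw [← this]
      refine Function.Periodic.differentiableAt_cuspFunction (by norm_num) hgper (hgd _ ?_)
      rw [Function.Periodic.im_invQParam]
      have : Real.log ‖q‖ ≤ 0 := Real.log_nonpos (norm_nonneg _) hq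
      have : 0 ≤ -2 / (2 * Real.pi) * Real.log ‖q‖ := by
        apply mul_nonneg_of_nonpos_of_nonpos _ this
        exact div_nonpos_of_nonpos_of_nonneg (by norm_num) (by positivity)
      linarith
  have hdiff : DiffContOnCl ℂ F (Metric.ball 0 1) := by
    refine DifferentiableOn.diffContOnCl fun q hq => (hFd q ?_).differentiableWithinAt
    rw [closure_ball _ one_ne_zero] at hq
    simpa using hq
  have hq : exp (-I * Real.pi * w) ∈ Metric.ball (0 : ℂ) 1 := by
    have hw' : w.im < 0 := hw
    rw [mem_ball_zero_iff, norm_exp]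
    simp
    exact mul_neg_of_pos_of_neg Real.pi_pos hw'
  have hP := hdiff.circleAverage_poissonKernel_smul hq
  rw [hFq, Real.circleAverage_def] at hP
  rw [← hP]
  have e1 : ∀ θ : ℝ, (poissonKernel 0 (exp (-I * Real.pi * w)) • F) (circleMap 0 1 θ) =
      (fun s : ℝ => (2 * stripKernel (w - s)) • f s) (-(θ / Real.pi)) := by
    intro θ
    have hpi : (Real.pi : ℂ) ≠ 0 := ofReal_ne_zero.2 Real.pi_ne_zero
    have h1 : circleMap 0 1 θ = exp (-I * Real.pi * ((-(θ / Real.pi) : ℝ) : ℂ)) := by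
      rw [circleMap]
      push_cast
      rw [zero_add, one_mul]
      congr 1
      field_simp
    have h2 : exp (-I * Real.pi * (w - ((-(θ / Real.pi) : ℝ) : ℂ))) =
        exp (-I * Real.pi * w) / circleMap 0 1 θ := by
      rw [h1, ← exp_sub]; congr 1; ring
    have h3 : ‖circleMap 0 1 θ‖ = 1 := by simp
    have h4 : circleMap 0 1 θ ≠ 0 := by rw [← norm_pos_iff, h3]; norm_num
    simp only [Pi.smul_apply', stripKernel]
    rw [h2]
    nth_rewrite 2 [h1]
    rw [hFq]
    congr 1
    rw [poissonKernel, norm_div, h3]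
    have : (1 : ℂ) - exp (-I * Real.pi * w) / circleMap 0 1 θ =
      (circleMap 0 1 θ - exp (-I * Real.pi * w)) / circleMap 0 1 θ := by field_simp
    rw [this, norm_div, h3]
    simp [h3]
  simp_rw [e1]
  -- The substitution s = -θ/π sends one turn of the circle to [-2, 0]; periodicity then moves this
  -- interval to [-1, 1].
  have e2 : ∫ θ in (0 : ℝ)..2 * Real.pi,
      (fun s : ℝ => (2 * stripKernel (w - s)) • f s) (-(θ / Real.pi)) =
      Real.pi • ∫ s in (-2 : ℝ)..0, (2 * stripKernel (w - s)) • f s := by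
    have := intervalIntegral.integral_comp_div
      (fun s => (fun s : ℝ => (2 * stripKernel (w - s)) • f s) (-s)) Real.pi_ne_zero
      (a := 0) (b := 2 * Real.pi)
    rw [this]
    congr 1
    rw [intervalIntegral.integral_comp_neg (f := fun s : ℝ => (2 * stripKernel (w - s)) • f s)]
    congr 1
    · rw [mul_div_assoc, div_self Real.pi_ne_zero, mul_one]
    · simp
  rw [e2]
  have hkper : Function.Periodic (fun s : ℝ => (2 * stripKernel (w - s)) • f s) 2 := by
    intro s
    simp only [stripKernel]
    push_cast
    rw [hper]
    have : exp (-I * Real.pi * (w - (s + 2))) = exp (-I * Real.pi * (w - s)) := by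
      rw [show -I * Real.pi * (w - (s + 2)) = -I * Real.pi * (w - s) + 2 * Real.pi * I by ring,
        exp_periodic]
    rw [this]
  have e3 := hkper.intervalIntegral_add_eq (-2) (-1)
  rw [show (-2 : ℝ) + 2 = 0 by norm_num, show (-1 : ℝ) + 2 = 1 by norm_num] at e3
  rw [e3]
  simp_rw [mul_smul, ← Complex.coe_smul, smul_smul]
  rw [← intervalIntegral.integral_smul]
  have hpi : (Real.pi : ℂ) ≠ 0 := ofReal_ne_zero.2 Real.pi_ne_zero
  refine intervalIntegral.integral_congr fun s _ => ?_
  simp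
  field_simp

end StripWave


namespace StripWave
open Complex

/-! ### A singular integral with kernel `1 / sin²` -/

theorem normSq_sin_eq (w : ℂ) : ‖sin w‖ ^ 2 = Real.sin w.re ^ 2 + Real.sinh w.im ^ 2 := by
  rw [sin_eq, ← normSq_eq_norm_sq, normSq_apply, ← ofReal_sin, ← ofReal_cos, ← ofReal_sinh,
    ← ofReal_cosh]
  simp only [add_re, mul_re, ofReal_re, ofReal_im, I_re, I_im, add_im, mul_im]
  have h1 := Real.cosh_sq w.im
  have h2 := Real.sin_sq_add_cos_sq w.re
  ring_nf
  rw [h1, show Real.cos w.re ^ 2 = 1 - Real.sin w.re ^ 2 by linarith]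
  ring

theorem sq_le_sinh_sq (y : ℝ) : y ^ 2 ≤ Real.sinh y ^ 2 := by
  rw [sq_le_sq]
  rcases le_total 0 y with h | h
  · rw [abs_of_nonneg h, abs_of_nonneg (Real.sinh_nonneg_iff.2 h)]
    exact Real.self_le_sinh_iff.2 h
  · rw [abs_of_nonpos h, abs_of_nonpos (Real.sinh_nonpos_iff.2 h)]
    exact neg_le_neg (Real.sinh_le_self_iff.2 h)

theorem abs_le_abs_sin_half_pi {x : ℝ} (hx : |x| ≤ 1) : |x| ≤ |Real.sin (Real.pi / 2 * x)| := by
  have h : ∀ x : ℝ, 0 ≤ x → x ≤ 1 → x ≤ Real.sin (Real.pi / 2 * x) := by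
    intro x h0 h1
    have := Real.mul_le_sin (x := Real.pi / 2 * x) (by positivity)
      (by nlinarith [Real.pi_pos])
    have e : 2 / Real.pi * (Real.pi / 2 * x) = x := by
      have := Real.pi_ne_zero
      field_simp
    linarith
  rcases le_total 0 x with h0 | h0
  · rw [abs_of_nonneg h0] at *
    exact (h x h0 hx).trans (le_abs_self _)
  · rw [abs_of_nonpos h0] at *
    have := h (-x) (by linarith) hx
    rw [mul_neg, Real.sin_neg] at this
    exact this.trans (neg_le_abs _)

/-- From |sin(x + iy)|² = sin²x + sinh²y, with Jordan's inequality for the first term and |y| ≤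
|sinh y| for the second. -/
theorem norm_le_norm_sin_half_pi {w : ℂ} (hw : |w.re| ≤ 1) : ‖w‖ ≤ ‖sin (Real.pi / 2 * w)‖ := by
  rw [← sq_le_sq₀ (norm_nonneg _) (norm_nonneg _), normSq_sin_eq, ← normSq_eq_norm_sq,
    normSq_apply]
  have h1 := abs_le_abs_sin_half_pi hw
  rw [← sq_le_sq] at h1
  have h2 := sq_le_sinh_sq (Real.pi / 2 * w.im)
  have e1 : ((Real.pi : ℂ) / 2 * w).re = Real.pi / 2 * w.re := by
    rw [show (Real.pi : ℂ) / 2 = ((Real.pi / 2 : ℝ) : ℂ) by push_cast; ring, re_ofReal_mul]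
  have e2 : ((Real.pi : ℂ) / 2 * w).im = Real.pi / 2 * w.im := by
    rw [show (Real.pi : ℂ) / 2 = ((Real.pi / 2 : ℝ) : ℂ) by push_cast; ring, im_ofReal_mul]
  rw [e1, e2]
  have h3 : w.im ^ 2 ≤ (Real.pi / 2 * w.im) ^ 2 := by
    rw [mul_pow]
    have : 1 ≤ (Real.pi / 2) ^ 2 := by nlinarith [Real.pi_gt_three]
    nlinarith [sq_nonneg w.im]
  nlinarith

theorem abs_im_le_norm_sin_half_pi (w : ℂ) : |w.im| ≤ ‖sin (Real.pi / 2 * w)‖ := by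
  rw [← sq_le_sq₀ (abs_nonneg _) (norm_nonneg _), normSq_sin_eq, sq_abs]
  have h2 := sq_le_sinh_sq (Real.pi / 2 * w.im)
  have e2 : ((Real.pi : ℂ) / 2 * w).im = Real.pi / 2 * w.im := by
    rw [show (Real.pi : ℂ) / 2 = ((Real.pi / 2 : ℝ) : ℂ) by push_cast; ring, im_ofReal_mul]
  rw [e2]
  have h3 : w.im ^ 2 ≤ (Real.pi / 2 * w.im) ^ 2 := by
    rw [mul_pow]
    have : 1 ≤ (Real.pi / 2) ^ 2 := by nlinarith [Real.pi_gt_three]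
    nlinarith [sq_nonneg w.im]
  nlinarith [sq_nonneg (Real.sin ((Real.pi : ℂ) / 2 * w).re)]

/-- The kernel `1 / sin² (π w / 2)`. -/
noncomputable def sinKernel (w : ℂ) : ℂ := (sin (Real.pi / 2 * w) ^ 2)⁻¹

theorem sinKernel_add_two (w : ℂ) : sinKernel (w + 2) = sinKernel w := by
  rw [sinKernel, sinKernel, show (Real.pi : ℂ) / 2 * (w + 2) = Real.pi / 2 * w + Real.pi by ring,
    sin_add_pi, neg_sq]

theorem differentiableAt_sinKernel {w : ℂ} (hw : sin (Real.pi / 2 * w) ≠ 0) :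
    DifferentiableAt ℂ sinKernel w := by
  unfold sinKernel
  exact DifferentiableAt.inv (by fun_prop) (pow_ne_zero 2 hw)

theorem norm_sinKernel_le {w : ℂ} (hw : |w.re| ≤ 1) : ‖sinKernel w‖ ≤ (‖w‖ ^ 2)⁻¹ := by
  by_cases h0 : w = 0
  · simp [h0, sinKernel]
  rw [sinKernel, norm_inv, norm_pow]
  have := norm_pos_iff.2 h0
  exact inv_anti₀ (by positivity) (pow_le_pow_left₀ (norm_nonneg _) (norm_le_norm_sin_half_pi hw) 2)

theorem sin_half_pi_ne_zero {w : ℂ} (hw : w.im < 0) : sin (Real.pi / 2 * w) ≠ 0 := by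
  rw [← norm_pos_iff]
  exact (abs_pos.2 hw.ne).trans_le (abs_im_le_norm_sin_half_pi w)

theorem sin_half_pi_pos {x : ℝ} (h0 : 0 < x) (h2 : x < 2) : 0 < Real.sin (Real.pi / 2 * x) :=
  Real.sin_pos_of_pos_of_lt_pi (by have := Real.pi_pos; positivity)
    (by nlinarith [Real.pi_pos])

/-- The integral of a periodic holomorphic function against the kernel over a period vanishes on
every horizontal line below the singularities. -/
theorem integral_sinKernel_period_eq_zero {g : ℂ → ℂ} {C : ℝ}
    (hg : ∀ w : ℂ, w.im ≤ 0 → DifferentiableAt ℂ g w) (hper : ∀ w : ℂ, w.im ≤ 0 → g (w + 2) = g w)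
    (hgrow : ∀ w : ℂ, w.im ≤ -2 → ‖g w‖ ≤ C * (1 + |w.im|)) (a : ℝ) {y : ℝ} (hy : y < 0) :
    ∫ x in a..(a + 2), g (x + y * I) * sinKernel (x + y * I) = 0 := by
  set F : ℂ → ℂ := fun w => g w * sinKernel w with hF
  have hFd : ∀ w : ℂ, w.im < 0 → DifferentiableAt ℂ F w := fun w hw =>
    (hg w hw.le).mul (differentiableAt_sinKernel (sin_half_pi_ne_zero hw))
  have hFper : ∀ w : ℂ, w.im < 0 → F (w + 2) = F w := fun w hw => by
    simp only [hF, hper w hw.le, sinKernel_add_two]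
  have hshift : ∀ Y : ℝ, Y < y → ∫ x in a..(a + 2), F (x + y * I) = ∫ x in a..(a + 2), F (x + Y * I) := by
    intro Y hY
    have := integral_boundary_rect_eq_zero_of_differentiableOn F (a + Y * I) ((a + 2 : ℝ) + y * I) ?_
    · simp only [add_re, ofReal_re, mul_re, I_re, mul_zero, ofReal_im, I_im, mul_one, sub_self,
        add_zero, add_im, mul_im, zero_add] at this
      have hv : ∫ x in Y..y, F ((a + 2 : ℝ) + x * I) = ∫ x in Y..y, F (a + x * I) := by
        refine intervalIntegral.integral_congr fun x hx => ?_
        rw [uIcc_of_le hY.le] at hx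
        have := hFper (a + x * I) (by simpa using hx.2.trans_lt hy)
        rw [← this]
        congr 1
        push_cast
        ring
      rw [hv] at this
      linear_combination -this
    · intro w hw
      rw [mem_reProdIm] at hw
      simp only [add_re, ofReal_re, mul_re, I_re, mul_zero, ofReal_im, I_im, mul_one, sub_self,
        add_zero, add_im, mul_im, zero_add] at hw
      rw [uIcc_of_le hY.le] at hw
      exact (hFd w (hw.2.2.trans_lt hy)).differentiableWithinAt
  -- The integral does not depend on the height, because the vertical sides cancel by periodicity.
  -- The crude bound Y⁻² for the kernel already beats the linear growth of g as the line goes down.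
  have hbound : ∀ Y : ℝ, 2 ≤ Y → -Y < y → ‖∫ x in a..(a + 2), F (x + y * I)‖ ≤ C * (1 + Y) / Y ^ 2 * 2 := by
    intro Y hY hYy
    rw [hshift (-Y) hYy]
    have := intervalIntegral.norm_integral_le_of_norm_le_const (a := a) (b := a + 2)
      (f := fun x : ℝ => F (x + (-Y : ℝ) * I)) (C := C * (1 + Y) / Y ^ 2) ?_
    · simpa using this
    · intro x _
      have him : ((x : ℂ) + (-Y : ℝ) * I).im = -Y := by simp
      have h1 := hgrow (x + (-Y : ℝ) * I) (by rw [him]; linarith)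
      rw [him, abs_neg, abs_of_nonneg (by linarith)] at h1
      have h2 := abs_im_le_norm_sin_half_pi (x + (-Y : ℝ) * I)
      rw [him, abs_neg, abs_of_nonneg (by linarith)] at h2
      simp only [hF, norm_mul, div_eq_mul_inv]
      refine mul_le_mul h1 ?_ (norm_nonneg _) ((norm_nonneg _).trans h1)
      rw [sinKernel, norm_inv, norm_pow]
      exact inv_anti₀ (by positivity) (pow_le_pow_left₀ (by linarith) h2 2)
  have hlim : Tendsto (fun Y : ℝ => C * (1 + Y) / Y ^ 2 * 2) atTop (𝓝 0) := by
    have h1 : Tendsto (fun Y : ℝ => (C * (Y⁻¹ ^ 2 + Y⁻¹)) * 2) atTop (𝓝 ((C * (0 ^ 2 + 0)) * 2)) :=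
      (((tendsto_inv_atTop_zero.pow 2).add tendsto_inv_atTop_zero).const_mul C).mul_const 2
    simp only [ne_eq, OfNat.ofNat_ne_zero, not_false_eq_true, zero_pow, add_zero, mul_zero,
      zero_mul] at h1
    refine h1.congr' ?_
    filter_upwards [eventually_gt_atTop 0] with Y hY
    field_simp
  have := ge_of_tendsto hlim (b := ‖∫ x in a..(a + 2), F (x + y * I)‖) (by
    filter_upwards [eventually_ge_atTop 2, eventually_gt_atTop (-y)] with Y h1 h2
    exact hbound Y h1 (by linarith))
  exact norm_le_zero_iff.1 this

/-- Push the segment [ε, 2 - ε] down to height -ε. A full period at that height contributes nothing,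
so what remains is the piece of length 2ε below the pole 2 and two vertical sides of length ε. There
the integrand is at most δ|w|·|w|⁻² ≤ δ/ε, where w is the position relative to the nearest pole,
which gives 2δ + δ + δ. -/
theorem norm_integral_sinKernel_le {g : ℂ → ℂ} {C ε δ : ℝ} (hε : 0 < ε) (hε1 : ε < 1 / 2)
    (hg : ∀ w : ℂ, w.im ≤ 0 → DifferentiableAt ℂ g w) (hper : ∀ w : ℂ, w.im ≤ 0 → g (w + 2) = g w)
    (hgrow : ∀ w : ℂ, w.im ≤ -2 → ‖g w‖ ≤ C * (1 + |w.im|))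
    (hδ : ∀ w : ℂ, w.im ≤ 0 → ‖w‖ ≤ 2 * ε → ‖g w‖ ≤ δ * ‖w‖) :
    ‖∫ x in ε..(2 - ε), g x * sinKernel x‖ ≤ 4 * δ := by
  have hδ0 : 0 ≤ δ := by
    have := (norm_nonneg _).trans (hδ (ε : ℂ) (by simp) (by
      rw [norm_real, Real.norm_of_nonneg hε.le]; linarith))
    rw [norm_real, Real.norm_of_nonneg hε.le] at this
    exact nonneg_of_mul_nonneg_left this hε
  set F : ℂ → ℂ := fun w => g w * sinKernel w with hF
  have hFper : ∀ w : ℂ, w.im ≤ 0 → F (w + 2) = F w := fun w hw => by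
    simp only [hF, hper w hw, sinKernel_add_two]
  -- the estimate near the singularity
  have hFle : ∀ w : ℂ, w.im ≤ 0 → ‖w‖ ≤ 2 * ε → ε ≤ ‖w‖ → ‖F w‖ ≤ δ / ε := by
    intro w h1 h2 h3
    have h4 : |w.re| ≤ 1 := (abs_re_le_norm w).trans (by linarith)
    have h5 : 0 < ‖w‖ := hε.trans_le h3
    calc ‖F w‖ = ‖g w‖ * ‖sinKernel w‖ := norm_mul _ _
      _ ≤ (δ * ‖w‖) * (‖w‖ ^ 2)⁻¹ :=
        mul_le_mul (hδ w h1 h2) (norm_sinKernel_le h4) (norm_nonneg _) (by positivity)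
      _ = δ / ‖w‖ := by field_simp
      _ ≤ δ / ε := div_le_div_of_nonneg_left hδ0 hε h3
  have hrect := integral_boundary_rect_eq_zero_of_differentiableOn F (ε + (-ε : ℝ) * I)
    ((2 - ε : ℝ) + (0 : ℝ) * I) ?_
  swap
  · intro w hw
    rw [mem_reProdIm] at hw
    simp only [add_re, ofReal_re, mul_re, I_re, mul_zero, ofReal_im, I_im, mul_one, sub_self,
        add_zero, add_im, mul_im, zero_add] at hw
    rw [uIcc_of_le (by linarith), uIcc_of_le (by linarith)] at hw
    refine DifferentiableAt.differentiableWithinAt ((hg w hw.2.2).mul (differentiableAt_sinKernel ?_))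
    intro h0
    have h1 := normSq_sin_eq (Real.pi / 2 * w)
    rw [h0, norm_zero, show (Real.pi : ℂ) / 2 = ((Real.pi / 2 : ℝ) : ℂ) by push_cast; ring,
      re_ofReal_mul] at h1
    have h2 := sin_half_pi_pos (x := w.re) (by linarith [hw.1.1]) (by linarith [hw.1.2])
    nlinarith [sq_nonneg (Real.sinh (((Real.pi / 2 : ℝ) : ℂ) * w).im)]
  simp only [add_re, ofReal_re, mul_re, I_re, mul_zero, ofReal_im, I_im, mul_one, sub_self,
    add_zero, add_im, mul_im, zero_add] at hrect
  have hper0 := integral_sinKernel_period_eq_zero hg hper hgrow ε (y := -ε) (by linarith)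
  have hcont : ∀ a b : ℝ, IntervalIntegrable (fun x : ℝ => F (x + (-ε : ℝ) * I)) volume a b := by
    intro a b
    refine ContinuousOn.intervalIntegrable fun x _ => ContinuousAt.continuousWithinAt ?_
    have h1 : DifferentiableAt ℂ F (x + (-ε : ℝ) * I) :=
      (hg _ (by simpa using hε.le)).mul (differentiableAt_sinKernel (sin_half_pi_ne_zero (by simpa)))
    exact ContinuousAt.comp (f := fun x : ℝ => (x + (-ε : ℝ) * I : ℂ)) h1.continuousAt (by fun_prop)
  have hsplit := intervalIntegral.integral_add_adjacent_intervals (hcont ε (2 - ε))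
    (hcont (2 - ε) (ε + 2))
  have hJ : ‖∫ x in (2 - ε)..(ε + 2), F (x + (-ε : ℝ) * I)‖ ≤ δ / ε * (2 * ε) := by
    have := intervalIntegral.norm_integral_le_of_norm_le_const (a := 2 - ε) (b := ε + 2)
      (f := fun x : ℝ => F (x + (-ε : ℝ) * I)) (C := δ / ε) ?_
    · refine this.trans_eq ?_
      rw [abs_of_nonneg (by linarith)]
      ring
    · intro x hx
      rw [uIoc_of_le (by linarith)] at hx
      have e : (x : ℂ) + (-ε : ℝ) * I = ((x - 2 : ℝ) + (-ε : ℝ) * I) + 2 := by push_cast; ring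
      rw [e, hFper _ (by simpa using hε.le)]
      refine hFle _ (by simpa using hε.le) ?_ ?_
      · refine (norm_add_le _ _).trans ?_
        rw [norm_mul, norm_real, norm_real, norm_I, Real.norm_eq_abs, Real.norm_eq_abs, abs_neg,
          abs_of_pos hε]
        have : |x - 2| ≤ ε := abs_le.2 ⟨by linarith [hx.1], by linarith [hx.2]⟩
        linarith
      · refine le_trans ?_ (abs_im_le_norm _)
        simp [abs_of_pos hε]
  have hV : ∀ a : ℝ, (a = ε ∨ a = 2 - ε) → ‖∫ y in (-ε)..0, F (a + y * I)‖ ≤ δ / ε * ε := by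
    intro a ha
    have := intervalIntegral.norm_integral_le_of_norm_le_const (a := -ε) (b := 0)
      (f := fun y : ℝ => F (a + y * I)) (C := δ / ε) ?_
    · refine this.trans_eq ?_
      rw [abs_of_nonneg (by linarith)]
      ring
    · intro y hy
      rw [uIoc_of_le (by linarith)] at hy
      have hb : ∀ b : ℝ, |b| = ε → ‖F (b + y * I)‖ ≤ δ / ε := by
        intro b hb
        refine hFle _ (by simpa using hy.2) ?_ ?_
        · refine (norm_add_le _ _).trans ?_
          rw [norm_mul, norm_real, norm_real, norm_I, Real.norm_eq_abs, Real.norm_eq_abs, hb]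
          have : |y| ≤ ε := abs_le.2 ⟨by linarith [hy.1], by linarith [hy.2]⟩
          linarith
        · refine le_trans ?_ (abs_re_le_norm _)
          simp [hb]
      rcases ha with rfl | rfl
      · exact hb _ (abs_of_pos hε)
      · have e : ((2 - ε : ℝ) : ℂ) + y * I = ((-ε : ℝ) + y * I) + 2 := by push_cast; ring
        rw [e, hFper _ (by simpa using hy.2)]
        exact hb _ (by rw [abs_neg, abs_of_pos hε])
  have hV1 := hV ε (Or.inl rfl)
  have hV2 := hV (2 - ε) (Or.inr rfl)
  have hmain : ∫ x in ε..(2 - ε), F x = -(∫ x in (2 - ε)..(ε + 2), F (x + (-ε : ℝ) * I)) +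
      I * (∫ y in (-ε)..0, F ((2 - ε : ℝ) + y * I)) - I * ∫ y in (-ε)..0, F (ε + y * I) := by
    simp only [ofReal_zero, zero_mul, add_zero, smul_eq_mul] at hrect
    have h0 : ∫ x in ε..(ε + 2), F (x + (-ε : ℝ) * I) = 0 := hper0
    linear_combination -hrect + hsplit + h0
  have e1 : δ / ε * ε = δ := div_mul_cancel₀ _ hε.ne'
  have e2 : δ / ε * (2 * ε) = 2 * δ := by rw [mul_comm 2, ← mul_assoc, e1]; ring
  calc ‖∫ x in ε..(2 - ε), g x * sinKernel x‖ = _ := congrArg norm hmain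
    _ ≤ ‖∫ x in (2 - ε)..(ε + 2), F (x + (-ε : ℝ) * I)‖ +
        ‖∫ y in (-ε)..0, F ((2 - ε : ℝ) + y * I)‖ + ‖∫ y in (-ε)..0, F (ε + y * I)‖ := by
      refine (norm_sub_le _ _).trans (add_le_add ((norm_add_le _ _).trans ?_) ?_)
      · rw [norm_neg, norm_mul, norm_I, one_mul]
      · rw [norm_mul, norm_I, one_mul]
    _ ≤ 2 * δ + δ + δ := by
      rw [e2] at hJ
      rw [e1] at hV1 hV2
      exact add_le_add (add_le_add hJ hV2) hV1
    _ = 4 * δ := by ring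

theorem sinKernel_ofReal (x : ℝ) : sinKernel x = ((Real.sin (Real.pi / 2 * x) ^ 2)⁻¹ : ℝ) := by
  rw [sinKernel]
  push_cast
  rfl

theorem integral_cot_eq_zero (ε : ℝ) :
    ∫ x in ε..(2 - ε), Real.cot (Real.pi / 2 * x) = 0 := by
  have h := intervalIntegral.integral_comp_sub_left (fun x => Real.cot (Real.pi / 2 * x)) 2
    (a := ε) (b := 2 - ε)
  rw [show (2 : ℝ) - (2 - ε) = ε by ring] at h
  have h2 : ∀ x : ℝ, Real.cot (Real.pi / 2 * (2 - x)) = -Real.cot (Real.pi / 2 * x) := by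
    intro x
    rw [Real.cot_eq_cos_div_sin, Real.cot_eq_cos_div_sin,
      show Real.pi / 2 * (2 - x) = Real.pi - Real.pi / 2 * x by ring, Real.cos_pi_sub,
      Real.sin_pi_sub, neg_div]
  simp only [h2, intervalIntegral.integral_neg] at h
  linarith

/-- The model function with value `0` and derivative `1` at the origin. -/
noncomputable def modelFun (w : ℂ) : ℂ := (exp (-I * Real.pi * w) - 1) / (-I * Real.pi)

theorem neg_I_mul_pi_ne_zero : -I * (Real.pi : ℂ) ≠ 0 :=
  mul_ne_zero (neg_ne_zero.2 I_ne_zero) (ofReal_ne_zero.2 Real.pi_ne_zero)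

theorem hasDerivAt_modelFun (w : ℂ) : HasDerivAt modelFun (exp (-I * Real.pi * w)) w := by
  have h := ((((hasDerivAt_id w).const_mul (-I * (Real.pi : ℂ))).cexp).sub_const 1).div_const
    (-I * (Real.pi : ℂ))
  refine h.congr_deriv ?_
  have := neg_I_mul_pi_ne_zero
  simp only [id_eq, mul_one]
  field_simp

theorem modelFun_add_two (w : ℂ) : modelFun (w + 2) = modelFun w := by
  rw [modelFun, modelFun, show -I * (Real.pi : ℂ) * (w + 2) =
    -I * Real.pi * w + -(2 * Real.pi * I) by ring, exp_add, exp_neg, exp_two_pi_mul_I]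
  simp

theorem norm_modelFun_le {w : ℂ} (hw : w.im ≤ 0) : ‖modelFun w‖ ≤ 1 := by
  rw [modelFun, norm_div, norm_mul, norm_neg, norm_I, one_mul, norm_real,
    Real.norm_of_nonneg Real.pi_pos.le, div_le_one Real.pi_pos]
  refine (norm_sub_le _ _).trans ?_
  have : ‖exp (-I * Real.pi * w)‖ ≤ 1 := by
    rw [norm_exp]
    simp
    exact mul_nonpos_of_nonneg_of_nonpos Real.pi_pos.le hw
  rw [norm_one]
  linarith [Real.pi_gt_three]

/-- The product is the constant -2i/π plus (2/π) cot(πx/2), and the cotangent is odd about x = 1.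
This computation is the source of the factor 4/π in the singular integral. -/
theorem integral_modelFun_mul_sinKernel {ε : ℝ} (h0 : 0 < ε) (h1 : ε < 1) :
    ∫ x in ε..(2 - ε), modelFun x * sinKernel x = -(4 / Real.pi * (1 - ε) : ℝ) * I := by
  have e : ∀ x ∈ uIcc ε (2 - ε), modelFun x * sinKernel x =
      (-2 / Real.pi : ℂ) * I + (2 / Real.pi : ℂ) * (Real.cot (Real.pi / 2 * x) : ℝ) := by
    intro x hx
    rw [uIcc_of_le (by linarith)] at hx
    have hs := (sin_half_pi_pos (x := x) (by linarith [hx.1]) (by linarith [hx.2])).ne'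
    have hpi : (Real.pi : ℂ) ≠ 0 := ofReal_ne_zero.2 Real.pi_ne_zero
    rw [sinKernel_ofReal, modelFun, Real.cot_eq_cos_div_sin]
    rw [show -I * (Real.pi : ℂ) * x = ((-(2 * (Real.pi / 2 * x)) : ℝ) : ℂ) * I by push_cast; ring,
      exp_ofReal_mul_I, Real.cos_neg, Real.sin_neg, Real.cos_two_mul, Real.sin_two_mul]
    have h2 := Real.sin_sq_add_cos_sq (Real.pi / 2 * x)
    set s := Real.sin (Real.pi / 2 * x)
    set c := Real.cos (Real.pi / 2 * x)
    have hs' : (s : ℂ) ≠ 0 := ofReal_ne_zero.2 hs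
    have h3 : (c : ℂ) ^ 2 = 1 - (s : ℂ) ^ 2 := by
      have : c ^ 2 = 1 - s ^ 2 := by linarith
      exact_mod_cast this
    push_cast
    field_simp
    rw [h3]
    ring_nf
    rw [I_sq]
    ring
  have hci : IntervalIntegrable (fun x : ℝ => Real.cot (Real.pi / 2 * x)) volume ε (2 - ε) := by
    refine ContinuousOn.intervalIntegrable ?_
    simp only [Real.cot_eq_cos_div_sin]
    refine ContinuousOn.div (by fun_prop) (by fun_prop) fun x hx => ?_
    rw [uIcc_of_le (by linarith)] at hx
    exact (sin_half_pi_pos (by linarith [hx.1]) (by linarith [hx.2])).ne'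
  rw [intervalIntegral.integral_congr e, intervalIntegral.integral_add
    intervalIntegrable_const (IntervalIntegrable.const_mul ⟨hci.1.ofReal, hci.2.ofReal⟩ _), intervalIntegral.integral_const_mul (2 / Real.pi : ℂ),
    intervalIntegral.integral_ofReal, integral_cot_eq_zero, intervalIntegral.integral_const]
  simp
  ring

theorem intervalIntegrable_mul_inv_sin_sq {g : ℝ → ℝ} {ε : ℝ} (h0 : 0 < ε) (h1 : ε < 1)
    (hg : ContinuousOn g (uIcc ε (2 - ε))) :
    IntervalIntegrable (fun x : ℝ => g x * (Real.sin (Real.pi / 2 * x) ^ 2)⁻¹) volume ε (2 - ε) := by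
  refine ContinuousOn.intervalIntegrable (hg.mul (ContinuousOn.inv₀ (by fun_prop) fun x hx => ?_))
  rw [uIcc_of_le (by linarith)] at hx
  exact pow_ne_zero 2 (sin_half_pi_pos (by linarith [hx.1]) (by linarith [hx.2])).ne'

theorem ofReal_sub_mul_I_mem {x η : ℝ} (hη : 0 < η) : (x : ℂ) - η * I ∈ lowerPlane := by
  show ((x : ℂ) - η * I).im < 0
  simpa

/-- After subtraction of ℓ times the model function the derivative tends to 0 at the origin, so
`norm_integral_sinKernel_le` makes the rest small; the model contributes Re(-(4/π)(1 - ε) i ℓ) =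
(4/π)(1 - ε) Im ℓ. Only the real part of f is assumed to extend to the real line, so the estimate is
made at height -η and only its real part is taken to the limit. -/
theorem tendsto_singular_integral {f f' : ℂ → ℂ} {ρ : ℂ → ℝ} {ℓ : ℂ} {C : ℝ}
    (hf : ∀ w ∈ lowerPlane, HasDerivAt f (f' w) w) (hper : ∀ w ∈ lowerPlane, f (w + 2) = f w)
    (hgrow : ∀ w : ℂ, w.im ≤ -1 → ‖f w‖ ≤ C * (1 + |w.im|))
    (hρ : ContinuousOn ρ closedLowerPlane) (hρf : ∀ w ∈ lowerPlane, ρ w = (f w).re)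
    (hℓ : Tendsto f' (𝓝[lowerPlane] 0) (𝓝 ℓ)) :
    Tendsto (fun ε : ℝ => ∫ β in ε..(2 - ε), (ρ β - ρ 0) * (Real.sin (Real.pi / 2 * β) ^ 2)⁻¹)
      (𝓝[>] 0) (𝓝 (4 / Real.pi * ℓ.im)) := by
  have hC : 0 ≤ C := by
    have := (norm_nonneg _).trans (hgrow (-I) (by simp))
    simp at this
    linarith
  have hclosed : ∀ (x η : ℝ), 0 ≤ η → (x : ℂ) - η * I ∈ closedLowerPlane := by
    intro x η hη
    show ((x : ℂ) - η * I).im ≤ 0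
    simpa
  have key : ∀ δ > 0, ∀ᶠ ε : ℝ in 𝓝[>] 0,
      |(∫ β in ε..(2 - ε), (ρ β - ρ 0) * (Real.sin (Real.pi / 2 * β) ^ 2)⁻¹) -
        4 / Real.pi * (1 - ε) * ℓ.im| ≤ 4 * δ := by
    intro δ hδ
    obtain ⟨r1, hr1, h1⟩ := Metric.mem_nhdsWithin_iff.1
      (hℓ (Metric.closedBall_mem_nhds ℓ (half_pos hδ)))
    have hE : Tendsto (fun w : ℂ => ℓ - ℓ * exp (-I * Real.pi * w)) (𝓝 0) (𝓝 0) := by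
      have : Continuous (fun w : ℂ => ℓ - ℓ * exp (-I * Real.pi * w)) := by fun_prop
      simpa using this.tendsto 0
    obtain ⟨r2, hr2, h2⟩ := Metric.mem_nhds_iff.1 (hE (Metric.closedBall_mem_nhds 0 (half_pos hδ)))
    -- Division by 3 because the points w - iη with |w| ≤ 2ε and η < ε lie within 3ε of the origin.
    have hr : 0 < min (min r1 r2 / 3) (1 / 2) := by positivity
    filter_upwards [Ioo_mem_nhdsGT hr] with ε hε
    have hε0 : 0 < ε := hε.1
    have hε1 : ε < 1 / 2 := hε.2.trans_le (min_le_right _ _)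
    have hε2 : 3 * ε < min r1 r2 := by
      have := hε.2.trans_le (min_le_left _ _)
      linarith
    -- The estimate is uniform in η < ε, so η → 0 comes first with ε fixed, and ε → 0 afterwards.
    have hη : ∀ η ∈ Ioo 0 ε,
        |(∫ β in ε..(2 - ε), (ρ (β - η * I) - ρ ((0 : ℝ) - η * I)) *
          (Real.sin (Real.pi / 2 * β) ^ 2)⁻¹) - 4 / Real.pi * (1 - ε) * ℓ.im| ≤ 4 * δ := by
      intro η hη
      have hmem : ∀ w : ℂ, w.im ≤ 0 → w - η * I ∈ lowerPlane := by
        intro w hw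
        show (w - η * I).im < 0
        simp
        linarith [hη.1]
      have hder : ∀ w : ℂ, w.im ≤ 0 → HasDerivAt
          (fun w => f (w - η * I) - f ((0 : ℝ) - η * I) - ℓ * modelFun w)
          (f' (w - η * I) - ℓ * exp (-I * Real.pi * w)) w := by
        intro w hw
        have e := (hf _ (hmem w hw)).comp w ((hasDerivAt_id w).sub_const (η * I))
        rw [mul_one] at e
        exact (e.sub_const _).sub ((hasDerivAt_modelFun w).const_mul ℓ)
      have hb := norm_integral_sinKernel_le (C := 2 * C + ‖f ((0 : ℝ) - η * I)‖ + ‖ℓ‖) (δ := δ)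
        hε0 hε1 (fun w hw => (hder w hw).differentiableAt) (fun w hw => by
          rw [modelFun_add_two, show w + 2 - η * I = (w - η * I) + 2 by ring, hper _ (hmem w hw)])
        (fun w hw => by
          have a1 := hgrow (w - η * I) (by simp; linarith [hη.1])
          have a2 := norm_modelFun_le (w := w) (by linarith)
          have a3 : |(w - η * I).im| ≤ |w.im| + 1 := by
            simp only [sub_im, mul_im, ofReal_re, I_im, mul_one, ofReal_im, I_re, mul_zero,
              add_zero]
            refine (abs_sub _ _).trans ?_
            rw [abs_of_pos hη.1]
            linarith [hη.2]
          have a4 := abs_nonneg w.im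
          calc _ ≤ ‖f (w - η * I)‖ + ‖f ((0 : ℝ) - η * I)‖ + ‖ℓ‖ * ‖modelFun w‖ := by
                refine (norm_sub_le _ _).trans (add_le_add (norm_sub_le _ _) (norm_mul _ _).le)
            _ ≤ C * (1 + (|w.im| + 1)) + ‖f ((0 : ℝ) - η * I)‖ * 1 + ‖ℓ‖ * 1 := by
                refine add_le_add (add_le_add (a1.trans ?_) (by simp)) ?_
                · exact mul_le_mul_of_nonneg_left (by linarith) hC
                · exact mul_le_mul_of_nonneg_left a2 (norm_nonneg _)
            _ ≤ _ := by nlinarith [norm_nonneg (f ((0 : ℝ) - η * I)), norm_nonneg ℓ])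
        (fun w hw hw2 => by
          have hconv : Convex ℝ {w : ℂ | w.im ≤ 0 ∧ ‖w‖ ≤ 2 * ε} := by
            have := (convex_halfSpace_im_le 0).inter (convex_closedBall (0 : ℂ) (2 * ε))
            convert this using 1
            ext w
            simp
          have := hconv.norm_image_sub_le_of_norm_hasDerivWithin_le (x := 0) (y := w) (C := δ)
            (fun w hw => (hder w hw.1).hasDerivWithinAt) (fun w hw => by
              have b1 := h1 ⟨mem_ball_zero_iff.2 (?_ : ‖w - η * I‖ < r1), hmem w hw.1⟩
              have b2 := h2 (mem_ball_zero_iff.2 (?_ : ‖w‖ < r2))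
              · have b1' : ‖f' (w - η * I) - ℓ‖ ≤ δ / 2 := mem_closedBall_iff_norm.1 b1
                have b2' : ‖ℓ - ℓ * exp (-I * Real.pi * w)‖ ≤ δ / 2 := by simpa using b2
                calc _ = ‖(f' (w - η * I) - ℓ) + (ℓ - ℓ * exp (-I * Real.pi * w))‖ := by
                      congr 1; ring
                  _ ≤ _ := (norm_add_le _ _).trans (by linarith)
              · exact hw.2.trans_lt (by linarith [min_le_right r1 r2])
              · refine (norm_sub_le _ _).trans_lt ?_
                rw [norm_mul, norm_I, norm_real, Real.norm_of_nonneg hη.1.le]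
                linarith [hw.2, hη.2, min_le_left r1 r2]) ⟨by simp, by simp; linarith⟩ ⟨hw, hw2⟩
          simpa [modelFun] using this)
      refine le_trans ?_ hb
      refine le_trans (le_of_eq ?_) (abs_re_le_norm _)
      congr 1
      have hcf : ContinuousOn (fun x : ℝ => f (x - η * I) - f ((0 : ℝ) - η * I))
          (uIcc ε (2 - ε)) := by
        refine ContinuousOn.sub (fun x _ => ContinuousAt.continuousWithinAt ?_) continuousOn_const
        exact ContinuousAt.comp (f := fun x : ℝ => (x - η * I : ℂ))
          (hf _ (ofReal_sub_mul_I_mem hη.1)).continuousAt (by fun_prop)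
      have hk : ContinuousOn (fun x : ℝ => sinKernel x) (uIcc ε (2 - ε)) := by
        simp only [sinKernel_ofReal]
        refine continuous_ofReal.comp_continuousOn (ContinuousOn.inv₀ (by fun_prop) fun x hx => ?_)
        rw [uIcc_of_le (by linarith)] at hx
        exact pow_ne_zero 2 (sin_half_pi_pos (by linarith [hx.1]) (by linarith [hx.2])).ne'
      have hmc : Continuous (fun x : ℝ => modelFun x) := by
        unfold modelFun
        fun_prop
      have e1 : ∫ x in ε..(2 - ε), (f (x - η * I) - f ((0 : ℝ) - η * I) - ℓ * modelFun x) *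
          sinKernel x = (∫ x in ε..(2 - ε), (f (x - η * I) - f ((0 : ℝ) - η * I)) * sinKernel x) -
          ℓ * (-(4 / Real.pi * (1 - ε) : ℝ) * I) := by
        rw [← integral_modelFun_mul_sinKernel hε0 (by linarith),
          ← intervalIntegral.integral_const_mul, ← intervalIntegral.integral_sub]
        · exact intervalIntegral.integral_congr fun x _ => by ring
        · exact (hcf.mul hk).intervalIntegrable
        · exact (continuousOn_const.mul (hmc.continuousOn.mul hk)).intervalIntegrable
      rw [e1, sub_re]
      congr 1
      · have e2 := reCLM.intervalIntegral_comp_comm ((hcf.mul hk).intervalIntegrable (μ := volume))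
        simp only [reCLM_apply] at e2
        refine Eq.trans (intervalIntegral.integral_congr fun x _ => ?_) e2
        simp only [Pi.mul_apply]
        rw [sinKernel_ofReal, re_mul_ofReal, sub_re, ← hρf _ (ofReal_sub_mul_I_mem hη.1),
          ← hρf _ (ofReal_sub_mul_I_mem hη.1)]
      · simp
        ring
    have hlim : Tendsto (fun η : ℝ => ∫ β in ε..(2 - ε), (ρ (β - η * I) - ρ ((0 : ℝ) - η * I)) *
          (Real.sin (Real.pi / 2 * β) ^ 2)⁻¹) (𝓝[>] 0)
        (𝓝 (∫ β in ε..(2 - ε), (ρ β - ρ 0) * (Real.sin (Real.pi / 2 * β) ^ 2)⁻¹)) := by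
      have hcomp : IsCompact ((fun p : ℝ × ℝ => (p.1 : ℂ) - p.2 * I) '' (Icc 0 2 ×ˢ Icc 0 1)) :=
        (isCompact_Icc.prod isCompact_Icc).image (by fun_prop)
      obtain ⟨M, hM⟩ := hcomp.exists_bound_of_continuousOn (f := ρ) (hρ.mono (by
        rintro _ ⟨p, hp, rfl⟩
        exact hclosed _ _ hp.2.1))
      have hcontη : ∀ x : ℝ, Tendsto (fun η : ℝ => ρ (x - η * I)) (𝓝[>] 0) (𝓝 (ρ x)) := by
        intro x
        have h := (hρ x (show (x : ℂ).im ≤ 0 by simp)).tendsto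
        refine h.comp (tendsto_nhdsWithin_iff.2 ⟨?_, ?_⟩)
        · have : Continuous (fun η : ℝ => (x : ℂ) - η * I) := by fun_prop
          simpa using (this.tendsto 0).mono_left nhdsWithin_le_nhds
        · filter_upwards [self_mem_nhdsWithin] with η hη
          exact hclosed _ _ (le_of_lt hη)
      refine intervalIntegral.tendsto_integral_filter_of_dominated_convergence
        (fun β => (2 * M) * (Real.sin (Real.pi / 2 * β) ^ 2)⁻¹) ?_ ?_ ?_ ?_
      · filter_upwards [Ioo_mem_nhdsGT (zero_lt_one (α := ℝ))] with η hη
        rw [uIoc_of_le (by linarith)]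
        refine (intervalIntegrable_mul_inv_sin_sq hε0 (by linarith) ?_).1.aestronglyMeasurable
        refine ContinuousOn.sub (hρ.comp (by fun_prop) fun x _ => hclosed _ _ hη.1.le)
          continuousOn_const
      · filter_upwards [Ioo_mem_nhdsGT (zero_lt_one (α := ℝ))] with η hη
        refine Eventually.of_forall fun β hβ => ?_
        rw [uIoc_of_le (by linarith)] at hβ
        rw [norm_mul]
        have hpos : 0 ≤ (Real.sin (Real.pi / 2 * β) ^ 2)⁻¹ := by positivity
        rw [Real.norm_of_nonneg hpos]
        refine mul_le_mul_of_nonneg_right ?_ hpos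
        have m1 := hM _ ⟨(β, η), ⟨⟨by linarith [hβ.1], by linarith [hβ.2]⟩, ⟨hη.1.le, hη.2.le⟩⟩, rfl⟩
        have m2 := hM _ ⟨(0, η), ⟨⟨le_refl _, by norm_num⟩, ⟨hη.1.le, hη.2.le⟩⟩, rfl⟩
        exact (norm_sub_le _ _).trans (by linarith)
      · exact intervalIntegrable_mul_inv_sin_sq hε0 (by linarith) continuousOn_const
      · refine Eventually.of_forall fun β _ => ?_
        have := (hcontη β).sub (hcontη 0)
        simpa using this.mul_const ((Real.sin (Real.pi / 2 * β) ^ 2)⁻¹)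
    refine le_of_tendsto ((hlim.sub_const _).abs) ?_
    filter_upwards [Ioo_mem_nhdsGT hε0] with η h using hη η h
  have hlin : Tendsto (fun ε : ℝ => 4 / Real.pi * (1 - ε) * ℓ.im) (𝓝[>] 0)
      (𝓝 (4 / Real.pi * ℓ.im)) := by
    have : Continuous (fun ε : ℝ => 4 / Real.pi * (1 - ε) * ℓ.im) := by fun_prop
    simpa using (this.tendsto 0).mono_left nhdsWithin_le_nhds
  have hdiff : Tendsto (fun ε : ℝ =>
      (∫ β in ε..(2 - ε), (ρ β - ρ 0) * (Real.sin (Real.pi / 2 * β) ^ 2)⁻¹) -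
        4 / Real.pi * (1 - ε) * ℓ.im) (𝓝[>] 0) (𝓝 0) := by
    rw [Metric.tendsto_nhds]
    intro δ hδ
    filter_upwards [key (δ / 8) (by positivity)] with ε h
    rw [Real.dist_eq, sub_zero]
    linarith
  simpa using hdiff.add hlin

end StripWave


namespace StripWave
open Complex

/-! ### The periodic Poisson kernel -/

/-- The Herglotz kernel of the lower half plane for functions of period `2`. -/
noncomputable def herglotz (w : ℂ) : ℂ :=
  1 / 2 * ((1 + exp (-I * Real.pi * w)) / (1 - exp (-I * Real.pi * w)))

theorem norm_exp_neg_I_pi (w : ℂ) : ‖exp (-I * Real.pi * w)‖ = Real.exp (Real.pi * w.im) := by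
  rw [norm_exp]
  simp

theorem norm_exp_lt_one {w : ℂ} (hw : w ∈ lowerPlane) : ‖exp (-I * Real.pi * w)‖ < 1 := by
  rw [norm_exp_neg_I_pi, Real.exp_lt_one_iff]
  exact mul_neg_of_pos_of_neg Real.pi_pos hw

theorem one_sub_exp_ne_zero {w : ℂ} (hw : w ∈ lowerPlane) : 1 - exp (-I * Real.pi * w) ≠ 0 := by
  intro h
  have := norm_exp_lt_one hw
  rw [← sub_eq_zero.1 h, norm_one] at this
  exact lt_irrefl _ this

theorem stripKernel_eq_re (w : ℂ) : stripKernel w = (herglotz w).re := by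
  have := congrFun (poissonKernel_eq_re_herglotzRieszKernel (c := 0)
    (w := exp (-I * Real.pi * w))) 1
  simp only [poissonKernel, Function.comp, herglotzRieszKernel, sub_zero, norm_one, one_pow] at this
  rw [stripKernel, this, herglotz, show (1 / 2 : ℂ) = ((1 / 2 : ℝ) : ℂ) by push_cast; rfl,
    re_ofReal_mul]

theorem differentiableAt_herglotz {w : ℂ} (hw : w ∈ lowerPlane) :
    DifferentiableAt ℂ herglotz w := by
  unfold herglotz
  have h1 : DifferentiableAt ℂ (fun w => 1 + exp (-I * Real.pi * w)) w := by fun_prop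
  have h2 : DifferentiableAt ℂ (fun w => 1 - exp (-I * Real.pi * w)) w := by fun_prop
  exact (h1.div h2 (one_sub_exp_ne_zero hw)).const_mul _

theorem stripKernel_nonneg {w : ℂ} (hw : w ∈ lowerPlane) : 0 ≤ stripKernel w := by
  have := norm_exp_lt_one hw
  unfold stripKernel
  have h2 : ‖exp (-I * Real.pi * w)‖ ^ 2 ≤ 1 := by
    nlinarith [norm_nonneg (exp (-I * Real.pi * w))]
  have h3 : 0 ≤ 1 - ‖exp (-I * Real.pi * w)‖ ^ 2 := by linarith
  positivity

theorem sub_ofReal_mem_lowerPlane {w : ℂ} (hw : w ∈ lowerPlane) (s : ℝ) : w - s ∈ lowerPlane := by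
  have : w.im < 0 := hw
  show (w - s).im < 0
  simpa using this

theorem stripKernel_add_two (w : ℂ) : stripKernel (w + 2) = stripKernel w := by
  have : exp (-I * Real.pi * (w + 2)) = exp (-I * Real.pi * w) := by
    rw [show -I * (Real.pi : ℂ) * (w + 2) = -I * Real.pi * w + -(2 * Real.pi * I) by ring, exp_add,
      exp_neg, exp_two_pi_mul_I]
    simp
  rw [stripKernel, stripKernel, this]

theorem stripKernel_sub_two (w : ℂ) : stripKernel (w - 2) = stripKernel w := by
  rw [← stripKernel_add_two (w - 2), sub_add_cancel]

theorem continuousOn_stripKernel : ContinuousOn stripKernel lowerPlane := by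
  have : stripKernel = fun w => (herglotz w).re := funext stripKernel_eq_re
  rw [this]
  exact continuous_re.comp_continuousOn fun w hw =>
    (differentiableAt_herglotz hw).continuousAt.continuousWithinAt

theorem continuous_stripKernel_sub {w : ℂ} (hw : w ∈ lowerPlane) :
    Continuous fun s : ℝ => stripKernel (w - s) :=
  continuousOn_stripKernel.comp_continuous (by fun_prop) (sub_ofReal_mem_lowerPlane hw)

theorem contDiff_stripKernel_sub {w : ℂ} (hw : w ∈ lowerPlane) :
    ContDiff ℝ 1 fun s : ℝ => stripKernel (w - s) := by
  have h1 : ContDiffOn ℂ 1 herglotz lowerPlane :=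
    DifferentiableOn.contDiffOn (fun w hw => (differentiableAt_herglotz hw).differentiableWithinAt)
      isOpen_lowerPlane
  have h2 : ContDiff ℝ 1 fun s : ℝ => w - (s : ℂ) := contDiff_const.sub ofRealCLM.contDiff
  have h3 : ContDiff ℝ 1 fun s : ℝ => herglotz (w - s) :=
    (h1.restrict_scalars ℝ).comp_contDiff h2 (sub_ofReal_mem_lowerPlane hw)
  have : (fun s : ℝ => stripKernel (w - s)) = fun s : ℝ => reCLM (herglotz (w - s)) :=
    funext fun s => stripKernel_eq_re _
  rw [this]
  exact reCLM.contDiff.comp h3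

theorem integral_stripKernel {w : ℂ} (hw : w ∈ lowerPlane) :
    ∫ s in (-1 : ℝ)..1, stripKernel (w - s) = 1 := by
  have := poisson_periodic (f := fun _ => 1) (η := 1) (C := 1) one_pos (by fun_prop) (by simp)
    (by simp) hw
  simp only [real_smul, mul_one] at this
  rw [intervalIntegral.integral_ofReal] at this
  exact_mod_cast this.symm

theorem periodic_stripKernel_sub (w : ℂ) :
    Function.Periodic (fun s : ℝ => stripKernel (w - s)) 2 := by
  intro s
  simp only
  rw [← stripKernel_sub_two (w - s)]
  congr 1
  push_cast
  ring

/-- With r = exp(π Im w) and σ = sin²(π Re w/2) the denominator of the kernel is (1 - r)² + 4rσ ≥ σ,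
while 1 - r² ≤ 2π|Im w|. Away from its poles the kernel is thus O(|Im w|), which controls all
contributions of remote parts of the boundary. -/
theorem stripKernel_mul_le {w : ℂ} (hw : w ∈ lowerPlane) :
    stripKernel w * Real.sin (Real.pi / 2 * w.re) ^ 2 ≤ Real.pi * |w.im| := by
  have hw' : w.im < 0 := hw
  set r := Real.exp (Real.pi * w.im) with hr
  have hr0 : 0 < r := Real.exp_pos _
  have hr1 : r < 1 := by
    rw [hr, Real.exp_lt_one_iff]
    exact mul_neg_of_pos_of_neg Real.pi_pos hw'
  set σ := Real.sin (Real.pi / 2 * w.re) ^ 2 with hσ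
  have hσ0 : 0 ≤ σ := sq_nonneg _
  have hσ1 : σ ≤ 1 := Real.sin_sq_le_one _
  have e1 : ‖1 - exp (-I * Real.pi * w)‖ ^ 2 = (1 - r) ^ 2 + 4 * r * σ := by
    have e2 : exp (-I * Real.pi * w) = r * exp ((-(2 * (Real.pi / 2 * w.re)) : ℝ) * I) := by
      rw [hr, ofReal_exp, ← exp_add]
      congr 1
      apply Complex.ext <;> simp <;> ring
    rw [e2, exp_ofReal_mul_I, Real.cos_neg, Real.sin_neg, ← normSq_eq_norm_sq, normSq_apply]
    simp only [sub_re, one_re, add_re, ofReal_re, mul_re, I_re, mul_zero, ofReal_im,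
      I_im, mul_one, sub_self, add_zero, sub_im, one_im, add_im, mul_im, zero_add]
    have h1 := Real.sin_sq_add_cos_sq (2 * (Real.pi / 2 * w.re))
    have h2 := Real.cos_two_mul (Real.pi / 2 * w.re)
    have h3 := Real.sin_sq_add_cos_sq (Real.pi / 2 * w.re)
    have h4 : Real.cos (2 * (Real.pi / 2 * w.re)) = 1 - 2 * σ := by
      rw [h2, hσ]; linarith
    have h5 : Real.sin (2 * (Real.pi / 2 * w.re)) ^ 2 = 1 - (1 - 2 * σ) ^ 2 := by
      rw [← h4]; linarith
    rw [h4]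
    ring_nf
    rw [show Real.pi * w.re = 2 * (Real.pi / 2 * w.re) by ring, h5]
    ring
  have e3 : σ ≤ (1 - r) ^ 2 + 4 * r * σ := by
    rcases le_total σ (1 / 2) with h | h
    · nlinarith [sq_nonneg (r - (1 - 2 * σ))]
    · nlinarith
  have e4 : 0 < (1 - r) ^ 2 + 4 * r * σ := by
    have : 0 < (1 - r) ^ 2 := by nlinarith
    positivity
  have e5 : 1 - r ^ 2 ≤ 2 * Real.pi * |w.im| := by
    have : r ^ 2 = Real.exp (2 * (Real.pi * w.im)) := by rw [hr, ← Real.exp_nat_mul]; norm_num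
    have h6 := Real.add_one_le_exp (2 * (Real.pi * w.im))
    rw [abs_of_neg hw']
    linarith
  rw [stripKernel, e1, norm_exp_neg_I_pi, ← hr]
  have h7 : 0 ≤ 1 - r ^ 2 := by nlinarith
  calc 1 / 2 * ((1 - r ^ 2) / ((1 - r) ^ 2 + 4 * r * σ)) * σ
      = 1 / 2 * (1 - r ^ 2) * (σ / ((1 - r) ^ 2 + 4 * r * σ)) := by ring
    _ ≤ 1 / 2 * (1 - r ^ 2) * 1 := by
      refine mul_le_mul_of_nonneg_left ((div_le_one e4).2 e3) (by positivity)
    _ ≤ _ := by linarith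

/-! ### Absolutely continuous complex functions -/

section AC

variable {f : ℝ → ℂ} {a b : ℝ}

/-- The comparison principle by which absolute continuity passes to real and imaginary parts, from
arc length to the velocity, and to squared increments of the velocity. -/
theorem absolutelyContinuous_of_dist_le {X Y : Type*} [PseudoMetricSpace X] [PseudoMetricSpace Y]
    {f : ℝ → X} {N : ℝ → Y} {M : ℝ} (hN : AbsolutelyContinuousOnInterval N a b)
    (h : ∀ x ∈ uIcc a b, ∀ y ∈ uIcc a b, dist (f x) (f y) ≤ M * dist (N x) (N y)) :
    AbsolutelyContinuousOnInterval f a b := by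
  have h0 := Tendsto.const_mul M (show Tendsto _ _ _ from hN)
  rw [mul_zero] at h0
  refine squeeze_zero' (Eventually.of_forall fun E => Finset.sum_nonneg fun i _ => dist_nonneg)
    ?_ h0
  filter_upwards [mem_inf_of_right (mem_principal_self _)] with E hE
  rw [Finset.mul_sum]
  exact Finset.sum_le_sum fun i hi => h _ (hE.1 i hi).1 _ (hE.1 i hi).2

theorem absolutelyContinuous_re (hf : AbsolutelyContinuousOnInterval f a b) :
    AbsolutelyContinuousOnInterval (fun x => (f x).re) a b :=
  absolutelyContinuous_of_dist_le (M := 1) hf fun x _ y _ => by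
    rw [one_mul, Real.dist_eq, dist_eq_norm, ← sub_re]
    exact abs_re_le_norm _

theorem absolutelyContinuous_im (hf : AbsolutelyContinuousOnInterval f a b) :
    AbsolutelyContinuousOnInterval (fun x => (f x).im) a b :=
  absolutelyContinuous_of_dist_le (M := 1) hf fun x _ y _ => by
    rw [one_mul, Real.dist_eq, dist_eq_norm, ← sub_im]
    exact abs_im_le_norm _

theorem hasDerivAt_of_re_im {r i : ℝ → ℝ} {r' i' x : ℝ} {f : ℝ → ℂ}
    (hr : HasDerivAt r r' x) (hi : HasDerivAt i i' x)
    (hf : ∀ y, f y = r y + i y * I) : HasDerivAt f (r' + i' * I) x := by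
  have := hr.ofReal_comp.add (hi.ofReal_comp.mul_const I)
  exact this.congr_of_eventuallyEq (Eventually.of_forall fun y => hf y)

theorem absolutelyContinuous_ae_hasDerivAt (hf : AbsolutelyContinuousOnInterval f a b) :
    ∀ᵐ x : ℝ, x ∈ uIcc a b → HasDerivAt f (deriv f x) x ∧
      deriv f x = ((deriv (fun x => (f x).re) x : ℝ) : ℂ) + ((deriv (fun x => (f x).im) x : ℝ) : ℂ) * I := by
  filter_upwards [(absolutelyContinuous_re hf).ae_differentiableAt,
    (absolutelyContinuous_im hf).ae_differentiableAt] with x h1 h2 hx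
  have := hasDerivAt_of_re_im (f := f) (h1 hx).hasDerivAt (h2 hx).hasDerivAt
    (fun y => (re_add_im (f y)).symm)
  rw [this.deriv]
  exact ⟨this, rfl⟩

theorem absolutelyContinuous_deriv_ae_eq (hf : AbsolutelyContinuousOnInterval f a b) :
    (fun x => ((deriv (fun x => (f x).re) x : ℝ) : ℂ) + ((deriv (fun x => (f x).im) x : ℝ) : ℂ) * I)
      =ᵐ[volume.restrict (uIoc a b)] deriv f := by
  rw [EventuallyEq, ae_restrict_iff' measurableSet_uIoc]
  filter_upwards [absolutelyContinuous_ae_hasDerivAt hf] with x hx h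
  exact (hx (uIoc_subset_uIcc h)).2.symm

theorem absolutelyContinuous_intervalIntegrable_deriv (hf : AbsolutelyContinuousOnInterval f a b) :
    IntervalIntegrable (deriv f) volume a b := by
  have h1 := (absolutelyContinuous_re hf).intervalIntegrable_deriv
  have h2 := (absolutelyContinuous_im hf).intervalIntegrable_deriv
  have h1' : IntervalIntegrable (fun x => ((deriv (fun x => (f x).re) x : ℝ) : ℂ)) volume a b :=
    ⟨h1.1.ofReal, h1.2.ofReal⟩
  have h2' : IntervalIntegrable (fun x => ((deriv (fun x => (f x).im) x : ℝ) : ℂ) * I) volume a b :=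
    IntervalIntegrable.mul_const ⟨h2.1.ofReal, h2.2.ofReal⟩ I
  exact (h1'.add h2').congr_ae (absolutelyContinuous_deriv_ae_eq hf)

theorem absolutelyContinuous_integral_mul_deriv {k : ℝ → ℝ}
    (hk : AbsolutelyContinuousOnInterval k a b) (hf : AbsolutelyContinuousOnInterval f a b) :
    ∫ x in a..b, (k x : ℂ) * deriv f x =
      k b * f b - k a * f a - ∫ x in a..b, ((deriv k x : ℝ) : ℂ) * f x := by
  have hr := hk.integral_mul_deriv_eq_deriv_mul (absolutelyContinuous_re hf)
  have hi := hk.integral_mul_deriv_eq_deriv_mul (absolutelyContinuous_im hf)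
  have i1 := (absolutelyContinuous_re hf).intervalIntegrable_deriv.continuousOn_mul hk.continuousOn
  have i2 := (absolutelyContinuous_im hf).intervalIntegrable_deriv.continuousOn_mul hk.continuousOn
  have i3 := hk.intervalIntegrable_deriv.mul_continuousOn (absolutelyContinuous_re hf).continuousOn
  have i4 := hk.intervalIntegrable_deriv.mul_continuousOn (absolutelyContinuous_im hf).continuousOn
  have e1 : ∫ x in a..b, (k x : ℂ) * deriv f x =
      ∫ x in a..b, ((k x * deriv (fun x => (f x).re) x : ℝ) : ℂ) +
        ((k x * deriv (fun x => (f x).im) x : ℝ) : ℂ) * I := by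
    refine intervalIntegral.integral_congr_ae ?_
    filter_upwards [absolutelyContinuous_ae_hasDerivAt hf] with x hx h
    rw [(hx (uIoc_subset_uIcc h)).2]
    push_cast
    ring
  have e2 : ∫ x in a..b, ((deriv k x : ℝ) : ℂ) * f x =
      ∫ x in a..b, ((deriv k x * (f x).re : ℝ) : ℂ) + ((deriv k x * (f x).im : ℝ) : ℂ) * I := by
    refine intervalIntegral.integral_congr fun x _ => ?_
    push_cast
    linear_combination -((deriv k x : ℝ) : ℂ) * re_add_im (f x)
  have c : ∀ {g : ℝ → ℝ}, IntervalIntegrable g volume a b →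
      IntervalIntegrable (fun x => (g x : ℂ)) volume a b := fun h => ⟨h.1.ofReal, h.2.ofReal⟩
  rw [e1, e2, intervalIntegral.integral_add (c i1) ((c i2).mul_const I),
    intervalIntegral.integral_add (c i3) ((c i4).mul_const I),
    intervalIntegral.integral_mul_const, intervalIntegral.integral_mul_const,
    intervalIntegral.integral_ofReal, intervalIntegral.integral_ofReal,
    intervalIntegral.integral_ofReal, intervalIntegral.integral_ofReal, hr, hi]
  push_cast
  linear_combination (k b : ℂ) * re_add_im (f b) - (k a : ℂ) * re_add_im (f a)

theorem absolutelyContinuous_const {X : Type*} [PseudoMetricSpace X] (c : X) :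
    AbsolutelyContinuousOnInterval (fun _ => c) a b := by
  have : LipschitzOnWith 0 (fun _ : ℝ => c) (uIcc a b) := by
    simp [LipschitzOnWith]
  exact this.absolutelyContinuousOnInterval

theorem absolutelyContinuous_integral_deriv (hf : AbsolutelyContinuousOnInterval f a b) :
    ∫ x in a..b, deriv f x = f b - f a := by
  have := absolutelyContinuous_integral_mul_deriv (absolutelyContinuous_const (1 : ℝ)) hf
  simpa using this

end AC

end StripWave


namespace StripWave
open Complex

/-! ### The flow in the Riemannian variable -/

/-- A water wave at a fixed time, in the coordinates of the half plane `{Im w ≤ 0}` in which the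
fluid region is a period: `Ψ` is the inverse of the Riemann mapping, `φ = Φ_z ∘ Ψ` and `G`, `D`, `B`
are the conjugate velocity, its complex derivative and its time derivative, all composed with `Ψ`;
`S` is a holomorphic function whose real part `ρ` is the sum of pressure and half the squared
speed. -/
structure StripData (Ψ φ G D B S : ℂ → ℂ) (ρ : ℂ → ℝ) : Prop where
  Ψ_cont : ContinuousOn Ψ closedLowerPlane
  Ψ_add_two : ∀ w, Ψ (w + 2) = Ψ w + 2
  Ψ_deriv : ∀ w ∈ lowerPlane, HasDerivAt Ψ (φ w)⁻¹ w
  Ψ_ac : AbsolutelyContinuousOnInterval (fun x : ℝ => Ψ x) (-1) 1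
  φ_cont : ContinuousOn φ closedLowerPlane
  φ_add_two : ∀ w, φ (w + 2) = φ w
  φ_ne : ∀ w ∈ lowerPlane, φ w ≠ 0
  φ_inv_bdd : ∃ C, ∀ w : ℂ, w.im ≤ -1 → ‖(φ w)⁻¹‖ ≤ C
  G_cont : ContinuousOn G closedLowerPlane
  G_add_two : ∀ w, G (w + 2) = G w
  G_deriv : ∀ w ∈ lowerPlane, HasDerivAt G (D w / φ w) w
  G_bdd : ∃ C, ∀ w ∈ closedLowerPlane, ‖G w‖ ≤ C
  D_cont : ContinuousOn D closedLowerPlane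
  D_add_two : ∀ w, D (w + 2) = D w
  B_cont : ContinuousOn B closedLowerPlane
  B_add_two : ∀ w, B (w + 2) = B w
  B_bdd : ∃ C, ∀ w : ℂ, w.im ≤ -1 → ‖B w‖ ≤ C
  S_deriv : ∀ w ∈ lowerPlane, HasDerivAt S ((I - B w) / φ w) w
  S_add_two : ∀ w ∈ lowerPlane, S (w + 2) = S w + 2 * I
  ρ_cont : ContinuousOn ρ closedLowerPlane
  ρ_eq : ∀ w ∈ lowerPlane, ρ w = (S w).re
  ρ_top : ∀ x : ℝ, ρ x = ‖G x‖ ^ 2 / 2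

theorem ofReal_mem_closedLowerPlane (x : ℝ) : (x : ℂ) ∈ closedLowerPlane := by
  show (x : ℂ).im ≤ 0
  simp

theorem ofReal_sub_mul_I_mem_closed {x η : ℝ} (hη : 0 ≤ η) :
    (x : ℂ) - η * I ∈ closedLowerPlane := by
  show ((x : ℂ) - η * I).im ≤ 0
  simpa

theorem tendsto_shift {E : Type*} [TopologicalSpace E] {h : ℂ → E} {x : ℝ}
    (hh : ContinuousOn h closedLowerPlane) :
    Tendsto (fun η : ℝ => h (x - η * I)) (𝓝[>] 0) (𝓝 (h x)) := by
  refine (hh x (ofReal_mem_closedLowerPlane x)).tendsto.comp (tendsto_nhdsWithin_iff.2 ⟨?_, ?_⟩)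
  · have : Continuous (fun η : ℝ => (x : ℂ) - η * I) := by fun_prop
    simpa using (this.tendsto 0).mono_left nhdsWithin_le_nhds
  · filter_upwards [self_mem_nhdsWithin] with η hη
    exact ofReal_sub_mul_I_mem_closed (le_of_lt hη)

theorem tendsto_integral_shift {h : ℂ → ℂ} {k : ℝ → ℝ} (hk : Continuous k)
    (hh : ContinuousOn h closedLowerPlane) (a b : ℝ) :
    Tendsto (fun η : ℝ => ∫ s in a..b, (k s : ℂ) * h (s - η * I)) (𝓝[>] 0)
      (𝓝 (∫ s in a..b, (k s : ℂ) * h s)) := by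
  have hcomp : IsCompact ((fun p : ℝ × ℝ => (p.1 : ℂ) - p.2 * I) '' (uIcc a b ×ˢ Icc 0 1)) :=
    (isCompact_uIcc.prod isCompact_Icc).image (by fun_prop)
  obtain ⟨M, hM⟩ := hcomp.exists_bound_of_continuousOn (f := h) (hh.mono (by
    rintro _ ⟨p, hp, rfl⟩
    exact ofReal_sub_mul_I_mem_closed hp.2.1))
  refine intervalIntegral.tendsto_integral_filter_of_dominated_convergence
    (fun s => ‖k s‖ * M) ?_ ?_ ?_ ?_
  · filter_upwards [Ioo_mem_nhdsGT (zero_lt_one (α := ℝ))] with η hη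
    refine Continuous.aestronglyMeasurable ((by fun_prop : Continuous fun s => (k s : ℂ)).mul ?_)
    exact hh.comp_continuous (by fun_prop) fun s => ofReal_sub_mul_I_mem_closed hη.1.le
  · filter_upwards [Ioo_mem_nhdsGT (zero_lt_one (α := ℝ))] with η hη
    refine Eventually.of_forall fun s hs => ?_
    rw [norm_mul, norm_real]
    exact mul_le_mul_of_nonneg_left (hM _ ⟨(s, η), ⟨uIoc_subset_uIcc hs, hη.1.le, hη.2.le⟩, rfl⟩)
      (norm_nonneg _)
  · exact (by fun_prop : Continuous fun s => ‖k s‖ * M).intervalIntegrable _ _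
  · exact Eventually.of_forall fun s _ => (tendsto_shift hh).const_mul _

theorem closure_lowerPlane : closure lowerPlane = closedLowerPlane := by
  have : lowerPlane = im ⁻¹' (Iio 0) := rfl
  rw [this, ← isOpenMap_im.preimage_closure_eq_closure_preimage continuous_im, closure_Iio]
  rfl

/-- Derivatives of a function on the boundary, from the limit of the derivatives inside. -/
theorem hasDerivAt_boundary {E : Type*} [NormedAddCommGroup E] [NormedSpace ℝ E] {f : ℂ → E}
    {f' : ℂ → (ℂ →L[ℝ] E)} {ℓ : ℂ →L[ℝ] E} {x : ℝ} (hc : ContinuousOn f closedLowerPlane)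
    (hf : ∀ w ∈ lowerPlane, HasFDerivAt f (f' w) w)
    (hℓ : Tendsto f' (𝓝[lowerPlane] x) (𝓝 ℓ)) : HasDerivAt (fun y : ℝ => f y) (ℓ 1) x := by
  have h := hasFDerivWithinAt_closure_of_tendsto_fderiv (f := f) (s := lowerPlane) (x := (x : ℂ))
    (f' := ℓ) (fun w hw => (hf w hw).differentiableAt.differentiableWithinAt) convex_lowerPlane
    isOpen_lowerPlane (fun y hy => (hc y (closure_lowerPlane ▸ hy)).mono
      lowerPlane_subset_closedLowerPlane)
    (hℓ.congr' (by filter_upwards [self_mem_nhdsWithin] with w hw using (hf w hw).fderiv.symm))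
  rw [closure_lowerPlane] at h
  have h2 : HasDerivWithinAt (fun y : ℝ => (y : ℂ)) 1 univ x :=
    (hasDerivAt_id x).ofReal_comp.hasDerivWithinAt
  have := h.comp_hasDerivWithinAt x h2 (fun y _ => ofReal_mem_closedLowerPlane y)
  exact this.hasDerivAt univ_mem

theorem hasDerivAt_boundary_complex {f f' : ℂ → ℂ} {ℓ : ℂ} {x : ℝ}
    (hc : ContinuousOn f closedLowerPlane) (hf : ∀ w ∈ lowerPlane, HasDerivAt f (f' w) w)
    (hℓ : Tendsto f' (𝓝[lowerPlane] x) (𝓝 ℓ)) : HasDerivAt (fun y : ℝ => f y) ℓ x := by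
  have h := hasDerivAt_boundary (f' := fun w => f' w • (1 : ℂ →L[ℝ] ℂ))
    (ℓ := ℓ • (1 : ℂ →L[ℝ] ℂ)) (x := x) hc (fun w hw => (hf w hw).complexToReal_fderiv)
    (hℓ.smul_const _)
  simpa using h

/-- Meant for the function S, of which only the real part is known to extend continuously to the
real line. -/
theorem hasDerivAt_boundary_re {f f' : ℂ → ℂ} {r : ℂ → ℝ} {ℓ : ℂ} {x : ℝ}
    (hc : ContinuousOn r closedLowerPlane) (hr : ∀ w ∈ lowerPlane, r w = (f w).re)
    (hf : ∀ w ∈ lowerPlane, HasDerivAt f (f' w) w)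
    (hℓ : Tendsto f' (𝓝[lowerPlane] x) (𝓝 ℓ)) : HasDerivAt (fun y : ℝ => r y) ℓ.re x := by
  have h := hasDerivAt_boundary (f := r) (f' := fun w => reCLM.comp (f' w • (1 : ℂ →L[ℝ] ℂ)))
    (ℓ := reCLM.comp (ℓ • (1 : ℂ →L[ℝ] ℂ))) (x := x) hc (fun w hw => ?_)
    (((ContinuousLinearMap.compL ℝ ℂ ℂ ℝ reCLM).continuous.tendsto _).comp (hℓ.smul_const _))
  · simpa using h
  · refine (reCLM.hasFDerivAt.comp w (hf w hw).complexToReal_fderiv).congr_of_eventuallyEq ?_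
    filter_upwards [isOpen_lowerPlane.mem_nhds hw] with y hy using hr y hy

theorem tendsto_boundary {h : ℂ → ℂ} (hh : ContinuousOn h closedLowerPlane) (x : ℝ) :
    Tendsto h (𝓝[lowerPlane] x) (𝓝 (h x)) :=
  (hh x (ofReal_mem_closedLowerPlane x)).mono lowerPlane_subset_closedLowerPlane

namespace StripData

variable {Ψ φ G D B S : ℂ → ℂ} {ρ : ℂ → ℝ} (H : StripData Ψ φ G D B S ρ)
include H

theorem hasDerivAt_Ψ_real {x : ℝ} (hx : φ x ≠ 0) :
    HasDerivAt (fun y : ℝ => Ψ y) (φ x)⁻¹ x :=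
  hasDerivAt_boundary_complex H.Ψ_cont H.Ψ_deriv ((tendsto_boundary H.φ_cont x).inv₀ hx)

theorem hasDerivAt_G_real {x : ℝ} (hx : φ x ≠ 0) :
    HasDerivAt (fun y : ℝ => G y) (D x / φ x) x :=
  hasDerivAt_boundary_complex H.G_cont H.G_deriv
    ((tendsto_boundary H.D_cont x).div (tendsto_boundary H.φ_cont x) hx)

theorem periodic_G : Function.Periodic (fun x : ℝ => G x) 2 := fun x => by
  push_cast
  exact H.G_add_two x

theorem periodic_deriv : Function.Periodic (deriv fun x : ℝ => Ψ x) 2 := by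
  intro x
  have h1 : (fun y : ℝ => Ψ ((y + 2 : ℝ) : ℂ)) = fun y : ℝ => Ψ y + 2 := by
    funext y
    push_cast
    exact H.Ψ_add_two y
  have h2 := deriv_comp_add_const (fun x : ℝ => Ψ x) 2 x
  rw [← h2, h1, deriv_add_const]

theorem intervalIntegrable_deriv (a b : ℝ) :
    IntervalIntegrable (deriv fun x : ℝ => Ψ x) volume a b := by
  refine H.periodic_deriv.intervalIntegrable (t := -1) two_ne_zero ?_ a b
  have := absolutelyContinuous_intervalIntegrable_deriv H.Ψ_ac
  norm_num at this ⊢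
  exact this

/-- Absolute continuity is given on one period only. The difference of Ψ and the integral of its
derivative is 2-periodic, since both gain 2 over a period, and it is constant on [-1, 1]. -/
theorem integral_deriv (a b : ℝ) : ∫ x in a..b, deriv (fun x : ℝ => Ψ x) x = Ψ b - Ψ a := by
  have hper : Function.Periodic
      (fun x : ℝ => Ψ x - ∫ s in (-1 : ℝ)..x, deriv (fun x : ℝ => Ψ x) s) 2 := by
    intro x
    have h1 := intervalIntegral.integral_add_adjacent_intervals
      (H.intervalIntegrable_deriv (-1) x) (H.intervalIntegrable_deriv x (x + 2))
    have h2 := H.periodic_deriv.intervalIntegral_add_eq x (-1)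
    rw [show (-1 : ℝ) + 2 = 1 by norm_num, absolutelyContinuous_integral_deriv H.Ψ_ac] at h2
    have h3 := H.Ψ_add_two (-1)
    rw [show (-1 : ℂ) + 2 = 1 by norm_num] at h3
    have h4 := H.Ψ_add_two x
    simp only
    rw [← h1, h2]
    push_cast
    rw [h3, h4]
    ring
  have hconst : ∀ x : ℝ, Ψ x - ∫ s in (-1 : ℝ)..x, deriv (fun x : ℝ => Ψ x) s = Ψ (-1) := by
    intro x
    obtain ⟨y, hy, hxy⟩ := hper.exists_mem_Ico two_pos x (-1)
    rw [hxy]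
    have := absolutelyContinuous_integral_deriv (H.Ψ_ac.mono (c := -1) (d := y)
      (uIcc_subset_uIcc left_mem_uIcc (by
        rw [uIcc_of_le (by norm_num)]; exact ⟨hy.1, by linarith [hy.2]⟩)))
    rw [this]
    push_cast
    ring
  have h1 := intervalIntegral.integral_add_adjacent_intervals
      (H.intervalIntegrable_deriv (-1) a) (H.intervalIntegrable_deriv a b)
  linear_combination h1 - hconst b + hconst a

theorem differentiableOn_φ_inv : DifferentiableOn ℂ (fun w => (φ w)⁻¹) lowerPlane := by
  have h1 : DifferentiableOn ℂ Ψ lowerPlane := fun w hw =>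
    (H.Ψ_deriv w hw).differentiableAt.differentiableWithinAt
  exact (h1.deriv isOpen_lowerPlane).congr fun w hw => (H.Ψ_deriv w hw).deriv.symm

/-- The derivative of the conformal map is the Poisson integral of its boundary derivative. -/
theorem φ_inv_eq_poisson {w : ℂ} (hw : w ∈ lowerPlane) :
    (φ w)⁻¹ = ∫ s in (-1 : ℝ)..1, (stripKernel (w - s) : ℂ) * deriv (fun x : ℝ => Ψ x) s := by
  set k : ℝ → ℝ := fun s => stripKernel (w - s) with hk
  have hkd : ContDiff ℝ 1 k := contDiff_stripKernel_sub hw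
  have hk' : Continuous (deriv k) := hkd.continuous_deriv le_rfl
  obtain ⟨C, hC⟩ := H.φ_inv_bdd
  -- Integration by parts moves the derivative from Ψ to the kernel. The right side then involves
  -- only Ψ, which is continuous up to the boundary, so η → 0 is harmless; absolute continuity
  -- undoes the integration by parts at η = 0.
  have hη : ∀ η : ℝ, 0 < η → (φ (w - η * I))⁻¹ =
      k 1 * Ψ ((1 : ℝ) - η * I) - k (-1) * Ψ ((-1 : ℝ) - η * I) -
        ∫ s in (-1 : ℝ)..1, ((deriv k s : ℝ) : ℂ) * Ψ (s - η * I) := by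
    intro η hη
    have hmem : ∀ w : ℂ, w.im < η → w - η * I ∈ lowerPlane := by
      intro w hw
      show (w - η * I).im < 0
      simpa using hw
    have h1 := poisson_periodic (f := fun w => (φ (w - η * I))⁻¹) (C := C) hη
      (fun w hw => by
        exact DifferentiableAt.comp (g := fun w => (φ w)⁻¹) (f := fun w : ℂ => w - η * I) w
          (H.differentiableOn_φ_inv.differentiableAt (isOpen_lowerPlane.mem_nhds (hmem w hw)))
          (by fun_prop))
      (fun w => by rw [show w + 2 - η * I = (w - η * I) + 2 by ring, H.φ_add_two])
      (fun w hw => hC _ (by simp; linarith)) hw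
    rw [h1]
    have h2 := intervalIntegral.integral_mul_deriv_eq_deriv_mul (a := -1) (b := 1)
      (u := fun s : ℝ => (k s : ℂ)) (u' := fun s : ℝ => ((deriv k s : ℝ) : ℂ))
      (v := fun s : ℝ => Ψ (s - η * I)) (v' := fun s : ℝ => (φ (s - η * I))⁻¹)
      (fun s _ => ((hkd.differentiable one_ne_zero).differentiableAt.hasDerivAt).ofReal_comp)
      (fun s _ => by
        have e := (H.Ψ_deriv _ (ofReal_sub_mul_I_mem (x := s) hη)).comp s
          ((hasDerivAt_id s).ofReal_comp.sub_const (η * I))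
        exact e.congr_deriv (by simp))
      ((by fun_prop : Continuous fun s => ((deriv k s : ℝ) : ℂ)).intervalIntegrable _ _)
      (Continuous.intervalIntegrable (H.differentiableOn_φ_inv.continuousOn.comp_continuous
        (by fun_prop) fun s => ofReal_sub_mul_I_mem hη) _ _)
    simp only [real_smul]
    rw [h2]
  have hlim1 : Tendsto (fun η : ℝ => (φ (w - η * I))⁻¹) (𝓝[>] 0) (𝓝 (φ w)⁻¹) := by
    have h1 : ContinuousAt (fun w => (φ w)⁻¹) w :=
      (H.differentiableOn_φ_inv.differentiableAt (isOpen_lowerPlane.mem_nhds hw)).continuousAt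
    refine h1.tendsto.comp ?_
    have : Continuous (fun η : ℝ => w - η * I) := by fun_prop
    simpa using (this.tendsto 0).mono_left nhdsWithin_le_nhds
  have hlim2 := (((tendsto_shift (x := 1) H.Ψ_cont).const_mul (k 1 : ℂ)).sub
    ((tendsto_shift (x := -1) H.Ψ_cont).const_mul (k (-1) : ℂ))).sub
    (tendsto_integral_shift hk' H.Ψ_cont (-1) 1)
  have hac : AbsolutelyContinuousOnInterval k (-1) 1 :=
    (hkd.contDiffOn).absolutelyContinuousOnInterval
  rw [absolutelyContinuous_integral_mul_deriv hac H.Ψ_ac]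
  refine tendsto_nhds_unique (hlim1.congr' ?_) hlim2
  filter_upwards [self_mem_nhdsWithin] with η h using hη η h

theorem φ_inv_eq_poisson' {w : ℂ} (hw : w ∈ lowerPlane) (c : ℝ) :
    (φ w)⁻¹ = ∫ s in (c - 1)..(c + 1),
      (stripKernel (w - s) : ℂ) * deriv (fun x : ℝ => Ψ x) s := by
  have hper : Function.Periodic
      (fun s : ℝ => (stripKernel (w - s) : ℂ) * deriv (fun x : ℝ => Ψ x) s) 2 := by
    intro s
    have h1 := periodic_stripKernel_sub w s
    simp only at h1 ⊢
    rw [h1, H.periodic_deriv s]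
  have := hper.intervalIntegral_add_eq (-1) (c - 1)
  rw [show (-1 : ℝ) + 2 = 1 by norm_num, show c - 1 + 2 = c + 1 by ring] at this
  rw [H.φ_inv_eq_poisson hw, this]

end StripData
end StripWave


/-! ### Lengths of the level curves and almost everywhere nondegeneracy -/

namespace StripWave
open Complex

/-- The mass which the Poisson kernel of `{Im w < 0}` at height `-ε`, centred at `τ`, gives to
`[a, b]`. -/
noncomputable def kernelMass (a b ε τ : ℝ) : ℝ := ∫ s in a..b, stripKernel ((s : ℂ) - ε * I - τ)

theorem continuous_stripKernel_two {ε : ℝ} (hε : 0 < ε) :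
    Continuous fun p : ℝ × ℝ => stripKernel ((p.1 : ℂ) - ε * I - p.2) :=
  continuousOn_stripKernel.comp_continuous (by fun_prop) fun p =>
    sub_ofReal_mem_lowerPlane (ofReal_sub_mul_I_mem hε) _

theorem kernelMass_nonneg {a b ε : ℝ} (hab : a ≤ b) (hε : 0 < ε) (τ : ℝ) :
    0 ≤ kernelMass a b ε τ :=
  intervalIntegral.integral_nonneg hab fun _ _ =>
    stripKernel_nonneg (sub_ofReal_mem_lowerPlane (ofReal_sub_mul_I_mem hε) _)

/-- The two exponentials are complex conjugates. Exchanging s and τ turns the mass given to [a, b]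
into an integral in the variable for which the total mass is known to be 1. -/
theorem stripKernel_reflect (s ε τ : ℝ) :
    stripKernel ((s : ℂ) - ε * I - τ) = stripKernel ((τ : ℂ) - ε * I - s) := by
  have h : exp (-I * Real.pi * ((s : ℂ) - ε * I - τ)) =
      (starRingEnd ℂ) (exp (-I * Real.pi * ((τ : ℂ) - ε * I - s))) := by
    rw [← exp_conj]
    congr 1
    simp only [map_mul, map_neg, conj_I, conj_ofReal, map_sub]
    ring
  unfold stripKernel
  have h2 : (1 : ℂ) - exp (-I * Real.pi * ((s : ℂ) - ε * I - τ)) =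
      (starRingEnd ℂ) (1 - exp (-I * Real.pi * ((τ : ℂ) - ε * I - s))) := by
    rw [map_sub, map_one, h]
  rw [h2, h, norm_conj, norm_conj]

theorem kernelMass_le_one {a b ε : ℝ} (hab : a ≤ b) (hb : b ≤ a + 2) (hε : 0 < ε) (τ : ℝ) :
    kernelMass a b ε τ ≤ 1 := by
  have hw := ofReal_sub_mul_I_mem (x := τ) hε
  unfold kernelMass
  simp_rw [stripKernel_reflect _ ε τ]
  have h1 := (periodic_stripKernel_sub ((τ : ℂ) - ε * I)).intervalIntegral_add_eq a (-1)
  rw [show (-1 : ℝ) + 2 = 1 by norm_num, integral_stripKernel hw] at h1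
  rw [← h1]
  exact intervalIntegral.integral_mono_interval le_rfl hab hb
    (Eventually.of_forall fun s => stripKernel_nonneg (sub_ofReal_mem_lowerPlane hw s))
    ((continuous_stripKernel_sub hw).intervalIntegrable _ _)

/-- On [a, b] the quantity sin²(π(s - τ)/2) has a positive minimum, so `stripKernel_mul_le` bounds
the kernel there by a multiple of ε. -/
theorem tendsto_kernelMass {a b τ : ℝ} (hab : a ≤ b)
    (h : ∀ s ∈ Icc a b, s ≠ τ ∧ |s - τ| < 2) :
    Tendsto (fun ε => kernelMass a b ε τ) (𝓝[>] 0) (𝓝 0) := by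
  have hcont : ContinuousOn (fun s : ℝ => Real.sin (Real.pi / 2 * (s - τ)) ^ 2) (Icc a b) := by
    fun_prop
  obtain ⟨s0, hs0, hmin⟩ := isCompact_Icc.exists_isMinOn (nonempty_Icc.2 hab) hcont
  set δ := Real.sin (Real.pi / 2 * (s0 - τ)) ^ 2 with hδ
  have hδ0 : 0 < δ := by
    have h0 := h s0 hs0
    have hne : Real.sin (Real.pi / 2 * (s0 - τ)) ≠ 0 := by
      intro h1
      rcases lt_or_gt_of_ne h0.1 with h2 | h2
      · have := sin_half_pi_pos (x := τ - s0) (by linarith) (by linarith [(abs_lt.1 h0.2).1])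
        rw [show Real.pi / 2 * (τ - s0) = -(Real.pi / 2 * (s0 - τ)) by ring, Real.sin_neg] at this
        linarith
      · have := sin_half_pi_pos (x := s0 - τ) (by linarith) (by linarith [(abs_lt.1 h0.2).2])
        linarith
    positivity
  have hbound : ∀ ε > 0, kernelMass a b ε τ ≤ Real.pi * ε / δ * (b - a) := by
    intro ε hε
    have hle : ∀ s ∈ Icc a b, stripKernel ((s : ℂ) - ε * I - τ) ≤ Real.pi * ε / δ := by
      intro s hs
      have hw := sub_ofReal_mem_lowerPlane (ofReal_sub_mul_I_mem (x := s) hε) τ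
      have h1 := stripKernel_mul_le hw
      have h2 := stripKernel_nonneg hw
      have h3 : ((s : ℂ) - ε * I - τ).re = s - τ := by simp
      have h4 : ((s : ℂ) - ε * I - τ).im = -ε := by simp
      rw [h3, h4, abs_neg, abs_of_pos hε] at h1
      rw [le_div_iff₀ hδ0]
      exact (mul_le_mul_of_nonneg_left (hmin hs) h2).trans h1
    have := intervalIntegral.integral_mono_on (μ := volume) hab
      (((continuous_stripKernel_two hε).comp (by fun_prop : Continuous fun s : ℝ =>
        (s, τ))).intervalIntegrable _ _) (continuous_const.intervalIntegrable _ _) hle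
    rw [intervalIntegral.integral_const, smul_eq_mul] at this
    rw [mul_comm _ (b - a)]
    exact this
  refine squeeze_zero' ?_ (g := fun ε => Real.pi * ε / δ * (b - a)) ?_ ?_
  · filter_upwards [self_mem_nhdsWithin] with ε hε using kernelMass_nonneg hab hε τ
  · filter_upwards [self_mem_nhdsWithin] with ε hε using hbound ε hε
  · have : Continuous (fun ε : ℝ => Real.pi * ε / δ * (b - a)) := by fun_prop
    simpa using (this.tendsto 0).mono_left nhdsWithin_le_nhds

theorem continuous_kernelMass {a b ε : ℝ} (hε : 0 < ε) : Continuous (kernelMass a b ε) := by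
  have h : Continuous (Function.uncurry fun τ s : ℝ => stripKernel ((s : ℂ) - ε * I - τ)) :=
    continuousOn_stripKernel.comp_continuous
      (by fun_prop : Continuous fun p : ℝ × ℝ => (p.2 : ℂ) - ε * I - p.1) fun p =>
        sub_ofReal_mem_lowerPlane (ofReal_sub_mul_I_mem hε) _
  unfold kernelMass
  exact intervalIntegral.continuous_parametric_intervalIntegral_of_continuous' h a b

theorem tendsto_integral_mul_kernelMass {a b x y : ℝ} (hab : a ≤ b) (hb : b ≤ a + 2) (hxy : x ≤ y)
    (h : ∀ τ ∈ Ioo x y, ∀ s ∈ Icc a b, s ≠ τ ∧ |s - τ| < 2) {g : ℝ → ℝ}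
    (hg : IntervalIntegrable g volume x y) :
    Tendsto (fun ε => ∫ τ in x..y, g τ * kernelMass a b ε τ) (𝓝[>] 0) (𝓝 0) := by
  have := intervalIntegral.tendsto_integral_filter_of_dominated_convergence
    (μ := volume) (a := x) (b := y) (l := 𝓝[>] (0 : ℝ))
    (F := fun ε τ => g τ * kernelMass a b ε τ) (f := fun _ => (0 : ℝ))
    (fun τ => ‖g τ‖) ?_ ?_ hg.norm ?_
  · simpa using this
  · filter_upwards [self_mem_nhdsWithin] with ε hε
    exact (intervalIntegrable_iff.1 (hg.mul_continuousOn (continuous_kernelMass hε).continuousOn)).aestronglyMeasurable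
  · filter_upwards [self_mem_nhdsWithin] with ε hε
    refine Eventually.of_forall fun τ _ => ?_
    rw [norm_mul, Real.norm_of_nonneg (kernelMass_nonneg hab hε τ)]
    exact mul_le_of_le_one_right (norm_nonneg _) (kernelMass_le_one hab hb hε τ)
  · have hy : ∀ᵐ τ : ℝ, τ ≠ y := by
      simp [ae_iff]
    filter_upwards [hy] with τ hτ hmem
    rw [uIoc_of_le hxy] at hmem
    simpa using (tendsto_kernelMass hab (h τ ⟨hmem.1, lt_of_le_of_ne hmem.2 hτ⟩)).const_mul
        (g τ)

namespace StripData

variable {Ψ φ G D B S : ℂ → ℂ} {ρ : ℂ → ℝ} (H : StripData Ψ φ G D B S ρ)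
include H

/-- The triangle inequality in the Poisson formula for 1/φ, followed by Fubini's theorem. -/
theorem integral_norm_φ_inv_le {a b ε : ℝ} (hab : a ≤ b) (hε : 0 < ε) (c : ℝ) :
    ∫ s in a..b, ‖(φ (s - ε * I))⁻¹‖ ≤
      ∫ τ in (c - 1)..(c + 1), ‖deriv (fun x : ℝ => Ψ x) τ‖ * kernelMass a b ε τ := by
  have hg := H.intervalIntegrable_deriv (c - 1) (c + 1)
  have hint : IntegrableOn (Function.uncurry fun s τ : ℝ =>
      stripKernel ((s : ℂ) - ε * I - τ) * ‖deriv (fun x : ℝ => Ψ x) τ‖)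
      (uIoc a b ×ˢ uIoc (c - 1) (c + 1)) := by
    obtain ⟨M, hM⟩ := (isCompact_uIcc.prod isCompact_uIcc).exists_bound_of_continuousOn
      (s := uIcc a b ×ˢ uIcc (c - 1) (c + 1)) (continuous_stripKernel_two hε).continuousOn
    rw [IntegrableOn, Measure.volume_eq_prod, ← Measure.prod_restrict]
    have : IsFiniteMeasure (volume.restrict (uIoc a b)) := ⟨by simp [uIoc]⟩
    have h1 : Integrable (fun p : ℝ × ℝ => ‖deriv (fun x : ℝ => Ψ x) p.2‖)
        ((volume.restrict (uIoc a b)).prod (volume.restrict (uIoc (c - 1) (c + 1)))) :=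
      (intervalIntegrable_iff.1 hg).norm.comp_snd _
    refine h1.bdd_mul (c := M) (continuous_stripKernel_two hε).aestronglyMeasurable ?_
    rw [Measure.prod_restrict, ae_restrict_iff' (measurableSet_uIoc.prod measurableSet_uIoc)]
    exact Eventually.of_forall fun p hp => hM p ⟨uIoc_subset_uIcc hp.1, uIoc_subset_uIcc hp.2⟩
  have hswap := intervalIntegral_intervalIntegral_swap hint
  have hcont : Continuous fun s : ℝ => (φ (s - ε * I))⁻¹ :=
    H.differentiableOn_φ_inv.continuousOn.comp_continuous (by fun_prop)
      fun s => ofReal_sub_mul_I_mem hε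
  have hRint : IntervalIntegrable (fun s : ℝ => ∫ τ in (c - 1)..(c + 1),
      stripKernel ((s : ℂ) - ε * I - τ) * ‖deriv (fun x : ℝ => Ψ x) τ‖) volume a b := by
    rw [IntegrableOn, Measure.volume_eq_prod, ← Measure.prod_restrict] at hint
    rw [intervalIntegrable_iff]
    have := hint.integral_prod_left
    simp only [intervalIntegral.intervalIntegral_eq_integral_uIoc]
    exact this.smul (_ : ℝ)
  calc ∫ s in a..b, ‖(φ (s - ε * I))⁻¹‖
      ≤ ∫ s in a..b, ∫ τ in (c - 1)..(c + 1),
          stripKernel ((s : ℂ) - ε * I - τ) * ‖deriv (fun x : ℝ => Ψ x) τ‖ := by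
        refine intervalIntegral.integral_mono_on hab (hcont.norm.intervalIntegrable _ _) hRint
          fun s _ => ?_
        have hw := ofReal_sub_mul_I_mem (x := s) hε
        rw [H.φ_inv_eq_poisson' hw c]
        refine (intervalIntegral.norm_integral_le_integral_norm (by linarith)).trans
          (le_of_eq (intervalIntegral.integral_congr fun τ _ => ?_))
        simp only [norm_mul, norm_real]
        rw [Real.norm_of_nonneg (stripKernel_nonneg (sub_ofReal_mem_lowerPlane hw τ))]
    _ = _ := by
        rw [hswap]
        refine intervalIntegral.integral_congr fun τ _ => ?_
        simp only [kernelMass]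
        rw [intervalIntegral.integral_mul_const, mul_comm]

/-- The lengths of the curves at height `-ε` are, in the limit, at most that of the boundary
curve. -/
theorem exists_bound_integral_norm_φ_inv {a b : ℝ} (hab : a ≤ b) (hb : b ≤ a + 2) :
    ∃ R : ℝ → ℝ, (∀ ε : ℝ, 0 < ε → ∫ s in a..b, ‖(φ (s - ε * I))⁻¹‖ ≤ R ε) ∧
      Tendsto R (𝓝[>] 0) (𝓝 (∫ s in a..b, ‖deriv (fun x : ℝ => Ψ x) s‖)) := by
  set c := (a + b) / 2 with hc
  have hgi : ∀ x y, IntervalIntegrable (fun s => ‖deriv (fun x : ℝ => Ψ x) s‖) volume x y :=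
    fun x y => (H.intervalIntegrable_deriv x y).norm
  have hmi : ∀ ε > 0, ∀ x y, IntervalIntegrable
      (fun s => ‖deriv (fun x : ℝ => Ψ x) s‖ * kernelMass a b ε s) volume x y := fun ε hε x y =>
    (hgi x y).mul_continuousOn (continuous_kernelMass hε).continuousOn
  -- The period centred at the midpoint of [a, b] splits into [a, b], where the mass is at most 1,
  -- and two flanks, whose contribution vanishes in the limit by dominated convergence.
  refine ⟨fun ε => (∫ τ in (c - 1)..a, ‖deriv (fun x : ℝ => Ψ x) τ‖ * kernelMass a b ε τ) +
    (∫ s in a..b, ‖deriv (fun x : ℝ => Ψ x) s‖) +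
    ∫ τ in b..(c + 1), ‖deriv (fun x : ℝ => Ψ x) τ‖ * kernelMass a b ε τ, fun ε hε => ?_, ?_⟩
  · refine (H.integral_norm_φ_inv_le hab hε c).trans ?_
    rw [← intervalIntegral.integral_add_adjacent_intervals (hmi ε hε (c - 1) b) (hmi ε hε b (c + 1)),
      ← intervalIntegral.integral_add_adjacent_intervals (hmi ε hε (c - 1) a) (hmi ε hε a b)]
    have := intervalIntegral.integral_mono_on hab (hmi ε hε a b) (hgi a b) fun τ _ =>
      mul_le_of_le_one_right (norm_nonneg _) (kernelMass_le_one hab hb hε τ)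
    linarith
  · have h1 := tendsto_integral_mul_kernelMass (x := c - 1) (y := a) hab hb (by linarith)
      (fun τ hτ s hs => ⟨ne_of_gt (hτ.2.trans_le hs.1), by
        rw [abs_lt]; constructor <;> linarith [hτ.1, hτ.2, hs.1, hs.2]⟩) (hgi _ _)
    have h2 := tendsto_integral_mul_kernelMass (x := b) (y := c + 1) hab hb (by linarith)
      (fun τ hτ s hs => ⟨ne_of_lt (hs.2.trans_lt hτ.1), by
        rw [abs_lt]; constructor <;> linarith [hτ.1, hτ.2, hs.1, hs.2]⟩) (hgi _ _)
    simpa using (h1.add_const (∫ s in a..b, ‖deriv (fun x : ℝ => Ψ x) s‖)).add h2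

theorem continuous_φ_shift {η : ℝ} (hη : 0 ≤ η) : Continuous fun s : ℝ => φ (s - η * I) :=
  H.φ_cont.comp_continuous (by fun_prop) fun _ => ofReal_sub_mul_I_mem_closed hη

/-- By Fatou's lemma and the length bound, the lower limit of |1/φ(x - iε)| along a sequence ε → 0
is finite for almost every x. As φ is continuous up to the boundary, it would be infinite wherever
φ(x) = 0. -/
theorem ae_ne_zero_window {a b : ℝ} (hab : a ≤ b) (hb : b ≤ a + 2) :
    ∀ᵐ x : ℝ, x ∈ Ioc a b → φ x ≠ 0 := by
  obtain ⟨R, hR, hlim⟩ := H.exists_bound_integral_norm_φ_inv hab hb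
  set u : ℕ → ℝ := fun n => 1 / ((n : ℝ) + 1) with hu
  have hu0 : ∀ n, 0 < u n := fun n => by positivity
  have hut : Tendsto u atTop (𝓝[>] 0) := tendsto_nhdsWithin_iff.2
    ⟨tendsto_one_div_add_atTop_nhds_zero_nat, Eventually.of_forall hu0⟩
  have hcont : ∀ n, Continuous fun s : ℝ => (φ (s - u n * I))⁻¹ := fun n =>
    (H.continuous_φ_shift (hu0 n).le).inv₀ fun s => H.φ_ne _ (ofReal_sub_mul_I_mem (hu0 n))
  have hle : ∀ n, ∫⁻ s in Ioc a b, ‖(φ (s - u n * I))⁻¹‖ₑ ≤ ENNReal.ofReal (R (u n)) := by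
    intro n
    have h1 : IntegrableOn (fun s : ℝ => (φ (s - u n * I))⁻¹) (Ioc a b) :=
      ((hcont n).intervalIntegrable a b).1
    rw [← ofReal_integral_norm_eq_lintegral_enorm h1, ← intervalIntegral.integral_of_le hab]
    exact ENNReal.ofReal_le_ofReal (hR _ (hu0 n))
  have hF := lintegral_liminf_le (μ := volume.restrict (Ioc a b)) (u := atTop)
    (f := fun (n : ℕ) (s : ℝ) => ‖(φ (s - u n * I))⁻¹‖ₑ) fun n => (hcont n).measurable.enorm
  have hfin : ∫⁻ s in Ioc a b, liminf (fun n : ℕ => ‖(φ (s - u n * I))⁻¹‖ₑ) atTop ≠ ⊤ := by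
    refine ne_top_of_le_ne_top ?_ (hF.trans (liminf_le_liminf (Eventually.of_forall hle)))
    have := (ENNReal.continuous_ofReal.tendsto _).comp (hlim.comp hut)
    rw [show (fun n => ENNReal.ofReal (R (u n))) = ENNReal.ofReal ∘ R ∘ u from rfl,
      this.liminf_eq]
    exact ENNReal.ofReal_ne_top
  have hm : Measurable fun s : ℝ => liminf (fun n : ℕ => ‖(φ (s - u n * I))⁻¹‖ₑ) atTop :=
    Measurable.liminf fun n => (hcont n).measurable.enorm
  have hae := ae_lt_top hm hfin
  rw [ae_restrict_iff' measurableSet_Ioc] at hae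
  filter_upwards [hae] with x hx hmem h0
  have h1 : Tendsto (fun n => φ (x - u n * I)) atTop (𝓝[≠] 0) := by
    refine tendsto_nhdsWithin_iff.2 ⟨?_, Eventually.of_forall fun n =>
      H.φ_ne _ (ofReal_sub_mul_I_mem (hu0 n))⟩
    have := (tendsto_shift (x := x) H.φ_cont).comp hut
    rw [h0] at this
    exact this
  have h2 : Tendsto (fun n => ‖(φ (x - u n * I))⁻¹‖ₑ) atTop (𝓝 ⊤) := by
    have h3 := tendsto_norm_inv_nhdsNE_zero_atTop.comp h1
    have h4 := ENNReal.tendsto_ofReal_atTop.comp h3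
    refine h4.congr fun n => ?_
    simp only [Function.comp]
    rw [ofReal_norm]
  have := hx hmem
  rw [h2.liminf_eq] at this
  exact lt_irrefl _ this

/-- The Riemann mapping degenerates only on a null set. -/
theorem ae_ne_zero : ∀ᵐ x : ℝ, φ x ≠ 0 := by
  have h : ∀ n : ℤ, ∀ᵐ x : ℝ, x ∈ Ioc (n : ℝ) (n + 1) → φ x ≠ 0 := fun n =>
    H.ae_ne_zero_window (by linarith) (by linarith)
  filter_upwards [ae_all_iff.2 h] with x hx
  refine hx (⌈x⌉ - 1) ⟨?_, ?_⟩
  · push_cast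
    linarith [Int.ceil_lt_add_one x]
  · push_cast
    linarith [Int.le_ceil x]

theorem deriv_Ψ_ae : ∀ᵐ x : ℝ, deriv (fun x : ℝ => Ψ x) x = (φ x)⁻¹ := by
  filter_upwards [H.ae_ne_zero] with x hx using (H.hasDerivAt_Ψ_real hx).deriv

/-- At height -ε one has G' = D/φ with D bounded by M, so increments of G are at most M times the
length of the level curve; then ε → 0. This yields the absolute continuity of G across degenerate
points. -/
theorem exists_dist_G_le : ∃ M, 0 ≤ M ∧ ∀ a b : ℝ, a ≤ b → b ≤ a + 2 →
    ‖G b - G a‖ ≤ M * ∫ s in a..b, ‖deriv (fun x : ℝ => Ψ x) s‖ := by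
  have hcomp : IsCompact ((fun p : ℝ × ℝ => (p.1 : ℂ) - p.2 * I) '' (Icc (-1) 1 ×ˢ Icc 0 1)) :=
    (isCompact_Icc.prod isCompact_Icc).image (by fun_prop)
  obtain ⟨M, hM⟩ := hcomp.exists_bound_of_continuousOn (f := D) (H.D_cont.mono (by
    rintro _ ⟨p, hp, rfl⟩
    exact ofReal_sub_mul_I_mem_closed hp.2.1))
  have hM' : ∀ s η : ℝ, 0 ≤ η → η ≤ 1 → ‖D (s - η * I)‖ ≤ M := by
    intro s η h0 h1
    have hper : Function.Periodic (fun s : ℝ => D (s - η * I)) 2 := by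
      intro s
      have := H.D_add_two (s - η * I)
      simp only
      rw [← this]
      push_cast
      ring_nf
    obtain ⟨y, hy, hxy⟩ := hper.exists_mem_Ico two_pos s (-1)
    rw [hxy]
    exact hM _ ⟨(y, η), ⟨⟨hy.1, by linarith [hy.2]⟩, h0, h1⟩, rfl⟩
  have hM0 : 0 ≤ M := (norm_nonneg _).trans (hM' 0 0 le_rfl zero_le_one)
  refine ⟨M, hM0, fun a b hab hb => ?_⟩
  obtain ⟨R, hR, hlim⟩ := H.exists_bound_integral_norm_φ_inv hab hb
  have h1 : ∀ᶠ ε : ℝ in 𝓝[>] 0, ‖G (b - ε * I) - G (a - ε * I)‖ ≤ M * R ε := by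
    filter_upwards [Ioo_mem_nhdsGT (zero_lt_one (α := ℝ))] with ε hε
    have hc1 : Continuous fun s : ℝ => (φ (s - ε * I))⁻¹ :=
      (H.continuous_φ_shift hε.1.le).inv₀ fun s => H.φ_ne _ (ofReal_sub_mul_I_mem hε.1)
    have hc2 : Continuous fun s : ℝ => D (s - ε * I) :=
      H.D_cont.comp_continuous (by fun_prop) fun _ => ofReal_sub_mul_I_mem_closed hε.1.le
    have h2 := intervalIntegral.integral_eq_sub_of_hasDerivAt (a := a) (b := b)
      (f := fun s : ℝ => G (s - ε * I)) (f' := fun s : ℝ => D (s - ε * I) * (φ (s - ε * I))⁻¹)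
      (fun s _ => by
        have e := (H.G_deriv _ (ofReal_sub_mul_I_mem (x := s) hε.1)).comp s
          ((hasDerivAt_id s).ofReal_comp.sub_const (ε * I))
        exact e.congr_deriv (by simp [div_eq_mul_inv])) ((hc2.mul hc1).intervalIntegrable _ _)
    rw [← h2]
    refine (intervalIntegral.norm_integral_le_integral_norm hab).trans ?_
    have h3 := intervalIntegral.integral_mono_on (μ := volume) hab ((hc2.mul hc1).norm.intervalIntegrable _ _)
      ((hc1.norm.const_mul M).intervalIntegrable _ _) fun s _ => by
        simp only [Pi.mul_apply, norm_mul]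
        exact mul_le_mul_of_nonneg_right (hM' s ε hε.1.le hε.2.le) (norm_nonneg _)
    refine h3.trans ?_
    rw [intervalIntegral.integral_const_mul]
    exact mul_le_mul_of_nonneg_left (hR ε hε.1) hM0
  exact le_of_tendsto_of_tendsto
    ((tendsto_shift (x := b) H.G_cont).sub (tendsto_shift (x := a) H.G_cont)).norm
    (hlim.const_mul M) h1

theorem absolutelyContinuous_G {a b : ℝ} (hab : a ≤ b) (hb : b ≤ a + 2) :
    AbsolutelyContinuousOnInterval (fun x : ℝ => G x) a b := by
  obtain ⟨M, hM0, hM⟩ := H.exists_dist_G_le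
  have hgi : ∀ x y, IntervalIntegrable (fun s => ‖deriv (fun x : ℝ => Ψ x) s‖) volume x y :=
    fun x y => (H.intervalIntegrable_deriv x y).norm
  refine absolutelyContinuous_of_dist_le (M := M)
    ((hgi a b).absolutelyContinuousOnInterval_intervalIntegral (c := a) left_mem_uIcc) ?_
  have key : ∀ x ∈ uIcc a b, ∀ y ∈ uIcc a b, x ≤ y → dist (G x) (G y) ≤
      M * dist (∫ s in a..x, ‖deriv (fun x : ℝ => Ψ x) s‖)
        (∫ s in a..y, ‖deriv (fun x : ℝ => Ψ x) s‖) := by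
    intro x hx y hy hxy
    rw [uIcc_of_le hab] at hx hy
    rw [dist_comm, dist_eq_norm, dist_comm, Real.dist_eq,
      intervalIntegral.integral_interval_sub_left (hgi _ _) (hgi _ _)]
    exact (hM x y hxy (by linarith [hx.1, hy.2])).trans
      (mul_le_mul_of_nonneg_left (le_abs_self _) hM0)
  intro x hx y hy
  rcases le_total x y with h | h
  · exact key x hx y hy h
  · rw [dist_comm, dist_comm (∫ s in a..x, _)]
    exact key y hy x hx h

end StripData
end StripWave


/-! ### The pressure gradient and the direction of the surface -/

namespace StripWave
open Complex

/-- For nonnegative integrands the existence of the principal value is absolute convergence. This is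
how the integral in the formula for A₁ is seen to converge. -/
theorem intervalIntegrable_of_tendsto_truncated {k : ℝ → ℝ} {L : ℝ} (h0 : ∀ x, 0 ≤ k x)
    (hk : ∀ ε, 0 < ε → ε < 1 → IntervalIntegrable k volume ε (2 - ε))
    (hL : Tendsto (fun ε => ∫ x in ε..(2 - ε), k x) (𝓝[>] 0) (𝓝 L)) :
    IntervalIntegrable k volume 0 2 ∧ ∫ x in (0 : ℝ)..2, k x = L := by
  set u : ℕ → ℝ := fun n => 1 / ((n : ℝ) + 1) / 2 with hu
  have hu0 : ∀ n, 0 < u n := fun n => by positivity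
  have hu1 : ∀ n, u n < 1 := fun n => by
    have : 1 / ((n : ℝ) + 1) ≤ 1 := by
      rw [div_le_one (by positivity)]
      linarith [Nat.cast_nonneg (α := ℝ) n]
    simp only [hu]
    linarith
  have hut0 : Tendsto u atTop (𝓝 0) := by
    have := (tendsto_one_div_add_atTop_nhds_zero_nat (𝕜 := ℝ)).div_const 2
    rwa [zero_div] at this
  have hut : Tendsto u atTop (𝓝[>] 0) :=
    tendsto_nhdsWithin_iff.2 ⟨hut0, Eventually.of_forall hu0⟩
  have hut2 : Tendsto (fun n => 2 - u n) atTop (𝓝 2) := by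
    simpa using hut0.const_sub 2
  have hlim := hL.comp hut
  have hset : ∀ n, ∫ x in Ioc (u n) (2 - u n), k x = ∫ x in (u n)..(2 - u n), k x := fun n =>
    (intervalIntegral.integral_of_le (by linarith [hu1 n])).symm
  have hfi : ∀ n, IntegrableOn k (Ioc (u n) (2 - u n)) := fun n => (hk _ (hu0 n) (hu1 n)).1
  have hint : IntegrableOn k (Ioc 0 2) := by
    refine integrableOn_Ioc_of_intervalIntegral_norm_bounded (I := L + 1) hfi hut0 hut2 ?_
    filter_upwards [hlim.eventually (gt_mem_nhds (lt_add_one L))] with n hn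
    simp only [Real.norm_of_nonneg (h0 _)]
    rw [hset]
    exact hn.le
  refine ⟨⟨hint, by simp⟩, ?_⟩
  have := (aecover_Ioc_of_Ioc hut0 hut2).integral_tendsto_of_countably_generated hint
  rw [intervalIntegral.integral_of_le zero_le_two]
  refine tendsto_nhds_unique this (hlim.congr fun n => ?_)
  rw [Measure.restrict_restrict measurableSet_Ioc, inter_eq_left.2, hset]
  · rfl
  · exact Ioc_subset_Ioc (hu0 n).le (by linarith [hu0 n])

/-- A function with bounded derivative deep down grows at most linearly. -/
theorem exists_linear_growth {f f' : ℂ → ℂ} {K : ℝ}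
    (hf : ∀ w ∈ lowerPlane, HasDerivAt f (f' w) w) (hper : ∀ w ∈ lowerPlane, f (w + 2) = f w)
    (hK : ∀ w : ℂ, w.im ≤ -1 → ‖f' w‖ ≤ K) :
    ∃ C, ∀ w : ℂ, w.im ≤ -1 → ‖f w‖ ≤ C * (1 + |w.im|) := by
  have hK0 : 0 ≤ K := (norm_nonneg _).trans (hK (-I) (by simp))
  have hbase : ∀ w : ℂ, |w.re| ≤ 1 → w.im ≤ -1 → ‖f w‖ ≤ (‖f (-I)‖ + K) * (1 + |w.im|) := by
    intro w hr hw
    have hconv : Convex ℝ {w : ℂ | w.im ≤ -1} := convex_halfSpace_im_le (-1)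
    have h1 := hconv.norm_image_sub_le_of_norm_hasDerivWithin_le (f := f) (f' := f') (C := K)
      (x := -I) (y := w) (fun z hz => (hf z (show z.im < 0 by
        have : z.im ≤ -1 := hz
        linarith)).hasDerivWithinAt) (fun z hz => hK z hz) (show (-I).im ≤ -1 by simp) hw
    have h2 : ‖w - -I‖ ≤ 1 + |w.im| := by
      refine (norm_le_abs_re_add_abs_im _).trans ?_
      have : |(w - -I).im| ≤ |w.im| := by
        simp only [sub_im, neg_im, I_im]
        rw [abs_of_nonpos (by linarith), abs_of_nonpos (by linarith)]
        linarith
      have h3 : |(w - -I).re| ≤ 1 := by simpa using hr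
      linarith
    have h3 : ‖f w‖ ≤ ‖f (-I)‖ + ‖f w - f (-I)‖ := by
      have := norm_add_le (f (-I)) (f w - f (-I))
      simpa using this
    nlinarith [norm_nonneg (f (-I)), abs_nonneg w.im, mul_le_mul_of_nonneg_left h2 hK0]
  refine ⟨‖f (-I)‖ + K, fun w hw => ?_⟩
  have hp : Function.Periodic (fun x : ℝ => f (x + w.im * I)) 2 := by
    intro x
    have := hper (x + w.im * I) (show ((x : ℂ) + w.im * I).im < 0 by simp; linarith)
    simp only
    rw [← this]
    push_cast
    ring_nf
  obtain ⟨y, hy, hxy⟩ := hp.exists_mem_Ico two_pos w.re (-1)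
  rw [re_add_im] at hxy
  rw [hxy]
  have := hbase (y + w.im * I) (by simp; rw [abs_le]; exact ⟨hy.1, by linarith [hy.2]⟩)
    (by simpa using hw)
  simpa using this

/-- The square of a difference quotient, in the periodic form. -/
noncomputable def sqQuotient (G : ℂ → ℂ) (x β : ℝ) : ℝ :=
  ‖G (x + β) - G x‖ ^ 2 * (Real.sin (Real.pi / 2 * β) ^ 2)⁻¹

theorem sqQuotient_nonneg (G : ℂ → ℂ) (x β : ℝ) : 0 ≤ sqQuotient G x β := by
  unfold sqQuotient
  positivity

/-- The complex conjugate of the pressure gradient `-(v_t + v · ∇v) - i`, in terms of the conjugate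
velocity. -/
noncomputable def conjGrad (G D B : ℂ → ℂ) (w : ℂ) : ℂ := I - B w - (starRingEnd ℂ) (G w) * D w

theorem tendsto_translate {h : ℂ → ℂ} {ℓ : ℂ} {x : ℝ} (hh : Tendsto h (𝓝[lowerPlane] x) (𝓝 ℓ)) :
    Tendsto (fun w => h (w + x)) (𝓝[lowerPlane] 0) (𝓝 ℓ) := by
  refine hh.comp (tendsto_nhdsWithin_iff.2 ⟨?_, ?_⟩)
  · have : Continuous (fun w : ℂ => w + x) := by fun_prop
    simpa using (this.tendsto 0).mono_left nhdsWithin_le_nhds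
  · filter_upwards [self_mem_nhdsWithin] with w hw
    have : w.im < 0 := hw
    show (w + x).im < 0
    simpa

namespace StripData

variable {Ψ φ G D B S : ℂ → ℂ} {ρ : ℂ → ℝ} (H : StripData Ψ φ G D B S ρ)
include H

theorem tendsto_S_deriv {x : ℝ} (hx : φ x ≠ 0) :
    Tendsto (fun w => (I - B w) / φ w) (𝓝[lowerPlane] x) (𝓝 ((I - B x) / φ x)) :=
  ((tendsto_boundary H.B_cont x).const_sub I).div (tendsto_boundary H.φ_cont x) hx

theorem tendsto_G_deriv {x : ℝ} (hx : φ x ≠ 0) :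
    Tendsto (fun w => D w / φ w) (𝓝[lowerPlane] x) (𝓝 (D x / φ x)) :=
  (tendsto_boundary H.D_cont x).div (tendsto_boundary H.φ_cont x) hx

theorem continuous_G_real : Continuous fun x : ℝ => G x :=
  H.G_cont.comp_continuous continuous_ofReal ofReal_mem_closedLowerPlane

/-- The pressure gradient is normal to the surface. -/
theorem conjGrad_div_re {x : ℝ} (hx : φ x ≠ 0) : (conjGrad G D B x / φ x).re = 0 := by
  -- The derivative of Re S along the line is computed twice: from S' = (i - B)/φ, and from the
  -- boundary value |G|²/2, which holds because P = 0 there.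
  have h1 := hasDerivAt_boundary_re H.ρ_cont H.ρ_eq H.S_deriv (H.tendsto_S_deriv hx)
  have h2 := (H.hasDerivAt_G_real hx).norm_sq.div_const 2
  have h3 : (fun y : ℝ => ρ y) = fun y : ℝ => ‖G y‖ ^ 2 / 2 := funext H.ρ_top
  rw [h3] at h1
  have h4 := h1.unique h2
  rw [mul_div_cancel_left₀ _ (two_ne_zero' ℝ)] at h4
  rw [conjGrad, sub_div, sub_re, h4, mul_div_assoc, Complex.inner]
  ring_nf

/-- The basic formula for the pressure gradient at a nondegenerate point of the surface. -/
theorem conjGrad_div_im {x : ℝ} (hx : φ x ≠ 0) :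
    IntervalIntegrable (sqQuotient G x) volume 0 2 ∧
      (conjGrad G D B x / φ x).im = 1 + Real.pi / 8 * ∫ β in (0 : ℝ)..2, sqQuotient G x β := by
  set c := G x with hc
  obtain ⟨CG, hCG⟩ := H.G_bdd
  obtain ⟨Cφ, hCφ⟩ := H.φ_inv_bdd
  obtain ⟨CB, hCB⟩ := H.B_bdd
  have hmem : ∀ w ∈ lowerPlane, w + x ∈ lowerPlane := fun w hw => by
    have : w.im < 0 := hw
    show (w + x).im < 0
    simpa
  have hS : ∀ w ∈ lowerPlane, HasDerivAt (fun w => S (w + x) - I * w)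
      ((I - B (w + x)) / φ (w + x) - I) w := fun w hw => by
    have h1 := (H.S_deriv _ (hmem w hw)).comp_add_const w x
    exact h1.sub (((hasDerivAt_id w).const_mul I).congr_deriv (mul_one I))
  have hSper : ∀ w ∈ lowerPlane, S (w + 2 + x) - I * (w + 2) = S (w + x) - I * w :=
    fun w hw => by
      rw [show w + 2 + x = (w + x) + 2 by ring, H.S_add_two _ (hmem w hw)]
      ring
  obtain ⟨C, hC⟩ := exists_linear_growth (K := (1 + CB) * Cφ + 1) hS hSper (fun w hw => by
    have h1 : (w + x).im ≤ -1 := by simpa using hw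
    refine (norm_sub_le _ _).trans (add_le_add ?_ (by simp))
    rw [div_eq_mul_inv, norm_mul]
    have h2 : ‖I - B (w + x)‖ ≤ 1 + CB := (norm_sub_le _ _).trans (add_le_add (by simp) (hCB _ h1))
    exact mul_le_mul h2 (hCφ _ h1) (norm_nonneg _) ((norm_nonneg _).trans h2))
  have hCG0 : 0 ≤ CG := (norm_nonneg _).trans (hCG x (ofReal_mem_closedLowerPlane x))
  have hCC := continuous_G_real H
  -- Subtracting iw makes S periodic, and subtracting conj(c) G completes the square: up to a
  -- constant, the real part on the axis is |G - c|²/2. The derivative of this function at 0 is N/φ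
  -- - i, where N is `conjGrad`.
  have hsing := tendsto_singular_integral (f := fun w => S (w + x) - I * w -
      (starRingEnd ℂ) c * G (w + x))
    (f' := fun w => (I - B (w + x)) / φ (w + x) - I -
      (starRingEnd ℂ) c * (D (w + x) / φ (w + x)))
    (ρ := fun w => ρ (w + x) - (I * w).re - ((starRingEnd ℂ) c * G (w + x)).re)
    (ℓ := (I - B x) / φ x - I - (starRingEnd ℂ) c * (D x / φ x)) (C := C + ‖c‖ * CG)
    (fun w hw => (hS w hw).sub (((H.G_deriv _ (hmem w hw)).comp_add_const w x).const_mul _))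
    (fun w hw => by
      rw [hSper w hw, show w + 2 + x = (w + x) + 2 by ring, H.G_add_two])
    (fun w hw => by
      have h1 : (w + x) ∈ closedLowerPlane := by
        show (w + x).im ≤ 0
        simp
        linarith
      refine (norm_sub_le _ _).trans ?_
      rw [norm_mul, RCLike.norm_conj]
      have := mul_le_mul_of_nonneg_left (hCG _ h1) (norm_nonneg c)
      nlinarith [hC w hw, abs_nonneg w.im, mul_nonneg (mul_nonneg (norm_nonneg c) hCG0)
        (abs_nonneg w.im)])
    (by
      have hsh : MapsTo (fun w : ℂ => w + x) closedLowerPlane closedLowerPlane := fun w hw => by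
        have : w.im ≤ 0 := hw
        show (w + x).im ≤ 0
        simpa
      have h1 := H.ρ_cont.comp (by fun_prop : ContinuousOn (fun w : ℂ => w + x) _) hsh
      have h2 := H.G_cont.comp (by fun_prop : ContinuousOn (fun w : ℂ => w + x) _) hsh
      exact (h1.sub (by fun_prop)).sub
        (continuous_re.comp_continuousOn (continuousOn_const.mul h2)))
    (fun w hw => by
      rw [H.ρ_eq _ (hmem w hw), sub_re, sub_re])
    (((tendsto_translate (H.tendsto_S_deriv hx)).sub_const I).sub
      ((tendsto_translate (H.tendsto_G_deriv hx)).const_mul _))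
  have hρ : ∀ β : ℝ, (ρ (β + x) - (I * β).re - ((starRingEnd ℂ) c * G (β + x)).re) -
      (ρ ((0 : ℝ) + x) - (I * (0 : ℝ)).re - ((starRingEnd ℂ) c * G ((0 : ℝ) + x)).re) =
      ‖G (x + β) - c‖ ^ 2 / 2 := by
    intro β
    have h1 := H.ρ_top (β + x)
    have h2 := H.ρ_top x
    push_cast at h1
    rw [h1, ofReal_zero, zero_add, h2, add_comm (β : ℂ), ← hc, @norm_sub_sq ℝ ℂ]
    simp [Complex.inner, ← normSq_eq_norm_sq, normSq_apply]
    ring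
  have hk : Tendsto (fun ε => ∫ β in ε..(2 - ε), sqQuotient G x β) (𝓝[>] 0)
      (𝓝 (2 * (4 / Real.pi * ((I - B x) / φ x - I - (starRingEnd ℂ) c * (D x / φ x)).im))) := by
    refine (hsing.const_mul 2).congr fun ε => ?_
    rw [← intervalIntegral.integral_const_mul]
    refine intervalIntegral.integral_congr fun β _ => ?_
    have := hρ β
    simp only [ofReal_zero] at this ⊢
    rw [this, sqQuotient]
    ring
  obtain ⟨h1, h2⟩ := intervalIntegrable_of_tendsto_truncated (sqQuotient_nonneg G x)
    (fun ε h0 h1 => intervalIntegrable_mul_inv_sin_sq h0 h1 (by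
      have : Continuous fun β : ℝ => G (x + β) := by
        have := hCC.comp (by fun_prop : Continuous fun β : ℝ => x + β)
        simpa [Function.comp_def] using this
      exact ((this.sub continuous_const).norm.pow 2).continuousOn)) hk
  refine ⟨h1, ?_⟩
  have h3 : (I - B x) / φ x - I - (starRingEnd ℂ) c * (D x / φ x) = conjGrad G D B x / φ x - I := by
    rw [conjGrad]
    ring
  rw [h2, h3, sub_im, I_im]
  have := Real.pi_ne_zero
  field_simp
  ring

omit H in
/-- The coefficient `A₁` as a function of the boundary point is at least `1`. -/
theorem one_le_coeff {x : ℝ} : 1 ≤ 1 + Real.pi / 8 * ∫ β in (0 : ℝ)..2, sqQuotient G x β := by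
  have : 0 ≤ ∫ β in (0 : ℝ)..2, sqQuotient G x β :=
    intervalIntegral.integral_nonneg zero_le_two fun β _ => sqQuotient_nonneg G x β
  have h2 := mul_nonneg (by positivity : 0 ≤ Real.pi / 8) this
  linarith

/-- The central identity: the conjugate of ∇P is A₁ i Φ_z, since the quotient by φ is purely
imaginary with the computed imaginary part. -/
theorem conjGrad_eq {x : ℝ} (hx : φ x ≠ 0) : conjGrad G D B x =
    ((1 + Real.pi / 8 * ∫ β in (0 : ℝ)..2, sqQuotient G x β : ℝ) : ℂ) * I * φ x := by
  rw [← H.conjGrad_div_im hx |>.2, ← div_eq_iff hx]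
  apply Complex.ext
  · rw [H.conjGrad_div_re hx]
    simp
  · simp

theorem continuousOn_conjGrad : ContinuousOn (conjGrad G D B) closedLowerPlane :=
  (continuousOn_const.sub H.B_cont).sub
    ((continuous_conj.comp_continuousOn H.G_cont).mul H.D_cont)

omit H in
theorem continuous_real {E : Type*} [TopologicalSpace E] {f : ℂ → E}
    (hf : ContinuousOn f closedLowerPlane) : Continuous fun x : ℝ => f x :=
  hf.comp_continuous continuous_ofReal ofReal_mem_closedLowerPlane

/-- At nondegenerate points this is A₁ ≥ 1. These points are dense and both sides are continuous, so
degenerate points inherit the bound; it is why ∇P = 0 forces Φ_z = 0. -/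
theorem norm_φ_le (x : ℝ) : ‖φ x‖ ≤ ‖conjGrad G D B x‖ := by
  have hcl : IsClosed {x : ℝ | ‖φ x‖ ≤ ‖conjGrad G D B x‖} :=
    isClosed_le (continuous_real H.φ_cont).norm (continuous_real H.continuousOn_conjGrad).norm
  have hd : Dense {x : ℝ | φ x ≠ 0} := MeasureTheory.Measure.dense_of_ae H.ae_ne_zero
  have hsub : {x : ℝ | φ x ≠ 0} ⊆ {x : ℝ | ‖φ x‖ ≤ ‖conjGrad G D B x‖} := fun x hx => by
    show ‖φ x‖ ≤ ‖conjGrad G D B x‖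
    rw [H.conjGrad_eq hx, norm_mul, norm_mul, norm_I, mul_one, norm_real]
    exact le_mul_of_one_le_left (norm_nonneg _) (one_le_coeff.trans (le_abs_self _))
  exact hcl.closure_subset_iff.2 hsub (hd x)

/-- Where the pressure gradient does not vanish, the surface has the tangent direction
`i \overline{N} / |N|`. -/
theorem direction {x₀ : ℝ} (h0 : conjGrad G D B x₀ ≠ 0) {δ : ℝ} (hδ : 0 < δ) (h : δ ≤ 1) :
    ∃ r > 0, ∀ a b : ℝ, x₀ - r < a → a ≤ b → b < x₀ + r →
      (1 - δ) * ‖Ψ b - Ψ a‖ ≤ ((starRingEnd ℂ)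
        (I * (starRingEnd ℂ) (conjGrad G D B x₀) / ‖conjGrad G D B x₀‖) * (Ψ b - Ψ a)).re := by
  set N := fun x : ℝ => conjGrad G D B x with hN
  have hNc : Continuous N := continuous_real H.continuousOn_conjGrad
  set e : ℂ := (starRingEnd ℂ) (I * (starRingEnd ℂ) (N x₀) / ‖N x₀‖) with he
  have hcont : ContinuousAt (fun x : ℝ => (e * (I * (starRingEnd ℂ) (N x) / ‖N x‖)).re) x₀ := by
    have hne : (‖N x₀‖ : ℂ) ≠ 0 := by simpa using h0
    have h1 : Continuous fun x => (starRingEnd ℂ) (N x) := continuous_conj.comp hNc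
    have h2 : ContinuousAt (fun x => I * (starRingEnd ℂ) (N x) / (‖N x‖ : ℂ)) x₀ :=
      ContinuousAt.div (by fun_prop) (by fun_prop) hne
    exact continuous_re.continuousAt.comp (continuousAt_const.mul h2)
  have hval : (e * (I * (starRingEnd ℂ) (N x₀) / ‖N x₀‖)).re = 1 := by
    rw [he, mul_comm, mul_conj, normSq_eq_norm_sq]
    simp [h0, hN]
  have hev : ∀ᶠ x in 𝓝 x₀, N x ≠ 0 ∧ 1 - δ < (e * (I * (starRingEnd ℂ) (N x) / ‖N x‖)).re :=
    (hNc.continuousAt.eventually_ne h0).and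
      (hcont.eventually (lt_mem_nhds (by simp only [hval]; linarith)))
  obtain ⟨r, hr, hball⟩ := Metric.eventually_nhds_iff.1 hev
  refine ⟨r, hr, fun a b ha hab hb => ?_⟩
  -- Almost everywhere Ψ' = 1/φ = A₁ i/N, a positive multiple of the unit vector i conj(N)/|N|. That
  -- vector varies continuously, so near x₀ its cosine with the value at x₀ exceeds 1 - δ.
  -- Integration gives the same for chords.
  have hae : ∀ᵐ x : ℝ, x ∈ Icc a b → (1 - δ) * ‖deriv (fun x : ℝ => Ψ x) x‖ ≤
      (e * deriv (fun x : ℝ => Ψ x) x).re := by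
    filter_upwards [H.deriv_Ψ_ae, H.ae_ne_zero] with x hx hφ hmem
    obtain ⟨hN0, hlt⟩ := hball (y := x) (by
      rw [Real.dist_eq, abs_lt]; constructor <;> linarith [hmem.1, hmem.2])
    have hA := one_le_coeff (G := G) (x := x)
    have hNx := H.conjGrad_eq hφ
    set A := 1 + Real.pi / 8 * ∫ β in (0 : ℝ)..2, sqQuotient G x β
    have hNn : ‖N x‖ ≠ 0 := norm_ne_zero_iff.2 hN0
    have hg : (φ x)⁻¹ = (A / ‖N x‖ : ℝ) * (I * (starRingEnd ℂ) (N x) / ‖N x‖) := by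
      rw [inv_eq_iff_eq_inv]
      have h1 : (starRingEnd ℂ) (N x) * N x = ‖N x‖ ^ 2 := by
        rw [mul_comm, mul_conj, normSq_eq_norm_sq]
        push_cast
        rfl
      have h2 : φ x = N x / (A * I) := by
        rw [eq_div_iff (by simp; linarith), hN]
        simp only
        rw [hNx]
        ring
      have h3 : (‖N x‖ : ℂ) ≠ 0 := by simpa using hNn
      have hA0 : (A : ℂ) ≠ 0 := by
        rw [Ne, ofReal_eq_zero]
        linarith
      have h4 : (starRingEnd ℂ) (N x) ≠ 0 := by simpa using hN0
      rw [h2]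
      push_cast
      field_simp
      rw [mul_comm (N x), h1]
    have hpos : 0 ≤ A / ‖N x‖ := div_nonneg (by linarith) (norm_nonneg _)
    rw [hx, hg, mul_left_comm, re_ofReal_mul, norm_mul, norm_real, Real.norm_of_nonneg hpos]
    have hn : ‖I * (starRingEnd ℂ) (N x) / (‖N x‖ : ℂ)‖ = 1 := by
      rw [norm_div, norm_mul, norm_I, one_mul, RCLike.norm_conj, norm_real, norm_norm,
        div_self hNn]
    rw [hn, mul_one, mul_comm]
    exact mul_le_mul_of_nonneg_left hlt.le hpos
  have hgi := H.intervalIntegrable_deriv a b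
  have hgi2 : IntervalIntegrable (fun x => e * deriv (fun x : ℝ => Ψ x) x) volume a b :=
    hgi.const_mul e
  have hre : (e * (Ψ b - Ψ a)).re = ∫ x in a..b, (e * deriv (fun x : ℝ => Ψ x) x).re := by
    rw [← H.integral_deriv, ← intervalIntegral.integral_const_mul]
    exact (reCLM.intervalIntegral_comp_comm hgi2).symm
  have hmono := intervalIntegral.integral_mono_ae_restrict hab (hgi.norm.const_mul (1 - δ))
    (⟨reCLM.integrable_comp hgi2.1, reCLM.integrable_comp hgi2.2⟩ :
      IntervalIntegrable (fun x => (e * deriv (fun x : ℝ => Ψ x) x).re) volume a b)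
    ((ae_restrict_iff' measurableSet_Icc).2 hae)
  rw [← hre, intervalIntegral.integral_const_mul] at hmono
  have hnn : ‖Ψ b - Ψ a‖ ≤ ∫ x in a..b, ‖deriv (fun x : ℝ => Ψ x) x‖ := by
    rw [← H.integral_deriv]
    exact intervalIntegral.norm_integral_le_integral_norm hab
  exact (mul_le_mul_of_nonneg_left hnn (by linarith)).trans hmono

end StripData
end StripWave


/-! ### Narrow sectors and logarithmic derivatives -/

namespace StripWave
open Complex

/-- Jordan's inequality gives |arg z| ≤ (π/2) |sin(arg z)| ≤ (π/2) η, and π ≤ 4. -/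
theorem abs_arg_le {z : ℂ} {η : ℝ} (h0 : 0 < z.re) (h : |z.im| ≤ η * z.re) : |arg z| ≤ 2 * η := by
  have h1 : |arg z| < Real.pi / 2 := abs_arg_lt_pi_div_two_iff.2 (Or.inl h0)
  have hz : 0 < ‖z‖ := h0.trans_le (re_le_norm z)
  have h2 : 2 / Real.pi * |arg z| ≤ |Real.sin (arg z)| := Real.mul_abs_le_abs_sin h1.le
  rw [sin_arg, abs_div, abs_of_pos hz, le_div_iff₀ hz] at h2
  have h3 : 2 / Real.pi * |arg z| * ‖z‖ ≤ η * ‖z‖ := by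
    have hη : 0 ≤ η := by
      by_contra hc
      nlinarith [abs_nonneg z.im]
    exact h2.trans (h.trans (mul_le_mul_of_nonneg_left (re_le_norm z) hη))
  have h4 := le_of_mul_le_mul_right h3 hz
  have hp := Real.pi_pos
  rw [div_mul_eq_mul_div, div_le_iff₀ hp] at h4
  have hη : 0 ≤ η := by
    by_contra hc
    nlinarith [abs_nonneg (arg z)]
  nlinarith [Real.pi_le_four]

/-- A holomorphic function with values in a narrow sector has a small logarithmic derivative. -/
theorem norm_deriv_le_of_abs_im_le {f : ℂ → ℂ} {w₀ : ℂ} {R η : ℝ} (hR : 0 < R) (hη : 0 < η)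
    (hf : DifferentiableOn ℂ f (Metric.ball w₀ R))
    (h : ∀ w ∈ Metric.ball w₀ R, 0 < (f w).re ∧ |(f w).im| ≤ η * (f w).re) :
    ‖deriv f w₀‖ ≤ 16 * η / R * ‖f w₀‖ := by
  have hmem0 : w₀ ∈ Metric.ball w₀ R := Metric.mem_ball_self hR
  have hshift : ∀ z ∈ Metric.ball (0 : ℂ) R, w₀ + z ∈ Metric.ball w₀ R := fun z hz => by
    simpa using hz
  -- Rotation by -i makes the real part of F a difference of arguments, at most 4η.
  -- Borel–Carathéodory bounds |F| by 8η on the half radius, and Cauchy's estimate gives 8η/(R/2) =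
  -- 16η/R.
  set F : ℂ → ℂ := fun z => -I * (log (f (w₀ + z)) - log (f w₀)) with hF
  have hslit : ∀ w ∈ Metric.ball w₀ R, f w ∈ slitPlane := fun w hw => Or.inl (h w hw).1
  have hFd : DifferentiableOn ℂ F (Metric.ball 0 R) := by
    have h1 : DifferentiableOn ℂ (fun w => log (f w)) (Metric.ball w₀ R) := hf.clog hslit
    have h2 : DifferentiableOn ℂ (fun z => log (f (w₀ + z))) (Metric.ball 0 R) :=
      h1.comp (by fun_prop) hshift
    exact (h2.sub_const _).const_mul _
  have hF0 : F 0 = 0 := by simp [hF]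
  have hre : MapsTo F (Metric.ball 0 R) {z | z.re ≤ 4 * η} := by
    intro z hz
    have h1 := abs_arg_le (h _ (hshift z hz)).1 (h _ (hshift z hz)).2
    have h2 := abs_arg_le (h _ hmem0).1 (h _ hmem0).2
    show (F z).re ≤ 4 * η
    simp only [hF, neg_mul, neg_re, mul_re, I_re, I_im, sub_re, sub_im, log_im, zero_mul, one_mul]
    linarith [(abs_le.1 h1).2, (abs_le.1 h2).1]
  have hmaps : MapsTo F (Metric.ball 0 (R / 2)) (Metric.closedBall (F 0) (8 * η)) := by
    intro z hz
    have hzn : ‖z‖ < R / 2 := by simpa using hz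
    have hz' : z ∈ Metric.ball (0 : ℂ) R := by simp; linarith
    have := borelCaratheodory_zero (by positivity) hFd hre hR hz' hF0
    rw [mem_closedBall_iff_norm, hF0, sub_zero]
    refine this.trans ?_
    rw [div_le_iff₀ (by linarith)]
    nlinarith [norm_nonneg z]
  have hder := norm_deriv_le_div_of_mapsTo_ball
    (hFd.mono (Metric.ball_subset_ball (by linarith))) hmaps (by linarith)
  have hfd : DifferentiableAt ℂ f w₀ := hf.differentiableAt (Metric.isOpen_ball.mem_nhds hmem0)
  have hne : f w₀ ≠ 0 := fun h0 => by
    have := (h _ hmem0).1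
    rw [h0] at this
    simp at this
  have hFderiv : HasDerivAt F (-I * (deriv f w₀ / f w₀)) 0 := by
    have h1 : HasDerivAt (fun z => f (w₀ + z)) (deriv f w₀) 0 := by
      have := hfd.hasDerivAt
      rw [← add_zero w₀] at this
      have := this.comp_const_add w₀ 0
      simpa using this
    have h2 := (h1.clog (by simpa using hslit _ hmem0)).sub_const (log (f w₀)) |>.const_mul (-I)
    rw [add_zero] at h2
    exact h2
  rw [hFderiv.deriv, norm_mul, norm_neg, norm_I, one_mul, norm_div,
    div_le_iff₀ (norm_pos_iff.2 hne)] at hder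
  refine hder.trans (le_of_eq ?_)
  field_simp
  ring

namespace StripData

variable {Ψ φ G D B S : ℂ → ℂ} {ρ : ℂ → ℝ} (H : StripData Ψ φ G D B S ρ)
include H

/-- If the boundary tangent lies in a narrow sector near `x₀`, then so does the derivative of the
conformal map, up to the contribution of the rest of the boundary. -/
theorem abs_im_le {x₀ κ r : ℝ} {e : ℂ} (hκ : 0 ≤ κ) (hr : 0 < r)
    (h : ∀ᵐ s : ℝ, |s - x₀| < r → |(e * deriv (fun x : ℝ => Ψ x) s).im| ≤
      κ * (e * deriv (fun x : ℝ => Ψ x) s).re)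
    {w : ℂ} (hw : w ∈ lowerPlane) (hwr : |w.re - x₀| ≤ r / 2) :
    |(e * (φ w)⁻¹).im| ≤ κ * (e * (φ w)⁻¹).re + (κ + 1) * (4 * Real.pi * |w.im| / r ^ 2) *
      (‖e‖ * ∫ s in (-1 : ℝ)..1, ‖deriv (fun x : ℝ => Ψ x) s‖) := by
  set g := deriv fun x : ℝ => Ψ x with hg
  set c := w.re
  set k : ℝ → ℝ := fun s => stripKernel (w - s) with hk
  have hkc : Continuous k := continuous_stripKernel_sub hw
  have hk0 : ∀ s, 0 ≤ k s := fun s => stripKernel_nonneg (sub_ofReal_mem_lowerPlane hw s)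
  have hgi := H.intervalIntegrable_deriv (c - 1) (c + 1)
  have hui : IntervalIntegrable (fun s => (k s : ℂ) * (e * g s)) volume (c - 1) (c + 1) :=
    (hgi.const_mul e).continuousOn_mul (continuous_ofReal.comp hkc).continuousOn
  have hrep : e * (φ w)⁻¹ = ∫ s in (c - 1)..(c + 1), (k s : ℂ) * (e * g s) := by
    rw [H.φ_inv_eq_poisson' hw c, ← intervalIntegral.integral_const_mul]
    exact intervalIntegral.integral_congr fun s _ => by simp only [hk, hg]; ring
  have him : (e * (φ w)⁻¹).im = ∫ s in (c - 1)..(c + 1), k s * (e * g s).im := by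
    rw [hrep]
    have := (imCLM.intervalIntegral_comp_comm hui).symm
    simpa [im_ofReal_mul] using this
  have hre : (e * (φ w)⁻¹).re = ∫ s in (c - 1)..(c + 1), k s * (e * g s).re := by
    rw [hrep]
    have := (reCLM.intervalIntegral_comp_comm hui).symm
    simpa [re_ofReal_mul] using this
  have hii : IntervalIntegrable (fun s => k s * (e * g s).im) volume (c - 1) (c + 1) := by
    have : IntervalIntegrable (fun s => ((k s : ℂ) * (e * g s)).im) volume (c - 1) (c + 1) :=
      ⟨imCLM.integrable_comp hui.1, imCLM.integrable_comp hui.2⟩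
    simpa [im_ofReal_mul] using this
  have hri : IntervalIntegrable (fun s => k s * (e * g s).re) volume (c - 1) (c + 1) := by
    have : IntervalIntegrable (fun s => ((k s : ℂ) * (e * g s)).re) volume (c - 1) (c + 1) :=
      ⟨reCLM.integrable_comp hui.1, reCLM.integrable_comp hui.2⟩
    simpa [re_ofReal_mul] using this
  set F := 4 * Real.pi * |w.im| / r ^ 2 with hF
  have hF0 : 0 ≤ F := by
    have := Real.pi_pos
    positivity
  have hper : ∫ s in (-1 : ℝ)..1, ‖g s‖ = ∫ s in (c - 1)..(c + 1), ‖g s‖ := by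
    have hp : Function.Periodic (fun s => ‖g s‖) 2 := fun s => by
      simp only [hg]
      rw [H.periodic_deriv s]
    have := hp.intervalIntegral_add_eq (-1) (c - 1)
    rwa [show (-1 : ℝ) + 2 = 1 by norm_num, show c - 1 + 2 = c + 1 by ring] at this
  -- Within r of x₀ the sector condition applies. Elsewhere |Re(w - s)| ≥ r/2, so the kernel is at
  -- most F; the terms 1 and κ in κ + 1 pay for the imaginary part and for a possibly negative real
  -- part.
  have hle : ∀ᵐ s : ℝ, s ∈ Icc (c - 1) (c + 1) →
      k s * |(e * g s).im| ≤ κ * (k s * (e * g s).re) + (κ + 1) * F * (‖e‖ * ‖g s‖) := by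
    filter_upwards [h] with s hs hmem
    have hn : ‖e * g s‖ = ‖e‖ * ‖g s‖ := norm_mul _ _
    rcases lt_or_ge (|s - x₀|) r with hlt | hge
    · have h1 := mul_le_mul_of_nonneg_left (hs hlt) (hk0 s)
      have h2 : 0 ≤ (κ + 1) * F * (‖e‖ * ‖g s‖) := by positivity
      linarith
    · have hfar : r / 2 ≤ |(w - s).re| := by
        have : |s - x₀| ≤ |(w - s).re| + |w.re - x₀| := by
          rw [show (w - s).re = w.re - s by simp, abs_sub_comm w.re s]
          exact abs_sub_le _ _ _
        linarith
      have h1 : |(w - s).re| ≤ 1 := by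
        rw [show (w - s).re = c - s by simp [c], abs_le]
        constructor <;> linarith [hmem.1, hmem.2]
      have h2 := stripKernel_mul_le (sub_ofReal_mem_lowerPlane hw s)
      have h3 := hfar.trans (abs_le_abs_sin_half_pi h1)
      have h4 : (r / 2) ^ 2 ≤ Real.sin (Real.pi / 2 * (w - s).re) ^ 2 := by
        rw [← sq_abs (Real.sin _)]
        exact pow_le_pow_left₀ (by linarith) h3 2
      have h5 : k s ≤ F := by
        have h6 := (mul_le_mul_of_nonneg_left h4 (hk0 s)).trans h2
        rw [show (w - s).im = w.im by simp] at h6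
        rw [hF, le_div_iff₀ (by positivity)]
        linarith
      have h7 : k s * |(e * g s).im| ≤ F * (‖e‖ * ‖g s‖) := by
        rw [← hn]
        exact mul_le_mul h5 (abs_im_le_norm _) (abs_nonneg _) hF0
      have h8 : k s * (-(e * g s).re) ≤ F * (‖e‖ * ‖g s‖) := by
        rw [← hn]
        refine (mul_le_mul_of_nonneg_left (neg_le_abs _ |>.trans (abs_re_le_norm _)) (hk0 s)).trans ?_
        exact mul_le_mul_of_nonneg_right h5 (norm_nonneg _)
      nlinarith [mul_le_mul_of_nonneg_left h8 hκ]
  calc |(e * (φ w)⁻¹).im| ≤ ∫ s in (c - 1)..(c + 1), k s * |(e * g s).im| := by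
        rw [him]
        refine (intervalIntegral.abs_integral_le_integral_abs (by linarith)).trans (le_of_eq ?_)
        refine intervalIntegral.integral_congr fun s _ => ?_
        simp only [abs_mul, abs_of_nonneg (hk0 s)]
    _ ≤ ∫ s in (c - 1)..(c + 1),
          (κ * (k s * (e * g s).re) + (κ + 1) * F * (‖e‖ * ‖g s‖)) := by
        refine intervalIntegral.integral_mono_ae_restrict (by linarith) ?_
          ((hri.const_mul κ).add ((hgi.norm.const_mul ‖e‖).const_mul _))
          ((ae_restrict_iff' measurableSet_Icc).2 hle)
        have := hii.abs
        simpa only [abs_mul, abs_of_nonneg (hk0 _)] using this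
    _ = _ := by
        rw [intervalIntegral.integral_add (hri.const_mul κ)
          ((hgi.norm.const_mul ‖e‖).const_mul _), intervalIntegral.integral_const_mul,
          intervalIntegral.integral_const_mul, intervalIntegral.integral_const_mul, hre, hper]

theorem differentiableAt_φ_inv {e w : ℂ} (hw : w ∈ lowerPlane) :
    DifferentiableAt ℂ (fun w => e * (φ w)⁻¹) w :=
  (H.differentiableOn_φ_inv.differentiableAt (isOpen_lowerPlane.mem_nhds hw)).const_mul e

theorem exists_large {x₀ : ℝ} (h0 : φ x₀ = 0) {e : ℂ} (he : e ≠ 0) (M : ℝ) :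
    ∃ r > 0, ∀ w ∈ lowerPlane, ‖w - x₀‖ < r → M ≤ ‖e * (φ w)⁻¹‖ := by
  have h1 : Tendsto φ (𝓝[lowerPlane] x₀) (𝓝[≠] 0) := tendsto_nhdsWithin_iff.2
    ⟨by simpa [h0] using tendsto_boundary H.φ_cont x₀, by
      filter_upwards [self_mem_nhdsWithin] with w hw using H.φ_ne w hw⟩
  have h2 := (tendsto_norm_inv_nhdsNE_zero_atTop.comp h1).const_mul_atTop (norm_pos_iff.2 he)
  obtain ⟨r, hr, h3⟩ := Metric.mem_nhdsWithin_iff.1 (h2 (Ici_mem_atTop M))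
  refine ⟨r, hr, fun w hw hwr => ?_⟩
  have := h3 ⟨mem_ball_iff_norm.2 hwr, hw⟩
  rw [norm_mul]
  exact this

/-- Near a degenerate point at which the boundary has a tangent, the derivative of the conformal
map is large and lies in a narrow sector. -/
theorem exists_sector {x₀ : ℝ} (h0 : φ x₀ = 0) {e : ℂ} (he : e ≠ 0)
    (h : ∀ η > 0, ∃ r > 0, ∀ᵐ s : ℝ, |s - x₀| < r → |(e * deriv (fun x : ℝ => Ψ x) s).im| ≤
      η * (e * deriv (fun x : ℝ => Ψ x) s).re) {η : ℝ} (hη : 0 < η) :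
    ∃ r > 0, ∀ w ∈ lowerPlane, ‖w - x₀‖ < r → 1 ≤ (e * (φ w)⁻¹).re ∧
      |(e * (φ w)⁻¹).im| ≤ η * (e * (φ w)⁻¹).re := by
  set κ := η / 2 with hκ
  have hκ0 : 0 < κ := by positivity
  obtain ⟨r1, hr1, h1⟩ := h κ hκ0
  set K := ‖e‖ * ∫ s in (-1 : ℝ)..1, ‖deriv (fun x : ℝ => Ψ x) s‖ with hK
  have hK0 : 0 ≤ K := mul_nonneg (norm_nonneg _)
    (intervalIntegral.integral_nonneg (by norm_num) fun _ _ => norm_nonneg _)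
  set c := (κ + 1) * (4 * Real.pi / r1 ^ 2) * K with hc
  have hc0 : 0 ≤ c := by
    have := Real.pi_pos
    positivity
  -- The remote part of the boundary adds an error of at most 1: |Im F| ≤ κ Re F + 1. This lower
  -- bound for |F| forces Re F ≥ 1 + 1/κ, so that 1 ≤ κ Re F absorbs the error and the slope becomes
  -- 2κ = η.
  obtain ⟨r2, hr2, h2⟩ := H.exists_large h0 he ((1 + κ) * (1 + 1 / κ) + 2 + 1 / κ)
  refine ⟨min (min (r1 / 2) r2) (1 / (c + 1)), by positivity, fun w hw hwr => ?_⟩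
  have hw1 : ‖w - x₀‖ < r1 / 2 := hwr.trans_le ((min_le_left _ _).trans (min_le_left _ _))
  have hw2 : ‖w - x₀‖ < r2 := hwr.trans_le ((min_le_left _ _).trans (min_le_right _ _))
  have hw3 : ‖w - x₀‖ < 1 / (c + 1) := hwr.trans_le (min_le_right _ _)
  have hre : |w.re - x₀| ≤ ‖w - x₀‖ := by simpa using abs_re_le_norm (w - x₀)
  have him : |w.im| ≤ ‖w - x₀‖ := by simpa using abs_im_le_norm (w - x₀)
  have h3 := H.abs_im_le hκ0.le hr1 h1 hw (hre.trans hw1.le)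
  have h4 : (κ + 1) * (4 * Real.pi * |w.im| / r1 ^ 2) * K ≤ 1 := by
    have : (κ + 1) * (4 * Real.pi * |w.im| / r1 ^ 2) * K = c * |w.im| := by
      rw [hc]
      ring
    rw [this]
    have h5 := (him.trans hw3.le)
    rw [le_div_iff₀ (by positivity)] at h5
    nlinarith [abs_nonneg w.im]
  rw [← hK] at h3
  have h5 := h2 w hw hw2
  set F := e * (φ w)⁻¹
  have h6 : |F.im| ≤ κ * F.re + 1 := h3.trans (by linarith)
  have h7 : ‖F‖ ≤ |F.re| + |F.im| := norm_le_abs_re_add_abs_im F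
  have hneg : -(1 / κ) ≤ F.re := by
    have : 0 ≤ κ * F.re + 1 := (abs_nonneg _).trans h6
    rw [neg_le, div_eq_mul_inv, one_mul, ← mul_le_mul_iff_right₀ hκ0, mul_inv_cancel₀ hκ0.ne']
    linarith
  have h1κ : 0 < 1 / κ := by positivity
  have hpos : 0 ≤ F.re := by
    by_contra hc
    push Not at hc
    rw [abs_of_neg hc] at h7
    nlinarith [mul_pos hκ0 h1κ]
  rw [abs_of_nonneg hpos] at h7
  have hbig : 1 + 1 / κ ≤ F.re := by
    by_contra hc
    push Not at hc
    nlinarith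
  refine ⟨by linarith, h6.trans ?_⟩
  have : 1 ≤ κ * F.re := by
    have := mul_le_mul_of_nonneg_left hbig hκ0.le
    rw [mul_add, mul_one_div_cancel hκ0.ne'] at this
    linarith
  rw [show η = κ + κ by rw [hκ]; ring, add_mul]
  linarith

end StripData
end StripWave


/-! ### A local theorem of Kellogg type -/

namespace StripWave
open Complex

theorem ball_subset_lowerPlane {w z : ℂ} (hw : w ∈ lowerPlane)
    (hz : z ∈ Metric.ball w (|w.im| / 2)) : z ∈ lowerPlane := by
  have hw' : w.im < 0 := hw
  rw [mem_ball_iff_norm] at hz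
  have h1 := (abs_im_le_norm (z - w)).trans_lt hz
  rw [sub_im, abs_of_neg hw'] at h1
  show z.im < 0
  linarith [(abs_lt.1 h1).2]

theorem hasDerivAt_vertical {f : ℂ → ℂ} {f' : ℂ} {a t : ℝ} (hf : HasDerivAt f f' (a - t * I)) :
    HasDerivAt (fun t : ℝ => f (a - t * I)) (f' * (-I)) t := by
  have h1 : HasDerivAt (fun t : ℝ => (a : ℂ) - t * I) (-I) t := by
    simpa using ((hasDerivAt_id t).ofReal_comp.mul_const I).const_sub (a : ℂ)
  exact HasDerivAt.comp t hf h1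

namespace StripData

variable {Ψ φ G D B S : ℂ → ℂ} {ρ : ℂ → ℝ} (H : StripData Ψ φ G D B S ρ)
include H

theorem norm_deriv_le_of_sector {e w : ℂ} {η : ℝ} (hw : w ∈ lowerPlane) (hη : 0 < η)
    (h : ∀ z ∈ Metric.ball w (|w.im| / 2), 1 ≤ (e * (φ z)⁻¹).re ∧
      |(e * (φ z)⁻¹).im| ≤ η * (e * (φ z)⁻¹).re) :
    ‖deriv (fun w => e * (φ w)⁻¹) w‖ ≤ 32 * η / |w.im| * ‖e * (φ w)⁻¹‖ := by
  have hw' : w.im < 0 := hw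
  have hpos : 0 < |w.im| := abs_pos.2 hw'.ne
  have := norm_deriv_le_of_abs_im_le (f := fun w => e * (φ w)⁻¹) (half_pos hpos) hη
    (fun z hz => (H.differentiableAt_φ_inv (ball_subset_lowerPlane hw hz)).differentiableWithinAt)
    (fun z hz => ⟨by linarith [(h z hz).1], (h z hz).2⟩)
  refine this.trans (le_of_eq ?_)
  rw [show 16 * η / (|w.im| / 2) = 32 * η / |w.im| by field_simp; ring]

/-- Near a degenerate point at which the boundary has a tangent, the derivative of the conformal
map grows slowly. -/
theorem exists_growth {x₀ : ℝ} (h0 : φ x₀ = 0) {e : ℂ} (he : e ≠ 0)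
    (h : ∀ η > 0, ∃ r > 0, ∀ᵐ s : ℝ, |s - x₀| < r → |(e * deriv (fun x : ℝ => Ψ x) s).im| ≤
      η * (e * deriv (fun x : ℝ => Ψ x) s).re) :
    ∃ r > 0, ∃ C, 0 ≤ C ∧ ∀ a y : ℝ, |a - x₀| ≤ r → 0 < y → y ≤ r →
      ‖(φ (a - y * I))⁻¹‖ * √y ≤ C := by
  -- With slope 1/64 the logarithmic derivative at height -y is at most 32/(64y) = 1/(2y), exactly
  -- what makes |f|² y nondecreasing in y.
  obtain ⟨r', hr', hsec⟩ := H.exists_sector h0 he h (η := 1 / 64) (by norm_num)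
  set r := r' / 4 with hr
  have hr0 : 0 < r := by positivity
  -- The radius r'/4 leaves room for the discs of radius |Im w|/2 on which the sector condition is
  -- used.
  set f : ℂ → ℂ := fun w => e * (φ w)⁻¹ with hf
  obtain ⟨M, hM⟩ := (isCompact_Icc (a := x₀ - r) (b := x₀ + r)).exists_bound_of_continuousOn
    (f := fun a : ℝ => f (a - r * I)) (by
      refine Continuous.continuousOn ?_
      exact (continuous_const.mul ((H.continuous_φ_shift hr0.le).inv₀ fun s =>
        H.φ_ne _ (ofReal_sub_mul_I_mem hr0))))
  have hM0 : 0 ≤ M := (norm_nonneg _).trans (hM x₀ ⟨by linarith, by linarith⟩)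
  have key : ∀ a y : ℝ, |a - x₀| ≤ r → 0 < y → y ≤ r → ‖f (a - y * I)‖ ^ 2 * y ≤ M ^ 2 * r := by
    intro a y ha hy hyr
    have hder : ∀ t : ℝ, 0 < t → HasDerivAt (fun t : ℝ => ‖f (a - t * I)‖ ^ 2 * t)
        (2 * inner ℝ (f (a - t * I)) (deriv f (a - t * I) * (-I)) * t +
          ‖f (a - t * I)‖ ^ 2 * 1) t := fun t ht => by
      have h1 := (H.differentiableAt_φ_inv (e := e) (ofReal_sub_mul_I_mem (x := a) ht)).hasDerivAt
      exact (hasDerivAt_vertical h1).norm_sq.mul (hasDerivAt_id t)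
    have hmono : MonotoneOn (fun t : ℝ => ‖f (a - t * I)‖ ^ 2 * t) (Ioc 0 r) := by
      refine monotoneOn_of_deriv_nonneg (convex_Ioc 0 r)
        (fun t ht => (hder t ht.1).continuousAt.continuousWithinAt)
        (fun t ht => by
          rw [interior_Ioc] at ht
          exact (hder t ht.1).differentiableAt.differentiableWithinAt) fun t ht => ?_
      rw [interior_Ioc] at ht
      rw [(hder t ht.1).deriv]
      set w : ℂ := a - t * I with hw
      have hwim : |w.im| = t := by
        rw [hw]
        simp [abs_of_pos ht.1]
      have h1 := H.norm_deriv_le_of_sector (e := e) (w := w) (η := 1 / 64)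
        (ofReal_sub_mul_I_mem ht.1) (by norm_num) (fun z hz => by
          refine hsec z (ball_subset_lowerPlane (ofReal_sub_mul_I_mem ht.1) hz) ?_
          rw [mem_ball_iff_norm, hwim] at hz
          have h2 : ‖w - x₀‖ ≤ |a - x₀| + t := by
            refine (norm_le_abs_re_add_abs_im _).trans (le_of_eq ?_)
            rw [hw]
            simp [abs_of_pos ht.1]
          have h3 := norm_add_le (z - w) (w - x₀)
          rw [sub_add_sub_cancel] at h3
          linarith [ht.2])
      rw [hwim] at h1
      have h4 : ‖deriv f w‖ * t ≤ 1 / 2 * ‖f w‖ := by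
        have h5 := mul_le_mul_of_nonneg_right h1 ht.1.le
        rw [show 32 * (1 / 64) / t * ‖e * (φ w)⁻¹‖ * t = 1 / 2 * ‖e * (φ w)⁻¹‖ * (t / t) by ring,
          div_self ht.1.ne', mul_one] at h5
        exact h5
      have h6 := abs_real_inner_le_norm (f w) (deriv f w * (-I))
      rw [show ‖deriv f w * (-I)‖ = ‖deriv f w‖ by simp] at h6
      have h7 := (abs_le.1 h6).1
      have h8 := mul_le_mul_of_nonneg_right h7 ht.1.le
      have h9 := mul_le_mul_of_nonneg_left h4 (norm_nonneg (f w))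
      nlinarith
    have h1 := hmono ⟨hy, hyr⟩ ⟨hr0, le_rfl⟩ hyr
    refine h1.trans (mul_le_mul_of_nonneg_right ?_ hr0.le)
    exact pow_le_pow_left₀ (norm_nonneg _) (hM a ⟨by linarith [(abs_le.1 ha).1],
      by linarith [(abs_le.1 ha).2]⟩) 2
  refine ⟨r, hr0, M * √r / ‖e‖, by positivity, fun a y ha hy hyr => ?_⟩
  have h1 := key a y ha hy hyr
  have hen := norm_pos_iff.2 he
  rw [le_div_iff₀ hen]
  have h2 : ‖f (a - y * I)‖ = ‖e‖ * ‖(φ (a - y * I))⁻¹‖ := norm_mul _ _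
  refine le_of_sq_le_sq ?_ (by positivity)
  rw [mul_pow, mul_pow, mul_pow, Real.sq_sqrt hy.le, Real.sq_sqrt hr0.le]
  rw [h2, mul_pow] at h1
  linarith

/-- Near a degenerate point at which the boundary has a tangent, the boundary parametrization is
Hölder continuous with exponent `1 / 2`. -/
theorem exists_holder_half {x₀ : ℝ} (h0 : φ x₀ = 0) {e : ℂ} (he : e ≠ 0)
    (h : ∀ η > 0, ∃ r > 0, ∀ᵐ s : ℝ, |s - x₀| < r → |(e * deriv (fun x : ℝ => Ψ x) s).im| ≤
      η * (e * deriv (fun x : ℝ => Ψ x) s).re) :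
    ∃ r > 0, ∃ C, 0 ≤ C ∧ ∀ x : ℝ, |x - x₀| ≤ r → ‖Ψ x - Ψ x₀‖ ≤ C * √|x - x₀| := by
  obtain ⟨r, hr, C, hC0, hC⟩ := H.exists_growth h0 he h
  have hvert : ∀ a y : ℝ, |a - x₀| ≤ r → 0 < y → y ≤ r →
      ‖Ψ (a - y * I) - Ψ a‖ ≤ 2 * C * √y := by
    intro a y ha hy hyr
    -- The depth is t², so the factor 2t cancels the bound C/√y for |Ψ'| and the derivative in t is
    -- bounded by 2C up to the boundary.
    set F : ℝ → ℂ := fun t => Ψ (a - (t ^ 2 : ℝ) * I) with hF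
    have hd : ∀ t ∈ Ioc 0 (√y), HasDerivWithinAt F
        ((2 * t : ℝ) • ((φ (a - (t ^ 2 : ℝ) * I))⁻¹ * (-I))) (Ioc 0 (√y)) t := fun t ht => by
      have h1 := hasDerivAt_vertical (H.Ψ_deriv _ (ofReal_sub_mul_I_mem (x := a)
        (by have := ht.1; positivity : 0 < t ^ 2)))
      have h2 : HasDerivAt (fun t : ℝ => t ^ 2) (2 * t) t := by simpa using hasDerivAt_pow 2 t
      exact (HasDerivAt.scomp (h := fun t : ℝ => t ^ 2) t h1 h2).hasDerivWithinAt
    have hb : ∀ t ∈ Ioc 0 (√y), ‖(2 * t : ℝ) • ((φ (a - (t ^ 2 : ℝ) * I))⁻¹ * (-I))‖ ≤ 2 * C := by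
      intro t ht
      have h1 : t ^ 2 ≤ r := by
        have := pow_le_pow_left₀ ht.1.le ht.2 2
        rw [Real.sq_sqrt hy.le] at this
        linarith
      have h2 := hC a (t ^ 2) ha (by have := ht.1; positivity) h1
      rw [Real.sqrt_sq ht.1.le] at h2
      rw [norm_smul, norm_mul (φ _)⁻¹, norm_neg, norm_I, mul_one,
        Real.norm_of_nonneg (by linarith [ht.1])]
      linarith
    have hlip : ∀ s ∈ Ioc 0 (√y), ‖F (√y) - F s‖ ≤ 2 * C * √y := fun s hs => by
      refine ((convex_Ioc 0 (√y)).norm_image_sub_le_of_norm_hasDerivWithin_le hd hb hs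
        ⟨Real.sqrt_pos.2 hy, le_rfl⟩).trans ?_
      refine mul_le_mul_of_nonneg_left ?_ (by positivity)
      rw [Real.norm_of_nonneg (by linarith [hs.2])]
      linarith [hs.1]
    have hFc : Continuous F := H.Ψ_cont.comp_continuous (by fun_prop) fun t =>
      ofReal_sub_mul_I_mem_closed (sq_nonneg t)
    have hlim : Tendsto (fun s => ‖F (√y) - F s‖) (𝓝[>] 0) (𝓝 ‖F (√y) - F 0‖) :=
      ((hFc.tendsto 0).mono_left nhdsWithin_le_nhds).const_sub _ |>.norm
    have h3 := le_of_tendsto hlim (by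
      filter_upwards [Ioc_mem_nhdsGT (Real.sqrt_pos.2 hy)] with s hs using hlip s hs)
    simpa [hF, Real.sq_sqrt hy.le, ← ofReal_pow] using h3
  refine ⟨r, hr, 5 * C, by positivity, fun x hx => ?_⟩
  rcases eq_or_ne x x₀ with rfl | hne
  · simp
  set y := |x - x₀| with hy
  have hy0 : 0 < y := abs_pos.2 (sub_ne_zero.2 hne)
  have hhor : ‖Ψ (x - y * I) - Ψ (x₀ - y * I)‖ ≤ C * √y := by
    have h1 : ∀ s ∈ uIcc x₀ x, HasDerivWithinAt (fun s : ℝ => Ψ (s - y * I))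
        (φ (s - y * I))⁻¹ (uIcc x₀ x) s := fun s _ => by
      have e := (H.Ψ_deriv _ (ofReal_sub_mul_I_mem (x := s) hy0)).comp s
          ((hasDerivAt_id s).ofReal_comp.sub_const (y * I))
      exact (e.congr_deriv (by simp)).hasDerivWithinAt
    have h2 := (convex_uIcc x₀ x).norm_image_sub_le_of_norm_hasDerivWithin_le (C := C / √y) h1
      (fun s hs => by
        rw [le_div_iff₀ (Real.sqrt_pos.2 hy0)]
        exact hC s y ((abs_sub_left_of_mem_uIcc hs).trans hx) hy0 hx) left_mem_uIcc right_mem_uIcc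
    refine h2.trans (le_of_eq ?_)
    rw [Real.norm_eq_abs, ← hy]
    nth_rw 2 [← Real.mul_self_sqrt hy0.le]
    have := (Real.sqrt_pos.2 hy0).ne'
    field_simp
  have h1 := hvert x y hx hy0 hx
  have h2 := hvert x₀ y (by simpa using hr.le) hy0 hx
  -- Go down by y = |x - x₀|, across, and up again: 2C + C + 2C = 5C.
  have h3 : Ψ x - Ψ x₀ = -(Ψ (x - y * I) - Ψ x) + (Ψ (x - y * I) - Ψ (x₀ - y * I)) +
      (Ψ (x₀ - y * I) - Ψ x₀) := by ring
  rw [h3]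
  refine (norm_add_le _ _).trans (add_le_add ((norm_add_le _ _).trans (add_le_add
    ((norm_neg _).le.trans h1) hhor)) h2 |>.trans (le_of_eq ?_))
  ring

/-- A version of Kellogg's theorem: the Riemann mapping does not degenerate at a point where the
direction of the boundary is Hölder continuous. -/
theorem ne_zero_of_holder {x₀ : ℝ} {e : ℂ} (he : e ≠ 0) {C γ r : ℝ} (hC : 0 ≤ C) (hγ : 0 < γ)
    (hγ1 : γ ≤ 1) (hr : 0 < r)
    (h : ∀ᵐ s : ℝ, |s - x₀| < r → 0 ≤ (e * deriv (fun x : ℝ => Ψ x) s).re ∧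
      |(e * deriv (fun x : ℝ => Ψ x) s).im| ≤
        C * ‖Ψ s - Ψ x₀‖ ^ γ * (e * deriv (fun x : ℝ => Ψ x) s).re) : φ x₀ ≠ 0 := by
  intro h0
  have hΨc := continuous_real H.Ψ_cont
  have hweak : ∀ η > 0, ∃ r > 0, ∀ᵐ s : ℝ, |s - x₀| < r →
      |(e * deriv (fun x : ℝ => Ψ x) s).im| ≤ η * (e * deriv (fun x : ℝ => Ψ x) s).re := by
    intro η hη
    have hc : ContinuousAt (fun s : ℝ => C * ‖Ψ s - Ψ x₀‖ ^ γ) x₀ :=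
      ((hΨc.sub continuous_const).norm.rpow_const fun _ => Or.inr hγ.le).continuousAt.const_mul C
    have h1 : ∀ᶠ s : ℝ in 𝓝 x₀, C * ‖Ψ s - Ψ x₀‖ ^ γ < η :=
      hc.eventually (gt_mem_nhds (by simp [Real.zero_rpow hγ.ne', hη]))
    obtain ⟨r', hr', h2⟩ := Metric.eventually_nhds_iff.1 h1
    refine ⟨min r r', by positivity, ?_⟩
    filter_upwards [h] with s hs hlt
    obtain ⟨h3, h4⟩ := hs (hlt.trans_le (min_le_left _ _))
    exact h4.trans (mul_le_mul_of_nonneg_right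
      (h2 (show dist s x₀ < r' from hlt.trans_le (min_le_right _ _))).le h3)
  obtain ⟨r2, hr2, C2, hC2, hhol⟩ := H.exists_holder_half h0 he hweak
  obtain ⟨r3, hr3, hsec⟩ := H.exists_sector h0 he hweak one_pos
  set K := ‖e‖ * ∫ s in (-1 : ℝ)..1, ‖deriv (fun x : ℝ => Ψ x) s‖ with hK
  have hK0 : 0 ≤ K := mul_nonneg (norm_nonneg _)
    (intervalIntegral.integral_nonneg (by norm_num) fun _ _ => norm_nonneg _)
  set C3 := C * C2 ^ γ with hC3
  have hC30 : 0 ≤ C3 := by positivity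
  set C4 := C3 + (C3 + 1) * (6 * Real.pi) * K + 1 with hC4
  have hpi := Real.pi_pos
  have hC40 : 0 < C4 := by positivity
  set t₀ := min (min (min 1 r) r2) (r3 / 2) / 2 with ht₀
  have ht0 : 0 < t₀ := by positivity
  have ht1 : t₀ ≤ 1 / 2 := by
    have : min (min (min 1 r) r2) (r3 / 2) ≤ 1 :=
      (min_le_left _ _).trans ((min_le_left _ _).trans (min_le_left _ _))
    linarith
  have htr : t₀ < r := by
    have : min (min (min 1 r) r2) (r3 / 2) ≤ r :=
      (min_le_left _ _).trans ((min_le_left _ _).trans (min_le_right _ _))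
    linarith
  have htr2 : t₀ ≤ r2 := by
    have : min (min (min 1 r) r2) (r3 / 2) ≤ r2 := (min_le_left _ _).trans (min_le_right _ _)
    linarith
  have htr3 : 2 * t₀ < r3 := by
    have : min (min (min 1 r) r2) (r3 / 2) ≤ r3 / 2 := min_le_right _ _
    linarith
  set f : ℂ → ℂ := fun w => e * (φ w)⁻¹ with hf
  have hmem : ∀ t : ℝ, 0 < t → (x₀ : ℂ) - (t ^ 4 : ℝ) * I ∈ lowerPlane := fun t ht =>
    ofReal_sub_mul_I_mem (by positivity)
  -- At height t⁴ the boundary within t of x₀ counts as near. There |Ψ - Ψ(x₀)| ≤ C2 √t, so the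
  -- direction deviates by at most C3 t^(γ/2). The remote boundary contributes a multiple of t⁴/t² =
  -- t² ≤ t^(γ/2). Both effects together give a sector of slope C4 t^(γ/2).
  have hlog : ∀ t, 0 < t → t ≤ t₀ → ‖deriv f (x₀ - (t ^ 4 : ℝ) * I)‖ ≤
      32 * (C4 * t ^ (γ / 2)) / t ^ 4 * ‖f (x₀ - (t ^ 4 : ℝ) * I)‖ := by
    intro t ht htt
    have ht1' : t ≤ 1 := by linarith
    have ht4 : t ^ 4 ≤ t := by
      have := pow_le_of_le_one ht.le ht1' (four_ne_zero)
      exact this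
    have hae : ∀ᵐ s : ℝ, |s - x₀| < t → |(e * deriv (fun x : ℝ => Ψ x) s).im| ≤
        C3 * t ^ (γ / 2) * (e * deriv (fun x : ℝ => Ψ x) s).re := by
      filter_upwards [h] with s hs hlt
      obtain ⟨h3, h4⟩ := hs (by linarith)
      refine h4.trans (mul_le_mul_of_nonneg_right ?_ h3)
      rw [hC3, mul_assoc]
      refine mul_le_mul_of_nonneg_left ?_ hC
      have h5 : ‖Ψ s - Ψ x₀‖ ≤ C2 * √t := (hhol s (by linarith)).trans
        (mul_le_mul_of_nonneg_left (Real.sqrt_le_sqrt hlt.le) hC2)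
      refine (Real.rpow_le_rpow (norm_nonneg _) h5 hγ.le).trans (le_of_eq ?_)
      rw [Real.mul_rpow hC2 (Real.sqrt_nonneg t), Real.sqrt_eq_rpow, ← Real.rpow_mul ht.le]
      ring_nf
    have hwim : |((x₀ : ℂ) - (t ^ 4 : ℝ) * I).im| = t ^ 4 := by
      simp only [sub_im, ofReal_im, mul_im, ofReal_re, I_im, mul_one, I_re, mul_zero, add_zero,
        zero_sub, abs_neg]
      exact abs_of_pos (by positivity)
    have hp0 : 0 < t ^ (γ / 2) := Real.rpow_pos_of_pos ht _
    have hp1 : t ^ (γ / 2) ≤ 1 := Real.rpow_le_one ht.le ht1' (by positivity)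
    have hp2 : t ^ 2 ≤ t ^ (γ / 2) := by
      rw [← Real.rpow_natCast]
      exact Real.rpow_le_rpow_of_exponent_ge ht ht1' (by push_cast; linarith)
    have := H.norm_deriv_le_of_sector (e := e) (hmem t ht) (η := C4 * t ^ (γ / 2)) (by positivity)
      (fun z hz => by
        have hzl := ball_subset_lowerPlane (hmem t ht) hz
        rw [mem_ball_iff_norm, hwim] at hz
        have h1 := (abs_re_le_norm _).trans_lt hz
        have h2 := (abs_im_le_norm _).trans_lt hz
        have hzre : |z.re - x₀| ≤ t / 2 := by
          have : (z - ((x₀ : ℂ) - (t ^ 4 : ℝ) * I)).re = z.re - x₀ := by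
            rw [sub_re, sub_re, ofReal_re, re_ofReal_mul, I_re]
            ring
          rw [this] at h1
          linarith
        have hzim : |z.im| ≤ 3 / 2 * t ^ 4 := by
          have : (z - ((x₀ : ℂ) - (t ^ 4 : ℝ) * I)).im = z.im + t ^ 4 := by
            rw [sub_im, sub_im, ofReal_im, im_ofReal_mul, I_im]
            ring
          rw [this, abs_lt] at h2
          rw [abs_le]
          constructor <;> linarith [pow_pos ht 4]
        have hz3 : ‖z - x₀‖ < r3 := by
          have := norm_le_abs_re_add_abs_im (z - x₀)
          rw [sub_re, sub_im, ofReal_re, ofReal_im, sub_zero] at this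
          linarith
        obtain ⟨h5, -⟩ := hsec z hzl hz3
        refine ⟨h5, (H.abs_im_le (κ := C3 * t ^ (γ / 2)) (by positivity) ht hae hzl hzre).trans ?_⟩
        rw [← hK]
        have h6 : 4 * Real.pi * |z.im| / t ^ 2 ≤ 6 * Real.pi * t ^ (γ / 2) := by
          rw [div_le_iff₀ (by positivity)]
          calc 4 * Real.pi * |z.im| ≤ 4 * Real.pi * (3 / 2 * t ^ 4) :=
                mul_le_mul_of_nonneg_left hzim (by positivity)
            _ = 6 * Real.pi * t ^ 2 * t ^ 2 := by ring
            _ ≤ 6 * Real.pi * t ^ (γ / 2) * t ^ 2 := by gcongr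
        have h7 : (C3 * t ^ (γ / 2) + 1) * (4 * Real.pi * |z.im| / t ^ 2) * K ≤
            (C3 + 1) * (6 * Real.pi * t ^ (γ / 2)) * K := by
          refine mul_le_mul_of_nonneg_right (mul_le_mul ?_ h6 (by positivity) (by positivity)) hK0
          nlinarith
        set X := (e * (φ z)⁻¹).re
        have h8 : (C3 + 1) * (6 * Real.pi * t ^ (γ / 2)) * K ≤
            (C3 + 1) * (6 * Real.pi * t ^ (γ / 2)) * K * X :=
          le_mul_of_one_le_right (by positivity) h5
        have h9 : C4 * t ^ (γ / 2) * X = C3 * t ^ (γ / 2) * X +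
            (C3 + 1) * (6 * Real.pi * t ^ (γ / 2)) * K * X + t ^ (γ / 2) * X := by
          rw [hC4]
          ring
        have h10 : 0 ≤ t ^ (γ / 2) * X := by positivity
        linarith)
    rwa [hwim] at this
  -- Along the vertical line |f|² decreases in t at a relative rate of at most 256 C4 t^(γ/2 - 1) =
  -- cγ/2 · t^(γ/2 - 1), which the exponential in N compensates. Hence N is nondecreasing and |f|
  -- stays bounded as t → 0, although f blows up at x₀.
  set c := 512 * C4 / γ with hc
  set N : ℝ → ℝ := fun t => ‖f (x₀ - (t ^ 4 : ℝ) * I)‖ ^ 2 * Real.exp (c * t ^ (γ / 2)) with hN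
  have hder : ∀ t : ℝ, 0 < t → HasDerivAt N
      (2 * inner ℝ (f (x₀ - (t ^ 4 : ℝ) * I))
        ((4 * t ^ 3) • (deriv f (x₀ - (t ^ 4 : ℝ) * I) * (-I))) * Real.exp (c * t ^ (γ / 2)) +
      ‖f (x₀ - (t ^ 4 : ℝ) * I)‖ ^ 2 *
        (Real.exp (c * t ^ (γ / 2)) * (c * (γ / 2 * t ^ (γ / 2 - 1))))) t := fun t ht => by
    have h1 := hasDerivAt_vertical (H.differentiableAt_φ_inv (e := e) (hmem t ht)).hasDerivAt
    have h2 : HasDerivAt (fun t : ℝ => t ^ 4) (4 * t ^ 3) t := by simpa using hasDerivAt_pow 4 t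
    have h3 := (HasDerivAt.scomp (h := fun t : ℝ => t ^ 4) t h1 h2).norm_sq
    have h4 := ((Real.hasDerivAt_rpow_const (p := γ / 2) (Or.inl ht.ne')).const_mul c).exp
    exact h3.mul h4
  have hmono : MonotoneOn N (Ioc 0 t₀) := by
    refine monotoneOn_of_deriv_nonneg (convex_Ioc 0 t₀)
      (fun t ht => (hder t ht.1).continuousAt.continuousWithinAt)
      (fun t ht => by
        rw [interior_Ioc] at ht
        exact (hder t ht.1).differentiableAt.differentiableWithinAt) fun t ht => ?_
    rw [interior_Ioc] at ht
    rw [(hder t ht.1).deriv]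
    have h1 := hlog t ht.1 ht.2.le
    set X := f (x₀ - (t ^ 4 : ℝ) * I)
    set Y := deriv f (x₀ - (t ^ 4 : ℝ) * I)
    have h2 := abs_real_inner_le_norm X ((4 * t ^ 3) • (Y * (-I)))
    rw [norm_smul, norm_mul Y, norm_neg, norm_I, mul_one, Real.norm_of_nonneg
      (by have := ht.1; positivity : 0 ≤ 4 * t ^ 3)] at h2
    have h3 : 4 * t ^ 3 * ‖Y‖ ≤ 128 * C4 * t ^ (γ / 2 - 1) * ‖X‖ := by
      refine (mul_le_mul_of_nonneg_left h1 (by have := ht.1; positivity)).trans (le_of_eq ?_)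
      rw [Real.rpow_sub_one ht.1.ne']
      have := ht.1.ne'
      field_simp
      ring
    have h4 := (abs_le.1 h2).1
    have h5 := mul_le_mul_of_nonneg_left h3 (norm_nonneg X)
    have h6 : ‖X‖ ^ 2 * (c * (γ / 2 * t ^ (γ / 2 - 1))) =
        2 * (‖X‖ * (128 * C4 * t ^ (γ / 2 - 1) * ‖X‖)) := by
      rw [hc]
      field_simp
      ring
    have h7 := Real.exp_pos (c * t ^ (γ / 2))
    have h8 : 0 ≤ 2 * inner ℝ X ((4 * t ^ 3) • (Y * (-I))) +
        ‖X‖ ^ 2 * (c * (γ / 2 * t ^ (γ / 2 - 1))) := by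
      rw [h6]
      linarith
    have := mul_nonneg h8 h7.le
    linarith
  obtain ⟨r4, hr4, hlarge⟩ := H.exists_large h0 he (N t₀ + 1)
  set t := min t₀ (r4 / 2) with ht
  have htpos : 0 < t := by positivity
  have htle : t ≤ t₀ := min_le_left _ _
  have h1 := hmono ⟨htpos, htle⟩ ⟨ht0, le_rfl⟩ htle
  have h2 := hlarge _ (hmem t htpos) (by
    rw [sub_sub_cancel_left, norm_neg, norm_mul, norm_I, mul_one, norm_real,
      Real.norm_of_nonneg (by positivity)]
    have h3 := pow_le_of_le_one htpos.le (by linarith : t ≤ 1) four_ne_zero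
    have : t ≤ r4 / 2 := min_le_right _ _
    linarith)
  have hc0 : 0 ≤ c := by positivity
  have h3 : (1 : ℝ) ≤ Real.exp (c * t ^ (γ / 2)) := Real.one_le_exp (by positivity)
  have hN0 : 0 ≤ N t₀ := by positivity
  have h4 : N t₀ + 1 ≤ ‖f (x₀ - (t ^ 4 : ℝ) * I)‖ := h2
  have h5 : ‖f (x₀ - (t ^ 4 : ℝ) * I)‖ ^ 2 ≤ N t := le_mul_of_one_le_right (by positivity) h3
  nlinarith

end StripData
end StripWave


/-! ### Truncated Hilbert transforms of periodic functions -/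

namespace StripWave
open Complex

theorem truncHilbert_congr {f g : ℝ → ℂ} (h : f =ᵐ[volume.restrict CornerWave.I] g) (ε x : ℝ) :
    CornerWave.truncHilbert ε f x = CornerWave.truncHilbert ε g x := by
  unfold CornerWave.truncHilbert
  congr 1
  refine integral_congr_ae ?_
  filter_upwards [ae_restrict_of_ae_restrict_of_subset inter_subset_left h] with y hy
  rw [hy]

theorem hilbert_congr {f g : ℝ → ℂ} (h : f =ᵐ[volume.restrict CornerWave.I] g) (x : ℝ) :
    CornerWave.hilbert f x = CornerWave.hilbert g x := by
  unfold CornerWave.hilbert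
  simp only [truncHilbert_congr h]

theorem hilbertExists_congr {f g : ℝ → ℂ} (h : f =ᵐ[volume.restrict CornerWave.I] g) (x : ℝ) :
    CornerWave.HilbertExists f x ↔ CornerWave.HilbertExists g x := by
  unfold CornerWave.HilbertExists IntegrableOn
  simp only [truncHilbert_congr h, integrable_congr h]

/-- The half width of the truncation in terms of the truncated values of the sine. -/
noncomputable def truncWidth (ε : ℝ) : ℝ := 2 / Real.pi * Real.arcsin ε

theorem tendsto_truncWidth : Tendsto truncWidth (𝓝[>] 0) (𝓝[>] 0) := by
  refine tendsto_nhdsWithin_iff.2 ⟨?_, ?_⟩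
  · have : Continuous truncWidth := continuous_const.mul Real.continuous_arcsin
    have h := this.tendsto 0
    simp only [truncWidth, Real.arcsin_zero, mul_zero] at h
    exact h.mono_left nhdsWithin_le_nhds
  · filter_upwards [self_mem_nhdsWithin] with ε hε
    have := Real.pi_pos
    exact mul_pos (by positivity) (Real.arcsin_pos.2 hε)

theorem truncWidth_mem {ε : ℝ} (h0 : 0 < ε) (h1 : ε < 1) : truncWidth ε ∈ Ioo 0 1 := by
  have hp := Real.pi_pos
  refine ⟨mul_pos (by positivity) (Real.arcsin_pos.2 h0), ?_⟩
  unfold truncWidth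
  rw [div_mul_eq_mul_div, div_lt_one hp]
  linarith [Real.arcsin_lt_pi_div_two.2 h1]

theorem lt_sin_iff {ε s : ℝ} (h0 : 0 < ε) (h1 : ε < 1) (hs : s ∈ Ioc (0 : ℝ) 2) :
    ε < |Real.sin (Real.pi / 2 * s)| ↔ s ∈ Ioo (truncWidth ε) (2 - truncWidth ε) := by
  have hp := Real.pi_pos
  have hwid : Real.pi / 2 * truncWidth ε = Real.arcsin ε := by
    unfold truncWidth
    field_simp
  have hw := truncWidth_mem h0 h1
  have hnn : 0 ≤ Real.sin (Real.pi / 2 * s) := Real.sin_nonneg_of_nonneg_of_le_pi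
    (by have := hs.1; positivity) (by nlinarith [hs.2])
  rw [abs_of_nonneg hnn]
  have key : ∀ s : ℝ, 0 ≤ s → s ≤ 1 → (ε < Real.sin (Real.pi / 2 * s) ↔ truncWidth ε < s) := by
    intro s h2 h3
    rw [← Real.arcsin_lt_iff_lt_sin' (x := ε) (y := Real.pi / 2 * s)
      ⟨by nlinarith, by nlinarith⟩, ← hwid]
    exact mul_lt_mul_iff_right₀ (by positivity)
  rcases le_total s 1 with h | h
  · rw [key s hs.1.le h]
    exact ⟨fun h2 => ⟨h2, by linarith [hw.2]⟩, fun h2 => h2.1⟩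
  · have h2 := key (2 - s) (by linarith [hs.2]) (by linarith)
    rw [show Real.pi / 2 * (2 - s) = Real.pi - Real.pi / 2 * s by ring, Real.sin_pi_sub] at h2
    rw [h2]
    exact ⟨fun h2 => ⟨by linarith [hw.2], by linarith⟩, fun h2 => by linarith [h2.2]⟩

/-- The truncated Hilbert transform of a periodic function. -/
theorem truncHilbert_eq {F : ℝ → ℂ} (hF : Function.Periodic F 2) {ε : ℝ} (h0 : 0 < ε)
    (h1 : ε < 1) (x : ℝ) : CornerWave.truncHilbert ε F x = -(1 / (2 * I)) *
      ∫ s in (truncWidth ε)..(2 - truncWidth ε),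
        ((Real.cot (Real.pi / 2 * s) : ℝ) : ℂ) * F (x + s) := by
  have hw := truncWidth_mem h0 h1
  set A : Set ℝ := {β | ε < |Real.sin (Real.pi / 2 * (x - β))|} with hA
  -- Truncation by the size of the sine keeps the integrand 2-periodic, so the integral over I may
  -- be moved to the period that starts at x, also when x is an endpoint of I.
  set k : ℝ → ℂ := A.indicator fun β => (Real.cot (Real.pi / 2 * (x - β)) : ℂ) * F β with hk
  have hAm : MeasurableSet A := measurableSet_lt measurable_const (by fun_prop)
  have hsin : ∀ β : ℝ, Real.sin (Real.pi / 2 * (x - (β + 2))) = -Real.sin (Real.pi / 2 * (x - β)) :=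
    fun β => by
      rw [show Real.pi / 2 * (x - (β + 2)) = Real.pi / 2 * (x - β) - Real.pi by ring,
        Real.sin_sub_pi]
  have hcos : ∀ β : ℝ, Real.cos (Real.pi / 2 * (x - (β + 2))) = -Real.cos (Real.pi / 2 * (x - β)) :=
    fun β => by
      rw [show Real.pi / 2 * (x - (β + 2)) = Real.pi / 2 * (x - β) - Real.pi by ring,
        Real.cos_sub_pi]
  have hkp : Function.Periodic k 2 := by
    intro β
    have h2 : β + 2 ∈ A ↔ β ∈ A := by
      simp only [hA, mem_ofPred_eq, hsin, abs_neg]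
    simp only [hk, indicator, h2, hF β, Real.cot_eq_cos_div_sin, hsin, hcos, neg_div_neg_eq]
  have h2 : ∫ β in CornerWave.I ∩ A, (Real.cot (Real.pi / 2 * (x - β)) : ℂ) * F β =
      ∫ β in (-1 : ℝ)..1, k β := by
    rw [intervalIntegral.integral_of_le (by norm_num), ← integral_Icc_eq_integral_Ioc, hk,
      setIntegral_indicator hAm]
  have h3 := hkp.intervalIntegral_add_eq (-1) x
  rw [show (-1 : ℝ) + 2 = 1 by norm_num] at h3
  have h4 : ∫ β in x..(x + 2), k β = ∫ s in (0 : ℝ)..2, k (x + s) := by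
    have := intervalIntegral.integral_comp_add_left (a := 0) (b := 2) k x
    rw [this, add_zero]
  have h5 : ∫ s in (0 : ℝ)..2, k (x + s) = ∫ s in (truncWidth ε)..(2 - truncWidth ε),
      -(((Real.cot (Real.pi / 2 * s) : ℝ) : ℂ) * F (x + s)) := by
    rw [intervalIntegral.integral_of_le zero_le_two, intervalIntegral.integral_of_le
      (by linarith [hw.2]), integral_Ioc_eq_integral_Ioo (x := truncWidth ε),
      ← integral_indicator measurableSet_Ioc, ← integral_indicator measurableSet_Ioo]
    congr 1
    funext s
    have hne : ∀ s : ℝ, Real.cot (Real.pi / 2 * (x - (x + s))) = -Real.cot (Real.pi / 2 * s) := by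
      intro s
      rw [show Real.pi / 2 * (x - (x + s)) = -(Real.pi / 2 * s) by ring,
        Real.cot_eq_cos_div_sin, Real.cot_eq_cos_div_sin, Real.sin_neg, Real.cos_neg, div_neg]
    by_cases hs : s ∈ Ioc (0 : ℝ) 2
    · have h6 : x + s ∈ A ↔ s ∈ Ioo (truncWidth ε) (2 - truncWidth ε) := by
        rw [← lt_sin_iff h0 h1 hs, hA]
        show ε < |Real.sin (Real.pi / 2 * (x - (x + s)))| ↔ _
        rw [show Real.pi / 2 * (x - (x + s)) = -(Real.pi / 2 * s) by ring, Real.sin_neg, abs_neg]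
      rw [indicator_of_mem hs, hk]
      by_cases h7 : s ∈ Ioo (truncWidth ε) (2 - truncWidth ε)
      · rw [indicator_of_mem (h6.2 h7), indicator_of_mem h7, hne]
        push_cast
        ring
      · rw [indicator_of_notMem (fun h => h7 (h6.1 h)), indicator_of_notMem h7]
    · rw [indicator_of_notMem hs, indicator_of_notMem]
      exact fun h => hs ⟨hw.1.trans h.1, by linarith [h.2, hw.1]⟩
  unfold CornerWave.truncHilbert
  rw [h2, h3, h4, h5, intervalIntegral.integral_neg]
  ring

/-- The width of the truncation tends to 0 from the right, so truncation by the sine and truncation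
by distance have the same limit. The sign comes from the odd kernel under β = x + s. -/
theorem hilbert_eq_of_tendsto {F : ℝ → ℂ} (hF : Function.Periodic F 2) {x : ℝ} {L : ℂ}
    (h : Tendsto (fun ε => ∫ s in ε..(2 - ε), ((Real.cot (Real.pi / 2 * s) : ℝ) : ℂ) * F (x + s))
      (𝓝[>] 0) (𝓝 L)) :
    Tendsto (fun ε => CornerWave.truncHilbert ε F x) (𝓝[>] 0) (𝓝 (-(1 / (2 * I)) * L)) := by
  refine ((h.comp tendsto_truncWidth).const_mul (-(1 / (2 * I)))).congr' ?_
  filter_upwards [Ioo_mem_nhdsGT (zero_lt_one (α := ℝ))] with ε hε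
  exact (truncHilbert_eq hF hε.1 hε.2 x).symm

theorem hasDerivAt_cot_half_pi {s : ℝ} (h : Real.sin (Real.pi / 2 * s) ≠ 0) :
    HasDerivAt (fun s => Real.cot (Real.pi / 2 * s))
      (-(Real.pi / 2) * (Real.sin (Real.pi / 2 * s) ^ 2)⁻¹) s := by
  have h0 : HasDerivAt (fun s : ℝ => Real.pi / 2 * s) (Real.pi / 2) s := by
    simpa using (hasDerivAt_id s).const_mul (Real.pi / 2)
  have h1 := h0.cos.div h0.sin h
  have h2 : (fun s => Real.cot (Real.pi / 2 * s)) =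
      (fun s => Real.cos (Real.pi / 2 * s)) / fun s => Real.sin (Real.pi / 2 * s) := by
    funext s
    rw [Real.cot_eq_cos_div_sin, Pi.div_apply]
  rw [h2]
  refine h1.congr_deriv ?_
  rw [div_eq_mul_inv]
  congr 1
  have := Real.sin_sq_add_cos_sq (Real.pi / 2 * s)
  linear_combination (-(Real.pi / 2)) * this

theorem sin_ne_zero_of_mem {ε s : ℝ} (h0 : 0 < ε) (h1 : ε < 1) (hs : s ∈ uIcc ε (2 - ε)) :
    Real.sin (Real.pi / 2 * s) ≠ 0 := by
  rw [uIcc_of_le (by linarith)] at hs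
  exact (sin_half_pi_pos (by linarith [hs.1]) (by linarith [hs.2])).ne'

theorem absolutelyContinuous_cot {ε : ℝ} (h0 : 0 < ε) (h1 : ε < 1) :
    AbsolutelyContinuousOnInterval (fun s => Real.cot (Real.pi / 2 * s)) ε (2 - ε) := by
  refine ContDiffOn.absolutelyContinuousOnInterval ?_
  have h2 : (fun s => Real.cot (Real.pi / 2 * s)) =
      fun s => Real.cos (Real.pi / 2 * s) / Real.sin (Real.pi / 2 * s) := by
    funext s
    rw [Real.cot_eq_cos_div_sin]
  rw [h2]
  exact ContDiffOn.div (Real.contDiff_cos.comp (by fun_prop)).contDiffOn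
    (Real.contDiff_sin.comp (by fun_prop)).contDiffOn fun s hs => sin_ne_zero_of_mem h0 h1 hs

theorem abs_cot_mul_le {s : ℝ} (h0 : 0 < s) (h1 : s ≤ 1) :
    |Real.cot (Real.pi / 2 * s)| ≤ 1 / s := by
  have h2 := abs_le_abs_sin_half_pi (x := s) (by rw [abs_of_pos h0]; exact h1)
  rw [abs_of_pos h0] at h2
  rw [Real.cot_eq_cos_div_sin, abs_div]
  exact div_le_div₀ zero_le_one (Real.abs_cos_le_one _) h0 h2

theorem cot_two_sub (ε : ℝ) :
    Real.cot (Real.pi / 2 * (2 - ε)) = -Real.cot (Real.pi / 2 * ε) := by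
  rw [Real.cot_eq_cos_div_sin, Real.cot_eq_cos_div_sin,
    show Real.pi / 2 * (2 - ε) = Real.pi - Real.pi / 2 * ε by ring, Real.cos_pi_sub,
    Real.sin_pi_sub, neg_div]

end StripWave


/-! ### Hilbert transforms of the velocity and the commutator -/

namespace StripWave
open Complex

namespace StripData

variable {Ψ φ G D B S : ℂ → ℂ} {ρ : ℂ → ℝ} (H : StripData Ψ φ G D B S ρ)
include H

theorem periodic_deriv_G : Function.Periodic (deriv fun x : ℝ => G x) 2 := by
  intro x
  have h1 : (fun y : ℝ => G ((y + 2 : ℝ) : ℂ)) = fun y : ℝ => G y := funext H.periodic_G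
  rw [← deriv_comp_add_const (fun x : ℝ => G x) 2 x, h1]

theorem intervalIntegrable_deriv_G (a b : ℝ) :
    IntervalIntegrable (deriv fun x : ℝ => G x) volume a b := by
  refine H.periodic_deriv_G.intervalIntegrable (t := 0) two_ne_zero ?_ a b
  rw [zero_add]
  exact absolutelyContinuous_intervalIntegrable_deriv
    (H.absolutelyContinuous_G zero_le_two (by norm_num))

theorem absolutelyContinuous_G_translate (x : ℝ) :
    AbsolutelyContinuousOnInterval (fun s : ℝ => G (x + s)) 0 2 := by
  obtain ⟨M, hM0, hM⟩ := H.exists_dist_G_le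
  set g : ℝ → ℝ := fun s => ‖deriv (fun x : ℝ => Ψ x) (x + s)‖ with hg
  have hgi : ∀ a b, IntervalIntegrable g volume a b := fun a b => by
    have := (H.intervalIntegrable_deriv (x + a) (x + b)).norm.comp_add_left x
    simpa using this
  refine absolutelyContinuous_of_dist_le (M := M)
    ((hgi 0 2).absolutelyContinuousOnInterval_intervalIntegral (c := 0) left_mem_uIcc) ?_
  have key : ∀ s ∈ uIcc (0 : ℝ) 2, ∀ t ∈ uIcc (0 : ℝ) 2, s ≤ t → dist (G (x + s)) (G (x + t)) ≤
      M * dist (∫ s in (0 : ℝ)..s, g s) (∫ s in (0 : ℝ)..t, g s) := by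
    intro s hs t ht hst
    rw [uIcc_of_le zero_le_two] at hs ht
    rw [dist_comm, dist_eq_norm, dist_comm, Real.dist_eq,
      intervalIntegral.integral_interval_sub_left (hgi _ _) (hgi _ _)]
    have h1 := hM (x + s) (x + t) (by linarith) (by linarith [hs.1, ht.2])
    rw [← intervalIntegral.integral_comp_add_left (fun s => ‖deriv (fun x : ℝ => Ψ x) s‖) x] at h1
    push_cast at h1
    exact h1.trans (mul_le_mul_of_nonneg_left (le_abs_self _) hM0)
  intro s hs t ht
  rcases le_total s t with h | h
  · exact key s hs t ht h
  · rw [dist_comm, dist_comm (∫ s in (0 : ℝ)..s, _)]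
    exact key t ht s hs h

/-- The difference quotient of the velocity at a nondegenerate point is bounded. -/
theorem exists_norm_sub_le {x : ℝ} (hx : φ x ≠ 0) :
    ∃ K, 0 ≤ K ∧ ∀ s ∈ Ioo (0 : ℝ) 2, ‖G (x + s) - G x‖ ≤ K * Real.sin (Real.pi / 2 * s) := by
  obtain ⟨C, hC⟩ := H.G_bdd
  have hC0 : 0 ≤ C := (norm_nonneg _).trans (hC x (ofReal_mem_closedLowerPlane x))
  obtain ⟨K, hK0, hK⟩ := ((H.hasDerivAt_G_real hx).isBigO_sub).exists_pos
  rw [Asymptotics.isBigOWith_iff, Metric.eventually_nhds_iff] at hK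
  obtain ⟨r', hr', hr⟩ := hK
  set r := min r' 1 / 2 with hrd
  have hr0 : 0 < r := by positivity
  have hr1 : r < 1 := by
    have : min r' 1 ≤ 1 := min_le_right _ _
    linarith
  have hrr : r < r' := by
    have : min r' 1 ≤ r' := min_le_left _ _
    linarith
  have hsin : ∀ s : ℝ, 0 ≤ s → s ≤ 1 → s ≤ Real.sin (Real.pi / 2 * s) := by
    intro s h0 h1
    have := abs_le_abs_sin_half_pi (x := s) (by rwa [abs_of_nonneg h0])
    rwa [abs_of_nonneg h0, abs_of_nonneg (Real.sin_nonneg_of_nonneg_of_le_pi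
      (by have := Real.pi_pos; positivity) (by nlinarith [Real.pi_pos]))] at this
  have hsin2 : ∀ s : ℝ, 1 ≤ s → s ≤ 2 → 2 - s ≤ Real.sin (Real.pi / 2 * s) := by
    intro s h1 h2
    have := hsin (2 - s) (by linarith) (by linarith)
    rwa [show Real.pi / 2 * (2 - s) = Real.pi - Real.pi / 2 * s by ring, Real.sin_pi_sub] at this
  have hnear : ∀ s : ℝ, |s| ≤ r → ‖G (x + s) - G x‖ ≤ K * |s| := by
    intro s hs
    have := hr (y := x + s) (by rw [Real.dist_eq]; simpa using hs.trans_lt hrr)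
    simpa using this
  refine ⟨max K (2 * C / r), by positivity, fun s hs => ?_⟩
  have hsp := sin_half_pi_pos hs.1 hs.2
  rcases le_or_gt s r with h1 | h1
  · refine (hnear s (by rwa [abs_of_pos hs.1])).trans ?_
    rw [abs_of_pos hs.1]
    exact mul_le_mul (le_max_left _ _) (hsin s hs.1.le (by linarith)) hs.1.le (by positivity)
  rcases le_or_gt (2 - r) s with h2 | h2
  · have h3 := hnear (s - 2) (by rw [abs_of_neg (by linarith [hs.2])]; linarith)
    have h4 := H.G_add_two (x + (s - 2 : ℝ))
    rw [show (x : ℂ) + (s - 2 : ℝ) + 2 = x + s by push_cast; ring] at h4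
    rw [← h4] at h3
    refine h3.trans ?_
    rw [abs_of_neg (by linarith [hs.2]), neg_sub]
    exact mul_le_mul (le_max_left _ _) (hsin2 s (by linarith) hs.2.le) (by linarith [hs.2])
      (by positivity)
  · have h3 : r ≤ Real.sin (Real.pi / 2 * s) := by
      rcases le_total s 1 with h | h
      · exact h1.le.trans (hsin s hs.1.le h)
      · exact (by linarith : r ≤ 2 - s).trans (hsin2 s h hs.2.le)
    have h4 : ‖G (x + s) - G x‖ ≤ 2 * C := by
      have h5 := hC _ (ofReal_mem_closedLowerPlane (x + s))
      push_cast at h5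
      linarith [norm_sub_le (G (x + s)) (G x), hC _ (ofReal_mem_closedLowerPlane x)]
    refine h4.trans ?_
    calc 2 * C = 2 * C / r * r := by field_simp
      _ ≤ _ := mul_le_mul (le_max_right _ _) h3 hr0.le (by positivity)

theorem continuous_G_translate (x : ℝ) : Continuous fun s : ℝ => G (x + s) := by
  have := (continuous_G_real H).comp (by fun_prop : Continuous fun β : ℝ => x + β)
  simpa [Function.comp_def] using this

omit H in
theorem deriv_G_translate (x s : ℝ) :
    deriv (fun s : ℝ => G (x + s)) s = deriv (fun x : ℝ => G x) (x + s) := by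
  rw [← deriv_comp_const_add]
  simp

/-- The boundary term of an integration by parts: the symmetric second difference of G is o(ε)
because G is differentiable at x, and the cotangent is O(1/ε). -/
theorem tendsto_boundary_term {x : ℝ} (hx : φ x ≠ 0) :
    Tendsto (fun ε : ℝ => ((Real.cot (Real.pi / 2 * ε) : ℝ) : ℂ) *
      ((G (x + ε) - G x) + (G (x - ε) - G x))) (𝓝[>] 0) (𝓝 0) := by
  have hd := H.hasDerivAt_G_real hx
  have h1 : HasDerivAt (fun ε : ℝ => (G (x + ε) - G x) + (G (x - ε) - G x)) 0 0 := by
    have e1 : HasDerivAt (fun ε : ℝ => G ((x + ε : ℝ) : ℂ)) (D x / φ x) 0 :=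
      HasDerivAt.comp_const_add (f := fun y : ℝ => G y) x 0 (by rwa [add_zero])
    have e2 : HasDerivAt (fun ε : ℝ => G ((x - ε : ℝ) : ℂ)) (-(D x / φ x)) 0 :=
      HasDerivAt.comp_const_sub (f := fun y : ℝ => G y) x 0 (by rwa [sub_zero])
    have e3 := (e1.sub_const (G x)).add (e2.sub_const (G x))
    rw [add_neg_cancel] at e3
    refine e3.congr_of_eventuallyEq (Eventually.of_forall fun ε => ?_)
    simp
  have h2 := h1.tendsto_slope_zero_right
  simp only [zero_add, ofReal_zero, add_zero, sub_zero, sub_self] at h2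
  have h3 := h2.norm
  rw [norm_zero] at h3
  refine squeeze_zero_norm' ?_ h3
  filter_upwards [Ioo_mem_nhdsGT (zero_lt_one (α := ℝ))] with ε hε
  rw [norm_mul, norm_smul, norm_real]
  refine mul_le_mul_of_nonneg_right ?_ (norm_nonneg _)
  rw [Real.norm_eq_abs, norm_inv, Real.norm_of_nonneg hε.1.le, ← one_div]
  exact abs_cot_mul_le hε.1 hε.2.le

/-- The complex singular integral of the velocity. -/
theorem tendsto_singular {x : ℝ} (hx : φ x ≠ 0) : ∃ L : ℂ,
    Tendsto (fun ε : ℝ => ∫ s in ε..(2 - ε), (((Real.sin (Real.pi / 2 * s) ^ 2)⁻¹ : ℝ) : ℂ) *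
      (G (x + s) - G x)) (𝓝[>] 0) (𝓝 L) := by
  obtain ⟨C, hC⟩ := H.G_bdd
  have hC0 : 0 ≤ C := (norm_nonneg _).trans (hC x (ofReal_mem_closedLowerPlane x))
  have hmem : ∀ w ∈ lowerPlane, w + x ∈ lowerPlane := fun w hw => by
    have : w.im < 0 := hw
    show (w + x).im < 0
    simpa
  have hsh : MapsTo (fun w : ℂ => w + x) closedLowerPlane closedLowerPlane := fun w hw => by
    have : w.im ≤ 0 := hw
    show (w + x).im ≤ 0
    simpa
  have hGc := H.G_cont.comp (by fun_prop : ContinuousOn (fun w : ℂ => w + x) _) hsh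
  -- `tendsto_singular_integral` sees real parts only; c = 1 gives Re G and c = -i gives Im G.
  have key : ∀ c : ℂ, ‖c‖ = 1 → ∃ L : ℝ, Tendsto (fun ε : ℝ => ∫ s in ε..(2 - ε),
      (c * (G (x + s) - G x)).re * (Real.sin (Real.pi / 2 * s) ^ 2)⁻¹) (𝓝[>] 0) (𝓝 L) := by
    intro c hc
    have := tendsto_singular_integral (f := fun w => c * G (w + x))
      (f' := fun w => c * (D (w + x) / φ (w + x))) (ρ := fun w => (c * G (w + x)).re)
      (ℓ := c * (D x / φ x)) (C := C)
      (fun w hw => ((H.G_deriv _ (hmem w hw)).comp_add_const w x).const_mul _)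
      (fun w hw => by rw [show w + 2 + x = (w + x) + 2 by ring, H.G_add_two])
      (fun w hw => by
        rw [norm_mul, hc, one_mul]
        have := hC (w + x) (hsh (show w.im ≤ 0 by linarith))
        nlinarith [abs_nonneg w.im])
      (continuous_re.comp_continuousOn (continuousOn_const.mul hGc)) (fun _ _ => rfl)
      ((tendsto_translate (H.tendsto_G_deriv hx)).const_mul _)
    refine ⟨_, this.congr fun ε => intervalIntegral.integral_congr fun s _ => ?_⟩
    simp only [zero_add]
    rw [mul_sub, sub_re, add_comm (s : ℂ)]
  obtain ⟨L1, hL1⟩ := key 1 (by simp)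
  obtain ⟨L2, hL2⟩ := key (-I) (by simp)
  refine ⟨L1 + L2 * I, ?_⟩
  have h1 : Tendsto _ _ (𝓝 ((L1 : ℂ) + L2 * I)) :=
    ((continuous_ofReal.tendsto L1).comp hL1).add
      (((continuous_ofReal.tendsto L2).comp hL2).mul_const I)
  refine h1.congr' ?_
  filter_upwards [Ioo_mem_nhdsGT (zero_lt_one (α := ℝ))] with ε hε
  have hGt := H.continuous_G_translate x
  have hi : ∀ c : ℂ, IntervalIntegrable (fun s : ℝ => (c * (G (x + s) - G x)).re *
      (Real.sin (Real.pi / 2 * s) ^ 2)⁻¹) volume ε (2 - ε) := fun c =>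
    intervalIntegrable_mul_inv_sin_sq hε.1 hε.2 (continuous_re.comp
      (continuous_const.mul (hGt.sub continuous_const))).continuousOn
  have hi' : ∀ c : ℂ, IntervalIntegrable (fun s : ℝ => (((c * (G (x + s) - G x)).re *
      (Real.sin (Real.pi / 2 * s) ^ 2)⁻¹ : ℝ) : ℂ)) volume ε (2 - ε) := fun c =>
    ⟨(hi c).1.ofReal, (hi c).2.ofReal⟩
  simp only [Function.comp]
  rw [← intervalIntegral.integral_ofReal, ← intervalIntegral.integral_ofReal,
    ← intervalIntegral.integral_mul_const, ← intervalIntegral.integral_add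
    (hi' 1) ((hi' (-I)).mul_const I)]
  refine intervalIntegral.integral_congr fun s _ => ?_
  apply Complex.ext <;> simp <;> ring

/-- Integration by parts trades the cotangent against G' for the kernel 1/sin² against G - G(x),
whose truncated integrals converge. No regularity of G' beyond integrability is available. -/
theorem exists_tendsto_cot_deriv {x : ℝ} (hx : φ x ≠ 0) : ∃ L : ℂ,
    Tendsto (fun ε : ℝ => ∫ s in ε..(2 - ε), ((Real.cot (Real.pi / 2 * s) : ℝ) : ℂ) *
      deriv (fun x : ℝ => G x) (x + s)) (𝓝[>] 0) (𝓝 L) := by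
  obtain ⟨L, hL⟩ := H.tendsto_singular hx
  refine ⟨_, ((hL.const_mul (Real.pi / 2 : ℂ)).sub (H.tendsto_boundary_term hx)).congr' ?_⟩
  filter_upwards [Ioo_mem_nhdsGT (zero_lt_one (α := ℝ))] with ε hε
  have hac : AbsolutelyContinuousOnInterval (fun s : ℝ => G (x + s) - G x) ε (2 - ε) :=
    absolutelyContinuous_of_dist_le (M := 1) ((H.absolutelyContinuous_G_translate x).mono (by
      rw [uIcc_of_le (by linarith [hε.2]), uIcc_of_le zero_le_two]
      exact Icc_subset_Icc hε.1.le (by linarith [hε.1]))) fun s _ t _ => by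
        rw [dist_sub_right, one_mul]
  have h1 := absolutelyContinuous_integral_mul_deriv (absolutelyContinuous_cot hε.1 hε.2) hac
  have h2 : ∀ s, deriv (fun s : ℝ => G (x + s) - G x) s = deriv (fun x : ℝ => G x) (x + s) :=
    fun s => by rw [deriv_sub_const, deriv_G_translate]
  simp only [h2] at h1
  rw [h1, cot_two_sub]
  have h3 : ∫ s in ε..(2 - ε), ((deriv (fun s => Real.cot (Real.pi / 2 * s)) s : ℝ) : ℂ) *
      (G (x + s) - G x) = -(Real.pi / 2 : ℂ) * ∫ s in ε..(2 - ε),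
        (((Real.sin (Real.pi / 2 * s) ^ 2)⁻¹ : ℝ) : ℂ) * (G (x + s) - G x) := by
    rw [← intervalIntegral.integral_const_mul]
    refine intervalIntegral.integral_congr fun s hs => ?_
    rw [(hasDerivAt_cot_half_pi (sin_ne_zero_of_mem hε.1 hε.2 hs)).deriv]
    push_cast
    ring
  rw [h3]
  have h4 := H.G_add_two (x - ε)
  rw [show (x : ℂ) - ε + 2 = x + (2 - ε : ℝ) by push_cast; ring] at h4
  rw [h4]
  push_cast
  ring

/-- The increment of G is at most K sin(πs/2), so it cancels the poles of the cotangent and leaves a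
bounded factor times the integrable G'. No principal value is needed for this part. -/
theorem integrableOn_cot_mul {x : ℝ} (hx : φ x ≠ 0) :
    IntervalIntegrable (fun s : ℝ => ((Real.cot (Real.pi / 2 * s) : ℝ) : ℂ) *
      (starRingEnd ℂ) (G (x + s) - G x) * deriv (fun x : ℝ => G x) (x + s)) volume 0 2 := by
  obtain ⟨K, hK0, hK⟩ := H.exists_norm_sub_le hx
  have hGt := H.continuous_G_translate x
  have hgi : IntervalIntegrable (fun s : ℝ => deriv (fun x : ℝ => G x) (x + s)) volume 0 2 := by
    have := (H.intervalIntegrable_deriv_G x (x + 2)).comp_add_left x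
    simpa using this
  rw [intervalIntegrable_iff, uIoc_of_le zero_le_two, IntegrableOn,
    ← Measure.restrict_congr_set Ioo_ae_eq_Ioc] at hgi ⊢
  refine hgi.bdd_mul (c := K) ?_ ?_
  · have h1 : Measurable fun s : ℝ => Real.cot (Real.pi / 2 * s) := by
      have : (fun s => Real.cot (Real.pi / 2 * s)) =
          fun s => Real.cos (Real.pi / 2 * s) / Real.sin (Real.pi / 2 * s) := by
        funext s
        rw [Real.cot_eq_cos_div_sin]
      rw [this]
      fun_prop
    exact ((measurable_ofReal.comp h1).mul
      (continuous_conj.comp (hGt.sub continuous_const)).measurable).aestronglyMeasurable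
  · rw [ae_restrict_iff' measurableSet_Ioo]
    refine Eventually.of_forall fun s hs => ?_
    have hsp := sin_half_pi_pos hs.1 hs.2
    rw [norm_mul, norm_real, RCLike.norm_conj, Real.norm_eq_abs, Real.cot_eq_cos_div_sin, abs_div,
      abs_of_pos hsp, div_mul_eq_mul_div, div_le_iff₀ hsp]
    calc |Real.cos (Real.pi / 2 * s)| * ‖G (x + s) - G x‖
        ≤ 1 * (K * Real.sin (Real.pi / 2 * s)) :=
          mul_le_mul (Real.abs_cos_le_one _) (hK s hs) (norm_nonneg _) zero_le_one
      _ = _ := one_mul _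

omit H in
theorem tendsto_integral_trunc {f : ℝ → ℂ} (hf : IntervalIntegrable f volume 0 2) :
    Tendsto (fun ε : ℝ => ∫ s in ε..(2 - ε), f s) (𝓝[>] 0) (𝓝 (∫ s in (0 : ℝ)..2, f s)) := by
  have h1 : ContinuousOn (fun b : ℝ => ∫ s in (0 : ℝ)..b, f s) (uIcc 0 2) :=
    intervalIntegral.continuousOn_primitive_interval' hf left_mem_uIcc
  have h0 : Tendsto (fun ε : ℝ => ε) (𝓝[>] 0) (𝓝[uIcc 0 2] 0) := tendsto_nhdsWithin_iff.2
    ⟨tendsto_id.mono_left nhdsWithin_le_nhds, by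
      filter_upwards [Ioo_mem_nhdsGT (zero_lt_one (α := ℝ))] with ε hε
      rw [uIcc_of_le zero_le_two]
      exact ⟨hε.1.le, by linarith [hε.2]⟩⟩
  have h2 : Tendsto (fun ε : ℝ => 2 - ε) (𝓝[>] 0) (𝓝[uIcc 0 2] 2) := tendsto_nhdsWithin_iff.2
    ⟨by
      have : Continuous fun ε : ℝ => 2 - ε := by fun_prop
      simpa using (this.tendsto 0).mono_left nhdsWithin_le_nhds, by
      filter_upwards [Ioo_mem_nhdsGT (zero_lt_one (α := ℝ))] with ε hε
      rw [uIcc_of_le zero_le_two]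
      exact ⟨by linarith [hε.2], by linarith [hε.1]⟩⟩
  have h3 := ((h1 2 right_mem_uIcc).tendsto.comp h2).sub ((h1 0 left_mem_uIcc).tendsto.comp h0)
  simp only [intervalIntegral.integral_same, sub_zero] at h3
  refine h3.congr' ?_
  filter_upwards [Ioo_mem_nhdsGT (zero_lt_one (α := ℝ))] with ε hε
  simp only [Function.comp]
  refine intervalIntegral.integral_interval_sub_left (hf.mono_set ?_) (hf.mono_set ?_) <;>
  rw [uIcc_of_le zero_le_two]
  · rw [uIcc_of_le (by linarith [hε.2])]
    exact Icc_subset_Icc le_rfl (by linarith [hε.1])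
  · rw [uIcc_of_le hε.1.le]
    exact Icc_subset_Icc le_rfl (by linarith [hε.2])

/-- Integration by parts in the quadratic singular integral. -/
theorem re_integral_cot_mul {x : ℝ} (hx : φ x ≠ 0) :
    (∫ s in (0 : ℝ)..2, ((Real.cot (Real.pi / 2 * s) : ℝ) : ℂ) *
      (starRingEnd ℂ) (G (x + s) - G x) * deriv (fun x : ℝ => G x) (x + s)).re =
      Real.pi / 4 * ∫ s in (0 : ℝ)..2, sqQuotient G x s := by
  obtain ⟨K, hK0, hK⟩ := H.exists_norm_sub_le hx
  obtain ⟨C, hC⟩ := H.G_bdd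
  have hC0 : 0 ≤ C := (norm_nonneg _).trans (hC x (ofReal_mem_closedLowerPlane x))
  have hCs : ∀ s : ℝ, ‖G (x + s) - G x‖ ≤ 2 * C := fun s => by
    have h5 := hC _ (ofReal_mem_closedLowerPlane (x + s))
    push_cast at h5
    linarith [norm_sub_le (G (x + s)) (G x), hC _ (ofReal_mem_closedLowerPlane x)]
  have hint := H.integrableOn_cot_mul hx
  have hsq := (H.conjGrad_div_im hx).1
  have h1 := (continuous_re.tendsto _).comp (tendsto_integral_trunc hint)
  have h2 := (tendsto_integral_trunc (⟨hsq.1.ofReal, hsq.2.ofReal⟩ :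
    IntervalIntegrable (fun s => (sqQuotient G x s : ℂ)) volume 0 2))
  have h2' := (continuous_re.tendsto _).comp h2
  rw [intervalIntegral.integral_ofReal, ofReal_re] at h2'
  set q : ℝ → ℝ := fun s => ‖G (x + s) - G x‖ ^ 2 with hq
  have hb : ∀ u : ℝ → ℝ, (∀ᶠ ε in 𝓝[>] (0 : ℝ), |u ε| ≤ K ^ 2 * ε * 10) →
      Tendsto u (𝓝[>] 0) (𝓝 0) := fun u hu => by
    refine squeeze_zero_norm' hu ?_
    have : Continuous fun ε : ℝ => K ^ 2 * ε * 10 := by fun_prop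
    simpa using (this.tendsto 0).mono_left nhdsWithin_le_nhds
  -- The squared increment is O(sin²) and the cotangent O(1/sin), so the boundary terms are O(ε).
  have hbd : Tendsto (fun ε : ℝ => Real.cot (Real.pi / 2 * (2 - ε)) * q (2 - ε) -
      Real.cot (Real.pi / 2 * ε) * q ε) (𝓝[>] 0) (𝓝 0) := by
    refine hb _ ?_
    filter_upwards [Ioo_mem_nhdsGT (zero_lt_one (α := ℝ))] with ε hε
    have hs := Real.sin_le (x := Real.pi / 2 * ε) (by have := hε.1; have := Real.pi_pos; positivity)
    have hsp := sin_half_pi_pos hε.1 (by linarith [hε.2])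
    have hsb : Real.sin (Real.pi / 2 * ε) ≤ 2 * ε := by nlinarith [Real.pi_le_four, hε.1]
    have hq1 : ∀ s ∈ Ioo (0 : ℝ) 2, q s ≤ K ^ 2 * Real.sin (Real.pi / 2 * s) ^ 2 := fun s hs => by
      have := pow_le_pow_left₀ (norm_nonneg _) (hK s hs) 2
      rwa [mul_pow] at this
    have e1 := hq1 ε ⟨hε.1, by linarith [hε.2]⟩
    have e2 := hq1 (2 - ε) ⟨by linarith [hε.2], by linarith [hε.1]⟩
    rw [show Real.pi / 2 * (2 - ε) = Real.pi - Real.pi / 2 * ε by ring, Real.sin_pi_sub] at e2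
    have hqn : ∀ s, 0 ≤ q s := fun s => by positivity
    rw [cot_two_sub, show -Real.cot (Real.pi / 2 * ε) * q (2 - ε) -
      Real.cot (Real.pi / 2 * ε) * q ε = -(Real.cot (Real.pi / 2 * ε) * (q (2 - ε) + q ε)) by ring,
      abs_neg, abs_mul, Real.cot_eq_cos_div_sin, abs_div, abs_of_pos hsp,
      abs_of_nonneg (add_nonneg (hqn _) (hqn _)), div_mul_eq_mul_div, div_le_iff₀ hsp]
    calc |Real.cos (Real.pi / 2 * ε)| * (q (2 - ε) + q ε)
        ≤ 1 * (2 * (K ^ 2 * Real.sin (Real.pi / 2 * ε) ^ 2)) :=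
          mul_le_mul (Real.abs_cos_le_one _) (by linarith) (add_nonneg (hqn _) (hqn _)) zero_le_one
      _ = 2 * K ^ 2 * Real.sin (Real.pi / 2 * ε) * Real.sin (Real.pi / 2 * ε) := by ring
      _ ≤ K ^ 2 * ε * 10 * Real.sin (Real.pi / 2 * ε) := by
          refine mul_le_mul_of_nonneg_right ?_ hsp.le
          nlinarith [sq_nonneg K, mul_le_mul_of_nonneg_left hsb (sq_nonneg K),
            mul_nonneg (sq_nonneg K) hε.1.le]
  have h3 := ((hbd.const_mul (1 / 2)).add (h2'.const_mul (Real.pi / 4)))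
  rw [mul_zero, zero_add] at h3
  refine tendsto_nhds_unique h1 (h3.congr' ?_)
  filter_upwards [Ioo_mem_nhdsGT (zero_lt_one (α := ℝ))] with ε hε
  have hsub : uIcc ε (2 - ε) ⊆ uIcc 0 2 := by
    rw [uIcc_of_le (by linarith [hε.2]), uIcc_of_le zero_le_two]
    exact Icc_subset_Icc hε.1.le (by linarith [hε.1])
  have hac : AbsolutelyContinuousOnInterval q ε (2 - ε) := by
    refine absolutelyContinuous_of_dist_le (M := 4 * C)
      ((H.absolutelyContinuous_G_translate x).mono hsub) fun s _ t _ => ?_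
    have e1 := abs_norm_sub_norm_le (G (x + s) - G x) (G (x + t) - G x)
    rw [sub_sub_sub_cancel_right] at e1
    rw [Real.dist_eq, dist_eq_norm, hq]
    simp only
    rw [sq_sub_sq, abs_mul]
    refine mul_le_mul ?_ e1 (abs_nonneg _) (by positivity)
    rw [abs_of_nonneg (by positivity)]
    linarith [hCs s, hCs t]
  have h4 := (absolutelyContinuous_cot hε.1 hε.2).integral_mul_deriv_eq_deriv_mul hac
  have hintε := hint.mono_set hsub
  -- The real part of conj(G - G(x)) G' is half the derivative of |G - G(x)|².
  have h5 : (∫ s in ε..(2 - ε), ((Real.cot (Real.pi / 2 * s) : ℝ) : ℂ) *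
      (starRingEnd ℂ) (G (x + s) - G x) * deriv (fun x : ℝ => G x) (x + s)).re =
      1 / 2 * ∫ s in ε..(2 - ε), Real.cot (Real.pi / 2 * s) * deriv q s := by
    rw [← intervalIntegral.integral_const_mul]
    refine (reCLM.intervalIntegral_comp_comm hintε).symm.trans ?_
    refine intervalIntegral.integral_congr_ae ?_
    filter_upwards [absolutelyContinuous_ae_hasDerivAt
      ((H.absolutelyContinuous_G_translate x).mono hsub)] with s hs hmem
    have e1 := ((hs (uIoc_subset_uIcc hmem)).1.sub_const (G x)).norm_sq
    rw [deriv_G_translate] at e1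
    have e2 : deriv q s = _ := e1.deriv
    rw [e2, reCLM_apply, mul_assoc, re_ofReal_mul, Complex.inner]
    ring_nf
  have h6 : ∫ s in ε..(2 - ε), deriv (fun s => Real.cot (Real.pi / 2 * s)) s * q s =
      -(Real.pi / 2) * ∫ s in ε..(2 - ε), sqQuotient G x s := by
    rw [← intervalIntegral.integral_const_mul]
    refine intervalIntegral.integral_congr fun s hs => ?_
    rw [(hasDerivAt_cot_half_pi (sin_ne_zero_of_mem hε.1 hε.2 hs)).deriv, sqQuotient]
    ring
  simp only [Function.comp]
  rw [h5, h4, h6, intervalIntegral.integral_ofReal, ofReal_re]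
  ring

omit H in
theorem integrableOn_I {f : ℝ → ℂ} (hf : IntervalIntegrable f volume (-1) 1) :
    IntegrableOn f CornerWave.I := by
  rw [integrableOn_Icc_iff_integrableOn_Ioc]
  exact hf.1

/-- The Hilbert transforms in the formula for `A₁`. -/
theorem hilbert_formula {x : ℝ} (hx : φ x ≠ 0) :
    CornerWave.HilbertExists (deriv fun x : ℝ => G x) x ∧
    CornerWave.HilbertExists (fun y : ℝ => (starRingEnd ℂ) (G y) * deriv (fun x : ℝ => G x) y) x ∧
    (-CornerWave.hilbertComm (fun y : ℝ => (starRingEnd ℂ) (G y)) (deriv fun x : ℝ => G x) x).im =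
      Real.pi / 8 * ∫ s in (0 : ℝ)..2, sqQuotient G x s := by
  obtain ⟨L, hL⟩ := H.exists_tendsto_cot_deriv hx
  have hint := H.integrableOn_cot_mul hx
  have hX := tendsto_integral_trunc hint
  set X := ∫ s in (0 : ℝ)..2, ((Real.cot (Real.pi / 2 * s) : ℝ) : ℂ) *
      (starRingEnd ℂ) (G (x + s) - G x) * deriv (fun x : ℝ => G x) (x + s) with hXd
  have hper : Function.Periodic
      (fun y : ℝ => (starRingEnd ℂ) (G y) * deriv (fun x : ℝ => G x) y) 2 := fun y => by
    have := H.periodic_G y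
    simp only at this ⊢
    rw [this, H.periodic_deriv_G y]
  -- Split conj G(x + s) into conj G(x) and the increment. The first gives conj G(x) L, which
  -- cancels in the commutator; the second is the absolutely convergent X.
  have hL2 : Tendsto (fun ε : ℝ => ∫ s in ε..(2 - ε), ((Real.cot (Real.pi / 2 * s) : ℝ) : ℂ) *
      ((starRingEnd ℂ) (G ((x + s : ℝ) : ℂ)) * deriv (fun x : ℝ => G x) (x + s))) (𝓝[>] 0)
      (𝓝 ((starRingEnd ℂ) (G x) * L + X)) := by
    refine ((hL.const_mul ((starRingEnd ℂ) (G x))).add hX).congr' ?_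
    filter_upwards [Ioo_mem_nhdsGT (zero_lt_one (α := ℝ))] with ε hε
    have hsub : uIcc ε (2 - ε) ⊆ uIcc 0 2 := by
      rw [uIcc_of_le (by linarith [hε.2]), uIcc_of_le zero_le_two]
      exact Icc_subset_Icc hε.1.le (by linarith [hε.1])
    have hgi : IntervalIntegrable (fun s : ℝ => deriv (fun x : ℝ => G x) (x + s)) volume
        ε (2 - ε) := by
      have := (H.intervalIntegrable_deriv_G (x + ε) (x + (2 - ε))).comp_add_left x
      simpa using this
    have hci : IntervalIntegrable (fun s : ℝ => ((Real.cot (Real.pi / 2 * s) : ℝ) : ℂ) *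
        deriv (fun x : ℝ => G x) (x + s)) volume ε (2 - ε) :=
      hgi.continuousOn_mul (continuous_ofReal.comp_continuousOn
        (absolutelyContinuous_cot hε.1 hε.2).continuousOn)
    rw [← intervalIntegral.integral_const_mul, ← intervalIntegral.integral_add
      (hci.const_mul _) (hint.mono_set hsub)]
    refine intervalIntegral.integral_congr fun s _ => ?_
    simp only [map_sub, ofReal_add]
    ring
  have t1 := hilbert_eq_of_tendsto H.periodic_deriv_G hL
  have t2 := hilbert_eq_of_tendsto hper hL2
  have hcont : Continuous fun y : ℝ => (starRingEnd ℂ) (G y) :=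
    continuous_conj.comp (continuous_G_real H)
  refine ⟨⟨integrableOn_I (H.intervalIntegrable_deriv_G _ _), _, t1⟩,
    ⟨integrableOn_I ((H.intervalIntegrable_deriv_G _ _).continuousOn_mul hcont.continuousOn),
      _, t2⟩, ?_⟩
  unfold CornerWave.hilbertComm CornerWave.hilbert
  rw [t1.limUnder_eq, t2.limUnder_eq]
  have h1 : -((starRingEnd ℂ) (G x) * (-(1 / (2 * I)) * L) -
      -(1 / (2 * I)) * ((starRingEnd ℂ) (G x) * L + X)) = (1 / 2 : ℝ) * I * X := by
    push_cast
    field_simp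
    rw [I_sq]
    ring
  rw [h1, mul_assoc, im_ofReal_mul, I_mul_im, hXd, H.re_integral_cot_mul hx]
  ring

end StripData
end StripWave


namespace StripWave
open Complex
open CornerWave (closedHalfStrip openHalfStrip)

/-! ### Periodic extension of functions on the half strip -/

/-- The index of the translate of the half strip which contains a point. -/
noncomputable def stripIndex (w : ℂ) : ℤ := ⌈(w.re - 1) / 2⌉

/-- The `2`-periodic extension of a function on the half strip. -/
noncomputable def perExt {E : Type*} (f : ℂ → E) (w : ℂ) : E := f (w - 2 * stripIndex w)

section PerExt

variable {E : Type*} {f : ℂ → E}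

theorem stripIndex_eq {w : ℂ} {n : ℤ} (h1 : 2 * (n : ℝ) - 1 < w.re) (h2 : w.re ≤ 2 * n + 1) :
    stripIndex w = n := by
  unfold stripIndex
  rw [Int.ceil_eq_iff]
  constructor <;> linarith

theorem stripIndex_spec (w : ℂ) :
    2 * (stripIndex w : ℝ) - 1 < w.re ∧ w.re ≤ 2 * stripIndex w + 1 := by
  unfold stripIndex
  constructor
  · linarith [Int.ceil_lt_add_one ((w.re - 1) / 2)]
  · linarith [Int.le_ceil ((w.re - 1) / 2)]

theorem perExt_add_two (f : ℂ → E) (w : ℂ) : perExt f (w + 2) = perExt f w := by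
  have h := stripIndex_spec w
  have : stripIndex (w + 2) = stripIndex w + 1 := stripIndex_eq
    (by push_cast; simp only [add_re, re_ofNat]; linarith [h.1])
    (by push_cast; simp only [add_re, re_ofNat]; linarith [h.2])
  unfold perExt
  rw [this]
  push_cast
  ring_nf

theorem perExt_eq {w : ℂ} {n : ℤ} (h1 : 2 * (n : ℝ) - 1 < w.re) (h2 : w.re ≤ 2 * n + 1) :
    perExt f w = f (w - 2 * n) := by
  unfold perExt
  rw [stripIndex_eq h1 h2]

theorem sub_stripIndex_mem {w : ℂ} (hw : w ∈ closedLowerPlane) :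
    w - 2 * stripIndex w ∈ closedHalfStrip := by
  have h := stripIndex_spec w
  have hw' : w.im ≤ 0 := hw
  refine ⟨?_, by simpa using hw'⟩
  simp only [sub_re, mul_re, re_ofNat, intCast_re, im_ofNat, intCast_im, mul_zero, sub_zero]
  rw [abs_le]
  constructor <;> linarith

/-- The two sides of the half strip are matched by `f`. -/
def SidesMatch (f : ℂ → E) : Prop := ∀ y : ℝ, y ≤ 0 → f (1 + y * I) = f (-1 + y * I)

theorem perExt_eq_of_sidesMatch (hf : SidesMatch f) {w : ℂ} (hw : w ∈ closedLowerPlane) {n : ℤ}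
    (h1 : 2 * (n : ℝ) - 1 ≤ w.re) (h2 : w.re ≤ 2 * n + 1) : perExt f w = f (w - 2 * n) := by
  rcases h1.lt_or_eq with h | h
  · exact perExt_eq h h2
  · rw [perExt_eq (n := n - 1) (by push_cast; linarith) (by push_cast; linarith)]
    have e1 : w - 2 * ((n - 1 : ℤ) : ℂ) = 1 + w.im * I := by
      apply Complex.ext
      · simp
        linarith
      · simp
    have e2 : w - 2 * (n : ℂ) = -1 + w.im * I := by
      apply Complex.ext
      · simp
        linarith
      · simp
    rw [e1, e2, hf _ hw]

theorem perExt_eq_self_of_sidesMatch (hf : SidesMatch f) {w : ℂ} (hw : w ∈ closedHalfStrip) :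
    perExt f w = f w := by
  have := perExt_eq_of_sidesMatch hf (w := w) (show w.im ≤ 0 from hw.2) (n := 0)
    (by simpa using (abs_le.1 hw.1).1) (by simpa using (abs_le.1 hw.1).2)
  simpa using this

theorem locallyFinite_strips :
    LocallyFinite fun n : ℤ => {w : ℂ | w ∈ closedLowerPlane ∧
      2 * (n : ℝ) - 1 ≤ w.re ∧ w.re ≤ 2 * n + 1} := by
  intro w
  refine ⟨Metric.ball w 1, Metric.ball_mem_nhds _ one_pos,
    (finite_Icc ⌊(w.re - 2) / 2⌋ ⌈(w.re + 2) / 2⌉).subset ?_⟩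
  rintro n ⟨z, ⟨-, h1, h2⟩, hz⟩
  rw [mem_ball_iff_norm] at hz
  have h3 := (abs_re_le_norm (z - w)).trans_lt hz
  rw [sub_re, abs_lt] at h3
  have h4 := Int.floor_le ((w.re - 2) / 2)
  have h5 := Int.le_ceil ((w.re + 2) / 2)
  constructor
  · exact_mod_cast (by linarith : (⌊(w.re - 2) / 2⌋ : ℝ) ≤ n)
  · exact_mod_cast (by linarith : (n : ℝ) ≤ ⌈(w.re + 2) / 2⌉)

theorem isClosed_closedLowerPlane : IsClosed closedLowerPlane :=
  isClosed_le continuous_im continuous_const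

/-- On each closed strip the extension is a translate of f, including the left edge because the
sides match; the closed strips form a locally finite cover. -/
theorem continuousOn_perExt [TopologicalSpace E] (hf : ContinuousOn f closedHalfStrip)
    (hm : SidesMatch f) : ContinuousOn (perExt f) closedLowerPlane := by
  refine (locallyFinite_strips.continuousOn_iUnion (g := perExt f) (fun n => ?_) fun n => ?_).mono
    fun w hw => mem_iUnion.2 ⟨stripIndex w, hw, (stripIndex_spec w).1.le, (stripIndex_spec w).2⟩
  · exact isClosed_closedLowerPlane.inter
      ((isClosed_le continuous_const continuous_re).inter (isClosed_le continuous_re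
        continuous_const))
  · have h1 : ContinuousOn (fun w : ℂ => f (w - 2 * n)) {w : ℂ | w ∈ closedLowerPlane ∧
        2 * (n : ℝ) - 1 ≤ w.re ∧ w.re ≤ 2 * n + 1} := by
      refine hf.comp (by fun_prop) fun w hw => ⟨?_, ?_⟩
      · simp only [sub_re, mul_re, re_ofNat, intCast_re, im_ofNat, intCast_im, mul_zero, sub_zero]
        rw [abs_le]
        constructor <;> linarith [hw.2.1, hw.2.2]
      · have : w.im ≤ 0 := hw.1
        simpa using this
    exact h1.congr fun w hw => perExt_eq_of_sidesMatch hm hw.1 hw.2.1 hw.2.2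

end PerExt

theorem isOpen_openHalfStrip : IsOpen openHalfStrip :=
  (isOpen_lt continuous_re.abs continuous_const).inter (isOpen_lt continuous_im continuous_const)

theorem openHalfStrip_subset_lowerPlane : openHalfStrip ⊆ lowerPlane := fun _ hw => hw.2

theorem openHalfStrip_subset_closedHalfStrip : openHalfStrip ⊆ closedHalfStrip :=
  fun _ hw => ⟨hw.1.le, hw.2.le⟩

theorem convex_openHalfStrip : Convex ℝ openHalfStrip := by
  have : openHalfStrip = {w : ℂ | -1 < w.re} ∩ {w : ℂ | w.re < 1} ∩ {w : ℂ | w.im < 0} := by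
    ext w
    simp only [openHalfStrip, abs_lt, mem_inter_iff, mem_ofPred_eq]
  rw [this]
  exact ((convex_halfSpace_re_gt _).inter (convex_halfSpace_re_lt _)).inter
    (convex_halfSpace_im_lt _)

theorem add_int_period {F : ℂ → ℂ} {c : ℂ} (hper : ∀ w ∈ lowerPlane, F (w + 2) = F w + c) (n : ℤ)
    {w : ℂ} (hw : w ∈ lowerPlane) : F (w + 2 * n) = F w + n * c := by
  have hmem : ∀ m : ℤ, w + 2 * m ∈ lowerPlane := fun m => by
    have : w.im < 0 := hw
    show (w + 2 * m).im < 0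
    simpa using this
  induction n with
  | zero => simp
  | succ k ih =>
    have := hper _ (hmem k)
    rw [show w + 2 * ((k + 1 : ℤ) : ℂ) = w + 2 * ((k : ℤ) : ℂ) + 2 by push_cast; ring, this, ih]
    push_cast
    ring
  | pred k ih =>
    have := hper _ (hmem (-(k : ℤ) - 1))
    rw [show w + 2 * ((-(k : ℤ) - 1 : ℤ) : ℂ) + 2 = w + 2 * ((-(k : ℤ) : ℤ) : ℂ) by
      push_cast; ring, ih] at this
    push_cast at this ⊢
    linear_combination -this

/-- A continuous function which is periodic up to a constant and holomorphic in the open half strip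
is holomorphic across the walls. -/
theorem differentiableOn_of_halfStrip {F : ℂ → ℂ} {c : ℂ} (hF : ContinuousOn F lowerPlane)
    (hper : ∀ w ∈ lowerPlane, F (w + 2) = F w + c) (hd : DifferentiableOn ℂ F openHalfStrip) :
    DifferentiableOn ℂ F lowerPlane := by
  have hoff : ∀ (n : ℤ) (w : ℂ), w ∈ lowerPlane → |w.re - 2 * n| < 1 → DifferentiableAt ℂ F w := by
    intro n w hw hn
    have hmem : w - 2 * n ∈ openHalfStrip := ⟨by simpa using hn, by
      have : w.im < 0 := hw
      simpa using this⟩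
    have h1 : DifferentiableAt ℂ (fun w => F (w - 2 * n) + n * c) w :=
      (DifferentiableAt.comp (g := F) (f := fun w : ℂ => w - 2 * n) w
        (hd.differentiableAt (isOpen_openHalfStrip.mem_nhds hmem)) (by fun_prop)).add_const _
    refine h1.congr_of_eventuallyEq ?_
    filter_upwards [isOpen_lowerPlane.mem_nhds hw] with z hz
    have hz' : z - 2 * n ∈ lowerPlane := by
      have : z.im < 0 := hz
      show (z - 2 * n).im < 0
      simpa using this
    rw [← add_int_period hper n hz', sub_add_cancel]
  intro w hw
  obtain ⟨h1, h2⟩ := stripIndex_spec w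
  set n := stripIndex w
  rcases h2.lt_or_eq with h | h
  · exact (hoff n w hw (by rw [abs_lt]; constructor <;> linarith)).differentiableWithinAt
  -- A point of a translated wall: the function is continuous near it and holomorphic off the line,
  -- so Morera's theorem applies.
  · set U : Set ℂ := lowerPlane ∩ {z | |z.re - (2 * n + 1)| < 1} with hU
    have hUo : IsOpen U := isOpen_lowerPlane.inter
      (isOpen_lt (continuous_re.sub continuous_const).abs continuous_const)
    have hwU : w ∈ U := ⟨hw, by simp [h]⟩
    have := differentiableOn_of_off_vertical_line hUo (hF.mono inter_subset_left) (2 * n + 1)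
      fun z hz hne => by
        have hz2 : |z.re - (2 * n + 1)| < 1 := hz.2
        rw [abs_lt] at hz2
        rcases lt_or_gt_of_ne hne with h3 | h3
        · exact hoff n z hz.1 (by rw [abs_lt]; constructor <;> linarith [hz2.1])
        · exact hoff (n + 1) z hz.1 (by push_cast; rw [abs_lt]; constructor <;> linarith [hz2.2])
    exact (this.differentiableAt (hUo.mem_nhds hwU)).differentiableWithinAt

theorem differentiableOn_perExt {f : ℂ → ℂ} (hf : ContinuousOn f closedHalfStrip)
    (hm : SidesMatch f) (hd : DifferentiableOn ℂ f openHalfStrip) :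
    DifferentiableOn ℂ (perExt f) lowerPlane := by
  refine differentiableOn_of_halfStrip (c := 0)
    ((continuousOn_perExt hf hm).mono lowerPlane_subset_closedLowerPlane)
    (fun w _ => by rw [perExt_add_two, add_zero]) (hd.congr fun w hw => ?_)
  exact perExt_eq_self_of_sidesMatch hm (openHalfStrip_subset_closedHalfStrip hw)

theorem closure_openHalfStrip_inter {w : ℂ} (hw : w ∈ closedHalfStrip) :
    w ∈ closure openHalfStrip := by
  refine mem_closure_of_tendsto (f := fun n : ℕ => ((1 - 1 / ((n : ℝ) + 1) : ℝ) : ℂ) * w -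
    (1 / ((n : ℝ) + 1) : ℝ) * I) (b := atTop) ?_ ?_
  · have h1 := tendsto_one_div_add_atTop_nhds_zero_nat (𝕜 := ℝ)
    have h2 : Continuous fun x : ℝ => ((1 - x : ℝ) : ℂ) * w - (x : ℝ) * I := by fun_prop
    have := (h2.tendsto 0).comp h1
    simpa [Function.comp_def] using this
  · filter_upwards [eventually_ge_atTop 1] with n hn
    have hn' : (1 : ℝ) ≤ n := by exact_mod_cast hn
    set x := 1 / ((n : ℝ) + 1) with hx
    have hx0 : 0 < x := by positivity
    have hx1 : x < 1 := by
      rw [hx, div_lt_one (by positivity)]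
      linarith
    refine ⟨?_, ?_⟩
    · simp only [sub_re, re_ofReal_mul, I_re, mul_zero, sub_zero, abs_mul]
      rw [abs_of_pos (by linarith)]
      nlinarith [hw.1, abs_nonneg w.re]
    · simp only [sub_im, im_ofReal_mul, I_im, mul_one]
      nlinarith [hw.2]

theorem identity_closedHalfStrip {F k m : ℂ → ℂ} (hF : DifferentiableOn ℂ F lowerPlane)
    (hk : ContinuousOn k closedHalfStrip) (hm : ContinuousOn m closedHalfStrip)
    (h : ∀ w ∈ openHalfStrip, k w * deriv F w = m w) {w : ℂ} (hw : w ∈ closedHalfStrip)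
    (hwl : w ∈ lowerPlane) : k w * deriv F w = m w := by
  have hne : (𝓝[openHalfStrip] w).NeBot := mem_closure_iff_nhdsWithin_neBot.1
    (closure_openHalfStrip_inter hw)
  have h1 : Tendsto (fun z => k z * deriv F z) (𝓝[openHalfStrip] w) (𝓝 (k w * deriv F w)) :=
    ((hk w hw).mono openHalfStrip_subset_closedHalfStrip).tendsto.mul
      (((hF.deriv isOpen_lowerPlane).continuousOn w hwl).mono
        openHalfStrip_subset_lowerPlane).tendsto
  have h2 := ((hm w hw).mono openHalfStrip_subset_closedHalfStrip).tendsto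
  refine tendsto_nhds_unique h1 (h2.congr' ?_)
  filter_upwards [self_mem_nhdsWithin] with z hz using (h z hz).symm

theorem deriv_add_int_period {F : ℂ → ℂ} {c : ℂ}
    (hper : ∀ w ∈ lowerPlane, F (w + 2) = F w + c) (n : ℤ) {w : ℂ} (hw : w ∈ lowerPlane) :
    deriv F (w + 2 * n) = deriv F w := by
  have : (fun w => F (w + 2 * n)) =ᶠ[𝓝 w] fun w => F w + n * c := by
    filter_upwards [isOpen_lowerPlane.mem_nhds hw] with z hz using add_int_period hper n hz
  rw [← deriv_comp_add_const, this.deriv_eq, deriv_add_const]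

/-- If `k F' = m` in the open half strip and `F` is periodic up to a constant, then this holds in
the half plane for the periodic extensions. -/
theorem perExt_identity {F k m : ℂ → ℂ} {c : ℂ} (hF : DifferentiableOn ℂ F lowerPlane)
    (hper : ∀ w ∈ lowerPlane, F (w + 2) = F w + c)
    (hk : ContinuousOn k closedHalfStrip) (hm : ContinuousOn m closedHalfStrip)
    (h : ∀ w ∈ openHalfStrip, k w * deriv F w = m w) {w : ℂ} (hw : w ∈ lowerPlane) :
    perExt k w * deriv F w = perExt m w := by
  have hw' : w - 2 * stripIndex w ∈ lowerPlane := by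
    have : w.im < 0 := hw
    show (w - 2 * stripIndex w).im < 0
    simpa using this
  have := identity_closedHalfStrip hF hk hm h
    (sub_stripIndex_mem (lowerPlane_subset_closedLowerPlane hw)) hw'
  rwa [← deriv_add_int_period hper (stripIndex w) hw', sub_add_cancel] at this

/-- If `k F' = m` in the open half strip and `F` is periodic up to a constant, then this holds on
the walls, too, where the values of `F'` on both sides agree. -/
theorem wall_identity {F k m : ℂ → ℂ} {c : ℂ} (hF : DifferentiableOn ℂ F lowerPlane)
    (hper : ∀ w ∈ lowerPlane, F (w + 2) = F w + c)
    (hk : ContinuousOn k closedHalfStrip) (hm : ContinuousOn m closedHalfStrip)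
    (h : ∀ w ∈ openHalfStrip, k w * deriv F w = m w) {y : ℝ} (hy : y < 0) :
    k (1 + y * I) * deriv F (1 + y * I) = m (1 + y * I) ∧
      k (-1 + y * I) * deriv F (1 + y * I) = m (-1 + y * I) := by
  have e1 : ((1 : ℂ) + y * I) ∈ lowerPlane := by
    show ((1 : ℂ) + y * I).im < 0
    simpa using hy
  have e2 : ((-1 : ℂ) + y * I) ∈ lowerPlane := by
    show ((-1 : ℂ) + y * I).im < 0
    simpa using hy
  refine ⟨identity_closedHalfStrip hF hk hm h ⟨by simp, by simpa using hy.le⟩ e1, ?_⟩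
  have := deriv_add_int_period hper 1 e2
  rw [show (-1 + y * I + 2 * ((1 : ℤ) : ℂ) : ℂ) = 1 + y * I by push_cast; ring] at this
  rw [this]
  exact identity_closedHalfStrip hF hk hm h ⟨by simp, by simpa using hy.le⟩ e2

/-- The upper corners follow by continuity. This matters because identities obtained from holomorphy
across the walls are available only for y < 0. -/
theorem sidesMatch_of_neg {E : Type*} [TopologicalSpace E] [T2Space E] {f : ℂ → E}
    (hf : ContinuousOn f closedHalfStrip)
    (h : ∀ y : ℝ, y < 0 → f (1 + y * I) = f (-1 + y * I)) : SidesMatch f := by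
  intro y hy
  rcases hy.lt_or_eq with h0 | rfl
  · exact h y h0
  have key : ∀ s : ℂ, |s.re| ≤ 1 → s.im = 0 →
      Tendsto (fun y : ℝ => f (s + y * I)) (𝓝[<] 0) (𝓝 (f (s + (0 : ℝ) * I))) := by
    intro s hs hs'
    refine ((hf (s + (0 : ℝ) * I) ⟨by simpa using hs, by simp [hs']⟩).tendsto).comp
      (tendsto_nhdsWithin_iff.2 ⟨?_, ?_⟩)
    · have : Continuous fun y : ℝ => s + y * I := by fun_prop
      exact (this.tendsto 0).mono_left nhdsWithin_le_nhds
    · filter_upwards [self_mem_nhdsWithin] with y hy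
      have : y < 0 := hy
      exact ⟨by simpa using hs, by simpa [hs'] using this.le⟩
  refine tendsto_nhds_unique (key 1 (by simp) (by simp)) ((key (-1) (by simp) (by simp)).congr' ?_)
  filter_upwards [self_mem_nhdsWithin] with y hy using (h y hy).symm

/-- The Poisson formula for functions which are only continuous up to the boundary. -/
theorem poisson_of_continuousOn {g : ℂ → ℂ} {C : ℝ} (hg : ContinuousOn g closedLowerPlane)
    (hd : DifferentiableOn ℂ g lowerPlane) (hper : ∀ w, g (w + 2) = g w)
    (hC : ∀ w : ℂ, w.im ≤ -1 → ‖g w‖ ≤ C) {w : ℂ} (hw : w ∈ lowerPlane) :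
    g w = ∫ s in (-1 : ℝ)..1, (stripKernel (w - s) : ℂ) * g s := by
  have hη : ∀ η : ℝ, 0 < η → g (w - η * I) =
      ∫ s in (-1 : ℝ)..1, (stripKernel (w - s) : ℂ) * g (s - η * I) := by
    intro η hη
    have hmem : ∀ w : ℂ, w.im < η → w - η * I ∈ lowerPlane := by
      intro w hw
      show (w - η * I).im < 0
      simpa using hw
    have h1 := poisson_periodic (f := fun w => g (w - η * I)) (C := C) hη
      (fun w hw => DifferentiableAt.comp (g := g) (f := fun w : ℂ => w - η * I) w
          (hd.differentiableAt (isOpen_lowerPlane.mem_nhds (hmem w hw))) (by fun_prop))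
      (fun w => by rw [show w + 2 - η * I = (w - η * I) + 2 by ring, hper])
      (fun w hw => hC _ (by simp; linarith)) hw
    rw [h1]
    simp only [real_smul]
  have hlim1 : Tendsto (fun η : ℝ => g (w - η * I)) (𝓝[>] 0) (𝓝 (g w)) := by
    have h1 : ContinuousAt g w := (hd.differentiableAt (isOpen_lowerPlane.mem_nhds hw)).continuousAt
    refine h1.tendsto.comp ?_
    have : Continuous (fun η : ℝ => w - η * I) := by fun_prop
    simpa using (this.tendsto 0).mono_left nhdsWithin_le_nhds
  refine tendsto_nhds_unique (hlim1.congr' ?_)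
    (tendsto_integral_shift (continuous_stripKernel_sub hw) hg (-1) 1)
  filter_upwards [self_mem_nhdsWithin] with η h using hη η h

theorem norm_exp_I_pi (w : ℂ) : ‖exp (I * Real.pi * w)‖ = Real.exp (-(Real.pi * w.im)) := by
  rw [norm_exp]
  simp

/-- A function on the half strip which vanishes at infinity decays exponentially, with a bound in
terms of its values on the top. -/
theorem norm_le_exp_of_tendsto_zero {f : ℂ → ℂ} {M : ℝ} (hf : ContinuousOn f closedHalfStrip)
    (hm : SidesMatch f) (hd : DifferentiableOn ℂ f openHalfStrip)
    (h0 : ∀ ε > 0, ∃ R : ℝ, ∀ w ∈ closedHalfStrip, w.im < R → ‖f w‖ < ε)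
    (hM : ∀ s ∈ Icc (-1 : ℝ) 1, ‖f s‖ ≤ M) {w : ℂ} (hw : w ∈ closedHalfStrip) (hw0 : w.im < 0) :
    ‖f w‖ ≤ M * Real.exp (Real.pi * w.im) := by
  set F := perExt f with hF
  have hFc := continuousOn_perExt hf hm
  have hFd := differentiableOn_perExt hf hm hd
  -- The factor has period 2, modulus exp(-π Im w), and modulus 1 on the real line. It remains to
  -- see that g is bounded; the Poisson formula then acts as a maximum principle.
  set g : ℂ → ℂ := fun w => F w * exp (I * Real.pi * w) with hg
  have hper : ∀ w, g (w + 2) = g w := fun w => by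
    simp only [hg, hF, perExt_add_two]
    rw [show I * (Real.pi : ℂ) * (w + 2) = I * Real.pi * w + 2 * Real.pi * I by ring, exp_add,
      exp_two_pi_mul_I, mul_one]
  have hgc : ContinuousOn g closedLowerPlane := hFc.mul (by fun_prop)
  have hgd : DifferentiableOn ℂ g lowerPlane := hFd.mul (by fun_prop)
  -- In the variable q = exp(-iπw), F is holomorphic near q = 0 and vanishes there, so F = O(|q|),
  -- which the factor in g exactly compensates. The remaining range of heights is compact modulo the
  -- period.
  have hdecay : ∃ C, ∀ w : ℂ, w.im ≤ -1 → ‖g w‖ ≤ C := by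
    set k : ℂ → ℂ := fun z => F (-z) with hk
    have hkper : Function.Periodic k (2 : ℝ) := fun z => by
      have := perExt_add_two f (-(z + 2))
      simp only [hk, hF]
      push_cast
      rw [← this]
      ring_nf
    have hIm : ∀ R : ℝ, ∀ᶠ z in comap Complex.im atTop, R < z.im := fun R =>
      tendsto_comap.eventually (eventually_gt_atTop R)
    have h1 := Function.Periodic.exp_decay_of_zero_at_inf two_pos hkper (by
      filter_upwards [hIm 0] with z hz
      have : -z ∈ lowerPlane := by
        show (-z).im < 0
        simpa using hz
      exact DifferentiableAt.comp (g := F) (f := fun w : ℂ => -w) z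
          (hFd.differentiableAt (isOpen_lowerPlane.mem_nhds this)) (by fun_prop)) (by
      rw [Filter.ZeroAtFilter, Metric.tendsto_nhds]
      intro ε hε
      obtain ⟨R, hR⟩ := h0 ε hε
      filter_upwards [hIm (max 0 (-R))] with z hz
      have hz1 : 0 < z.im := (le_max_left _ _).trans_lt hz
      have hz2 : -R < z.im := (le_max_right _ _).trans_lt hz
      rw [dist_zero_right]
      refine hR _ (sub_stripIndex_mem (w := -z) ?_) ?_
      · show (-z).im ≤ 0
        simpa using hz1.le
      · simp
        linarith)
    obtain ⟨C, hC⟩ := h1.bound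
    obtain ⟨R, hR⟩ := (mem_comap.1 hC)
    obtain ⟨hR1, hR2⟩ := hR
    obtain ⟨R0, hR0⟩ := mem_atTop_sets.1 hR1
    have hdeep : ∀ w : ℂ, w.im ≤ -R0 → ‖g w‖ ≤ C := fun w hw => by
      have h2 : -w ∈ {x | ‖k x‖ ≤ C * ‖Real.exp (-2 * Real.pi * x.im / 2)‖} := by
        refine hR2 (hR0 _ ?_)
        show R0 ≤ (-w).im
        simp
        linarith
      have h3 : ‖F w‖ ≤ C * Real.exp (Real.pi * w.im) := by
        have h4 : ‖k (-w)‖ ≤ C * ‖Real.exp (-2 * Real.pi * (-w).im / 2)‖ := h2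
        rw [Real.norm_of_nonneg (Real.exp_pos _).le] at h4
        simp only [hk, neg_neg, neg_im] at h4
        rwa [show -2 * Real.pi * -w.im / 2 = Real.pi * w.im by ring] at h4
      rw [hg]
      simp only
      rw [norm_mul, norm_exp_I_pi]
      calc ‖F w‖ * Real.exp (-(Real.pi * w.im))
          ≤ C * Real.exp (Real.pi * w.im) * Real.exp (-(Real.pi * w.im)) := by gcongr
        _ = C := by rw [mul_assoc, ← Real.exp_add]; simp
    have hcomp : IsCompact (Icc (-1 : ℝ) 1 ×ℂ Icc (-R0) 0) := isCompact_Icc.reProdIm isCompact_Icc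
    obtain ⟨C2, hC2⟩ := hcomp.exists_bound_of_continuousOn (hgc.mono fun w hw =>
      show w.im ≤ 0 from (mem_reProdIm.1 hw).2.2)
    refine ⟨max C C2, fun w hw => ?_⟩
    rcases le_total w.im (-R0) with h | h
    · exact (hdeep w h).trans (le_max_left _ _)
    · refine le_trans (le_of_eq ?_) ((hC2 (w - 2 * stripIndex w) ?_).trans (le_max_right _ _))
      · have e := add_int_period (F := g) (c := 0) (fun w _ => by rw [hper, add_zero])
          (stripIndex w) (w := w - 2 * stripIndex w) (by
            show (w - 2 * stripIndex w).im < 0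
            simp
            linarith)
        rw [sub_add_cancel, mul_zero, add_zero] at e
        rw [e]
      · have h2 := sub_stripIndex_mem (w := w) (show w.im ≤ 0 by linarith)
        refine mem_reProdIm.2 ⟨abs_le.1 h2.1, ?_, h2.2⟩
        simpa using h
  obtain ⟨C, hC⟩ := hdecay
  have hrep := poisson_of_continuousOn hgc hgd hper hC hw0
  have hFw : F w = f w := perExt_eq_self_of_sidesMatch hm hw
  have hbound : ‖g w‖ ≤ M := by
    rw [hrep]
    have h1 : ∀ s ∈ Icc (-1 : ℝ) 1, ‖(stripKernel (w - s) : ℂ) * g s‖ ≤ M * stripKernel (w - s) := by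
      intro s hs
      have hs' : (s : ℂ) ∈ closedHalfStrip := ⟨by simpa [abs_le] using hs, by simp⟩
      have h2 : ‖g s‖ ≤ M := by
        simp only [hg]
        rw [norm_mul, norm_exp_I_pi, hF, perExt_eq_self_of_sidesMatch hm hs']
        simpa using hM s hs
      have h3 := stripKernel_nonneg (sub_ofReal_mem_lowerPlane hw0 s)
      rw [norm_mul, norm_real, Real.norm_of_nonneg h3, mul_comm]
      exact mul_le_mul_of_nonneg_right h2 h3
    refine (intervalIntegral.norm_integral_le_integral_norm (by norm_num)).trans ?_
    have hcont : Continuous fun s : ℝ => (stripKernel (w - s) : ℂ) * g s :=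
      (continuous_ofReal.comp (continuous_stripKernel_sub hw0)).mul (StripData.continuous_real hgc)
    refine (intervalIntegral.integral_mono_on (μ := volume) (by norm_num)
      (hcont.norm.intervalIntegrable _ _)
      (((continuous_stripKernel_sub hw0).const_mul M).intervalIntegrable _ _) h1).trans ?_
    rw [intervalIntegral.integral_const_mul, integral_stripKernel hw0, mul_one]
  simp only [hg] at hbound
  rw [norm_mul, norm_exp_I_pi, hFw, Real.exp_neg] at hbound
  rwa [← div_eq_mul_inv, div_le_iff₀ (Real.exp_pos _)] at hbound

end StripWave


/-! ### Persistence of the fluid region for short times -/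

theorem IsPreconnected.subset_of_disjoint_frontier {X : Type*} [TopologicalSpace X] {N U : Set X}
    (hN : IsPreconnected N) (hU : IsOpen U) (hne : (N ∩ U).Nonempty)
    (hd : Disjoint N (frontier U)) : N ⊆ U := by
  refine hN.subset_left_of_subset_union hU (isClosed_closure (s := U)).isOpen_compl
    (disjoint_compl_right_iff_subset.2 subset_closure) (fun x hx => ?_) hne
  by_cases h : x ∈ U
  · exact Or.inl h
  · refine Or.inr fun hc => disjoint_left.1 hd hx ?_
    rw [hU.frontier_eq]
    exact ⟨hc, h⟩

namespace CornerWave.WaterWave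

variable {T : ℝ} (W : WaterWave T) {t : ℝ} (ht : t ∈ Icc 0 T)

include ht

theorem isCompact_surface : IsCompact (W.z t '' I) :=
  isCompact_Icc.image_of_continuousOn
    (W.z_cont.comp (f := fun α => (t, α)) (by fun_prop) fun _ hα => ⟨ht, hα⟩)

theorem continuousOn_z : ContinuousOn (W.z t) I :=
  W.z_cont.comp (f := fun α => (t, α)) (by fun_prop) fun _ hα => ⟨ht, hα⟩

theorem abs_re_lt {w : ℂ} (hw : w ∈ W.Ω t) : |w.re| < 1 := by
  obtain ⟨c, hc⟩ := W.Ω_bdd t ht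
  exact (hc w hw).1

theorem abs_re_le {w : ℂ} (hw : w ∈ closure (W.Ω t)) : |w.re| ≤ 1 := by
  have : closure (W.Ω t) ⊆ {w : ℂ | |w.re| ≤ 1} :=
    closure_minimal (fun w hw => (W.abs_re_lt ht hw).le)
      (isClosed_le Complex.continuous_re.abs continuous_const)
  exact this hw

theorem mem_frontier {w : ℂ} (hw : w ∈ closure (W.Ω t)) (h : w ∉ W.Ω t) :
    w ∈ W.z t '' I ∨ ((w.re = -1 ∧ w.im ≤ (W.z t (-1)).im) ∨
      (w.re = 1 ∧ w.im ≤ (W.z t 1).im)) := by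
  have : w ∈ frontier (W.Ω t) := by
    rw [(W.Ω_open t ht).frontier_eq]
    exact ⟨hw, h⟩
  rwa [W.Ω_frontier t ht] at this

theorem frontier_subset_closure : frontier (W.Ω t) ⊆ closure (W.Ω t) := by
  rw [(W.Ω_open t ht).frontier_eq]
  exact sdiff_subset

theorem z_mem_closure {α : ℝ} (hα : α ∈ I) : W.z t α ∈ closure (W.Ω t) := by
  apply W.frontier_subset_closure ht
  rw [W.Ω_frontier t ht]
  exact Or.inl ⟨α, hα, rfl⟩

theorem z_notMem {α : ℝ} (hα : α ∈ I) : W.z t α ∉ W.Ω t := by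
  have : W.z t α ∈ frontier (W.Ω t) := by
    rw [W.Ω_frontier t ht]
    exact Or.inl ⟨α, hα, rfl⟩
  rw [(W.Ω_open t ht).frontier_eq] at this
  exact this.2

theorem eq_corner_of_abs_re {α : ℝ} (hα : α ∈ I) (h : |(W.z t α).re| = 1) : α = -1 ∨ α = 1 := by
  by_contra hc
  push Not at hc
  have := W.z_mid t ht α ⟨lt_of_le_of_ne hα.1 (Ne.symm hc.1), lt_of_le_of_ne hα.2 hc.2⟩
  linarith

/-- The fluid region at any time lies above every level which the surface stays above. -/
theorem deep_subset {m : ℝ} (hm : ∀ α ∈ I, m ≤ (W.z t α).im) :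
    {w : ℂ | |w.re| < 1 ∧ w.im < m} ⊆ W.Ω t := by
  have hconv : Convex ℝ {w : ℂ | |w.re| < 1 ∧ w.im < m} := by
    have : {w : ℂ | |w.re| < 1 ∧ w.im < m} =
        {w : ℂ | -1 < w.re} ∩ {w : ℂ | w.re < 1} ∩ {w : ℂ | w.im < m} := by
      ext w
      simp only [abs_lt, mem_inter_iff, mem_ofPred_eq]
    rw [this]
    exact ((convex_halfSpace_re_gt _).inter (convex_halfSpace_re_lt _)).inter
      (convex_halfSpace_im_lt _)
  refine hconv.isPreconnected.subset_of_disjoint_frontier (W.Ω_open t ht) ?_ ?_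
  · obtain ⟨c, hc⟩ := W.Ω_deep t ht
    refine ⟨⟨0, min c m - 1⟩, ⟨by simp, ?_⟩, hc _ (by simp) ?_⟩
    · show min c m - 1 < m
      linarith [min_le_right c m]
    · show min c m - 1 < c
      linarith [min_le_left c m]
  · rw [disjoint_left]
    rintro w ⟨h1, h2⟩ h3
    rw [W.Ω_frontier t ht] at h3
    rcases h3 with ⟨α, hα, rfl⟩ | ⟨h, -⟩ | ⟨h, -⟩
    · linarith [hm α hα]
    · rw [h] at h1; simp at h1
    · rw [h] at h1; simp at h1

theorem deep_subset_closure {m : ℝ} (hm : ∀ α ∈ I, m ≤ (W.z t α).im) {w : ℂ} (h1 : |w.re| ≤ 1)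
    (h2 : w.im < m) : w ∈ closure (W.Ω t) := by
  have h0 : w - ((w.im + (m - w.im) / 2 : ℝ) : ℂ) * Complex.I ∈ closedHalfStrip :=
    ⟨by simpa using h1, by simp; linarith⟩
  have := map_mem_closure (f := fun ζ : ℂ => ζ + ((w.im + (m - w.im) / 2 : ℝ) : ℂ) * Complex.I)
    (t := W.Ω t) (by fun_prop) (StripWave.closure_openHalfStrip_inter h0) fun ζ hζ =>
      W.deep_subset ht hm ⟨by simpa using hζ.1, by
        have := hζ.2
        simp only [Complex.add_im, Complex.mul_im, Complex.ofReal_re, Complex.I_im, mul_one,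
          Complex.ofReal_im, Complex.I_re, mul_zero, add_zero]
        linarith⟩
  simpa using this

omit ht in
theorem exists_depth : ∃ m : ℝ, ∀ s ∈ Icc 0 T, ∀ α ∈ I, m ≤ (W.z s α).im := by
  have hc : ContinuousOn (fun p : ℝ × ℝ => (W.z p.1 p.2).im) (Icc 0 T ×ˢ I) :=
    Complex.continuous_im.comp_continuousOn W.z_cont
  obtain ⟨m, hm⟩ := ((isCompact_Icc.prod isCompact_Icc).image_of_continuousOn hc).bddBelow
  exact ⟨m, fun s hs α hα => hm ⟨(s, α), ⟨hs, hα⟩, rfl⟩⟩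

/-- The surface does not reach a given point off the surface for a short time, so that a
neighbourhood of it (between the walls) stays in the fluid. -/
theorem exists_ball_subset {w₀ : ℂ} (hw : w₀ ∈ closure (W.Ω t)) (hz : w₀ ∉ W.z t '' I) :
    ∃ r > 0, ∃ δ > 0, ∀ s ∈ Icc 0 T, |s - t| < δ →
      Metric.ball w₀ r ∩ {w : ℂ | |w.re| < 1} ⊆ W.Ω s := by
  obtain ⟨r, hr, hrz⟩ := Metric.isOpen_iff.1
    (W.isCompact_surface ht).isClosed.isOpen_compl w₀ hz
  set r' := r / 2 with hr'
  have hr'0 : 0 < r' := by positivity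
  obtain ⟨p, hpΩ, hp⟩ := Metric.mem_closure_iff.1 hw r' hr'0
  obtain ⟨m, hm⟩ := W.exists_depth
  set q : ℂ := ⟨0, m - 1⟩ with hq
  have hqs : ∀ s ∈ Icc 0 T, q ∈ W.Ω s := fun s hs =>
    W.deep_subset hs (hm s hs) ⟨by simp [hq], by simp [hq]⟩
  obtain ⟨γ, hγ⟩ := ((W.Ω_open t ht).isConnected_iff_isPathConnected.1 (W.Ω_conn t ht)).joinedIn
    p hpΩ q (hqs t ht)
  -- The path leads to a point q so deep that it lies in the fluid at all times. For s near t the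
  -- surface misses the ball and the path, so the part of the ball between the walls, joined to q,
  -- is a connected set that avoids the boundary of the fluid at time s.
  have hA : IsCompact (Metric.closedBall w₀ r' ∪ range γ) :=
    (isCompact_closedBall _ _).union (isCompact_range γ.continuous)
  have hAz : Metric.closedBall w₀ r' ∪ range γ ⊆ (W.z t '' I)ᶜ := by
    refine union_subset ((Metric.closedBall_subset_ball (by linarith)).trans hrz) ?_
    rintro _ ⟨u, rfl⟩ ⟨α, hα, h⟩
    exact W.z_notMem ht hα (h ▸ hγ u)
  obtain ⟨d, hd, hdz⟩ := hA.exists_cthickening_subset_open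
    (W.isCompact_surface ht).isClosed.isOpen_compl hAz
  obtain ⟨δ, hδ, hδu⟩ := Metric.uniformContinuousOn_iff.1
    ((isCompact_Icc.prod isCompact_Icc).uniformContinuousOn_of_continuous W.z_cont) d hd
  refine ⟨r', hr'0, δ, hδ, fun s hs hst => ?_⟩
  have hconv : Convex ℝ (Metric.ball w₀ r' ∩ {w : ℂ | |w.re| < 1}) := by
    have : {w : ℂ | |w.re| < 1} = {w : ℂ | -1 < w.re} ∩ {w : ℂ | w.re < 1} := by
      ext w
      simp only [abs_lt, mem_inter_iff, mem_ofPred_eq]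
    rw [this]
    exact (convex_ball _ _).inter ((convex_halfSpace_re_gt _).inter (convex_halfSpace_re_lt _))
  have hpN : p ∈ Metric.ball w₀ r' ∩ {w : ℂ | |w.re| < 1} :=
    ⟨by rwa [Metric.mem_ball'], W.abs_re_lt ht hpΩ⟩
  have hpre : IsPreconnected ((Metric.ball w₀ r' ∩ {w : ℂ | |w.re| < 1}) ∪ range γ) :=
    hconv.isPreconnected.union p hpN ⟨0, γ.source⟩ (isPreconnected_range γ.continuous)
  refine subset_union_left.trans (hpre.subset_of_disjoint_frontier (W.Ω_open s hs)
    ⟨q, Or.inr ⟨1, γ.target⟩, hqs s hs⟩ ?_)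
  rw [disjoint_left]
  intro w hwN hwF
  have hre : |w.re| < 1 := by
    rcases hwN with h | ⟨u, rfl⟩
    · exact h.2
    · exact W.abs_re_lt ht (hγ u)
  rw [W.Ω_frontier s hs] at hwF
  rcases hwF with ⟨α, hα, rfl⟩ | ⟨h, -⟩ | ⟨h, -⟩
  · have hdist := hδu (s, α) ⟨hs, hα⟩ (t, α) ⟨ht, hα⟩ (by
      simpa [Prod.dist_eq, Real.dist_eq] using hst)
    refine hdz (Metric.mem_cthickening_of_dist_le (W.z t α) (W.z s α) d _ ?_ ?_) ⟨α, hα, rfl⟩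
    · rcases hwN with h | h
      · exact Or.inl (Metric.ball_subset_closedBall h.1)
      · exact Or.inr h
    · rw [dist_comm]
      exact hdist.le
  · rw [h] at hre; simp at hre
  · rw [h] at hre; simp at hre

end CornerWave.WaterWave

/-! ### The acceleration: walls, holomorphy, symmetry -/

namespace CornerWave.WaterWave

variable {T : ℝ} (W : WaterWave T) {t : ℝ} (ht : t ∈ Icc 0 T)

theorem _root_.CornerWave.continuous_refl : Continuous refl :=
  Complex.continuous_conj.neg

theorem _root_.CornerWave.refl_re (w : ℂ) : (refl w).re = -w.re := by simp [refl]

theorem _root_.CornerWave.refl_im (w : ℂ) : (refl w).im = w.im := by simp [refl]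

include ht

theorem refl_mem_closure {w : ℂ} (hw : w ∈ closure (W.Ω t)) : refl w ∈ closure (W.Ω t) :=
  map_mem_closure continuous_refl hw (W.Ω_symm t ht)

theorem continuousOn_v : ContinuousOn (W.v t) (closure (W.Ω t)) :=
  W.v_cont.comp (f := fun w => (t, w)) (by fun_prop) fun _ hw => ⟨ht, hw⟩

theorem continuousOn_vt : ContinuousOn (W.vt t) (closure (W.Ω t)) :=
  W.vt_cont.comp (f := fun w => (t, w)) (by fun_prop) fun _ hw => ⟨ht, hw⟩

/-- If a bound for `v_t` holds on a set of the fluid which persists for a while, then it bounds the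
increments of `v`, also on the closure of the set. -/
theorem norm_increment_le {N : Set ℂ} {J : Set ℝ} (hJ : Convex ℝ J) (hJT : J ⊆ Icc 0 T)
    (htJ : t ∈ J) (hN : ∀ s ∈ J, N ⊆ W.Ω s) {e : ℂ → ℂ} (he : ContinuousOn e (closure N)) {M : ℝ}
    (hM : ∀ s ∈ J, ∀ w ∈ N, ‖W.vt s w - e w‖ ≤ M) {s : ℝ} (hs : s ∈ J) {w : ℂ}
    (hw : w ∈ closure N) : ‖W.v s w - W.v t w - (s - t) * e w‖ ≤ M * |s - t| := by
  have hcl : ∀ s ∈ J, closure N ⊆ closure (W.Ω s) := fun s hs => closure_mono (hN s hs)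
  refine le_on_closure (s := N) (f := fun w => ‖W.v s w - W.v t w - (s - t) * e w‖)
    (g := fun _ => M * |s - t|) (fun w hw => ?_) ?_ continuousOn_const hw
  · have hd : ∀ σ ∈ J, HasDerivWithinAt (fun σ : ℝ => W.v σ w - (σ : ℂ) * e w)
        (W.vt σ w - e w) J σ := by
      intro σ hσ
      have h1 := (W.v_deriv_time σ (hJT hσ) w (hN σ hσ hw)).mono hJT
      have h2 : HasDerivWithinAt (fun σ : ℝ => (σ : ℂ) * e w) (1 * e w) J σ :=
        (Complex.ofRealCLM.hasDerivAt (x := σ)).hasDerivWithinAt.mul_const (e w)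
      have := h1.sub h2
      rw [one_mul] at this
      exact this
    have := hJ.norm_image_sub_le_of_norm_hasDerivWithin_le hd (fun σ hσ => hM σ hσ w hw) htJ hs
    rw [Real.norm_eq_abs] at this
    rwa [show W.v s w - W.v t w - (s - t) * e w =
      W.v s w - s * e w - (W.v t w - t * e w) by ring]
  · have h1 := (W.continuousOn_v (hJT hs)).mono (hcl s hs)
    have h2 := (W.continuousOn_v ht).mono (hcl t htJ)
    fun_prop

/-- `v` is differentiable in time, uniformly near a point off the surface. -/
theorem exists_increment_le {w₀ : ℂ} (hw : w₀ ∈ closure (W.Ω t)) (hz : w₀ ∉ W.z t '' I)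
    {ε : ℝ} (hε : 0 < ε) :
    ∃ r > 0, ∃ δ > 0, ∀ s ∈ Icc 0 T, |s - t| < δ → ∀ w ∈ Metric.ball w₀ r, w ∈ closure (W.Ω t) →
      w ∈ closure (W.Ω s) ∧ ‖W.v s w - W.v t w - (s - t) * W.vt t w‖ ≤ ε * |s - t| := by
  obtain ⟨r₁, hr₁, δ₁, hδ₁, hN⟩ := W.exists_ball_subset ht hw hz
  obtain ⟨η, hη, hη'⟩ := Metric.continuousWithinAt_iff.1 (W.vt_cont (t, w₀) ⟨ht, hw⟩) (ε / 2)
    (half_pos hε)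
  set r := min r₁ η with hr
  set δ := min δ₁ η with hδ
  have hr0 : 0 < r := lt_min hr₁ hη
  have hδ0 : 0 < δ := lt_min hδ₁ hη
  set N : Set ℂ := Metric.ball w₀ r ∩ {w : ℂ | |w.re| < 1} with hNdef
  set J : Set ℝ := Icc 0 T ∩ Metric.ball t δ with hJdef
  have htJ : t ∈ J := ⟨ht, Metric.mem_ball_self hδ0⟩
  have hNJ : ∀ s ∈ J, N ⊆ W.Ω s := fun s hs w hw =>
    hN s hs.1 ((by simpa [Real.dist_eq] using hs.2 : |s - t| < δ).trans_le (min_le_left _ _))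
      ⟨Metric.ball_subset_ball (min_le_left _ _) hw.1, hw.2⟩
  have hvt : ∀ s ∈ J, ∀ w ∈ N, ‖W.vt s w - W.vt t w₀‖ ≤ ε / 2 := by
    intro s hs w hw
    rw [← dist_eq_norm]
    refine (hη' (x := (s, w)) ⟨hs.1, subset_closure (hNJ s hs hw)⟩ ?_).le
    rw [Prod.dist_eq]
    exact max_lt ((Metric.mem_ball.1 hs.2).trans_le (min_le_right _ _))
      ((Metric.mem_ball.1 hw.1).trans_le (min_le_right _ _))
  refine ⟨r, hr0, δ, hδ0, fun s hs hst w hwr hwc => ?_⟩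
  have hsJ : s ∈ J := ⟨hs, by simpa [Real.dist_eq] using hst⟩
  have hwN : w ∈ closure N := by
    have : w ∈ closure (Metric.ball w₀ r ∩ W.Ω t) := Metric.isOpen_ball.inter_closure ⟨hwr, hwc⟩
    exact closure_mono (inter_subset_inter_right _ fun w hw => W.abs_re_lt ht hw) this
  refine ⟨closure_mono (hNJ s hsJ) hwN, ?_⟩
  refine W.norm_increment_le ht ((convex_Icc _ _).inter (convex_ball _ _)) inter_subset_left htJ hNJ
    ((W.continuousOn_vt ht).mono (closure_mono (hNJ t htJ))) (fun σ hσ ζ hζ => ?_) hsJ hwN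
  have h1 := hvt σ hσ ζ hζ
  have h2 := hvt t htJ ζ hζ
  calc ‖W.vt σ ζ - W.vt t ζ‖ = ‖(W.vt σ ζ - W.vt t w₀) - (W.vt t ζ - W.vt t w₀)‖ := by
        congr 1; ring
    _ ≤ ε := (norm_sub_le _ _).trans (by linarith)

omit ht in
include W in
theorem nhdsWithin_Icc_neBot {t : ℝ} (ht : t ∈ Icc 0 T) : (𝓝[Icc 0 T \ {t}] t).NeBot :=
  accPt_principal_iff_nhdsWithin.1 ((uniqueDiffOn_Icc W.T_pos t ht).accPt)

omit ht in
include W in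
theorem exists_ne_near {t : ℝ} (ht : t ∈ Icc 0 T) {δ : ℝ} (hδ : 0 < δ) :
    ∃ s ∈ Icc 0 T, |s - t| < δ ∧ s ≠ t := by
  have := W.nhdsWithin_Icc_neBot ht
  have h : ∀ᶠ s in 𝓝[Icc 0 T \ {t}] t, s ∈ Metric.ball t δ :=
    mem_nhdsWithin_of_mem_nhds (Metric.ball_mem_nhds t hδ)
  obtain ⟨s, h1, h2⟩ := (h.and self_mem_nhdsWithin).exists
  exact ⟨s, h2.1, by simpa [Real.dist_eq] using h1, h2.2⟩

/-- `v_t` is tangent to the walls. -/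
theorem vt_wall_of_notMem {w : ℂ} (hw : w ∈ closure (W.Ω t)) (hz : w ∉ W.z t '' I)
    (h : |w.re| = 1) : (W.vt t w).re = 0 := by
  by_contra hne
  obtain ⟨r, hr, δ, hδ, key⟩ := W.exists_increment_le ht hw hz (half_pos (abs_pos.2 hne))
  obtain ⟨s, hs, hst, hne'⟩ := W.exists_ne_near ht hδ
  obtain ⟨hwc, hb⟩ := key s hs hst w (Metric.mem_ball_self hr) hw
  -- The velocity is tangent to the wall at both times, so the increment has no horizontal
  -- component, and the approximation error is bounded below by |s - t| times the horizontal
  -- component of v_t.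
  have h1 := (Complex.abs_re_le_norm _).trans hb
  have h2 : (W.v s w - W.v t w - (s - t) * W.vt t w).re = -((s - t) * (W.vt t w).re) := by
    have := W.wall s hs w hwc h
    have := W.wall t ht w hw h
    simp only [Complex.sub_re, Complex.mul_re, Complex.ofReal_re, Complex.sub_im,
      Complex.ofReal_im]
    linarith
  rw [h2, abs_neg, abs_mul] at h1
  have h3 : 0 < |s - t| := abs_pos.2 (sub_ne_zero.2 hne')
  have h4 := abs_pos.2 hne
  nlinarith

/-- The two equations div v = 0 and curl v = 0 are the Cauchy–Riemann equations of the conjugate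
velocity, whose derivative is therefore complex linear. -/
theorem Dv_apply {w : ℂ} (hw : w ∈ W.Ω t) (u : ℂ) :
    (starRingEnd ℂ) (W.Dv t w u) = (starRingEnd ℂ) (W.Dv t w 1) * u := by
  have hI : W.Dv t w Complex.I = -Complex.I * W.Dv t w 1 := by
    have a := W.div_free t ht w hw
    have b := W.curl_free t ht w hw
    apply Complex.ext
    · simp; linarith
    · simp; linarith
  have hu : W.Dv t w u = u.re * W.Dv t w 1 + u.im * (-Complex.I * W.Dv t w 1) := by
    have h : u = u.re • (1 : ℂ) + u.im • Complex.I := by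
      apply Complex.ext <;> simp
    conv_lhs => rw [h, map_add, map_smul, map_smul, hI]
    simp
  rw [hu]
  apply Complex.ext
  · simp
    ring
  · simp
    ring

theorem hasDerivAt_conj_v {w : ℂ} (hw : w ∈ W.Ω t) :
    HasDerivAt (fun w => (starRingEnd ℂ) (W.v t w)) ((starRingEnd ℂ) (W.Dv t w 1)) w := by
  have h1 := W.v_deriv_space t ht w hw
  have h2 : HasFDerivAt (fun w => (starRingEnd ℂ) (W.v t w))
      (Complex.conjCLE.toContinuousLinearMap.comp (W.Dv t w)) w :=
    (Complex.conjCLE.toContinuousLinearMap.hasFDerivAt).comp w h1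
  rw [hasDerivAt_iff_hasFDerivAt]
  refine hasFDerivAt_of_restrictScalars ℝ h2 ?_
  ext1 u
  simp [W.Dv_apply ht hw u, mul_comm]

theorem differentiableOn_conj_v :
    DifferentiableOn ℂ (fun w => (starRingEnd ℂ) (W.v t w)) (W.Ω t) := fun _ hw =>
  (W.hasDerivAt_conj_v ht hw).differentiableAt.differentiableWithinAt

/-- The conjugate of v_t is a locally uniform limit of difference quotients in time, each of them
holomorphic since the neighbourhood stays in the fluid. No space derivative of v_t is assumed. -/
theorem differentiableOn_conj_vt :
    DifferentiableOn ℂ (fun w => (starRingEnd ℂ) (W.vt t w)) (W.Ω t) := by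
  have := W.nhdsWithin_Icc_neBot ht
  intro w₀ hw₀
  have hz : w₀ ∉ W.z t '' I := by
    rintro ⟨α, hα, rfl⟩
    exact W.z_notMem ht hα hw₀
  obtain ⟨r₀, hr₀, δ₀, hδ₀, hN⟩ := W.exists_ball_subset ht (subset_closure hw₀) hz
  obtain ⟨r₁, hr₁, hΩ⟩ := Metric.isOpen_iff.1 (W.Ω_open t ht) w₀ hw₀
  set U := Metric.ball w₀ (min r₀ r₁) with hU
  have hUΩ : U ⊆ W.Ω t := (Metric.ball_subset_ball (min_le_right _ _)).trans hΩ
  have hlim : TendstoLocallyUniformlyOn (fun (s : ℝ) w =>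
      (starRingEnd ℂ) (W.v s w - W.v t w) * ((s - t : ℝ) : ℂ)⁻¹)
      (fun w => (starRingEnd ℂ) (W.vt t w)) (𝓝[Icc 0 T \ {t}] t) U := by
    rw [Metric.tendstoLocallyUniformlyOn_iff]
    intro ε hε w hw
    have hwz : w ∉ W.z t '' I := by
      rintro ⟨α, hα, rfl⟩
      exact W.z_notMem ht hα (hUΩ hw)
    obtain ⟨r, hr, δ, hδ, key⟩ := W.exists_increment_le ht (subset_closure (hUΩ hw)) hwz
      (half_pos hε)
    refine ⟨Metric.ball w r ∩ U, inter_mem (mem_nhdsWithin_of_mem_nhds (Metric.ball_mem_nhds w hr))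
      self_mem_nhdsWithin, ?_⟩
    have h : ∀ᶠ s in 𝓝[Icc 0 T \ {t}] t, s ∈ Metric.ball t δ :=
      mem_nhdsWithin_of_mem_nhds (Metric.ball_mem_nhds t hδ)
    filter_upwards [h, self_mem_nhdsWithin] with s h1 h2 ζ hζ
    have hb := (key s h2.1 (by simpa [Real.dist_eq] using h1) ζ hζ.1
      (subset_closure (hUΩ hζ.2))).2
    have h3 : 0 < |s - t| := abs_pos.2 (sub_ne_zero.2 h2.2)
    have hne : ((s - t : ℝ) : ℂ) ≠ 0 := by exact_mod_cast sub_ne_zero.2 h2.2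
    have e : (starRingEnd ℂ) (W.vt t ζ) - (starRingEnd ℂ) (W.v s ζ - W.v t ζ) *
        ((s - t : ℝ) : ℂ)⁻¹ = -((starRingEnd ℂ) (W.v s ζ - W.v t ζ - (s - t) * W.vt t ζ) *
          ((s - t : ℝ) : ℂ)⁻¹) := by
      field_simp
      simp
      ring
    rw [dist_eq_norm, e, norm_neg, norm_mul, RCLike.norm_conj, norm_inv, Complex.norm_real,
      Real.norm_eq_abs, ← div_eq_mul_inv, div_lt_iff₀ h3]
    nlinarith
  have hd := hlim.differentiableOn ?_ Metric.isOpen_ball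
  · exact (hd.differentiableAt (Metric.isOpen_ball.mem_nhds
      (Metric.mem_ball_self (lt_min hr₀ hr₁)))).differentiableWithinAt
  · have h : ∀ᶠ s in 𝓝[Icc 0 T \ {t}] t, s ∈ Metric.ball t δ₀ :=
      mem_nhdsWithin_of_mem_nhds (Metric.ball_mem_nhds t hδ₀)
    filter_upwards [h, self_mem_nhdsWithin] with s h1 h2
    have hsub : U ⊆ W.Ω s := fun w hw => hN s h2.1 (by simpa [Real.dist_eq] using h1)
      ⟨Metric.ball_subset_ball (min_le_left _ _) hw, W.abs_re_lt ht (hUΩ hw)⟩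
    have h3 := ((W.differentiableOn_conj_v h2.1).mono hsub).sub
      ((W.differentiableOn_conj_v ht).mono hUΩ)
    refine (h3.mul_const (((s - t : ℝ) : ℂ)⁻¹)).congr fun w _ => ?_
    simp

/-- Differentiate the symmetry of v in time at interior points, then pass to the closure by
continuity. -/
theorem vt_symm {w : ℂ} (hw : w ∈ closure (W.Ω t)) : W.vt t (refl w) = refl (W.vt t w) := by
  have hmaps : MapsTo refl (closure (W.Ω t)) (closure (W.Ω t)) := fun w => W.refl_mem_closure ht
  refine Set.EqOn.of_subset_closure (s := W.Ω t) (f := fun w => W.vt t (refl w))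
    (g := fun w => refl (W.vt t w)) (fun w hw => ?_)
    ((W.continuousOn_vt ht).comp continuous_refl.continuousOn hmaps)
    (continuous_refl.comp_continuousOn (W.continuousOn_vt ht)) subset_closure Subset.rfl hw
  have hz : w ∉ W.z t '' I := by
    rintro ⟨α, hα, rfl⟩
    exact W.z_notMem ht hα hw
  obtain ⟨r, hr, δ, hδ, hN⟩ := W.exists_ball_subset ht (subset_closure hw) hz
  have h1 := W.v_deriv_time t ht _ (W.Ω_symm t ht w hw)
  have h2 : HasDerivWithinAt (fun s => refl (W.v s w)) (refl (W.vt t w)) (Icc 0 T) t := by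
    have := (Complex.conjCLE.toContinuousLinearMap.hasFDerivAt.comp_hasDerivWithinAt t
      (W.v_deriv_time t ht w hw)).neg
    exact this
  refine (uniqueDiffOn_Icc W.T_pos t ht).eq_deriv _ h1 (h2.congr_of_eventuallyEq ?_ ?_)
  · have h : ∀ᶠ s in 𝓝[Icc 0 T] t, s ∈ Metric.ball t δ :=
      mem_nhdsWithin_of_mem_nhds (Metric.ball_mem_nhds t hδ)
    filter_upwards [h, self_mem_nhdsWithin] with s h1 h2
    exact W.v_symm s h2 w (subset_closure (hN s h2 (by simpa [Real.dist_eq] using h1)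
      ⟨Metric.mem_ball_self hr, W.abs_re_lt ht hw⟩))
  · exact W.v_symm t ht w (subset_closure hw)

end CornerWave.WaterWave

/-! ### Decay of the acceleration and the Euler equation on the boundary -/

namespace CornerWave.WaterWave

variable {T : ℝ} (W : WaterWave T) {t : ℝ} (ht : t ∈ Icc 0 T)

theorem _root_.CornerWave.refl_eq_self_of_re {w : ℂ} (h : w.re = 0) : refl w = w := by
  apply Complex.ext <;> simp [refl, h]

theorem _root_.CornerWave.refl_one_add (y : ℝ) :
    refl (1 + y * Complex.I) = -1 + y * Complex.I := by
  apply Complex.ext <;> simp [refl]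

include ht

theorem decay_closure {ε : ℝ} (hε : 0 < ε) :
    ∃ R : ℝ, ∀ w ∈ closure (W.Ω t), w.im < R → ‖W.v t w‖ ≤ ε := by
  obtain ⟨R, hR⟩ := W.decay t ht ε hε
  refine ⟨R, fun w hw hwR => ?_⟩
  have hopen : IsOpen {w : ℂ | w.im < R} := isOpen_lt Complex.continuous_im continuous_const
  have hcl : w ∈ closure ({w : ℂ | w.im < R} ∩ W.Ω t) := hopen.inter_closure ⟨hwR, hw⟩
  exact le_on_closure (f := fun w => ‖W.v t w‖) (g := fun _ => ε)
    (fun w hw => (hR w hw.2 hw.1).le)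
    ((W.continuousOn_v ht).norm.mono (closure_mono inter_subset_right)) continuousOn_const hcl

/-- The acceleration decays at infinity. -/
theorem exists_norm_vt_le : ∃ m M : ℝ, (∀ s ∈ Icc 0 T, ∀ α ∈ I, m ≤ (W.z s α).im) ∧
    ∀ w : ℂ, |w.re| ≤ 1 → w.im < m - 1 →
      ‖W.vt t w‖ ≤ M * Real.exp (Real.pi * (w.im - (m - 1))) := by
  -- Below the level m - 1 the fluid region is a half strip at every time, so velocities at
  -- different times are compared on one fixed domain.
  obtain ⟨m, hm⟩ := W.exists_depth
  set c : ℂ := ((m - 1 : ℝ) : ℂ) * Complex.I with hc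
  have hcre : ∀ w : ℂ, (w + c).re = w.re := fun w => by simp [hc]
  have hcim : ∀ w : ℂ, (w + c).im = w.im + (m - 1) := fun w => by simp [hc]
  have hmem : ∀ s ∈ Icc 0 T, ∀ w ∈ closedHalfStrip, w + c ∈ closure (W.Ω s) := fun s hs w hw =>
    W.deep_subset_closure hs (hm s hs) (by rw [hcre]; exact hw.1)
      (by rw [hcim]; linarith [hw.2])
  have hmemo : ∀ s ∈ Icc 0 T, ∀ w : ℂ, |w.re| < 1 → w.im ≤ 0 → w + c ∈ W.Ω s :=
    fun s hs w h1 h2 => W.deep_subset hs (hm s hs) ⟨by rwa [hcre], by rw [hcim]; linarith⟩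
  have htop : ∀ x : ℝ, x ∈ I → (x : ℂ) ∈ closedHalfStrip := fun x hx =>
    ⟨by simpa [abs_le] using hx, by simp⟩
  obtain ⟨M, hM⟩ : ∃ M : ℝ, ∀ s ∈ Icc 0 T, ∀ x ∈ I, ‖W.vt s ((x : ℂ) + c)‖ ≤ M := by
    have h : ContinuousOn (fun p : ℝ × ℝ => W.vt p.1 ((p.2 : ℂ) + c)) (Icc 0 T ×ˢ I) :=
      W.vt_cont.comp (f := fun p : ℝ × ℝ => (p.1, (p.2 : ℂ) + c)) (by fun_prop)
        fun p hp => ⟨hp.1, hmem _ hp.1 _ (htop _ hp.2)⟩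
    obtain ⟨M, hM⟩ := (isCompact_Icc.prod isCompact_Icc).exists_bound_of_continuousOn h
    exact ⟨M, fun s hs x hx => hM (s, x) ⟨hs, hx⟩⟩
  -- The difference of the conjugate velocities at two times is holomorphic, matches at the walls
  -- and vanishes at infinity, so it decays exponentially, with a constant given by its values on
  -- the top. Those are at most M|s - t| by the bound for v_t there. Division by s - t transfers the
  -- decay to v_t.
  have hinc : ∀ s ∈ Icc 0 T, ∀ w ∈ closedHalfStrip, w.im < 0 →
      ‖W.v s (w + c) - W.v t (w + c)‖ ≤ M * |s - t| * Real.exp (Real.pi * w.im) := by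
    intro s hs w hw hw0
    set f : ℂ → ℂ := fun w =>
      (starRingEnd ℂ) (W.v s (w + c)) - (starRingEnd ℂ) (W.v t (w + c)) with hf
    have hfn : ∀ w, ‖f w‖ = ‖W.v s (w + c) - W.v t (w + c)‖ := fun w => by
      show ‖(starRingEnd ℂ) (W.v s (w + c)) - (starRingEnd ℂ) (W.v t (w + c))‖ = _
      rw [← map_sub, RCLike.norm_conj]
    have hcont : ∀ s ∈ Icc 0 T, ContinuousOn (fun w => W.v s (w + c)) closedHalfStrip :=
      fun s hs => (W.continuousOn_v hs).comp (by fun_prop) (hmem s hs)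
    have hsym : ∀ s ∈ Icc 0 T, ∀ y : ℝ, y ≤ 0 →
        W.v s (1 + y * Complex.I + c) = W.v s (-1 + y * Complex.I + c) := by
      intro s hs y hy
      have h1 : (1 + y * Complex.I : ℂ) ∈ closedHalfStrip := ⟨by simp, by simpa using hy⟩
      have h2 := hmem s hs _ h1
      have h3 : -1 + y * Complex.I + c = refl (1 + y * Complex.I + c) := by
        apply Complex.ext <;> simp [refl, hc, add_comm]
      rw [h3, W.v_symm s hs _ h2, refl_eq_self_of_re]
      exact W.wall s hs _ h2 (by rw [hcre]; simp)
    rw [← hfn]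
    refine StripWave.norm_le_exp_of_tendsto_zero ?_ ?_ ?_ ?_ ?_ hw hw0
    · exact (Complex.continuous_conj.comp_continuousOn (hcont s hs)).sub
        (Complex.continuous_conj.comp_continuousOn (hcont t ht))
    · intro y hy
      simp only [hf, hsym s hs y hy, hsym t ht y hy]
    · have hd : ∀ s ∈ Icc 0 T, DifferentiableOn ℂ
          (fun w => (starRingEnd ℂ) (W.v s (w + c))) openHalfStrip := fun s hs =>
        (W.differentiableOn_conj_v hs).comp (f := fun w : ℂ => w + c) (by fun_prop)
          fun w hw => hmemo s hs w hw.1 hw.2.le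
      exact (hd s hs).sub (hd t ht)
    · intro ε hε
      obtain ⟨R₁, h1⟩ := W.decay_closure hs (ε := ε / 3) (by positivity)
      obtain ⟨R₂, h2⟩ := W.decay_closure ht (ε := ε / 3) (by positivity)
      refine ⟨min R₁ R₂ - (m - 1), fun w hw hwR => ?_⟩
      rw [hfn]
      have a := h1 (w + c) (hmem s hs w hw) (by rw [hcim]; linarith [min_le_left R₁ R₂])
      have b := h2 (w + c) (hmem t ht w hw) (by rw [hcim]; linarith [min_le_right R₁ R₂])
      exact (norm_sub_le _ _).trans_lt (by linarith)
    · intro x hx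
      rw [hfn]
      set N : Set ℂ := (fun x : ℝ => (x : ℂ) + c) '' Ioo (-1) 1 with hN
      have hxN : (x : ℂ) + c ∈ closure N := by
        have hx' : x ∈ closure (Ioo (-1 : ℝ) 1) := by
          rw [closure_Ioo (by norm_num)]
          exact hx
        exact map_mem_closure (f := fun x : ℝ => (x : ℂ) + c) (by fun_prop) hx'
          fun y hy => mem_image_of_mem _ hy
      have := W.norm_increment_le ht (N := N) (J := Icc 0 T) (convex_Icc _ _) Subset.rfl ht ?_
        (e := fun _ => 0) continuousOn_const (M := M) ?_ hs hxN
      · simpa using this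
      · rintro s hs _ ⟨y, hy, rfl⟩
        exact hmemo s hs y (by simpa [abs_lt] using hy) (by simp)
      · rintro s hs _ ⟨y, hy, rfl⟩
        simpa using hM s hs y ⟨hy.1.le, hy.2.le⟩
  have hopen : ∀ w : ℂ, |w.re| < 1 → w.im < 0 →
      ‖W.vt t (w + c)‖ ≤ M * Real.exp (Real.pi * w.im) := by
    intro w h1 h2
    have hw : w ∈ closedHalfStrip := ⟨h1.le, h2.le⟩
    refine le_of_forall_pos_le_add fun ε hε => ?_
    have hΩ := hmemo t ht w h1 h2.le
    have hz : w + c ∉ W.z t '' I := by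
      rintro ⟨α, hα, h⟩
      exact W.z_notMem ht hα (h ▸ hΩ)
    obtain ⟨r, hr, δ, hδ, key⟩ := W.exists_increment_le ht (subset_closure hΩ) hz hε
    obtain ⟨s, hs, hst, hne⟩ := W.exists_ne_near ht hδ
    have hb := (key s hs hst _ (Metric.mem_ball_self hr) (subset_closure hΩ)).2
    have hi := hinc s hs w hw h2
    have h3 : 0 < |s - t| := abs_pos.2 (sub_ne_zero.2 hne)
    have h4 : |s - t| * ‖W.vt t (w + c)‖ ≤ ε * |s - t| + M * |s - t| * Real.exp (Real.pi * w.im) := by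
      have : (((s - t : ℝ) : ℂ)) * W.vt t (w + c) = (W.v s (w + c) - W.v t (w + c)) -
          (W.v s (w + c) - W.v t (w + c) - (s - t) * W.vt t (w + c)) := by push_cast; ring
      calc |s - t| * ‖W.vt t (w + c)‖ = ‖(((s - t : ℝ) : ℂ)) * W.vt t (w + c)‖ := by
            rw [norm_mul, Complex.norm_real, Real.norm_eq_abs]
        _ ≤ _ := by
            rw [this]
            exact (norm_sub_le _ _).trans (by linarith)
    have h5 : |s - t| * ‖W.vt t (w + c)‖ ≤
        |s - t| * (M * Real.exp (Real.pi * w.im) + ε) := by linarith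
    exact le_of_mul_le_mul_left h5 h3
  refine ⟨m, M, hm, fun w h1 h2 => ?_⟩
  have h0 : w - c ∈ closedHalfStrip := ⟨by simpa [hc] using h1, by simp [hc]; linarith⟩
  have hbd : ∀ w ∈ openHalfStrip, ‖W.vt t (w + c)‖ ≤ M * Real.exp (Real.pi * w.im) :=
    fun w hw => hopen w hw.1 hw.2
  have hev : w - c ∈ closure (openHalfStrip) := StripWave.closure_openHalfStrip_inter h0
  have hsub : closure openHalfStrip ⊆ closedHalfStrip :=
    closure_minimal StripWave.openHalfStrip_subset_closedHalfStrip
      ((isClosed_le Complex.continuous_re.abs continuous_const).inter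
        (isClosed_le Complex.continuous_im continuous_const))
  have := le_on_closure (f := fun w => ‖W.vt t (w + c)‖)
    (g := fun w => M * Real.exp (Real.pi * w.im)) hbd
    (((W.continuousOn_vt ht).comp (by fun_prop) (hmem t ht)).norm.mono hsub)
    (by fun_prop) hev
  simpa [hc] using this

theorem tendsto_vt {ε : ℝ} (hε : 0 < ε) :
    ∃ R : ℝ, ∀ w ∈ closure (W.Ω t), w.im < R → ‖W.vt t w‖ < ε := by
  obtain ⟨m, M, -, hM⟩ := W.exists_norm_vt_le ht
  have hlim : Tendsto (fun y : ℝ => M * Real.exp (Real.pi * (y - (m - 1)))) atBot (𝓝 (M * 0)) := by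
    refine (Real.tendsto_exp_atBot.comp ?_).const_mul M
    exact (tendsto_atBot_add_const_right _ _ tendsto_id).const_mul_atBot Real.pi_pos
  rw [mul_zero] at hlim
  obtain ⟨R, hR⟩ := ((hlim.eventually (gt_mem_nhds hε)).and
    (eventually_lt_atBot (m - 1))).exists_forall_of_atBot
  exact ⟨R, fun w hw hwR => (hM w (W.abs_re_le ht hw) (hR _ hwR.le).2).trans_lt (hR _ hwR.le).1⟩

/-- The Euler equation in complex form, up to the boundary. -/
theorem conj_gradP {w : ℂ} (hw : w ∈ closure (W.Ω t)) :
    (starRingEnd ℂ) (W.gradP t w) = Complex.I - (starRingEnd ℂ) (W.vt t w) -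
      W.v t w * (starRingEnd ℂ) (W.Dv t w 1) := by
  have h1 := W.continuousOn_v ht
  have h2 := W.continuousOn_vt ht
  have h3 := (W.Dv_cont t ht).clm_apply (continuousOn_const (c := (1 : ℂ)))
  have h4 := W.gradP_cont t ht
  have hc : Continuous (starRingEnd ℂ) := Complex.continuous_conj
  refine Set.EqOn.of_subset_closure (s := W.Ω t)
    (f := fun w => (starRingEnd ℂ) (W.gradP t w))
    (g := fun w => Complex.I - (starRingEnd ℂ) (W.vt t w) -
      W.v t w * (starRingEnd ℂ) (W.Dv t w 1)) (fun w hw => ?_)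
    (hc.comp_continuousOn h4)
    ((continuousOn_const.sub (hc.comp_continuousOn h2)).sub (h1.mul (hc.comp_continuousOn h3)))
    subset_closure Subset.rfl hw
  have e : W.gradP t w = -Complex.I - W.vt t w - W.Dv t w (W.v t w) := by
    linear_combination W.euler t ht w hw
  show (starRingEnd ℂ) (W.gradP t w) = _
  rw [e, map_sub, map_sub, map_neg, Complex.conj_I, W.Dv_apply ht hw]
  ring

/-- The pressure gradient is vertical at the walls. -/
theorem gradP_symm {w : ℂ} (hw : w ∈ closure (W.Ω t)) :
    W.gradP t (refl w) = refl (W.gradP t w) := by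
  have hmaps : MapsTo refl (closure (W.Ω t)) (closure (W.Ω t)) := fun w => W.refl_mem_closure ht
  refine Set.EqOn.of_subset_closure (s := W.Ω t) (f := fun w => W.gradP t (refl w))
    (g := fun w => refl (W.gradP t w)) (fun w hw => ?_)
    ((W.gradP_cont t ht).comp continuous_refl.continuousOn hmaps)
    (continuous_refl.comp_continuousOn (W.gradP_cont t ht)) subset_closure Subset.rfl hw
  have hw' := W.Ω_symm t ht w hw
  have hr : HasFDerivAt refl (-(Complex.conjCLE.toContinuousLinearMap) : ℂ →L[ℝ] ℂ) w :=
    Complex.conjCLE.toContinuousLinearMap.hasFDerivAt.neg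
  have h1 := (W.P_deriv t ht _ hw').hasFDerivAt.comp w hr
  have h2 : HasFDerivAt (fun w => W.P t (refl w))
      (InnerProductSpace.toDual ℝ ℂ (W.gradP t w)) w := by
    refine (W.P_deriv t ht w hw).hasFDerivAt.congr_of_eventuallyEq ?_
    filter_upwards [(W.Ω_open t ht).mem_nhds hw] with ζ hζ
    exact W.P_symm t ht ζ (subset_closure hζ)
  have h3 := h1.unique h2
  have e1 := DFunLike.congr_fun h3 1
  have e2 := DFunLike.congr_fun h3 Complex.I
  simp [Complex.inner] at e1 e2
  apply Complex.ext
  · rw [refl_re]; linarith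
  · rw [refl_im]; linarith

end CornerWave.WaterWave

/-! ### The inverse Riemann mapping and its boundary correspondence -/

namespace CornerWave

theorem ofReal_mem_closedHalfStrip {x : ℝ} (hx : x ∈ I) : (x : ℂ) ∈ closedHalfStrip :=
  ⟨by simpa [abs_le] using hx, by simp⟩

/-- The inverse of the Riemann mapping. -/
noncomputable def riemannInv (Ω : Set ℂ) (Φ : ℂ → ℂ) : ℂ → ℂ := Function.invFunOn Φ (closure Ω)

namespace IsRiemannMap

variable {Ω : Set ℂ} {z : ℝ → ℂ} {Φ : ℂ → ℂ} (hΦ : IsRiemannMap Ω z Φ)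

include hΦ

theorem inv_mem {w : ℂ} (hw : w ∈ closedHalfStrip) : riemannInv Ω Φ w ∈ closure Ω :=
  Function.invFunOn_mem (hΦ.bij.surjOn hw)

theorem apply_inv {w : ℂ} (hw : w ∈ closedHalfStrip) : Φ (riemannInv Ω Φ w) = w :=
  Function.invFunOn_eq (hΦ.bij.surjOn hw)

theorem inv_apply {w : ℂ} (hw : w ∈ closure Ω) : riemannInv Ω Φ (Φ w) = w :=
  hΦ.bij.injOn (hΦ.inv_mem (hΦ.bij.mapsTo hw)) hw (hΦ.apply_inv (hΦ.bij.mapsTo hw))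

theorem inv_mem_inside {w : ℂ} (hw : w ∈ openHalfStrip) : riemannInv Ω Φ w ∈ Ω := by
  obtain ⟨ζ, hζ, rfl⟩ := hΦ.bij_inside.surjOn hw
  rwa [hΦ.inv_apply (subset_closure hζ)]

theorem notMem_inside {w : ℂ} (hw : w ∈ closedHalfStrip) (h : w ∉ openHalfStrip) :
    riemannInv Ω Φ w ∉ Ω := fun hc => h (by
  have := hΦ.bij_inside.mapsTo hc
  rwa [hΦ.apply_inv hw] at this)

theorem injOn_inv : InjOn (riemannInv Ω Φ) closedHalfStrip := fun a ha b hb h => by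
  rw [← hΦ.apply_inv ha, ← hΦ.apply_inv hb, h]

/-- Take an ultrafilter converging to w in the half strip. Its image either leaves every compact
set, which is impossible because Φ would then go to infinity, or converges to some k in the closure
of the region, and then Φ k = w. -/
theorem continuousOn_inv : ContinuousOn (riemannInv Ω Φ) closedHalfStrip := by
  intro w hw
  show Tendsto _ _ _
  rw [tendsto_iff_ultrafilter]
  intro u hu
  have hu1 : (u : Filter ℂ) ≤ 𝓝 w := hu.trans nhdsWithin_le_nhds
  have hu2 : closedHalfStrip ∈ u := hu self_mem_nhdsWithin
  have hK : ∀ᶠ x in (u : Filter ℂ), riemannInv Ω Φ x ∈ closure Ω := by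
    filter_upwards [hu2] with x hx using hΦ.inv_mem hx
  have hinv : ∀ᶠ x in (u : Filter ℂ), Φ (riemannInv Ω Φ x) = x := by
    filter_upwards [hu2] with x hx using hΦ.apply_inv hx
  by_cases hcc : ((u.map (riemannInv Ω Φ) : Ultrafilter ℂ) : Filter ℂ) ≤ cocompact ℂ
  · have h1 : Tendsto (riemannInv Ω Φ) u (cocompact ℂ ⊓ 𝓟 (closure Ω)) :=
      tendsto_inf.2 ⟨hcc, tendsto_principal.2 hK⟩
    have h2 : Tendsto id (u : Filter ℂ) (cocompact ℂ) := (hΦ.infty.comp h1).congr' hinv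
    exact (u.neBot.ne (le_bot_iff.1 (disjoint_nhds_cocompact w hu1 (tendsto_id'.1 h2)))).elim
  · obtain ⟨C, hC, hCu⟩ : ∃ C, IsCompact C ∧ C ∈ u.map (riemannInv Ω Φ) := by
      by_contra hne
      push Not at hne
      refine hcc fun s hs => ?_
      obtain ⟨C, hC, hCs⟩ := mem_cocompact.1 hs
      exact mem_of_superset (Ultrafilter.compl_mem_iff_notMem.2 (hne C hC)) hCs
    obtain ⟨k, hkC, hk⟩ := (hC.inter_right isClosed_closure).ultrafilter_le_nhds
      (u.map (riemannInv Ω Φ)) (le_principal_iff.2 (inter_mem hCu hK))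
    have h1 : Tendsto (riemannInv Ω Φ) u (𝓝[closure Ω] k) :=
      tendsto_inf.2 ⟨hk, tendsto_principal.2 hK⟩
    have h2 : Tendsto id (u : Filter ℂ) (𝓝 (Φ k)) := ((hΦ.cont k hkC.2).tendsto.comp h1).congr' hinv
    have h3 : Φ k = w := tendsto_nhds_unique h2 hu1
    rw [← h3, hΦ.inv_apply hkC.2]
    exact hk

/-- The derivative of the Riemann mapping does not vanish in the region. -/
theorem deriv_ne_zero_and_hasDerivAt_inv (hΩ : IsOpen Ω) {Φz : ℂ → ℂ}
    (hΦz : ∀ w ∈ Ω, HasDerivAt Φ (Φz w) w) {w : ℂ} (hw : w ∈ openHalfStrip) :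
    Φz (riemannInv Ω Φ w) ≠ 0 ∧
      HasDerivAt (riemannInv Ω Φ) (Φz (riemannInv Ω Φ w))⁻¹ w := by
  set ψ := riemannInv Ω Φ with hψ
  have hcont : ∀ w ∈ openHalfStrip, ContinuousAt ψ w := fun w hw =>
    hΦ.continuousOn_inv.continuousAt (mem_of_superset
      (StripWave.isOpen_openHalfStrip.mem_nhds hw) StripWave.openHalfStrip_subset_closedHalfStrip)
  have hev : ∀ w ∈ openHalfStrip, ∀ᶠ y in 𝓝 w, Φ (ψ y) = y := fun w hw => by
    filter_upwards [StripWave.isOpen_openHalfStrip.mem_nhds hw] with y hy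
    exact hΦ.apply_inv (StripWave.openHalfStrip_subset_closedHalfStrip hy)
  have hder : ∀ w ∈ openHalfStrip, Φz (ψ w) ≠ 0 → HasDerivAt ψ (Φz (ψ w))⁻¹ w := fun w hw hne =>
    HasDerivAt.of_local_left_inverse (hcont w hw) (hΦz _ (hΦ.inv_mem_inside hw)) hne (hev w hw)
  suffices h : Φz (ψ w) ≠ 0 from ⟨h, hder w hw h⟩
  have hz := hΦ.inv_mem_inside hw
  have hna : AnalyticAt ℂ Φz (ψ w) := by
    refine (hΦ.holo.analyticAt (hΩ.mem_nhds hz)).deriv.congr ?_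
    filter_upwards [hΩ.mem_nhds hz] with ζ hζ using (hΦz ζ hζ).deriv
  -- A nonisolated zero of Φ_z would make Φ locally constant, against injectivity. Around an
  -- isolated zero the inverse is differentiable off one point and continuous there, hence
  -- differentiable by removability, and the chain rule for Φ∘ψ = id rules out the zero.
  rcases hna.eventually_eq_zero_or_eventually_ne_zero with h0 | h0
  · exfalso
    obtain ⟨r, hr, hrs⟩ := Metric.mem_nhds_iff.1 (h0.and (hΩ.mem_nhds hz))
    have hball : ∀ ζ ∈ Metric.ball (ψ w) r, ζ ∈ Ω := fun ζ hζ => (hrs hζ).2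
    have hy : ψ w + (r / 2 : ℝ) ∈ Metric.ball (ψ w) r := by
      rw [mem_ball_iff_norm, add_sub_cancel_left, Complex.norm_real, Real.norm_of_nonneg (by linarith)]
      linarith
    have := Metric.isOpen_ball.is_const_of_deriv_eq_zero (convex_ball (ψ w) r).isPreconnected
      (hΦ.holo.mono hball) (fun ζ hζ => by rw [(hΦz ζ (hball ζ hζ)).deriv]; exact (hrs hζ).1)
      hy (Metric.mem_ball_self hr)
    have h1 := hΦ.bij_inside.injOn (hball _ hy) hz this
    have h2 : ((r / 2 : ℝ) : ℂ) = 0 := by linear_combination h1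
    have h3 : r / 2 = 0 := by exact_mod_cast h2
    linarith
  · have hp : Tendsto ψ (𝓝[≠] w) (𝓝[≠] (ψ w)) := by
      refine tendsto_nhdsWithin_iff.2 ⟨(hcont w hw).tendsto.mono_left nhdsWithin_le_nhds, ?_⟩
      filter_upwards [self_mem_nhdsWithin, mem_nhdsWithin_of_mem_nhds
        (StripWave.isOpen_openHalfStrip.mem_nhds hw)] with y hy hyo hc
      exact hy (hΦ.injOn_inv (StripWave.openHalfStrip_subset_closedHalfStrip hyo)
        (StripWave.openHalfStrip_subset_closedHalfStrip hw) hc)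
    have hd : DifferentiableAt ℂ ψ w := by
      refine (Complex.analyticAt_of_differentiable_on_punctured_nhds_of_continuousAt ?_
        (hcont w hw)).differentiableAt
      filter_upwards [hp.eventually h0, mem_nhdsWithin_of_mem_nhds
        (StripWave.isOpen_openHalfStrip.mem_nhds hw)] with y hy hyo
      exact (hder y hyo hy).differentiableAt
    have h1 := (hΦz _ hz).comp w hd.hasDerivAt
    have h2 : HasDerivAt (Φ ∘ ψ) 1 w := (hasDerivAt_id w).congr_of_eventuallyEq (hev w hw)
    intro h
    have := h1.unique h2
    rw [h, zero_mul] at this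
    exact zero_ne_one this

theorem inv_refl (hsymm : ∀ w ∈ closure Ω, refl w ∈ closure Ω) {w : ℂ}
    (hw : w ∈ closedHalfStrip) : riemannInv Ω Φ (refl w) = refl (riemannInv Ω Φ w) := by
  have h1 := hΦ.symm _ (hΦ.inv_mem hw)
  rw [hΦ.apply_inv hw] at h1
  rw [← h1, hΦ.inv_apply (hsymm _ (hΦ.inv_mem hw))]

end IsRiemannMap

namespace WaterWave

variable {T : ℝ} (W : WaterWave T) {t : ℝ} (ht : t ∈ Icc 0 T) {Φ : ℂ → ℂ}
  (hΦ : IsRiemannMap (W.Ω t) (W.z t) Φ)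

include ht hΦ

omit ht in
theorem Φ_z {α : ℝ} (hα : α ∈ I) : Φ (W.z t α) = (W.h t Φ α : ℂ) := by
  apply Complex.ext
  · simp [h]
  · rw [hΦ.surface α hα, Complex.ofReal_im]

theorem h_mem {α : ℝ} (hα : α ∈ I) : W.h t Φ α ∈ I :=
  abs_le.1 (hΦ.bij.mapsTo (W.z_mem_closure ht hα)).1

omit ht in
theorem h_neg_one : W.h t Φ (-1) = -1 := by simp [h, hΦ.left]

omit ht in
theorem h_one : W.h t Φ 1 = 1 := by simp [h, hΦ.right]

theorem continuousOn_h : ContinuousOn (W.h t Φ) I :=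
  Complex.continuous_re.comp_continuousOn (hΦ.cont.comp (W.continuousOn_z ht)
    fun _ hα => W.z_mem_closure ht hα)

theorem injOn_h : InjOn (W.h t Φ) I := fun a ha b hb hab => by
  refine W.z_inj t ht ha hb (hΦ.bij.injOn (W.z_mem_closure ht ha) (W.z_mem_closure ht hb) ?_)
  rw [W.Φ_z hΦ ha, W.Φ_z hΦ hb, hab]

theorem strictMonoOn_h : StrictMonoOn (W.h t Φ) I :=
  (W.continuousOn_h ht hΦ).strictMonoOn_of_injOn_Icc (by norm_num)
    (by rw [W.h_neg_one hΦ, W.h_one hΦ]; norm_num) (W.injOn_h ht hΦ)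

theorem surjOn_h : SurjOn (W.h t Φ) I I := by
  have := intermediate_value_Icc (by norm_num : (-1 : ℝ) ≤ 1) (W.continuousOn_h ht hΦ)
  rwa [W.h_neg_one hΦ, W.h_one hΦ] at this

theorem hinv_mem {x : ℝ} (hx : x ∈ I) : W.hinv t Φ x ∈ I :=
  Function.invFunOn_mem (W.surjOn_h ht hΦ hx)

theorem h_hinv {x : ℝ} (hx : x ∈ I) : W.h t Φ (W.hinv t Φ x) = x :=
  Function.invFunOn_eq (W.surjOn_h ht hΦ hx)

theorem hinv_h {α : ℝ} (hα : α ∈ I) : W.hinv t Φ (W.h t Φ α) = α :=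
  W.injOn_h ht hΦ (W.hinv_mem ht hΦ (W.h_mem ht hΦ hα)) hα (W.h_hinv ht hΦ (W.h_mem ht hΦ hα))

theorem inv_h {α : ℝ} (hα : α ∈ I) : riemannInv (W.Ω t) Φ (W.h t Φ α) = W.z t α := by
  rw [← W.Φ_z hΦ hα, hΦ.inv_apply (W.z_mem_closure ht hα)]

theorem inv_eq_Z {x : ℝ} (hx : x ∈ I) : riemannInv (W.Ω t) Φ x = W.Z t Φ x := by
  conv_lhs => rw [← W.h_hinv ht hΦ hx]
  exact W.inv_h ht hΦ (W.hinv_mem ht hΦ hx)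

/-- Boundary points go to boundary points, and the top is already taken by the surface, so along the
wall Re Φ takes only the values ±1. The wall is connected and contains the corner, where the value
is 1. -/
theorem re_Φ_right_wall {w : ℂ} (h1 : w.re = 1) (h2 : w.im ≤ (W.z t 1).im) : (Φ w).re = 1 := by
  have hcl : ∀ y ≤ (W.z t 1).im, (1 + y * Complex.I : ℂ) ∈ frontier (W.Ω t) := fun y hy => by
    rw [W.Ω_frontier t ht]
    exact Or.inr (Or.inr ⟨by simp, by simpa using hy⟩)
  have hc : ContinuousOn (fun y : ℝ => (Φ (1 + y * Complex.I)).re) (Iic (W.z t 1).im) :=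
    Complex.continuous_re.comp_continuousOn (hΦ.cont.comp (by fun_prop)
      fun y hy => W.frontier_subset_closure ht (hcl y hy))
  have hz1 : (1 + (W.z t 1).im * Complex.I : ℂ) = W.z t 1 := by
    apply Complex.ext <;> simp [W.z_right t ht]
  have hmaps : MapsTo (fun y : ℝ => (Φ (1 + y * Complex.I)).re) (Iic (W.z t 1).im)
      ({-1, 1} : Set ℝ) := by
    intro y hy
    have hK := W.frontier_subset_closure ht (hcl y hy)
    have hH := hΦ.bij.mapsTo hK
    have hnot : (1 + y * Complex.I : ℂ) ∉ W.Ω t := by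
      have := hcl y hy
      rw [(W.Ω_open t ht).frontier_eq] at this
      exact this.2
    have hnot' : Φ (1 + y * Complex.I) ∉ openHalfStrip := fun hc => hnot (by
      have := hΦ.inv_mem_inside hc
      rwa [hΦ.inv_apply hK] at this)
    suffices h : |(Φ (1 + y * Complex.I)).re| = 1 by
      rcases (abs_eq one_pos.le).1 h with h | h
      · exact Or.inr h
      · exact Or.inl h
    rcases hH.1.lt_or_eq with h | h
    · exfalso
      rcases hH.2.lt_or_eq with h' | h'
      · exact hnot' ⟨h, h'⟩
      · obtain ⟨α, hα, hαx⟩ := W.surjOn_h ht hΦ (abs_le.1 h.le)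
        have e : Φ (W.z t α) = Φ (1 + y * Complex.I) := by
          rw [W.Φ_z hΦ hα, hαx]
          apply Complex.ext <;> simp [h']
        have e2 := hΦ.bij.injOn (W.z_mem_closure ht hα) hK e
        have e3 := W.eq_corner_of_abs_re ht hα (by rw [e2]; simp)
        rcases e3 with rfl | rfl
        · have := W.z_left t ht
          rw [e2] at this
          norm_num at this
        · rw [W.h_one hΦ] at hαx
          rw [← hαx] at h
          norm_num at h
    · exact h
  have := (isPreconnected_Iic (a := (W.z t 1).im)).constant_of_mapsTo
    (Set.toFinite ({-1, 1} : Set ℝ)).isDiscrete hc hmaps (x := w.im) (y := (W.z t 1).im) h2 (mem_Iic.2 le_rfl)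
  rw [hz1, hΦ.right] at this
  have hw : (1 + w.im * Complex.I : ℂ) = w := by
    apply Complex.ext <;> simp [h1]
  rw [hw] at this
  simpa using this

/-- The preimage lies on the boundary of the fluid. If it is a surface point, injectivity of h makes
it the corner. If it were on the left wall, its mirror image would be on the right wall with image
on the left side. -/
theorem re_inv_right {y : ℝ} (hy : y ≤ 0) :
    (riemannInv (W.Ω t) Φ (1 + y * Complex.I)).re = 1 := by
  have hw : (1 + y * Complex.I : ℂ) ∈ closedHalfStrip := ⟨by simp, by simpa using hy⟩
  have hnot := hΦ.notMem_inside hw (fun h => by simpa using h.1)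
  rcases W.mem_frontier ht (hΦ.inv_mem hw) hnot with ⟨α, hα, h⟩ | ⟨h1, h2⟩ | ⟨h1, h2⟩
  · have h3 := W.Φ_z hΦ hα
    rw [h, hΦ.apply_inv hw] at h3
    have h4 : W.h t Φ α = W.h t Φ 1 := by
      rw [W.h_one hΦ]
      have := congrArg Complex.re h3
      simpa using this.symm
    have h5 := W.injOn_h ht hΦ hα (by norm_num) h4
    rw [← h, h5, W.z_right t ht]
  · exfalso
    have hr := W.re_Φ_right_wall ht hΦ (w := refl (riemannInv (W.Ω t) Φ (1 + y * Complex.I)))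
      (by rw [refl_re, h1]; norm_num) (by
        rw [refl_im]
        have := W.z_symm t ht 1 (by norm_num)
        rw [this, refl_im] at h2
        exact h2)
    rw [hΦ.symm _ (hΦ.inv_mem hw), hΦ.apply_inv hw, refl_re] at hr
    simp at hr
    norm_num at hr
  · exact h1

theorem inv_left {y : ℝ} (hy : y ≤ 0) : riemannInv (W.Ω t) Φ (-1 + y * Complex.I) =
    refl (riemannInv (W.Ω t) Φ (1 + y * Complex.I)) := by
  have hw : (1 + y * Complex.I : ℂ) ∈ closedHalfStrip := ⟨by simp, by simpa using hy⟩
  rw [← refl_one_add, hΦ.inv_refl (fun w => W.refl_mem_closure ht) hw]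

/-- The inverse Riemann mapping takes low points to low points. -/
theorem exists_im_inv_lt (R : ℝ) :
    ∃ R' : ℝ, ∀ w ∈ closedHalfStrip, w.im < R' → (riemannInv (W.Ω t) Φ w).im < R := by
  obtain ⟨c, hc⟩ := W.Ω_bdd t ht
  have hcl : ∀ w ∈ closure (W.Ω t), w.im ≤ c := fun w hw =>
    (closure_minimal (t := {w : ℂ | w.im ≤ c}) (fun w hw => (hc w hw).2.le)
      (isClosed_le Complex.continuous_im continuous_const)) hw
  have hK : IsCompact (closure (W.Ω t) ∩ {w : ℂ | R ≤ w.im}) := by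
    refine (isCompact_Icc.reProdIm isCompact_Icc : IsCompact
      (Icc (-1 : ℝ) 1 ×ℂ Icc R c)).of_isClosed_subset
      (isClosed_closure.inter (isClosed_le continuous_const Complex.continuous_im)) ?_
    rintro w ⟨h1, h2⟩
    exact ⟨abs_le.1 (W.abs_re_le ht h1), h2, hcl w h1⟩
  obtain ⟨B, hB⟩ := (hK.image_of_continuousOn (Complex.continuous_im.comp_continuousOn
    (hΦ.cont.mono inter_subset_left))).bddBelow
  refine ⟨B, fun w hw hwB => ?_⟩
  by_contra hne
  have := hB ⟨_, ⟨hΦ.inv_mem hw, not_lt.1 hne⟩, rfl⟩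
  simp only [Function.comp_apply, hΦ.apply_inv hw] at this
  linarith

end WaterWave
end CornerWave


/-! ### Derivative bounds and the Bernoulli potential -/

theorem AbsolutelyContinuousOnInterval.congr' {X : Type*} [PseudoMetricSpace X] {f g : ℝ → X}
    {a b : ℝ} (hf : AbsolutelyContinuousOnInterval f a b) (h : EqOn g f (uIcc a b)) :
    AbsolutelyContinuousOnInterval g a b := by
  rw [absolutelyContinuousOnInterval_iff] at hf ⊢
  intro ε hε
  obtain ⟨δ, hδ, key⟩ := hf ε hε
  refine ⟨δ, hδ, fun E hE hlen => ?_⟩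
  refine (Finset.sum_congr rfl fun i hi => ?_).trans_lt (key E hE hlen)
  rw [h (hE.1 i hi).1, h (hE.1 i hi).2]

namespace StripWave
open Complex
open CornerWave (closedHalfStrip openHalfStrip)

/-- Borel–Carathéodory on the unit disc about w, followed by Cauchy's estimate on the half radius.
-/
theorem norm_deriv_le_of_abs_re_le {F : ℂ → ℂ} {w : ℂ} {M : ℝ} (hM : 0 < M)
    (hF : DifferentiableOn ℂ F lowerPlane) (h : ∀ w ∈ lowerPlane, |(F w).re| ≤ M)
    (hw : w.im ≤ -1) : ‖deriv F w‖ ≤ 16 * M := by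
  have hshift : ∀ z ∈ Metric.ball (0 : ℂ) 1, w + z ∈ lowerPlane := fun z hz => by
    have hz' : ‖z‖ < 1 := by simpa using hz
    have := (abs_le.1 (abs_im_le_norm z)).2
    show (w + z).im < 0
    rw [add_im]
    linarith
  set f : ℂ → ℂ := fun z => F (w + z) - F w with hf
  have hfd : DifferentiableOn ℂ f (Metric.ball 0 1) :=
    (hF.comp (by fun_prop) hshift).sub_const _
  have hf0 : f 0 = 0 := by simp [hf]
  have hw0 : w ∈ lowerPlane := by
    show w.im < 0
    linarith
  have hre : MapsTo f (Metric.ball 0 1) {z | z.re ≤ 2 * M} := fun z hz => by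
    have h1 := (abs_le.1 (h _ (hshift z hz))).2
    have h2 := (abs_le.1 (h _ hw0)).1
    show (F (w + z) - F w).re ≤ 2 * M
    rw [sub_re]
    linarith
  have hmaps : MapsTo f (Metric.ball 0 (1 / 2)) (Metric.closedBall (f 0) (4 * M)) := by
    intro z hz
    have hzn : ‖z‖ < 1 / 2 := by simpa using hz
    have := borelCaratheodory_zero (by positivity) hfd hre one_pos
      (by simpa using (by linarith : ‖z‖ < 1)) hf0
    rw [mem_closedBall_iff_norm, hf0, sub_zero]
    refine this.trans ?_
    rw [div_le_iff₀ (by linarith)]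
    nlinarith [norm_nonneg z]
  have hder := norm_deriv_le_div_of_mapsTo_ball
    (hfd.mono (Metric.ball_subset_ball (by norm_num))) hmaps (by norm_num)
  have e : deriv f 0 = deriv F w := by
    rw [hf, deriv_sub_const, deriv_comp_const_add, add_zero]
  rw [← e]
  refine hder.trans ?_
  rw [div_le_iff₀ (by norm_num)]
  nlinarith

/-- A continuous function on the half strip which is small near infinity is bounded. -/
theorem exists_bound_of_decay {f : ℂ → ℂ} (hf : ContinuousOn f closedHalfStrip)
    (h : ∃ R : ℝ, ∀ w ∈ closedHalfStrip, w.im < R → ‖f w‖ ≤ 1) :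
    ∃ C, ∀ w ∈ closedLowerPlane, ‖perExt f w‖ ≤ C := by
  obtain ⟨R, hR⟩ := h
  have hK : IsCompact (Icc (-1 : ℝ) 1 ×ℂ Icc R 0) := isCompact_Icc.reProdIm isCompact_Icc
  obtain ⟨C, hC⟩ := hK.exists_bound_of_continuousOn (hf.mono fun w hw =>
    ⟨abs_le.2 hw.1, hw.2.2⟩)
  refine ⟨max C 1, fun w hw => ?_⟩
  have hw' := sub_stripIndex_mem hw
  unfold perExt
  rcases lt_or_ge (w - 2 * stripIndex w).im R with hlt | hge
  · exact (hR _ hw' hlt).trans (le_max_right _ _)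
  · exact (hC _ ⟨abs_le.1 hw'.1, hge, hw'.2⟩).trans (le_max_left _ _)

/-- Assembly of a holomorphic function with given real part on the half strip and given
derivative. -/
theorem exists_primitive_with_re {φ B Ψ : ℂ → ℂ} {ρ : ℂ → ℝ}
    (hΨ : ∀ w ∈ lowerPlane, HasDerivAt Ψ (φ w)⁻¹ w) (hΨ2 : ∀ w, Ψ (w + 2) = Ψ w + 2)
    (hφ2 : ∀ w, φ (w + 2) = φ w)
    (hφb : ∃ C, ∀ w : ℂ, w.im ≤ -1 → ‖(φ w)⁻¹‖ ≤ C)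
    (hB : DifferentiableOn ℂ B lowerPlane) (hB2 : ∀ w, B (w + 2) = B w)
    (hB0 : ∀ ε > 0, ∃ R : ℝ, ∀ w : ℂ, w.im < R → ‖B w‖ ≤ ε)
    (hρ : ContinuousOn ρ closedHalfStrip)
    (hρd : ∀ w ∈ openHalfStrip, HasFDerivAt ρ (reCLM.comp
      (((I - B w) / φ w) • (1 : ℂ →L[ℝ] ℂ))) w) :
    ∃ S : ℂ → ℂ, (∀ w ∈ lowerPlane, HasDerivAt S ((I - B w) / φ w) w) ∧
      (∀ w ∈ lowerPlane, S (w + 2) = S w + 2 * I) ∧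
      ∀ w ∈ lowerPlane, perExt ρ w = (S w).re := by
  have hc : DifferentiableOn ℂ (fun w => (I - B w) / φ w) lowerPlane := by
    have h1 : DifferentiableOn ℂ Ψ lowerPlane := fun w hw =>
      (hΨ w hw).differentiableAt.differentiableWithinAt
    refine (((differentiableOn_const I).sub hB).mul (h1.deriv isOpen_lowerPlane)).congr
      fun w hw => ?_
    rw [Pi.mul_apply, (hΨ w hw).deriv, div_eq_mul_inv]
    rfl
  obtain ⟨S₀, hS₀⟩ := exists_primitive_lowerPlane hc
  -- The derivative of ρ is the real part of that of S₀, so the two differ by a real constant, which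
  -- is added to S₀.
  obtain ⟨a, ha⟩ : ∃ a : ℝ, ∀ w ∈ openHalfStrip, ρ w - (S₀ w).re = a := by
    have hd : ∀ w ∈ openHalfStrip, HasFDerivAt (fun w => ρ w - (S₀ w).re) (0 : ℂ →L[ℝ] ℝ) w := by
      intro w hw
      have h1 := (hS₀ w (openHalfStrip_subset_lowerPlane hw)).complexToReal_fderiv
      have h2 := (reCLM.hasFDerivAt).comp w h1
      have h3 := (hρd w hw).sub h2
      rw [sub_self] at h3
      exact h3
    exact isOpen_openHalfStrip.exists_is_const_of_fderiv_eq_zero (𝕜 := ℝ)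
      convex_openHalfStrip.isPreconnected
      (fun w hw => (hd w hw).differentiableAt.differentiableWithinAt) fun w hw => (hd w hw).fderiv
  set S : ℂ → ℂ := fun w => S₀ w + a with hS
  have hSd : ∀ w ∈ lowerPlane, HasDerivAt S ((I - B w) / φ w) w := fun w hw =>
    (hS₀ w hw).add_const _
  have hSre : ∀ w ∈ closedHalfStrip, w ∈ lowerPlane → ρ w = (S w).re := by
    intro w hw hwl
    have hne : (𝓝[openHalfStrip] w).NeBot := mem_closure_iff_nhdsWithin_neBot.1
      (closure_openHalfStrip_inter hw)
    have h1 : Tendsto (fun z => (S z).re) (𝓝[openHalfStrip] w) (𝓝 (S w).re) :=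
      (continuous_re.continuousAt.comp (hSd w hwl).continuousAt).tendsto.mono_left
        nhdsWithin_le_nhds
    refine tendsto_nhds_unique ((hρ w hw).mono openHalfStrip_subset_closedHalfStrip).tendsto
      (h1.congr' ?_)
    filter_upwards [self_mem_nhdsWithin] with z hz
    have := ha z hz
    simp only [hS, add_re, ofReal_re]
    linarith
  have hl2 : ∀ w ∈ lowerPlane, w + 2 ∈ lowerPlane := fun w hw => by
    have : w.im < 0 := hw
    show (w + 2).im < 0
    simpa using this
  obtain ⟨κ, hκ⟩ : ∃ κ : ℂ, ∀ w ∈ lowerPlane, S (w + 2) - S w = κ := by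
    have hd : ∀ w ∈ lowerPlane, HasDerivAt (fun w => S (w + 2) - S w) 0 w := by
      intro w hw
      have h1 := (hSd _ (hl2 w hw)).comp_add_const w 2
      have h2 := h1.sub (hSd w hw)
      rw [hB2, hφ2, sub_self] at h2
      exact h2
    exact isOpen_lowerPlane.exists_is_const_of_deriv_eq_zero convex_lowerPlane.isPreconnected
      (fun w hw => (hd w hw).differentiableAt.differentiableWithinAt) fun w hw => (hd w hw).deriv
  -- S - iΨ has the derivative -B/φ, which tends to 0 deep down because B does and 1/φ is bounded.
  -- Its change over one horizontal period is κ - 2i, independently of the depth.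
  have hκ2 : κ = 2 * I := by
    obtain ⟨C, hC⟩ := hφb
    have hC0 : 0 ≤ C := (norm_nonneg _).trans (hC (-I) (by simp))
    have hle : ∀ ε > 0, ‖κ - 2 * I‖ ≤ ε * (C * 2) := by
      intro ε hε
      obtain ⟨R, hR⟩ := hB0 ε hε
      obtain ⟨y, hy⟩ : ∃ y, y < min R (-1) := exists_lt _
      have hconv : Convex ℝ {w : ℂ | w.im < min R (-1)} := convex_halfSpace_im_lt _
      have hsub : ∀ w ∈ {w : ℂ | w.im < min R (-1)}, w ∈ lowerPlane := fun w hw => by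
        have h1 : w.im < min R (-1) := hw
        show w.im < 0
        linarith [min_le_right R (-1)]
      have := hconv.norm_image_sub_le_of_norm_hasDerivWithin_le (C := ε * C)
        (f := fun w => S w - I * Ψ w) (f' := fun w => (I - B w) / φ w - I * (φ w)⁻¹)
        (fun w hw => ((hSd w (hsub w hw)).sub
          ((hΨ w (hsub w hw)).const_mul I)).hasDerivWithinAt) (fun w hw => ?_)
        (x := (y : ℂ) * I) (y := (y : ℂ) * I + 2) ?_ ?_
      · have hyl : (y : ℂ) * I ∈ lowerPlane := hsub _ (by
          show ((y : ℂ) * I).im < min R (-1)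
          simpa using hy)
        have e : S ((y : ℂ) * I + 2) - I * Ψ ((y : ℂ) * I + 2) -
            (S ((y : ℂ) * I) - I * Ψ ((y : ℂ) * I)) = κ - 2 * I := by
          rw [hΨ2, ← hκ _ hyl]
          ring
        rw [e] at this
        refine this.trans (le_of_eq ?_)
        rw [add_sub_cancel_left]
        simp
        ring
      · have h1 : w.im < min R (-1) := hw
        rw [show (I - B w) / φ w - I * (φ w)⁻¹ = -(B w * (φ w)⁻¹) by
          rw [div_eq_mul_inv]; ring, norm_neg, norm_mul]
        exact mul_le_mul (hR w (h1.trans_le (min_le_left _ _)))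
          (hC w (h1.le.trans (min_le_right _ _))) (norm_nonneg _) hε.le
      · show ((y : ℂ) * I).im < min R (-1)
        simpa using hy
      · show ((y : ℂ) * I + 2).im < min R (-1)
        simpa using hy
    have h0 : ‖κ - 2 * I‖ ≤ 0 := by
      refine le_of_forall_pos_le_add fun ε hε => ?_
      refine (hle (ε / (C * 2 + 1)) (by positivity)).trans ?_
      rw [zero_add, div_mul_eq_mul_div, div_le_iff₀ (by positivity)]
      nlinarith
    exact sub_eq_zero.1 (norm_le_zero_iff.1 h0)
  have hper : ∀ w ∈ lowerPlane, S (w + 2) = S w + 2 * I := fun w hw => by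
    rw [← hκ2, ← hκ w hw]
    ring
  refine ⟨S, hSd, hper, fun w hw => ?_⟩
  have hw' : w - 2 * stripIndex w ∈ lowerPlane := by
    have : w.im < 0 := hw
    show (w - 2 * stripIndex w).im < 0
    simpa using this
  have h1 := hSre _ (sub_stripIndex_mem (lowerPlane_subset_closedLowerPlane hw)) hw'
  have h2 := add_int_period hper (stripIndex w) hw'
  rw [sub_add_cancel] at h2
  show ρ (w - 2 * stripIndex w) = _
  rw [h1, h2]
  simp

end StripWave

/-! ### Transplantation of the flow to the half plane -/

namespace CornerWave.WaterWave
open StripWave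

variable {T : ℝ} (W : WaterWave T) (t : ℝ) (Φ Φz : ℂ → ℂ)

/-- The periodic extension of the inverse Riemann mapping. -/
noncomputable def extInv (w : ℂ) : ℂ := w + perExt (fun w => riemannInv (W.Ω t) Φ w - w) w

/-- The periodic extension of `Φ_z ∘ Φ⁻¹`. -/
noncomputable def extDeriv : ℂ → ℂ := perExt fun w => Φz (riemannInv (W.Ω t) Φ w)

/-- The conjugate velocity in the Riemannian variable. -/
noncomputable def extVel : ℂ → ℂ :=
  perExt fun w => (starRingEnd ℂ) (W.v t (riemannInv (W.Ω t) Φ w))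

/-- The complex derivative of the conjugate velocity in the Riemannian variable. -/
noncomputable def extVelDeriv : ℂ → ℂ :=
  perExt fun w => (starRingEnd ℂ) (W.Dv t (riemannInv (W.Ω t) Φ w) 1)

/-- The time derivative of the conjugate velocity in the Riemannian variable. -/
noncomputable def extAcc : ℂ → ℂ :=
  perExt fun w => (starRingEnd ℂ) (W.vt t (riemannInv (W.Ω t) Φ w))

/-- The sum of the pressure and half the squared speed in the Riemannian variable. -/
noncomputable def extHead : ℂ → ℝ := perExt fun w =>
  W.P t (riemannInv (W.Ω t) Φ w) + ‖W.v t (riemannInv (W.Ω t) Φ w)‖ ^ 2 / 2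

variable {W t Φ Φz} (ht : t ∈ Icc 0 T) (hΦ : IsRiemannMap (W.Ω t) (W.z t) Φ)
  (hΦz : ∀ w ∈ W.Ω t, HasDerivAt Φ (Φz w) w) (hΦz_cont : ContinuousOn Φz (closure (W.Ω t)))

include ht hΦ

/-- Opposite points of the two sides come from mirror points with real parts 1 and -1, which differ
by 2 just as the points themselves do. -/
theorem sidesMatch_inv : SidesMatch fun w => riemannInv (W.Ω t) Φ w - w := by
  intro y hy
  simp only [W.inv_left ht hΦ hy]
  have := W.re_inv_right ht hΦ hy
  apply Complex.ext
  · simp [refl_re, this]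
  · simp [refl_im]

/-- Functions of the fluid region that agree at reflected points of the walls match. -/
theorem sidesMatch_comp {E : Type*} [TopologicalSpace E] [T2Space E] {f : ℂ → E}
    (hf : ContinuousOn f (closure (W.Ω t)))
    (h : ∀ w ∈ closure (W.Ω t), w ∉ W.z t '' I → w.re = 1 → f w = f (refl w)) :
    SidesMatch fun w => f (riemannInv (W.Ω t) Φ w) := by
  refine sidesMatch_of_neg (hf.comp hΦ.continuousOn_inv fun w hw => hΦ.inv_mem hw) fun y hy => ?_
  have hw : (1 + y * Complex.I : ℂ) ∈ closedHalfStrip := ⟨by simp, by simpa using hy.le⟩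
  simp only [W.inv_left ht hΦ hy.le]
  refine h _ (hΦ.inv_mem hw) ?_ (W.re_inv_right ht hΦ hy.le)
  rintro ⟨α, hα, hz⟩
  have := hΦ.surface α hα
  rw [hz, hΦ.apply_inv hw] at this
  simp at this
  exact hy.ne this

omit hΦ in
theorem conj_v_wall {w : ℂ} (hw : w ∈ closure (W.Ω t)) (h : w.re = 1) :
    W.v t w = W.v t (refl w) := by
  rw [W.v_symm t ht w hw, refl_eq_self_of_re (W.wall t ht w hw (by rw [h, abs_one]))]

theorem sidesMatch_vel :
    SidesMatch fun w => (starRingEnd ℂ) (W.v t (riemannInv (W.Ω t) Φ w)) :=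
  sidesMatch_comp (f := fun w => (starRingEnd ℂ) (W.v t w)) ht hΦ
    (Complex.continuous_conj.comp_continuousOn (W.continuousOn_v ht))
    fun w hw _ h => by rw [conj_v_wall ht hw h]

theorem sidesMatch_acc :
    SidesMatch fun w => (starRingEnd ℂ) (W.vt t (riemannInv (W.Ω t) Φ w)) :=
  sidesMatch_comp (f := fun w => (starRingEnd ℂ) (W.vt t w)) ht hΦ
    (Complex.continuous_conj.comp_continuousOn (W.continuousOn_vt ht))
    fun w hw hz h => by
      rw [W.vt_symm ht hw, refl_eq_self_of_re (W.vt_wall_of_notMem ht hw hz (by rw [h, abs_one]))]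

omit hΦ in
theorem continuousOn_head :
    ContinuousOn (fun w => W.P t w + ‖W.v t w‖ ^ 2 / 2) (closure (W.Ω t)) :=
  (W.P_cont t ht).add (((W.continuousOn_v ht).norm.pow 2).div_const 2)

theorem sidesMatch_head : SidesMatch fun w =>
    W.P t (riemannInv (W.Ω t) Φ w) + ‖W.v t (riemannInv (W.Ω t) Φ w)‖ ^ 2 / 2 :=
  sidesMatch_comp (f := fun w => W.P t w + ‖W.v t w‖ ^ 2 / 2) ht hΦ (continuousOn_head ht)
    fun w hw _ h => by rw [conj_v_wall ht hw h, W.P_symm t ht w hw]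

omit ht in
theorem continuousOn_comp_inv {E : Type*} [TopologicalSpace E] {f : ℂ → E}
    (hf : ContinuousOn f (closure (W.Ω t))) :
    ContinuousOn (fun w => f (riemannInv (W.Ω t) Φ w)) closedHalfStrip :=
  hf.comp hΦ.continuousOn_inv fun _ hw => hΦ.inv_mem hw

theorem extInv_eq {w : ℂ} (hw : w ∈ closedHalfStrip) : W.extInv t Φ w = riemannInv (W.Ω t) Φ w := by
  rw [extInv, perExt_eq_self_of_sidesMatch (sidesMatch_inv ht hΦ) hw]
  ring

omit ht hΦ in
theorem extInv_add_two (w : ℂ) : W.extInv t Φ (w + 2) = W.extInv t Φ w + 2 := by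
  rw [extInv, perExt_add_two, extInv]
  ring

theorem continuousOn_extInv : ContinuousOn (W.extInv t Φ) closedLowerPlane :=
  continuousOn_id.add (continuousOn_perExt (hΦ.continuousOn_inv.sub continuousOn_id)
    (sidesMatch_inv ht hΦ))

theorem continuousOn_velDeriv : ContinuousOn
    (fun w => (starRingEnd ℂ) (W.Dv t (riemannInv (W.Ω t) Φ w) 1)) closedHalfStrip :=
  continuousOn_comp_inv (f := fun w => (starRingEnd ℂ) (W.Dv t w 1)) hΦ
    (Complex.continuous_conj.comp_continuousOn ((W.Dv_cont t ht).clm_apply continuousOn_const))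

theorem norm_extAcc_le {ε : ℝ} (hε : 0 < ε) :
    ∃ R : ℝ, ∀ w : ℂ, w.im < R → ‖W.extAcc t Φ w‖ ≤ ε := by
  obtain ⟨R, hR⟩ := W.tendsto_vt ht hε
  obtain ⟨R', hR'⟩ := W.exists_im_inv_lt ht hΦ R
  refine ⟨min R' 0, fun w hw => ?_⟩
  have hwl : w ∈ closedLowerPlane := (hw.trans_le (min_le_right _ _)).le
  have hw' := sub_stripIndex_mem hwl
  simp only [extAcc, perExt, RCLike.norm_conj]
  refine (hR _ (hΦ.inv_mem hw') (hR' _ hw' ?_)).le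
  have := hw.trans_le (min_le_left _ _)
  simpa using this

include hΦz

theorem differentiableOn_comp_inv {f : ℂ → ℂ} (hf : DifferentiableOn ℂ f (W.Ω t)) :
    DifferentiableOn ℂ (fun w => f (riemannInv (W.Ω t) Φ w)) openHalfStrip :=
  hf.comp (fun _ hw => (hΦ.deriv_ne_zero_and_hasDerivAt_inv (W.Ω_open t ht) hΦz
    hw).2.differentiableAt.differentiableWithinAt) fun _ hw => hΦ.inv_mem_inside hw

theorem differentiableOn_extInv : DifferentiableOn ℂ (W.extInv t Φ) lowerPlane := by
  refine differentiableOn_id.add (differentiableOn_perExt (hΦ.continuousOn_inv.sub continuousOn_id)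
    (sidesMatch_inv ht hΦ) ?_)
  exact (differentiableOn_comp_inv ht hΦ hΦz differentiableOn_id).sub differentiableOn_id

theorem hasDerivAt_extInv_inside {w : ℂ} (hw : w ∈ openHalfStrip) :
    HasDerivAt (W.extInv t Φ) (Φz (riemannInv (W.Ω t) Φ w))⁻¹ w := by
  refine (hΦ.deriv_ne_zero_and_hasDerivAt_inv (W.Ω_open t ht) hΦz hw).2.congr_of_eventuallyEq ?_
  filter_upwards [isOpen_openHalfStrip.mem_nhds hw] with ζ hζ
  exact extInv_eq ht hΦ (openHalfStrip_subset_closedHalfStrip hζ)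

theorem differentiableOn_extVel : DifferentiableOn ℂ (W.extVel t Φ) lowerPlane :=
  differentiableOn_perExt (continuousOn_comp_inv (f := fun w => (starRingEnd ℂ) (W.v t w)) hΦ
    (Complex.continuous_conj.comp_continuousOn (W.continuousOn_v ht))) (sidesMatch_vel ht hΦ)
    (differentiableOn_comp_inv ht hΦ hΦz (W.differentiableOn_conj_v ht))

theorem differentiableOn_extAcc : DifferentiableOn ℂ (W.extAcc t Φ) lowerPlane :=
  differentiableOn_perExt (continuousOn_comp_inv (f := fun w => (starRingEnd ℂ) (W.vt t w)) hΦ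
    (Complex.continuous_conj.comp_continuousOn (W.continuousOn_vt ht))) (sidesMatch_acc ht hΦ)
    (differentiableOn_comp_inv ht hΦ hΦz (W.differentiableOn_conj_vt ht))

theorem deriv_mul_inside {w : ℂ} (hw : w ∈ openHalfStrip) :
    Φz (riemannInv (W.Ω t) Φ w) * deriv (W.extInv t Φ) w = 1 := by
  rw [(hasDerivAt_extInv_inside ht hΦ hΦz hw).deriv]
  exact mul_inv_cancel₀ (hΦ.deriv_ne_zero_and_hasDerivAt_inv (W.Ω_open t ht) hΦz hw).1

theorem deriv_mul_vel_inside {w : ℂ} (hw : w ∈ openHalfStrip) :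
    Φz (riemannInv (W.Ω t) Φ w) * deriv (W.extVel t Φ) w =
      (starRingEnd ℂ) (W.Dv t (riemannInv (W.Ω t) Φ w) 1) := by
  obtain ⟨h1, h2⟩ := hΦ.deriv_ne_zero_and_hasDerivAt_inv (W.Ω_open t ht) hΦz hw
  have h3 := (W.hasDerivAt_conj_v ht (hΦ.inv_mem_inside hw)).comp w h2
  have h4 : W.extVel t Φ =ᶠ[𝓝 w] (fun w => (starRingEnd ℂ) (W.v t w)) ∘ riemannInv (W.Ω t) Φ := by
    filter_upwards [isOpen_openHalfStrip.mem_nhds hw] with ζ hζ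
    exact perExt_eq_self_of_sidesMatch (sidesMatch_vel ht hΦ)
      (openHalfStrip_subset_closedHalfStrip hζ)
  rw [h4.deriv_eq, h3.deriv]
  field_simp

include hΦz_cont

/-- The extended inverse mapping is already holomorphic across the walls, so its derivative agrees
on both sides; by continuity Φ_z times this derivative is 1 on each of them. -/
theorem sidesMatch_deriv : SidesMatch fun w => Φz (riemannInv (W.Ω t) Φ w) := by
  refine sidesMatch_of_neg (continuousOn_comp_inv hΦ hΦz_cont) fun y hy => ?_
  obtain ⟨h1, h2⟩ := wall_identity (m := fun _ => 1) (differentiableOn_extInv ht hΦ hΦz)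
    (fun w _ => extInv_add_two w) (continuousOn_comp_inv hΦ hΦz_cont) continuousOn_const
    (fun w hw => deriv_mul_inside ht hΦ hΦz hw) hy
  exact mul_right_cancel₀ (right_ne_zero_of_mul_eq_one h1) (h1.trans h2.symm)

/-- The space derivative of the conjugate velocity equals Φ_z∘Ψ times G', and both factors are known
to agree on the two sides. -/
theorem sidesMatch_velDeriv :
    SidesMatch fun w => (starRingEnd ℂ) (W.Dv t (riemannInv (W.Ω t) Φ w) 1) := by
  refine sidesMatch_of_neg (continuousOn_velDeriv ht hΦ) fun y hy => ?_
  obtain ⟨h1, h2⟩ := wall_identity (c := 0) (differentiableOn_extVel ht hΦ hΦz)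
    (fun _ _ => by rw [extVel, perExt_add_two, add_zero]) (continuousOn_comp_inv hΦ hΦz_cont)
    (continuousOn_velDeriv ht hΦ) (fun w hw => deriv_mul_vel_inside ht hΦ hΦz hw) hy
  rw [← h1, ← h2]
  have := sidesMatch_deriv ht hΦ hΦz hΦz_cont y hy.le
  exact congrArg (· * _) this

theorem extDeriv_mul {w : ℂ} (hw : w ∈ lowerPlane) :
    W.extDeriv t Φ Φz w * deriv (W.extInv t Φ) w = 1 :=
  perExt_identity (m := fun _ => 1) (differentiableOn_extInv ht hΦ hΦz)
    (fun w _ => extInv_add_two w) (continuousOn_comp_inv hΦ hΦz_cont) continuousOn_const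
    (fun _ hw => deriv_mul_inside ht hΦ hΦz hw) hw

theorem extDeriv_mul_vel {w : ℂ} (hw : w ∈ lowerPlane) :
    W.extDeriv t Φ Φz w * deriv (W.extVel t Φ) w = W.extVelDeriv t Φ w :=
  perExt_identity (c := 0) (differentiableOn_extVel ht hΦ hΦz)
    (fun _ _ => by rw [extVel, perExt_add_two, add_zero]) (continuousOn_comp_inv hΦ hΦz_cont)
    (continuousOn_velDeriv ht hΦ) (fun w hw => deriv_mul_vel_inside ht hΦ hΦz hw) hw

theorem hasDerivAt_extInv {w : ℂ} (hw : w ∈ lowerPlane) :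
    HasDerivAt (W.extInv t Φ) (W.extDeriv t Φ Φz w)⁻¹ w := by
  have h1 := ((differentiableOn_extInv ht hΦ hΦz).differentiableAt
    (isOpen_lowerPlane.mem_nhds hw)).hasDerivAt
  rwa [eq_inv_of_mul_eq_one_right (extDeriv_mul ht hΦ hΦz hΦz_cont hw)] at h1

/-- Modulo the period, w and its image both have real part in [-1, 1], so the real part of Ψ(w) - w
is at most 2 in modulus, and Borel–Carathéodory bounds the derivative 1/φ - 1. -/
theorem exists_norm_extDeriv_inv_le :
    ∃ C, ∀ w : ℂ, w.im ≤ -1 → ‖(W.extDeriv t Φ Φz w)⁻¹‖ ≤ C := by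
  refine ⟨16 * 2 + 1, fun w hw => ?_⟩
  have hwl : w ∈ lowerPlane := by
    show w.im < 0
    linarith
  have hd : DifferentiableOn ℂ (fun w => W.extInv t Φ w - w) lowerPlane :=
    (differentiableOn_extInv ht hΦ hΦz).sub differentiableOn_id
  have h1 := norm_deriv_le_of_abs_re_le (M := 2) two_pos hd (fun w hw => by
    have hw' := sub_stripIndex_mem (lowerPlane_subset_closedLowerPlane hw)
    have h2 := abs_le.1 (W.abs_re_le ht (hΦ.inv_mem hw'))
    have h3 := abs_le.1 hw'.1
    simp only [extInv, add_sub_cancel_left, perExt, Complex.sub_re] at h2 h3 ⊢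
    rw [abs_le]
    constructor <;> linarith) hw
  have h2 : deriv (fun w => W.extInv t Φ w - w) w = (W.extDeriv t Φ Φz w)⁻¹ - 1 :=
    ((hasDerivAt_extInv ht hΦ hΦz hΦz_cont hwl).sub (hasDerivAt_id w)).deriv
  rw [h2] at h1
  calc ‖(W.extDeriv t Φ Φz w)⁻¹‖ = ‖((W.extDeriv t Φ Φz w)⁻¹ - 1) + 1‖ := by rw [sub_add_cancel]
    _ ≤ _ := (norm_add_le _ _).trans (by rw [norm_one]; linarith)

/-- Bernoulli's law: for an irrotational flow v·∇v is the gradient of |v|²/2, so P + |v|²/2 has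
gradient -i - v_t, whose conjugate is holomorphic. The factor 1/φ comes from the change of
variables. -/
theorem hasFDerivAt_head {w : ℂ} (hw : w ∈ openHalfStrip) :
    HasFDerivAt (fun w => W.P t (riemannInv (W.Ω t) Φ w) + ‖W.v t (riemannInv (W.Ω t) Φ w)‖ ^ 2 / 2)
      (Complex.reCLM.comp (((Complex.I - W.extAcc t Φ w) / W.extDeriv t Φ Φz w) •
        (1 : ℂ →L[ℝ] ℂ))) w := by
  set ζ := riemannInv (W.Ω t) Φ w with hζ
  have hζΩ : ζ ∈ W.Ω t := hΦ.inv_mem_inside hw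
  have h1 : HasFDerivAt (fun ζ => W.P t ζ + ‖W.v t ζ‖ ^ 2 / 2) (Complex.reCLM.comp
      ((Complex.I - (starRingEnd ℂ) (W.vt t ζ)) • (1 : ℂ →L[ℝ] ℂ))) ζ := by
    have hP := (W.P_deriv t ht ζ hζΩ).hasFDerivAt
    have hv := (W.v_deriv_space t ht ζ hζΩ).norm_sq.mul_const ((2 : ℝ)⁻¹)
    have := hP.add hv
    refine (this.congr_fderiv ?_)
    ext1 u
    have e1 := W.conj_gradP ht (subset_closure hζΩ)
    have e2 := W.Dv_apply ht hζΩ u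
    have e3 : ((starRingEnd ℂ) (W.gradP t ζ) * u).re + (W.v t ζ * (starRingEnd ℂ) (W.Dv t ζ u)).re
        = ((Complex.I - (starRingEnd ℂ) (W.vt t ζ)) * u).re := by
      rw [e1, e2, ← Complex.add_re]
      congr 1
      ring
    have e4 : inner ℝ (W.gradP t ζ) u = ((starRingEnd ℂ) (W.gradP t ζ) * u).re := by
      rw [Complex.inner, mul_comm]
    have e5 : inner ℝ (W.v t ζ) (W.Dv t ζ u) = (W.v t ζ * (starRingEnd ℂ) (W.Dv t ζ u)).re := by
      rw [Complex.inner]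
      simp
      ring
    simp [e4, e5] at e3 ⊢
    linarith
  have h2 := (hΦ.deriv_ne_zero_and_hasDerivAt_inv (W.Ω_open t ht) hΦz hw).2.complexToReal_fderiv
  have h3 := h1.comp w h2
  refine h3.congr_fderiv ?_
  have hcl := openHalfStrip_subset_closedHalfStrip hw
  have e6 : W.extAcc t Φ w = (starRingEnd ℂ) (W.vt t ζ) :=
    perExt_eq_self_of_sidesMatch (sidesMatch_acc ht hΦ) hcl
  have e7 : W.extDeriv t Φ Φz w = Φz ζ :=
    perExt_eq_self_of_sidesMatch (sidesMatch_deriv ht hΦ hΦz hΦz_cont) hcl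
  rw [e6, e7]
  ext1 u
  show (((Complex.I - (starRingEnd ℂ) (W.vt t ζ)) • ((Φz ζ)⁻¹ • u)).re) =
    (((Complex.I - (starRingEnd ℂ) (W.vt t ζ)) / Φz ζ) • u).re
  simp only [smul_eq_mul]
  congr 1
  ring

/-- The flow at a fixed time, in the Riemannian variable. -/
theorem exists_stripData (hZ : AbsolutelyContinuousOnInterval (W.Z t Φ) (-1) 1) :
    ∃ S : ℂ → ℂ, StripData (W.extInv t Φ) (W.extDeriv t Φ Φz) (W.extVel t Φ) (W.extVelDeriv t Φ)
      (W.extAcc t Φ) S (W.extHead t Φ) := by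
  have hv : ContinuousOn (fun w => (starRingEnd ℂ) (W.v t (riemannInv (W.Ω t) Φ w)))
      closedHalfStrip :=
    continuousOn_comp_inv (f := fun w => (starRingEnd ℂ) (W.v t w)) hΦ
      (Complex.continuous_conj.comp_continuousOn (W.continuousOn_v ht))
  have hvt : ContinuousOn (fun w => (starRingEnd ℂ) (W.vt t (riemannInv (W.Ω t) Φ w)))
      closedHalfStrip :=
    continuousOn_comp_inv (f := fun w => (starRingEnd ℂ) (W.vt t w)) hΦ
      (Complex.continuous_conj.comp_continuousOn (W.continuousOn_vt ht))
  have hhead := continuousOn_comp_inv hΦ (continuousOn_head ht)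
  have hbd : ∀ f : ℂ → ℂ, (∃ R : ℝ, ∀ w ∈ closure (W.Ω t), w.im < R → ‖f w‖ ≤ 1) →
      ∃ R : ℝ, ∀ w ∈ closedHalfStrip, w.im < R →
        ‖(starRingEnd ℂ) (f (riemannInv (W.Ω t) Φ w))‖ ≤ 1 := by
    rintro f ⟨R, hR⟩
    obtain ⟨R', hR'⟩ := W.exists_im_inv_lt ht hΦ R
    exact ⟨R', fun w hw h => by
      rw [RCLike.norm_conj]
      exact hR _ (hΦ.inv_mem hw) (hR' w hw h)⟩
  obtain ⟨S, hS1, hS2, hS3⟩ := exists_primitive_with_re (φ := W.extDeriv t Φ Φz)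
    (B := W.extAcc t Φ) (Ψ := W.extInv t Φ)
    (fun w hw => hasDerivAt_extInv ht hΦ hΦz hΦz_cont hw) extInv_add_two
    (perExt_add_two _) (exists_norm_extDeriv_inv_le ht hΦ hΦz hΦz_cont)
    (differentiableOn_extAcc ht hΦ hΦz) (perExt_add_two _)
    (fun ε hε => norm_extAcc_le ht hΦ hε) hhead
    (fun w hw => hasFDerivAt_head ht hΦ hΦz hΦz_cont hw)
  refine ⟨S, ?_⟩
  exact
    { Ψ_cont := continuousOn_extInv ht hΦ
      Ψ_add_two := extInv_add_two
      Ψ_deriv := fun w hw => hasDerivAt_extInv ht hΦ hΦz hΦz_cont hw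
      Ψ_ac := hZ.congr' fun x hx => by
        rw [uIcc_of_le (by norm_num)] at hx
        show W.extInv t Φ x = _
        rw [extInv_eq ht hΦ (ofReal_mem_closedHalfStrip hx), W.inv_eq_Z ht hΦ hx]
      φ_cont := continuousOn_perExt (continuousOn_comp_inv hΦ hΦz_cont)
        (sidesMatch_deriv ht hΦ hΦz hΦz_cont)
      φ_add_two := perExt_add_two _
      φ_ne := fun w hw => left_ne_zero_of_mul_eq_one (extDeriv_mul ht hΦ hΦz hΦz_cont hw)
      φ_inv_bdd := exists_norm_extDeriv_inv_le ht hΦ hΦz hΦz_cont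
      G_cont := continuousOn_perExt hv (sidesMatch_vel ht hΦ)
      G_add_two := perExt_add_two _
      G_deriv := fun w hw => by
        have h1 := ((differentiableOn_extVel ht hΦ hΦz).differentiableAt
          (isOpen_lowerPlane.mem_nhds hw)).hasDerivAt
        have h2 := extDeriv_mul_vel ht hΦ hΦz hΦz_cont hw
        have h3 := left_ne_zero_of_mul_eq_one (extDeriv_mul ht hΦ hΦz hΦz_cont hw)
        rwa [← h2, mul_div_cancel_left₀ _ h3]
      G_bdd := exists_bound_of_decay hv (hbd _ (W.decay_closure ht one_pos))
      D_cont := continuousOn_perExt (continuousOn_velDeriv ht hΦ)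
        (sidesMatch_velDeriv ht hΦ hΦz hΦz_cont)
      D_add_two := perExt_add_two _
      B_cont := continuousOn_perExt hvt (sidesMatch_acc ht hΦ)
      B_add_two := perExt_add_two _
      B_bdd := by
        obtain ⟨R, hR⟩ := W.tendsto_vt ht one_pos
        obtain ⟨C, hC⟩ := exists_bound_of_decay hvt (hbd _ ⟨R, fun w hw h => (hR w hw h).le⟩)
        refine ⟨C, fun w hw => hC w ?_⟩
        show w.im ≤ 0
        linarith
      S_deriv := hS1
      S_add_two := hS2
      ρ_cont := continuousOn_perExt hhead (sidesMatch_head ht hΦ)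
      ρ_eq := hS3
      ρ_top := fun x => by
        have hw := sub_stripIndex_mem (w := (x : ℂ)) (ofReal_mem_closedLowerPlane x)
        have e : (x : ℂ) - 2 * stripIndex (x : ℂ) = ((x - 2 * stripIndex (x : ℂ) : ℝ) : ℂ) := by
          push_cast
          rfl
        have hxI : x - 2 * stripIndex (x : ℂ) ∈ I := by
          have := abs_le.1 hw.1
          rw [e, Complex.ofReal_re] at this
          exact this
        simp only [extHead, extVel, perExt, RCLike.norm_conj]
        rw [e, W.inv_eq_Z ht hΦ hxI, Z, W.P_surface t ht _ (W.hinv_mem ht hΦ hxI), zero_add] }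

end CornerWave.WaterWave


/-! ### Tangents, the Taylor coefficient and A₁ in Lagrangian terms -/

/-- The slopes of z are those of Ψ times those of h. The latter are positive reals, so their limit
d/g is real and nonnegative; differentiability of h is a conclusion. The set s allows one-sided
tangents. -/
theorem HasDerivWithinAt.nonneg_quotient {z Ψ : ℝ → ℂ} {h : ℝ → ℝ} {s : Set ℝ} {α : ℝ} {d g : ℂ}
    (hz : HasDerivWithinAt z d s α) (hα : α ∈ s) (hΨ : HasDerivAt Ψ g (h α)) (hg : g ≠ 0)
    (hh : StrictMonoOn h s) (hc : ContinuousWithinAt h s α) (hzΨ : ∀ β ∈ s, z β = Ψ (h β))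
    [hne : (𝓝[s \ {α}] α).NeBot] :
    HasDerivWithinAt h (d / g).re s α ∧ (d / g).im = 0 ∧ 0 ≤ (d / g).re := by
  have hh' : Tendsto h (𝓝[s \ {α}] α) (𝓝[≠] (h α)) := by
    refine tendsto_nhdsWithin_iff.2 ⟨hc.tendsto.mono_left (nhdsWithin_mono _ sdiff_subset), ?_⟩
    filter_upwards [self_mem_nhdsWithin] with β hβ hc
    exact hβ.2 (hh.injOn hβ.1 hα hc)
  have h1 : Tendsto (slope z α) (𝓝[s \ {α}] α) (𝓝 d) := hasDerivWithinAt_iff_tendsto_slope.1 hz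
  have h2 : Tendsto (fun β => slope Ψ (h α) (h β)) (𝓝[s \ {α}] α) (𝓝 g) :=
    (hasDerivAt_iff_tendsto_slope.1 hΨ).comp hh'
  have h3 : Tendsto (fun β => ((slope h α β : ℝ) : ℂ)) (𝓝[s \ {α}] α) (𝓝 (d / g)) := by
    refine (h1.div h2 hg).congr' ?_
    filter_upwards [self_mem_nhdsWithin, h2.eventually_ne hg] with β hβ hs
    rw [Pi.div_apply, div_eq_iff hs]
    have e1 : β - α ≠ 0 := sub_ne_zero.2 hβ.2
    have e2 : h β - h α ≠ 0 := sub_ne_zero.2 fun hc => hβ.2 (hh.injOn hβ.1 hα hc)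
    have e1' : ((β - α : ℝ) : ℂ) ≠ 0 := by exact_mod_cast e1
    have e2' : ((h β - h α : ℝ) : ℂ) ≠ 0 := by exact_mod_cast e2
    rw [slope_def_field, slope_def_module, slope_def_module, hzΨ β hβ.1, hzΨ α hα,
      Complex.real_smul, Complex.real_smul, Complex.ofReal_inv, Complex.ofReal_inv,
      Complex.ofReal_div]
    field_simp
  have h4 : Tendsto (fun β => slope h α β) (𝓝[s \ {α}] α) (𝓝 (d / g).re) :=
    (Complex.continuous_re.tendsto _).comp h3
  refine ⟨hasDerivWithinAt_iff_tendsto_slope.2 h4, ?_, ?_⟩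
  · have h5 : Tendsto (fun _ : ℝ => (0 : ℝ)) (𝓝[s \ {α}] α) (𝓝 (d / g).im) :=
      (Complex.continuous_im.tendsto _).comp h3
    exact (tendsto_nhds_unique h5 tendsto_const_nhds)
  · refine ge_of_tendsto h4 ?_
    filter_upwards [self_mem_nhdsWithin] with β hβ
    rw [slope_def_field]
    rcases lt_or_gt_of_ne hβ.2 with hlt | hgt
    · exact div_nonneg_of_nonpos (sub_nonpos.2 (hh hβ.1 hα hlt).le) (by linarith)
    · exact div_nonneg (sub_nonneg.2 (hh hα hβ.1 hgt).le) (by linarith)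

namespace CornerWave.WaterWave
open StripWave

theorem nhdsWithin_Icc_sdiff_neBot {p q α : ℝ} (hpq : p < q) (hα : α ∈ Icc p q) :
    (𝓝[Icc p q \ {α}] α).NeBot :=
  accPt_principal_iff_nhdsWithin.1 ((uniqueDiffOn_Icc hpq α hα).accPt)

variable {T : ℝ} {W : WaterWave T} {t : ℝ} {Φ Φz : ℂ → ℂ} (ht : t ∈ Icc 0 T)
  (hΦ : IsRiemannMap (W.Ω t) (W.z t) Φ)
  (hΦz : ∀ w ∈ W.Ω t, HasDerivAt Φ (Φz w) w) (hΦz_cont : ContinuousOn Φz (closure (W.Ω t)))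

section
include ht hΦ

theorem extInv_h {α : ℝ} (hα : α ∈ I) : W.extInv t Φ (W.h t Φ α) = W.z t α := by
  rw [extInv_eq ht hΦ (ofReal_mem_closedHalfStrip (W.h_mem ht hΦ hα)), W.inv_h ht hΦ hα]

theorem extVel_h {α : ℝ} (hα : α ∈ I) :
    W.extVel t Φ (W.h t Φ α) = (starRingEnd ℂ) (W.v t (W.z t α)) := by
  rw [extVel, perExt_eq_self_of_sidesMatch (sidesMatch_vel ht hΦ)
    (ofReal_mem_closedHalfStrip (W.h_mem ht hΦ hα)), W.inv_h ht hΦ hα]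

theorem extVel_eq {x : ℝ} (hx : x ∈ I) : W.extVel t Φ x = (starRingEnd ℂ) (W.Zt t Φ x) := by
  conv_lhs => rw [← W.h_hinv ht hΦ hx]
  exact extVel_h ht hΦ (W.hinv_mem ht hΦ hx)

theorem extInv_eq_Z {x : ℝ} (hx : x ∈ I) : W.extInv t Φ x = W.Z t Φ x := by
  conv_lhs => rw [← W.h_hinv ht hΦ hx]
  exact extInv_h ht hΦ (W.hinv_mem ht hΦ hx)

include hΦz hΦz_cont

theorem extDeriv_h {α : ℝ} (hα : α ∈ I) : W.extDeriv t Φ Φz (W.h t Φ α) = Φz (W.z t α) := by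
  rw [extDeriv, perExt_eq_self_of_sidesMatch (sidesMatch_deriv ht hΦ hΦz hΦz_cont)
    (ofReal_mem_closedHalfStrip (W.h_mem ht hΦ hα)), W.inv_h ht hΦ hα]

theorem conjGrad_h {α : ℝ} (hα : α ∈ I) :
    conjGrad (W.extVel t Φ) (W.extVelDeriv t Φ) (W.extAcc t Φ) (W.h t Φ α) =
      (starRingEnd ℂ) (W.gradP t (W.z t α)) := by
  have hw := ofReal_mem_closedHalfStrip (W.h_mem ht hΦ hα)
  rw [W.conj_gradP ht (W.z_mem_closure ht hα), conjGrad, extVel_h ht hΦ hα, Complex.conj_conj,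
    extVelDeriv, perExt_eq_self_of_sidesMatch (sidesMatch_velDeriv ht hΦ hΦz hΦz_cont) hw,
    extAcc, perExt_eq_self_of_sidesMatch (sidesMatch_acc ht hΦ) hw, W.inv_h ht hΦ hα]

theorem norm_conjGrad_h {α : ℝ} (hα : α ∈ I) :
    ‖conjGrad (W.extVel t Φ) (W.extVelDeriv t Φ) (W.extAcc t Φ) (W.h t Φ α)‖ =
      ‖W.gradP t (W.z t α)‖ := by
  rw [conjGrad_h ht hΦ hΦz hΦz_cont hα, RCLike.norm_conj]

end

variable {S : ℂ → ℂ} (H : StripData (W.extInv t Φ) (W.extDeriv t Φ Φz) (W.extVel t Φ)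
  (W.extVelDeriv t Φ) (W.extAcc t Φ) S (W.extHead t Φ))

include ht hΦ hΦz hΦz_cont H

theorem norm_Φz_le {α : ℝ} (hα : α ∈ I) : ‖Φz (W.z t α)‖ ≤ ‖W.gradP t (W.z t α)‖ := by
  rw [← extDeriv_h ht hΦ hΦz hΦz_cont hα, ← norm_conjGrad_h ht hΦ hΦz hΦz_cont hα]
  exact H.norm_φ_le _

/-- Where the pressure gradient does not vanish, every one-sided tangent of the surface is
orthogonal to it, with the fluid on the right-hand side. -/
theorem eq_of_hasDerivWithinAt {α : ℝ} {s : Set ℝ} (hα : α ∈ s) (hs : s ⊆ I) {d : ℂ}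
    (hd : HasDerivWithinAt (W.z t) d s α) (hne : (𝓝[s \ {α}] α).NeBot)
    (hQ : W.gradP t (W.z t α) ≠ 0) :
    d = ‖d‖ * (Complex.I * W.gradP t (W.z t α) / ‖W.gradP t (W.z t α)‖) := by
  set Q := W.gradP t (W.z t α) with hQdef
  set e₀ : ℂ := Complex.I * Q / ‖Q‖ with he₀
  have hQn : (‖Q‖ : ℂ) ≠ 0 := by simpa using hQ
  have hnorm : ‖e₀‖ = 1 := by
    rw [he₀, norm_div, norm_mul, Complex.norm_I, one_mul, Complex.norm_real, norm_norm]
    exact div_self (by simpa using hQ)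
  have hslope : Tendsto (slope (W.z t) α) (𝓝[s \ {α}] α) (𝓝 d) :=
    hasDerivWithinAt_iff_tendsto_slope.1 hd
  -- The chord inequality of `direction`, divided by |β - α|. Chords are oriented by increasing h,
  -- which is also increasing α, so both cases of the order of β and α lead to the same slope.
  have hle : ∀ δ : ℝ, 0 < δ → δ ≤ 1 → (1 - δ) * ‖d‖ ≤ ((starRingEnd ℂ) e₀ * d).re := by
    intro δ hδ hδ1
    have hc : conjGrad (W.extVel t Φ) (W.extVelDeriv t Φ) (W.extAcc t Φ) (W.h t Φ α) ≠ 0 := by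
      rw [conjGrad_h ht hΦ hΦz hΦz_cont (hs hα)]
      simpa using hQ
    obtain ⟨r, hr, key⟩ := H.direction hc hδ hδ1
    rw [conjGrad_h ht hΦ hΦz hΦz_cont (hs hα), Complex.conj_conj, RCLike.norm_conj] at key
    have hnear : ∀ᶠ β in 𝓝[s \ {α}] α, W.h t Φ β ∈ Metric.ball (W.h t Φ α) r :=
      ((W.continuousOn_h ht hΦ α (hs hα)).tendsto.mono_left
        (nhdsWithin_mono _ (sdiff_subset.trans hs))).eventually (Metric.ball_mem_nhds _ hr)
    refine le_of_tendsto_of_tendsto (hslope.norm.const_mul (1 - δ))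
      ((Complex.continuous_re.tendsto _).comp (hslope.const_mul ((starRingEnd ℂ) e₀))) ?_
    filter_upwards [hnear, self_mem_nhdsWithin] with β hβ hβs
    have hβr := abs_lt.1 (show |W.h t Φ β - W.h t Φ α| < r by
      simpa [Real.dist_eq] using hβ)
    have hpos : 0 < |β - α| := abs_pos.2 (sub_ne_zero.2 hβs.2)
    suffices hsuff : (1 - δ) * (|β - α| * ‖slope (W.z t) α β‖) ≤
        |β - α| * ((starRingEnd ℂ) e₀ * slope (W.z t) α β).re by
      have : |β - α| * ((1 - δ) * ‖slope (W.z t) α β‖) ≤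
        |β - α| * ((starRingEnd ℂ) e₀ * slope (W.z t) α β).re := by linarith
      exact le_of_mul_le_mul_left this hpos
    have hsl : ((β - α : ℝ) : ℂ) * slope (W.z t) α β = W.z t β - W.z t α := by
      have : ((β - α : ℝ) : ℂ) ≠ 0 := by exact_mod_cast sub_ne_zero.2 hβs.2
      rw [slope_def_module, Complex.real_smul, Complex.ofReal_inv, mul_inv_cancel_left₀ this]
    have hre : ((starRingEnd ℂ) e₀ * (((|β - α| : ℝ) : ℂ) * slope (W.z t) α β)).re =
        |β - α| * ((starRingEnd ℂ) e₀ * slope (W.z t) α β).re := by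
      rw [mul_left_comm, Complex.re_ofReal_mul]
    rcases lt_or_gt_of_ne hβs.2 with hlt | hgt
    · have hm := W.strictMonoOn_h ht hΦ (hs hβs.1) (hs hα) hlt
      have hk := key (W.h t Φ β) (W.h t Φ α) (by linarith) hm.le (by linarith)
      rw [extInv_h ht hΦ (hs hα), extInv_h ht hΦ (hs hβs.1)] at hk
      have e : W.z t α - W.z t β = ((|β - α| : ℝ) : ℂ) * slope (W.z t) α β := by
        rw [abs_of_neg (by linarith), Complex.ofReal_neg, neg_mul, hsl]
        ring
      change (1 - δ) * _ ≤ ((starRingEnd ℂ) e₀ * _).re at hk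
      rwa [e, hre, norm_mul, Complex.norm_real, Real.norm_eq_abs, abs_abs] at hk
    · have hm := W.strictMonoOn_h ht hΦ (hs hα) (hs hβs.1) hgt
      have hk := key (W.h t Φ α) (W.h t Φ β) (by linarith) hm.le (by linarith)
      rw [extInv_h ht hΦ (hs hα), extInv_h ht hΦ (hs hβs.1)] at hk
      have e : W.z t β - W.z t α = ((|β - α| : ℝ) : ℂ) * slope (W.z t) α β := by
        rw [abs_of_pos (by linarith), hsl]
      change (1 - δ) * _ ≤ ((starRingEnd ℂ) e₀ * _).re at hk
      rwa [e, hre, norm_mul, Complex.norm_real, Real.norm_eq_abs, abs_abs] at hk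
  have h1 : ‖d‖ ≤ ((starRingEnd ℂ) e₀ * d).re := by
    have hlim : Tendsto (fun δ : ℝ => (1 - δ) * ‖d‖) (𝓝[>] 0) (𝓝 ((1 - 0) * ‖d‖)) :=
      ((by fun_prop : Continuous fun δ : ℝ => (1 - δ) * ‖d‖).tendsto 0).mono_left nhdsWithin_le_nhds
    rw [sub_zero, one_mul] at hlim
    refine le_of_tendsto hlim ?_
    filter_upwards [Ioc_mem_nhdsGT (zero_lt_one (α := ℝ))] with δ hδ using hle δ hδ.1 hδ.2
  have h2 : ‖(starRingEnd ℂ) e₀ * d‖ = ‖d‖ := by rw [norm_mul, RCLike.norm_conj, hnorm, one_mul]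
  -- With δ → 0 the real part is at least the modulus, which forces the number to be real and
  -- nonnegative.
  have h3 : (starRingEnd ℂ) e₀ * d = ‖d‖ := by
    have h4 : ((starRingEnd ℂ) e₀ * d).re = ‖(starRingEnd ℂ) e₀ * d‖ :=
      le_antisymm (Complex.re_le_norm _) (h2.le.trans h1)
    have h5 := Complex.re_eq_norm.1 h4
    rw [Complex.eq_re_of_ofReal_le h5, h4, h2]
  have h6 : e₀ * (starRingEnd ℂ) e₀ = 1 := by
    rw [Complex.mul_conj, Complex.normSq_eq_norm_sq, hnorm]
    simp
  calc d = e₀ * (starRingEnd ℂ) e₀ * d := by rw [h6, one_mul]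
    _ = _ := by rw [mul_assoc, h3, mul_comm]

theorem regular_direction {α : ℝ} (h : W.IsRegularPoint t α) (hQ : W.gradP t (W.z t α) ≠ 0) :
    W.normal t α = -(W.gradP t (W.z t α) / ‖W.gradP t (W.z t α)‖) := by
  have hd := eq_of_hasDerivWithinAt ht hΦ hΦz hΦz_cont H h.1 Subset.rfl
    h.2.1.hasDerivWithinAt (nhdsWithin_Icc_sdiff_neBot (by norm_num) h.1) hQ
  have hne : (‖W.zα t α‖ : ℂ) ≠ 0 := by simpa using h.2.2
  have hd' : W.zα t α = ‖W.zα t α‖ *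
      (Complex.I * W.gradP t (W.z t α) / ‖W.gradP t (W.z t α)‖) := hd
  rw [normal, div_eq_iff hne]
  conv_lhs => rw [hd']
  linear_combination (‖W.zα t α‖ : ℂ) * W.gradP t (W.z t α) / ‖W.gradP t (W.z t α)‖ *
    Complex.I_mul_I

theorem neg_dPdn_eq {α : ℝ} (h : W.IsRegularPoint t α) :
    -W.dPdn t α = ‖W.gradP t (W.z t α)‖ := by
  by_cases hQ : W.gradP t (W.z t α) = 0
  · simp [dPdn, hQ]
  · have hn : ‖W.gradP t (W.z t α)‖ ≠ 0 := by simpa using hQ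
    rw [dPdn, regular_direction ht hΦ hΦz hΦz_cont H h hQ, inner_neg_left, neg_neg,
      show W.gradP t (W.z t α) / (‖W.gradP t (W.z t α)‖ : ℂ) =
        (‖W.gradP t (W.z t α)‖⁻¹ : ℝ) • W.gradP t (W.z t α) by
        rw [Complex.real_smul, Complex.ofReal_inv, div_eq_inv_mul], real_inner_smul_left,
      real_inner_self_eq_norm_sq]
    field_simp

theorem gradP_eq {α : ℝ} (h : W.IsRegularPoint t α) :
    W.gradP t (W.z t α) = (W.dPdn t α : ℂ) * W.normal t α := by
  have h1 := neg_dPdn_eq ht hΦ hΦz hΦz_cont H h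
  by_cases hQ : W.gradP t (W.z t α) = 0
  · rw [hQ, norm_zero, neg_eq_zero] at h1
    rw [h1, hQ]
    simp
  · have hn : (‖W.gradP t (W.z t α)‖ : ℂ) ≠ 0 := by simpa using hQ
    rw [regular_direction ht hΦ hΦz hΦz_cont H h hQ, neg_eq_iff_eq_neg.1 h1]
    push_cast
    field_simp

theorem hasDerivAt_extInv_real {α : ℝ} (hα : α ∈ I) (h0 : Φz (W.z t α) ≠ 0) :
    HasDerivAt (fun x : ℝ => W.extInv t Φ x) (Φz (W.z t α))⁻¹ (W.h t Φ α) := by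
  have e := extDeriv_h ht hΦ hΦz hΦz_cont hα
  have := H.hasDerivAt_Ψ_real (x := W.h t Φ α) (by rwa [e])
  rwa [e] at this

theorem hasDerivWithinAt_Z {α : ℝ} (hα : α ∈ I) (h0 : Φz (W.z t α) ≠ 0) :
    HasDerivWithinAt (W.Z t Φ) (Φz (W.z t α))⁻¹ I (W.h t Φ α) :=
  (hasDerivAt_extInv_real ht hΦ hΦz hΦz_cont H hα h0).hasDerivWithinAt.congr
    (fun _ hx => (extInv_eq_Z ht hΦ hx).symm) (extInv_eq_Z ht hΦ (W.h_mem ht hΦ hα)).symm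

theorem hα_eq {α : ℝ} (h : W.IsRegularPoint t α) (h0 : Φz (W.z t α) ≠ 0) :
    W.hα t Φ α = ‖Φz (W.z t α)‖ * ‖W.zα t α‖ := by
  have hI : UniqueDiffWithinAt ℝ I α := uniqueDiffOn_Icc (by norm_num) α h.1
  have := nhdsWithin_Icc_sdiff_neBot (p := -1) (q := 1) (by norm_num) h.1
  obtain ⟨h1, h2, h3⟩ := h.2.1.hasDerivWithinAt.nonneg_quotient h.1
    (hasDerivAt_extInv_real ht hΦ hΦz hΦz_cont H h.1 h0) (inv_ne_zero h0) (W.strictMonoOn_h ht hΦ)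
    (W.continuousOn_h ht hΦ α h.1) fun β hβ => (extInv_h ht hΦ hβ).symm
  change 0 ≤ (W.zα t α / _).re at h3
  rw [hα, h1.derivWithin hI]
  have h4 : W.zα t α / (Φz (W.z t α))⁻¹ = ((W.zα t α / (Φz (W.z t α))⁻¹).re : ℂ) := by
    apply Complex.ext
    · simp
    · rw [Complex.ofReal_im]
      exact h2
  have h5 := congrArg norm h4
  rw [norm_div, norm_inv, div_inv_eq_mul, Complex.norm_real, Real.norm_of_nonneg h3] at h5
  rw [mul_comm, h5]
  rfl

/-- By definition A₁ is (|∇P|/|z_α|)·h_α·|Z_{,α'}|², with h_α = |Φ_z||z_α| and |Z_{,α'}| = 1/|Φ_z|;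
the factor |z_α| cancels. -/
theorem A₁_eq {α : ℝ} (h : W.IsRegularPoint t α) (h0 : Φz (W.z t α) ≠ 0) :
    W.A₁ t Φ (W.h t Φ α) * ‖Φz (W.z t α)‖ = ‖W.gradP t (W.z t α)‖ ∧
    W.Zα t Φ (W.h t Φ α) = (Φz (W.z t α))⁻¹ := by
  have hZα : W.Zα t Φ (W.h t Φ α) = (Φz (W.z t α))⁻¹ :=
    (hasDerivWithinAt_Z ht hΦ hΦz hΦz_cont H h.1 h0).derivWithin
      (uniqueDiffOn_Icc (by norm_num) _ (W.h_mem ht hΦ h.1))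
  refine ⟨?_, hZα⟩
  have hne : ‖Φz (W.z t α)‖ ≠ 0 := by simpa using h0
  have hne' : ‖W.zα t α‖ ≠ 0 := by simpa using h.2.2
  rw [A₁, calA, hZα, W.hinv_h ht hΦ h.1, hα_eq ht hΦ hΦz hΦz_cont H h h0, a,
    neg_dPdn_eq ht hΦ hΦz hΦz_cont H h, norm_inv]
  field_simp

/-- The coefficient `A₁` as an integral. -/
theorem A₁_eq_integral {α : ℝ} (h : W.IsRegularPoint t α) (h0 : Φz (W.z t α) ≠ 0) :
    W.A₁ t Φ (W.h t Φ α) =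
      1 + Real.pi / 8 * ∫ β in (0 : ℝ)..2, sqQuotient (W.extVel t Φ) (W.h t Φ α) β := by
  have hne : ‖Φz (W.z t α)‖ ≠ 0 := by simpa using h0
  have e := extDeriv_h ht hΦ hΦz hΦz_cont h.1
  refine mul_right_cancel₀ hne ?_
  rw [(A₁_eq ht hΦ hΦz hΦz_cont H h h0).1, ← norm_conjGrad_h ht hΦ hΦz hΦz_cont h.1,
    H.conjGrad_eq (by rwa [e]), e, norm_mul, norm_mul, Complex.norm_I, mul_one, Complex.norm_real,
    Real.norm_of_nonneg (zero_le_one.trans StripData.one_le_coeff)]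

end CornerWave.WaterWave


/-! ### Return to the interval I; Hölder arcs; density of good points -/

namespace StripWave

theorem periodic_sqQuotient {G : ℂ → ℂ} (hG : ∀ w, G (w + 2) = G w) (x : ℝ) :
    Function.Periodic (sqQuotient G x) 2 := fun β => by
  have e1 : ((x : ℂ) + ((β + 2 : ℝ) : ℂ)) = (x + β : ℂ) + 2 := by push_cast; ring
  have e2 : Real.pi / 2 * (β + 2) = Real.pi / 2 * β + Real.pi := by ring
  simp only [sqQuotient, e1, hG, e2, Real.sin_add_pi, neg_sq]

theorem integral_window {G : ℂ → ℂ} (hG : ∀ w, G (w + 2) = G w) {x : ℝ}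
    (hint : IntervalIntegrable (sqQuotient G x) volume 0 2) :
    IntegrableOn (fun y => sqQuotient G x (y - x)) CornerWave.I ∧
      ∫ y in CornerWave.I, sqQuotient G x (y - x) = ∫ β in (0 : ℝ)..2, sqQuotient G x β := by
  have hper := periodic_sqQuotient hG x
  have h1 : IntervalIntegrable (sqQuotient G x) volume (-1 - x) (1 - x) :=
    hper.intervalIntegrable two_pos.ne' (t := 0) (by simpa using hint) _ _
  constructor
  · have h2 := h1.comp_sub_right x
    simp only [sub_add_cancel] at h2
    rwa [intervalIntegrable_iff_integrableOn_Icc_of_le (by norm_num)] at h2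
  · rw [integral_Icc_eq_integral_Ioc, ← intervalIntegral.integral_of_le (by norm_num),
      intervalIntegral.integral_comp_sub_right]
    have := hper.intervalIntegral_add_eq (-1 - x) 0
    rwa [zero_add, show -1 - x + 2 = 1 - x by ring] at this

end StripWave

namespace CornerWave.WaterWave
open StripWave

variable {T : ℝ} {W : WaterWave T} {t : ℝ} {Φ Φz : ℂ → ℂ} (ht : t ∈ Icc 0 T)
  (hΦ : IsRiemannMap (W.Ω t) (W.z t) Φ)
  (hΦz : ∀ w ∈ W.Ω t, HasDerivAt Φ (Φz w) w) (hΦz_cont : ContinuousOn Φz (closure (W.Ω t)))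
  {S : ℂ → ℂ} (H : StripData (W.extInv t Φ) (W.extDeriv t Φ Φz) (W.extVel t Φ)
  (W.extVelDeriv t Φ) (W.extAcc t Φ) S (W.extHead t Φ))

section
include ht hΦ

theorem ZtbarDeriv_ae : W.ZtbarDeriv t Φ =ᵐ[volume.restrict I]
    deriv fun x : ℝ => W.extVel t Φ x := by
  rw [Filter.EventuallyEq, ← Measure.restrict_congr_set Ioo_ae_eq_Icc]
  refine ae_restrict_of_forall_mem measurableSet_Ioo fun y hy => ?_
  have hI : I ∈ 𝓝 y := Icc_mem_nhds hy.1 hy.2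
  rw [ZtbarDeriv, derivWithin_of_mem_nhds hI]
  refine Filter.EventuallyEq.deriv_eq ?_
  filter_upwards [hI] with x hx using (extVel_eq ht hΦ hx).symm

theorem Zt_eq {x : ℝ} (hx : x ∈ I) : W.Zt t Φ x = (starRingEnd ℂ) (W.extVel t Φ x) := by
  rw [extVel_eq ht hΦ hx, Complex.conj_conj]

theorem Zt_mul_ae : (fun y => W.Zt t Φ y * W.ZtbarDeriv t Φ y) =ᵐ[volume.restrict I]
    fun y : ℝ => (starRingEnd ℂ) (W.extVel t Φ y) * deriv (fun x : ℝ => W.extVel t Φ x) y := by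
  filter_upwards [ZtbarDeriv_ae ht hΦ, ae_restrict_mem measurableSet_Icc] with y h1 h2
  rw [h1, Zt_eq ht hΦ h2]

theorem hilbertComm_eq {x : ℝ} (hx : x ∈ I) :
    hilbertComm (W.Zt t Φ) (W.ZtbarDeriv t Φ) x =
      hilbertComm (fun y : ℝ => (starRingEnd ℂ) (W.extVel t Φ y))
        (deriv fun x : ℝ => W.extVel t Φ x) x := by
  simp only [hilbertComm]
  rw [hilbert_congr (ZtbarDeriv_ae ht hΦ), hilbert_congr (Zt_mul_ae ht hΦ), Zt_eq ht hΦ hx]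

theorem sqQuotient_eq {x y : ℝ} (hx : x ∈ I) (hy : y ∈ I) :
    sqQuotient (W.extVel t Φ) x (y - x) =
      ‖W.Zt t Φ x - W.Zt t Φ y‖ ^ 2 / Real.sin (Real.pi / 2 * (x - y)) ^ 2 := by
  have e1 : (x : ℂ) + ((y - x : ℝ) : ℂ) = y := by push_cast; ring
  have e2 : Real.pi / 2 * (y - x) = -(Real.pi / 2 * (x - y)) := by ring
  rw [sqQuotient, e1, e2, Real.sin_neg, neg_sq, extVel_eq ht hΦ hx, extVel_eq ht hΦ hy, ← map_sub,
    RCLike.norm_conj, norm_sub_rev]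
  exact (div_eq_mul_inv _ _).symm

theorem setIntegral_eq {x : ℝ} (hx : x ∈ I)
    (hint : IntervalIntegrable (sqQuotient (W.extVel t Φ) x) volume 0 2) :
    IntegrableOn (fun y => ‖W.Zt t Φ x - W.Zt t Φ y‖ ^ 2 /
      Real.sin (Real.pi / 2 * (x - y)) ^ 2) I ∧
    ∫ y in I, ‖W.Zt t Φ x - W.Zt t Φ y‖ ^ 2 / Real.sin (Real.pi / 2 * (x - y)) ^ 2 =
      ∫ β in (0 : ℝ)..2, sqQuotient (W.extVel t Φ) x β := by
  obtain ⟨h1, h2⟩ := integral_window (G := W.extVel t Φ) (perExt_add_two _) hint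
  constructor
  · exact h1.congr_fun (fun y hy => sqQuotient_eq ht hΦ hx hy) measurableSet_Icc
  · rw [← h2]
    exact setIntegral_congr_fun measurableSet_Icc fun y hy => (sqQuotient_eq ht hΦ hx hy).symm

theorem exists_dist_hinv_lt {α : ℝ} (hα : α ∈ I) {r : ℝ} (hr : 0 < r) :
    ∃ r' > 0, ∀ x ∈ I, |x - W.h t Φ α| < r' → |W.hinv t Φ x - α| < r := by
  have hK : IsCompact (W.h t Φ '' (I \ Metric.ball α r)) :=
    (isCompact_Icc.diff Metric.isOpen_ball).image_of_continuousOn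
      ((W.continuousOn_h ht hΦ).mono sdiff_subset)
  have hmem : W.h t Φ α ∈ (W.h t Φ '' (I \ Metric.ball α r))ᶜ := by
    rintro ⟨β, hβ, h⟩
    exact hβ.2 (W.injOn_h ht hΦ hβ.1 hα h ▸ Metric.mem_ball_self hr)
  obtain ⟨r', hr', hsub⟩ := Metric.isOpen_iff.1 hK.isClosed.isOpen_compl _ hmem
  refine ⟨r', hr', fun x hx hxr => ?_⟩
  by_contra hne
  refine hsub (show x ∈ Metric.ball (W.h t Φ α) r' by simpa [Real.dist_eq] using hxr)
    ⟨W.hinv t Φ x, ⟨W.hinv_mem ht hΦ hx, fun hb => hne ?_⟩, W.h_hinv ht hΦ hx⟩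
  simpa [Real.dist_eq] using hb

/-- The reflection in a wall, in the Riemannian variable. -/
theorem extInv_reflect {σ : ℝ} (hσ : σ = -1 ∨ σ = 1) {x : ℝ} (hx : x ∈ I) :
    W.extInv t Φ ((2 * σ - x : ℝ) : ℂ) = 2 * σ - (starRingEnd ℂ) (W.extInv t Φ x) := by
  have hx' : -x ∈ I := ⟨by linarith [hx.2], by linarith [hx.1]⟩
  have h1 : W.extInv t Φ ((-x : ℝ) : ℂ) = -(starRingEnd ℂ) (W.extInv t Φ x) := by
    rw [extInv_eq ht hΦ (ofReal_mem_closedHalfStrip hx'),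
      extInv_eq ht hΦ (ofReal_mem_closedHalfStrip hx),
      show ((-x : ℝ) : ℂ) = refl x by simp [refl],
      hΦ.inv_refl (fun w => W.refl_mem_closure ht) (ofReal_mem_closedHalfStrip hx)]
    rfl
  rcases hσ with rfl | rfl
  · have h2 := extInv_add_two (W := W) (t := t) (Φ := Φ) ((2 * (-1) - x : ℝ) : ℂ)
    rw [show ((2 * (-1) - x : ℝ) : ℂ) + 2 = ((-x : ℝ) : ℂ) by push_cast; ring, h1] at h2
    push_cast at h2 ⊢
    linear_combination -h2
  · rw [show ((2 * 1 - x : ℝ) : ℂ) = ((-x : ℝ) : ℂ) + 2 by push_cast; ring, extInv_add_two, h1]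
    push_cast
    ring

/-- Hölder continuity of the tangent along an arc bounds the direction of the boundary in the
Riemannian variable. -/
theorem exists_holder_bound {p q α : ℝ} (hpq : p < q) (hs : Icc p q ⊆ I) (hα : α ∈ Icc p q)
    (harc : IsC1HolderArc (W.z t) (Icc p q)) {d₀ : ℂ}
    (hd : HasDerivWithinAt (W.z t) d₀ (Icc p q) α) (hd₀ : d₀ ≠ 0) :
    ∃ γ₀ : ℝ, 0 < γ₀ ∧ γ₀ ≤ 1 ∧ ∀ γ : ℝ, 0 < γ → γ ≤ γ₀ → ∃ C : ℝ, 0 ≤ C ∧ ∃ r > 0,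
      ∀ β ∈ Icc p q, |β - α| < r → ∀ g : ℂ,
        HasDerivAt (fun x : ℝ => W.extInv t Φ x) g (W.h t Φ β) →
        0 ≤ ((starRingEnd ℂ) d₀ * g).re ∧
        |((starRingEnd ℂ) d₀ * g).im| ≤
          C * ‖W.z t β - W.z t α‖ ^ γ * ((starRingEnd ℂ) d₀ * g).re := by
  obtain ⟨d, hder, C₀, γ₁, hγ₁, hhol⟩ := harc
  have hdα : d α = d₀ := (uniqueDiffOn_Icc hpq α hα).eq_deriv _ (hder α hα).1 hd
  have hn : 0 < ‖d₀‖ := norm_pos_iff.2 hd₀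
  refine ⟨min γ₁ 1, lt_min (by exact_mod_cast hγ₁) one_pos, min_le_right _ _, fun γ hγ hγle => ?_⟩
  have hcont : ∀ᶠ β in 𝓝[Icc p q] α, ‖d β - d₀‖ < ‖d₀‖ / 2 := by
    have h1 := (hhol.uniformContinuousOn hγ₁).continuousOn α hα
    have h2 := h1.tendsto.eventually (Metric.ball_mem_nhds _ (half_pos hn))
    filter_upwards [h2] with β hβ
    rw [hdα] at hβ
    simpa [dist_eq_norm] using hβ
  -- Converts Hölder continuity in the Lagrangian parameter into Hölder continuity in the chord
  -- length, a form that survives the change to the Riemannian variable, where h itself is not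
  -- controlled.
  have hlow : ∀ᶠ β in 𝓝[Icc p q] α, ‖d₀‖ / 2 * |β - α| ≤ ‖W.z t β - W.z t α‖ := by
    have h1 := (hasDerivWithinAt_iff_isLittleO.1 hd).def (half_pos hn)
    filter_upwards [h1] with β hβ
    rw [Real.norm_eq_abs] at hβ
    have h2 : ‖(β - α) • d₀‖ = |β - α| * ‖d₀‖ := by rw [norm_smul, Real.norm_eq_abs]
    have h3 := norm_sub_norm_le ((β - α) • d₀) (W.z t β - W.z t α)
    rw [norm_sub_rev ((β - α) • d₀), h2] at h3
    linarith
  obtain ⟨r, hr, hball⟩ := Metric.mem_nhdsWithin_iff.1 (hcont.and hlow)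
  refine ⟨C₀ * (2 / ‖d₀‖) ^ γ * (2 / ‖d₀‖), by positivity, min r 1, lt_min hr one_pos,
    fun β hβ hβr g hg => ?_⟩
  by_cases hg0 : g = 0
  · simp [hg0]
  obtain ⟨h1, h2⟩ := hball ⟨show β ∈ Metric.ball α r by
    simpa [Real.dist_eq] using hβr.trans_le (min_le_left _ _), hβ⟩
  have hβ1 : |β - α| ≤ 1 := (hβr.trans_le (min_le_right _ _)).le
  have := nhdsWithin_Icc_sdiff_neBot hpq hβ
  obtain ⟨-, hq1, hq2⟩ := (hder β hβ).1.nonneg_quotient hβ hg hg0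
    ((W.strictMonoOn_h ht hΦ).mono hs) ((W.continuousOn_h ht hΦ β (hs hβ)).mono hs)
    fun x hx => (extInv_h ht hΦ (hs hx)).symm
  -- The tangent in the Lagrangian variable is a positive multiple of g, so the sector that contains
  -- the first contains the second.
  set κ := (d β / g).re with hκ
  have hκd : d β = κ * g := by
    rw [← div_eq_iff hg0]
    exact Complex.ext (by simp [hκ]) (by simp [hq1])
  have hκ0 : 0 < κ := hq2.lt_of_ne fun hc => (hder β hβ).2 (by rw [hκd, ← hc]; simp)
  set E := (starRingEnd ℂ) d₀ * (d β - d₀) with hE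
  have hdd : (starRingEnd ℂ) d₀ * d₀ = ((‖d₀‖ ^ 2 : ℝ) : ℂ) := by
    rw [mul_comm, Complex.mul_conj, Complex.normSq_eq_norm_sq]
  have hgE : ((κ : ℝ) : ℂ) * ((starRingEnd ℂ) d₀ * g) = ((‖d₀‖ ^ 2 : ℝ) : ℂ) + E := by
    rw [← hdd, hE, hκd]
    ring
  have hEn : ‖E‖ = ‖d₀‖ * ‖d β - d₀‖ := by rw [hE, norm_mul, RCLike.norm_conj]
  have hre : κ * ((starRingEnd ℂ) d₀ * g).re = ‖d₀‖ ^ 2 + E.re := by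
    have := congrArg Complex.re hgE
    rwa [Complex.re_ofReal_mul, Complex.add_re, Complex.ofReal_re] at this
  have him : κ * ((starRingEnd ℂ) d₀ * g).im = E.im := by
    have := congrArg Complex.im hgE
    rwa [Complex.im_ofReal_mul, Complex.add_im, Complex.ofReal_im, zero_add] at this
  have hre2 : ‖d₀‖ ^ 2 / 2 ≤ κ * ((starRingEnd ℂ) d₀ * g).re := by
    rw [hre]
    have := (abs_le.1 (Complex.abs_re_le_norm E)).1
    nlinarith
  have hre0 : 0 < ((starRingEnd ℂ) d₀ * g).re :=
    pos_of_mul_pos_right ((by positivity : 0 < ‖d₀‖ ^ 2 / 2).trans_le hre2) hκ0.le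
  have hholβ : ‖d β - d₀‖ ≤ C₀ * |β - α| ^ γ := by
    have h3 := hhol.dist_le hβ hα
    rw [dist_eq_norm, hdα, Real.dist_eq] at h3
    refine h3.trans (mul_le_mul_of_nonneg_left ?_ C₀.2)
    rcases (abs_nonneg (β - α)).eq_or_lt with h0 | h0
    · rw [← h0, Real.zero_rpow hγ.ne', Real.zero_rpow (by exact_mod_cast hγ₁.ne')]
    · exact Real.rpow_le_rpow_of_exponent_ge h0 hβ1 (hγle.trans (min_le_left _ _))
  have hpow : |β - α| ^ γ ≤ (2 / ‖d₀‖) ^ γ * ‖W.z t β - W.z t α‖ ^ γ := by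
    rw [← Real.mul_rpow (by positivity) (norm_nonneg _)]
    refine Real.rpow_le_rpow (abs_nonneg _) ?_ hγ.le
    rw [div_mul_eq_mul_div, le_div_iff₀ hn]
    linarith
  refine ⟨hre0.le, ?_⟩
  have hX : ‖d β - d₀‖ ≤ C₀ * (2 / ‖d₀‖) ^ γ * ‖W.z t β - W.z t α‖ ^ γ := by
    rw [mul_assoc]
    exact hholβ.trans (mul_le_mul_of_nonneg_left hpow C₀.2)
  have h4 : κ * |((starRingEnd ℂ) d₀ * g).im| ≤ ‖d₀‖ * ‖d β - d₀‖ := by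
    have h5 : κ * |((starRingEnd ℂ) d₀ * g).im| = |κ * ((starRingEnd ℂ) d₀ * g).im| := by
      rw [abs_mul, abs_of_pos hκ0]
    rw [h5, him, ← hEn]
    exact Complex.abs_im_le_norm E
  refine le_of_mul_le_mul_left ?_ hκ0
  set X := C₀ * (2 / ‖d₀‖) ^ γ * ‖W.z t β - W.z t α‖ ^ γ with hXdef
  have hX0 : 0 ≤ X := (norm_nonneg _).trans hX
  calc κ * |((starRingEnd ℂ) d₀ * g).im| ≤ ‖d₀‖ * X :=
        h4.trans (mul_le_mul_of_nonneg_left hX hn.le)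
    _ = X * (2 / ‖d₀‖) * (‖d₀‖ ^ 2 / 2) := by field_simp
    _ ≤ X * (2 / ‖d₀‖) * (κ * ((starRingEnd ℂ) d₀ * g).re) :=
        mul_le_mul_of_nonneg_left hre2 (by positivity)
    _ = _ := by rw [hXdef]; ring

end

include ht hΦ hΦz hΦz_cont H

theorem hilbert_statement {α : ℝ} (hα : α ∈ I) (h0 : Φz (W.z t α) ≠ 0) :
    HilbertExists (W.ZtbarDeriv t Φ) (W.h t Φ α) ∧
    HilbertExists (fun y => W.Zt t Φ y * W.ZtbarDeriv t Φ y) (W.h t Φ α) ∧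
    IntervalIntegrable (sqQuotient (W.extVel t Φ) (W.h t Φ α)) volume 0 2 ∧
    (-hilbertComm (W.Zt t Φ) (W.ZtbarDeriv t Φ) (W.h t Φ α)).im =
      Real.pi / 8 * ∫ s in (0 : ℝ)..2, sqQuotient (W.extVel t Φ) (W.h t Φ α) s := by
  have h1 : W.extDeriv t Φ Φz (W.h t Φ α) ≠ 0 := by
    rwa [extDeriv_h ht hΦ hΦz hΦz_cont hα]
  obtain ⟨a, b, c⟩ := H.hilbert_formula h1
  rw [hilbertComm_eq ht hΦ (W.h_mem ht hΦ hα)]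
  exact ⟨(hilbertExists_congr (ZtbarDeriv_ae ht hΦ) _).2 a,
    (hilbertExists_congr (Zt_mul_ae ht hΦ) _).2 b, (H.conjGrad_div_im h1).1, c⟩

omit hΦ hΦz hΦz_cont H in
theorem isRegularPoint_ae : ∀ᵐ α ∂(volume.restrict I), W.IsRegularPoint t α := by
  filter_upwards [W.z_regular t ht, ae_restrict_mem measurableSet_Icc] with α h1 h2
  obtain ⟨d, hd, hder⟩ := h1
  refine ⟨h2, hder.hasDerivWithinAt.differentiableWithinAt, ?_⟩
  rw [zα, hder.hasDerivWithinAt.derivWithin (uniqueDiffOn_Icc (by norm_num) α h2)]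
  exact hd

/-- The regular points at which the Riemann mapping does not degenerate are dense. -/
theorem exists_good_near {α : ℝ} (hα : α ∈ I) {ε : ℝ} (hε : 0 < ε) :
    ∃ β, |β - α| < ε ∧ W.IsRegularPoint t β ∧ Φz (W.z t β) ≠ 0 := by
  set p := max (-1) (α - ε) with hp
  set q := min 1 (α + ε) with hq
  have hpq : p < q := by
    simp only [hp, hq, max_lt_iff, lt_min_iff]
    refine ⟨⟨by norm_num, ?_⟩, ?_, ?_⟩ <;> linarith [hα.1, hα.2]
  have hpI : p ∈ I := ⟨le_max_left _ _, (hpq.trans_le (min_le_left _ _)).le⟩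
  have hqI : q ∈ I := ⟨(le_max_left _ _).trans hpq.le, min_le_left _ _⟩
  have hmono := W.strictMonoOn_h ht hΦ
  obtain ⟨x, hx0, hx⟩ := (MeasureTheory.Measure.dense_of_ae H.ae_ne_zero).inter_open_nonempty
    _ isOpen_Ioo (nonempty_Ioo.2 (hmono hpI hqI hpq)) |>.imp fun _ h => h.symm
  have hxI : x ∈ I := ⟨(W.h_mem ht hΦ hpI).1.trans hx.1.le, hx.2.le.trans (W.h_mem ht hΦ hqI).2⟩
  set β₀ := W.hinv t Φ x with hβ₀
  have hβ₀I := W.hinv_mem ht hΦ hxI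
  have hhβ₀ : W.h t Φ β₀ = x := W.h_hinv ht hΦ hxI
  have hpβ : p < β₀ := (hmono.lt_iff_lt hpI hβ₀I).1 (by rw [hhβ₀]; exact hx.1)
  have hβq : β₀ < q := (hmono.lt_iff_lt hβ₀I hqI).1 (by rw [hhβ₀]; exact hx.2)
  have hsub : Ioo p q ⊆ I := fun y hy => ⟨hpI.1.trans hy.1.le, hy.2.le.trans hqI.2⟩
  have hcont : ContinuousOn (fun β => Φz (W.z t β)) (Ioo p q) :=
    (hΦz_cont.comp (W.continuousOn_z ht) fun β hβ => W.z_mem_closure ht hβ).mono hsub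
  have hne : Φz (W.z t β₀) ≠ 0 := by
    rw [← extDeriv_h ht hΦ hΦz hΦz_cont hβ₀I, hhβ₀]
    exact hx0
  have hopen : IsOpen (Ioo p q ∩ (fun β => Φz (W.z t β)) ⁻¹' {0}ᶜ) :=
    hcont.isOpen_inter_preimage isOpen_Ioo isOpen_compl_singleton
  have hae := (ae_restrict_iff' measurableSet_Icc).1 (isRegularPoint_ae (W := W) ht)
  obtain ⟨β, hβ1, hβ2⟩ := (MeasureTheory.Measure.dense_of_ae hae).inter_open_nonempty _ hopen
    ⟨β₀, ⟨hpβ, hβq⟩, hne⟩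
  refine ⟨β, ?_, hβ2 (hsub hβ1.1), hβ1.2⟩
  rw [abs_lt]
  constructor
  · linarith [hβ1.1.1, le_max_right (-1) (α - ε)]
  · linarith [hβ1.1.2, min_le_right 1 (α + ε)]

/-- At regular nondegenerate points |∇P| = A₁|Φ_z| ≤ C|Φ_z|. Such points are dense and both sides
are continuous along the surface, so the bound holds everywhere. -/
theorem gradP_eq_zero_of_bounded {C : ℝ}
    (hC : ∀ x ∈ I, W.IsRegularPoint t (W.hinv t Φ x) → Φz (W.Z t Φ x) ≠ 0 → W.A₁ t Φ x ≤ C)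
    {α : ℝ} (hα : α ∈ I) (h0 : Φz (W.z t α) = 0) : W.gradP t (W.z t α) = 0 := by
  have hz := W.continuousOn_z ht
  have h1 : ContinuousOn (fun β => ‖W.gradP t (W.z t β)‖) I :=
    ((W.gradP_cont t ht).comp hz fun β hβ => W.z_mem_closure ht hβ).norm
  have h2 : ContinuousOn (fun β => C * ‖Φz (W.z t β)‖) I :=
    continuousOn_const.mul (hΦz_cont.comp hz fun β hβ => W.z_mem_closure ht hβ).norm
  set s := {β | W.IsRegularPoint t β ∧ Φz (W.z t β) ≠ 0} with hs
  have hsI : s ⊆ I := fun β hβ => hβ.1.1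
  have hcl : α ∈ closure s := Metric.mem_closure_iff.2 fun ε hε => by
    obtain ⟨β, h, h'⟩ := exists_good_near ht hΦ hΦz hΦz_cont H hα hε
    exact ⟨β, h', by rwa [dist_comm, Real.dist_eq]⟩
  have hclI : closure s ⊆ I := closure_minimal hsI isClosed_Icc
  have := le_on_closure (s := s) (f := fun β => ‖W.gradP t (W.z t β)‖)
    (g := fun β => C * ‖Φz (W.z t β)‖) (fun β hβ => by
      rw [← (A₁_eq ht hΦ hΦz hΦz_cont H hβ.1 hβ.2).1]
      refine mul_le_mul_of_nonneg_right (hC _ (W.h_mem ht hΦ hβ.1.1) ?_ ?_) (norm_nonneg _)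
      · rw [W.hinv_h ht hΦ hβ.1.1]
        exact hβ.1
      · rw [Z, W.hinv_h ht hΦ hβ.1.1]
        exact hβ.2) (h1.mono hclI) (h2.mono hclI) hcl
  simp only [h0, norm_zero, mul_zero] at this
  exact norm_le_zero_iff.1 this

/-- The pressure gradient is vertical at the upper corners. -/
theorem gradP_corner_re {σ : ℝ} (hσ : σ = -1 ∨ σ = 1) : (W.gradP t (W.z t σ)).re = 0 := by
  have h1 : (1 : ℝ) ∈ I := by norm_num
  have h2 : (-1 : ℝ) ∈ I := by norm_num
  have e1 := conjGrad_h ht hΦ hΦz hΦz_cont h1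
  have e2 := conjGrad_h ht hΦ hΦz hΦz_cont h2
  -- The two corners correspond to ±1, which the period identifies, so ∇P has the same value at
  -- both. By symmetry these values are mirror images, hence vertical.
  rw [W.h_one hΦ, show ((1 : ℝ) : ℂ) = ((-1 : ℝ) : ℂ) + 2 by push_cast; ring, conjGrad,
    H.G_add_two, H.D_add_two, H.B_add_two] at e1
  rw [W.h_neg_one hΦ, conjGrad, e1] at e2
  have e3 : W.gradP t (W.z t 1) = W.gradP t (W.z t (-1)) := (starRingEnd ℂ).injective e2
  have e4 : (W.gradP t (W.z t 1)).re = 0 := by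
    have h := e3
    rw [W.z_symm t ht 1 h1, W.gradP_symm ht (W.z_mem_closure ht h1)] at h
    have := congrArg Complex.re h
    rw [refl_re] at this
    linarith
  rcases hσ with rfl | rfl
  · rw [← e3, e4]
  · exact e4

/-- At a point of the surface with a `C^{1,γ}` neighbourhood in the surface, the Riemann mapping
does not degenerate. -/
theorem Φz_ne_zero_of_arcs {α p q : ℝ} (hα : α ∈ Ioo (-1 : ℝ) 1) (hp : p < α) (hq : α < q)
    (hpI : -1 ≤ p) (hqI : q ≤ 1) (hl : IsC1HolderArc (W.z t) (Icc p α))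
    (hr : IsC1HolderArc (W.z t) (Icc α q)) {dl : ℂ} {κ : ℝ} (hdl0 : dl ≠ 0) (hκ : 0 < κ)
    (hdl : HasDerivWithinAt (W.z t) dl (Icc p α) α)
    (hdr : HasDerivWithinAt (W.z t) (κ * dl) (Icc α q) α) : Φz (W.z t α) ≠ 0 := by
  have hαI : α ∈ I := ⟨hα.1.le, hα.2.le⟩
  obtain ⟨γ₁, hγ₁, hγ₁', k1⟩ := exists_holder_bound ht hΦ hp
    (Icc_subset_Icc hpI hα.2.le) ⟨hp.le, le_rfl⟩ hl hdl hdl0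
  obtain ⟨γ₂, hγ₂, -, k2⟩ := exists_holder_bound ht hΦ hq
    (Icc_subset_Icc hα.1.le hqI) ⟨le_rfl, hq.le⟩ hr hdr
    (mul_ne_zero (by exact_mod_cast hκ.ne') hdl0)
  have hγ : 0 < min γ₁ γ₂ := lt_min hγ₁ hγ₂
  obtain ⟨C₁, hC₁, r₁, hr₁, b1⟩ := k1 _ hγ (min_le_left _ _)
  obtain ⟨C₂, hC₂, r₂, hr₂, b2⟩ := k2 _ hγ (min_le_right _ _)
  set γ := min γ₁ γ₂
  obtain ⟨r', hr', hinv⟩ := exists_dist_hinv_lt ht hΦ hαI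
    (lt_min (lt_min hr₁ hr₂) (lt_min (sub_pos.2 hp) (sub_pos.2 hq)))
  have hx : W.h t Φ α ∈ Ioo (-1 : ℝ) 1 := by
    have hm := W.strictMonoOn_h ht hΦ
    have a := hm (by norm_num : (-1 : ℝ) ∈ I) hαI hα.1
    have b := hm hαI (by norm_num : (1 : ℝ) ∈ I) hα.2
    rw [W.h_neg_one hΦ] at a
    rw [W.h_one hΦ] at b
    exact ⟨a, b⟩
  obtain ⟨r₃, hr₃, hI⟩ := Metric.isOpen_iff.1 isOpen_Ioo _ hx
  rw [← extDeriv_h ht hΦ hΦz hΦz_cont hαI]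
  refine H.ne_zero_of_holder (e := (starRingEnd ℂ) dl) (by simpa using hdl0)
    (hC₁.trans (le_max_left C₁ C₂)) hγ ((min_le_left _ _).trans hγ₁')
    (lt_min hr' hr₃) ?_
  filter_upwards [H.ae_ne_zero] with x hx0 hxr
  have hxI : x ∈ I := Ioo_subset_Icc_self (hI (show x ∈ Metric.ball _ _ by
    simpa [Real.dist_eq] using hxr.trans_le (min_le_right _ _)))
  have hβ := hinv x hxI (hxr.trans_le (min_le_left _ _))
  have hβI := W.hinv_mem ht hΦ hxI
  have hβx := W.h_hinv ht hΦ hxI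
  set β := W.hinv t Φ x
  have hder := (H.hasDerivAt_Ψ_real hx0).differentiableAt.hasDerivAt
  set g := deriv (fun x : ℝ => W.extInv t Φ x) x
  rw [extInv_h ht hΦ hαI, ← hβx, extInv_h ht hΦ hβI]
  rw [← hβx] at hder
  simp only [lt_min_iff] at hβ
  obtain ⟨⟨ha, hb⟩, hc, hd⟩ := hβ
  rw [abs_lt] at hc hd
  rcases le_total β α with hle | hle
  · obtain ⟨u, v⟩ := b1 β ⟨by linarith, hle⟩ ha g hder
    refine ⟨u, v.trans ?_⟩
    gcongr
    exact le_max_left _ _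
  · obtain ⟨u, v⟩ := b2 β ⟨hle, by linarith⟩ hb g hder
    -- The right tangent is a positive multiple of the left one, so the bounds on both branches
    -- refer to the same direction e = conj(dl), as `ne_zero_of_holder` requires.
    have e : (starRingEnd ℂ) (κ * dl) * g = ((κ : ℝ) : ℂ) * ((starRingEnd ℂ) dl * g) := by
      rw [map_mul, Complex.conj_ofReal]
      ring
    rw [e, Complex.re_ofReal_mul] at u v
    rw [Complex.im_ofReal_mul, abs_mul, abs_of_pos hκ] at v
    have u' : 0 ≤ ((starRingEnd ℂ) dl * g).re := nonneg_of_mul_nonneg_right u hκ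
    refine ⟨u', ?_⟩
    have v' : |((starRingEnd ℂ) dl * g).im| ≤
        C₂ * ‖W.z t β - W.z t α‖ ^ γ * ((starRingEnd ℂ) dl * g).re := by
      refine le_of_mul_le_mul_left ?_ hκ
      linarith
    refine v'.trans ?_
    gcongr
    exact le_max_right _ _

end CornerWave.WaterWave


/-! ### The criteria at the corners and at the crests -/

namespace CornerWave.WaterWave
open StripWave

variable {T : ℝ} {W : WaterWave T} {t : ℝ} {Φ Φz : ℂ → ℂ} (ht : t ∈ Icc 0 T)
  (hΦ : IsRiemannMap (W.Ω t) (W.z t) Φ)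
  (hΦz : ∀ w ∈ W.Ω t, HasDerivAt Φ (Φz w) w) (hΦz_cont : ContinuousOn Φz (closure (W.Ω t)))
  {S : ℂ → ℂ} (H : StripData (W.extInv t Φ) (W.extDeriv t Φ Φz) (W.extVel t Φ)
  (W.extVelDeriv t Φ) (W.extAcc t Φ) S (W.extHead t Φ))

theorem _root_.CornerWave.IsC1HolderArc.mono {f : ℝ → ℂ} {s u : Set ℝ} (h : IsC1HolderArc f s)
    (hu : u ⊆ s) : IsC1HolderArc f u := by
  obtain ⟨d, h1, C, γ, hγ, h2⟩ := h
  exact ⟨d, fun α hα => ⟨(h1 α (hu hα)).1.mono hu, (h1 α (hu hα)).2⟩, C, γ, hγ, h2.mono hu⟩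

omit Φz in
include hΦ in
theorem h_corner {σ : ℝ} (hσ : σ = -1 ∨ σ = 1) : W.h t Φ σ = σ := by
  rcases hσ with rfl | rfl
  · exact W.h_neg_one hΦ
  · exact W.h_one hΦ

include ht hΦ hΦz hΦz_cont H

/-- At a right angle between a wall and a `C^{1,γ}` surface the Riemann mapping does not
degenerate. -/
theorem Φz_ne_zero_of_corner {σ : ℝ} (hσ : σ = -1 ∨ σ = 1) {δ : ℝ} (hδ : 0 < δ)
    (harc : IsC1HolderArc (W.z t) (I ∩ Icc (σ - δ) (σ + δ))) {d₀ : ℂ} (hd₀ : d₀ ≠ 0)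
    (him : d₀.im = 0) (hd : HasDerivWithinAt (W.z t) d₀ I σ) : Φz (W.z t σ) ≠ 0 := by
  have hσI : σ ∈ I := by rcases hσ with rfl | rfl <;> norm_num
  have hsI : Icc (max (-1) (σ - δ)) (min 1 (σ + δ)) ⊆ I :=
    Icc_subset_Icc (le_max_left _ _) (min_le_left _ _)
  have hseq : I ∩ Icc (σ - δ) (σ + δ) = Icc (max (-1) (σ - δ)) (min 1 (σ + δ)) := Icc_inter_Icc
  rw [hseq] at harc
  have hpq : max (-1) (σ - δ) < min 1 (σ + δ) := by
    simp only [max_lt_iff, lt_min_iff]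
    refine ⟨⟨by norm_num, ?_⟩, ?_, ?_⟩ <;> linarith [hσI.1, hσI.2]
  have hσs : σ ∈ Icc (max (-1) (σ - δ)) (min 1 (σ + δ)) := by
    rw [← hseq]
    exact ⟨hσI, by linarith, by linarith⟩
  obtain ⟨γ, hγ, hγ1, key⟩ := exists_holder_bound ht hΦ hpq hsI hσs harc (hd.mono hsI) hd₀
  obtain ⟨C, hC, r, hr, key⟩ := key γ hγ le_rfl
  obtain ⟨r', hr', hinv⟩ := exists_dist_hinv_lt ht hΦ hσI (lt_min hr hδ)
  have hhσ := h_corner hΦ hσ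
  have hconj : (starRingEnd ℂ) d₀ = d₀ := Complex.conj_eq_iff_im.2 him
  rw [← extDeriv_h ht hΦ hΦz hΦz_cont hσI, hhσ]
  rw [hhσ] at hinv
  have hΨσ : W.extInv t Φ σ = W.z t σ := by
    have := extInv_h ht hΦ hσI
    rwa [hhσ] at this
  have hin : ∀ x ∈ I, |x - σ| < r' → ∀ g : ℂ,
      HasDerivAt (fun x : ℝ => W.extInv t Φ x) g x →
      0 ≤ (d₀ * g).re ∧ |(d₀ * g).im| ≤
        C * ‖W.extInv t Φ x - W.extInv t Φ σ‖ ^ γ * (d₀ * g).re := by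
    intro x hxI hxr g hg
    have hβ := hinv x hxI hxr
    have hβI := W.hinv_mem ht hΦ hxI
    have hβx := W.h_hinv ht hΦ hxI
    set β := W.hinv t Φ x
    simp only [lt_min_iff] at hβ
    obtain ⟨ha, hb⟩ := hβ
    rw [abs_lt] at hb
    have hβs : β ∈ Icc (max (-1) (σ - δ)) (min 1 (σ + δ)) := by
      rw [← hseq]
      exact ⟨hβI, by linarith, by linarith⟩
    have := key β hβs ha g (by rwa [hβx])
    rwa [hconj, ← extInv_h ht hΦ hβI, hβx, ← hΨσ] at this
  refine H.ne_zero_of_holder (x₀ := σ) (e := d₀) hd₀ hC hγ hγ1 (lt_min hr' one_pos) ?_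
  filter_upwards [H.ae_ne_zero] with x hx0 hxr
  have hder := (H.hasDerivAt_Ψ_real hx0).differentiableAt.hasDerivAt
  set g := deriv (fun x : ℝ => W.extInv t Φ x) x
  have hxr' := hxr.trans_le (min_le_left _ _)
  by_cases hxI : x ∈ I
  · exact hin x hxI hxr' g hder
  -- Beyond the corner the curve is the mirror image of the surface in the wall, so its tangent g
  -- corresponds to conj(g) at the reflected parameter. As d₀ is real, d₀ conj(g) = conj(d₀ g) and
  -- the sector condition is preserved.
  · set y := 2 * σ - x with hy
    have hyx : 2 * σ - y = x := by rw [hy]; ring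
    have hyI : I ∈ 𝓝 y := by
      have h1 := abs_lt.1 (hxr.trans_le (min_le_right _ _))
      refine Icc_mem_nhds ?_ ?_
      · rcases hσ with rfl | rfl
        · by_contra hc
          exact hxI ⟨by linarith, by linarith⟩
        · linarith
      · rcases hσ with rfl | rfl
        · linarith
        · by_contra hc
          exact hxI ⟨by linarith, by linarith⟩
    have hyI' := mem_of_mem_nhds hyI
    have hg : HasDerivAt (fun x : ℝ => W.extInv t Φ x) ((starRingEnd ℂ) g) y := by
      have h1 : HasDerivAt (fun u : ℝ => W.extInv t Φ ((2 * σ - u : ℝ) : ℂ)) (-g) y := by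
        have h2 : HasDerivAt (fun u : ℝ => 2 * σ - u) (-1) y := by
          simpa using (hasDerivAt_id y).const_sub (2 * σ)
        have h3 := HasDerivAt.scomp (h := fun u : ℝ => 2 * σ - u)
          (g₁ := fun x : ℝ => W.extInv t Φ x) y (by rw [hyx]; exact hder) h2
        rw [neg_one_smul] at h3
        exact h3
      have h4 : HasDerivAt (fun u : ℝ => 2 * (σ : ℂ) -
          (starRingEnd ℂ) (W.extInv t Φ ((2 * σ - u : ℝ) : ℂ))) (-(starRingEnd ℂ) (-g)) y :=
        (Complex.conjCLE.toContinuousLinearMap.hasFDerivAt.comp_hasDerivAt y h1).const_sub _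
      rw [map_neg, neg_neg] at h4
      refine h4.congr_of_eventuallyEq ?_
      filter_upwards [hyI] with u hu
      rw [extInv_reflect ht hΦ hσ hu]
      simp only [map_sub, map_mul, Complex.conj_ofReal, Complex.conj_conj, map_ofNat]
      ring
    have h5 := hin y hyI' (by
      rwa [abs_sub_comm, show σ - y = x - σ by rw [hy]; ring]) _ hg
    have e1 : d₀ * (starRingEnd ℂ) g = (starRingEnd ℂ) (d₀ * g) := by rw [map_mul, hconj]
    have e2 : ‖W.extInv t Φ x - W.extInv t Φ σ‖ = ‖W.extInv t Φ y - W.extInv t Φ σ‖ := by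
      have a := extInv_reflect ht hΦ hσ hyI'
      have b := extInv_reflect ht hΦ hσ hσI
      rw [hyx] at a
      rw [show 2 * σ - σ = σ by ring] at b
      have c : W.extInv t Φ x - W.extInv t Φ σ =
          -(starRingEnd ℂ) (W.extInv t Φ y - W.extInv t Φ σ) := by
        rw [map_sub, a]
        conv_lhs => rw [b]
        ring
      rw [c, norm_neg, RCLike.norm_conj]
    rw [e1, Complex.conj_re, Complex.conj_im, abs_neg] at h5
    rwa [e2]

/-- The criterion at the corners. -/
theorem corner_statement {σ : ℝ} (hσ : σ = -1 ∨ σ = 1) {d : ℂ} (hd0 : d ≠ 0)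
    (hd : HasDerivWithinAt (W.z t) (-(σ : ℂ) * d) I σ) :
    (InnerProductGeometry.angle d (-Complex.I) ≠ Real.pi / 2 →
      Φz (W.z t σ) = 0 ∧ W.gradP t (W.z t σ) = 0 ∧ W.dPdn t σ = 0) ∧
    (InnerProductGeometry.angle d (-Complex.I) = Real.pi / 2 →
      (∃ δ > 0, IsC1HolderArc (W.z t) (I ∩ Icc (σ - δ) (σ + δ))) →
      Φz (W.z t σ) ≠ 0 ∧ W.gradP t (W.z t σ) ≠ 0 ∧ 0 < -W.dPdn t σ) := by
  have hσI : σ ∈ I := by rcases hσ with rfl | rfl <;> norm_num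
  have hσ0 : (σ : ℂ) ≠ 0 := by rcases hσ with rfl | rfl <;> norm_num
  have hne : -(σ : ℂ) * d ≠ 0 := mul_ne_zero (neg_ne_zero.2 hσ0) hd0
  have him : (-(σ : ℂ) * d).im = 0 ↔ d.im = 0 := by
    rw [← Complex.ofReal_neg, Complex.im_ofReal_mul]
    rcases hσ with rfl | rfl <;> simp
  have hreg : W.IsRegularPoint t σ := by
    refine ⟨hσI, hd.differentiableWithinAt, ?_⟩
    rwa [zα, hd.derivWithin (uniqueDiffOn_Icc (by norm_num) σ hσI)]
  -- The vector -i points down the wall, so a right angle means a horizontal tangent.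
  have hangle : InnerProductGeometry.angle d (-Complex.I) = Real.pi / 2 ↔ d.im = 0 := by
    rw [← InnerProductGeometry.inner_eq_zero_iff_angle_eq_pi_div_two, Complex.inner]
    simp
  have hdP := neg_dPdn_eq ht hΦ hΦz hΦz_cont H hreg
  constructor
  · intro ha
    have hQ : W.gradP t (W.z t σ) = 0 := by
      by_contra hQ
      refine ha (hangle.2 (him.1 ?_))
      -- If ∇P ≠ 0, the tangent is a positive multiple of i∇P; as ∇P is vertical at the corner, the
      -- tangent is horizontal.
      have h1 := eq_of_hasDerivWithinAt ht hΦ hΦz hΦz_cont H hσI Subset.rfl hd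
        (nhdsWithin_Icc_sdiff_neBot (by norm_num) hσI) hQ
      have h2 := gradP_corner_re ht hΦ hΦz hΦz_cont H hσ
      rw [h1, Complex.im_ofReal_mul, Complex.div_ofReal_im, Complex.I_mul_im, h2]
      simp
    refine ⟨?_, hQ, ?_⟩
    · have := norm_Φz_le ht hΦ hΦz hΦz_cont H hσI
      rw [hQ, norm_zero] at this
      exact norm_le_zero_iff.1 this
    · rw [hQ, norm_zero, neg_eq_zero] at hdP
      exact hdP
  · rintro ha ⟨δ, hδ, harc⟩
    have h1 := Φz_ne_zero_of_corner ht hΦ hΦz hΦz_cont H hσ hδ harc hne (him.2 (hangle.1 ha)) hd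
    have h2 := norm_Φz_le ht hΦ hΦz hΦz_cont H hσI
    have h3 : 0 < ‖W.gradP t (W.z t σ)‖ := (norm_pos_iff.2 h1).trans_le h2
    exact ⟨h1, norm_pos_iff.1 h3, by rwa [hdP]⟩

/-- The criterion at the crests. -/
theorem crest_statement {α : ℝ} (hα : α ∈ Ioo (-1 : ℝ) 1) {dl dr : ℂ} (hdl0 : dl ≠ 0)
    (hdr0 : dr ≠ 0) (hdl : HasDerivWithinAt (W.z t) dl (Iic α) α)
    (hdr : HasDerivWithinAt (W.z t) dr (Ici α) α) :
    (InnerProductGeometry.angle (-dl) dr ≠ Real.pi →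
      Φz (W.z t α) = 0 ∧ W.gradP t (W.z t α) = 0) ∧
    (InnerProductGeometry.angle (-dl) dr = Real.pi →
      (∃ δ > 0, IsC1HolderArc (W.z t) (Icc (α - δ) α) ∧
        IsC1HolderArc (W.z t) (Icc α (α + δ))) →
      Φz (W.z t α) ≠ 0 ∧ W.gradP t (W.z t α) ≠ 0) := by
  have hαI : α ∈ I := ⟨hα.1.le, hα.2.le⟩
  constructor
  · intro ha
    have hQ : W.gradP t (W.z t α) = 0 := by
      by_contra hQ
      refine ha ?_
      -- If ∇P ≠ 0, both one-sided tangents are positive multiples of the same unit vector, so -dl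
      -- and dr are opposite and the angle is π.
      have h1 := eq_of_hasDerivWithinAt ht hΦ hΦz hΦz_cont H (s := Icc (-1) α) ⟨hα.1.le, le_rfl⟩
        (Icc_subset_Icc le_rfl hα.2.le) (hdl.mono Icc_subset_Iic_self)
        (nhdsWithin_Icc_sdiff_neBot hα.1 ⟨hα.1.le, le_rfl⟩) hQ
      have h2 := eq_of_hasDerivWithinAt ht hΦ hΦz hΦz_cont H (s := Icc α 1) ⟨le_rfl, hα.2.le⟩
        (Icc_subset_Icc hα.1.le le_rfl) (hdr.mono Icc_subset_Ici_self)
        (nhdsWithin_Icc_sdiff_neBot hα.2 ⟨le_rfl, hα.2.le⟩) hQ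
      have hl : 0 < ‖dl‖ := norm_pos_iff.2 hdl0
      have hr : 0 < ‖dr‖ := norm_pos_iff.2 hdr0
      refine InnerProductGeometry.angle_eq_pi_iff.2 ⟨neg_ne_zero.2 hdl0, -(‖dr‖ / ‖dl‖),
        neg_neg_of_pos (div_pos hr hl), ?_⟩
      have hlc : (‖dl‖ : ℂ) ≠ 0 := by exact_mod_cast hl.ne'
      rw [neg_smul_neg, Complex.real_smul, Complex.ofReal_div, div_mul_eq_mul_div, eq_div_iff hlc]
      set E := Complex.I * W.gradP t (W.z t α) / (‖W.gradP t (W.z t α)‖ : ℂ)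
      calc dr * ‖dl‖ = ‖dr‖ * E * ‖dl‖ := by rw [← h2]
        _ = ‖dr‖ * (‖dl‖ * E) := by ring
        _ = _ := by rw [← h1]
    refine ⟨?_, hQ⟩
    have := norm_Φz_le ht hΦ hΦz hΦz_cont H hαI
    rw [hQ, norm_zero] at this
    exact norm_le_zero_iff.1 this
  · rintro ha ⟨δ, hδ, hl, hr⟩
    obtain ⟨-, κ, hκ, hκd⟩ := InnerProductGeometry.angle_eq_pi_iff.1 ha
    have hdr' : dr = ((-κ : ℝ) : ℂ) * dl := by
      rw [hκd, Complex.real_smul]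
      push_cast
      ring
    have h1 : Φz (W.z t α) ≠ 0 := Φz_ne_zero_of_arcs ht hΦ hΦz hΦz_cont H hα
      (p := max (-1) (α - δ)) (q := min 1 (α + δ)) (max_lt hα.1 (by linarith))
      (lt_min hα.2 (by linarith)) (le_max_left _ _) (min_le_left _ _)
      (hl.mono (Icc_subset_Icc (le_max_right _ _) le_rfl))
      (hr.mono (Icc_subset_Icc le_rfl (min_le_right _ _))) hdl0 (neg_pos.2 hκ)
      (hdl.mono Icc_subset_Iic_self) (by
        rw [← hdr']
        exact hdr.mono Icc_subset_Ici_self)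
    exact ⟨h1, norm_pos_iff.1 ((norm_pos_iff.2 h1).trans_le
      (norm_Φz_le ht hΦ hΦz hΦz_cont H hαI))⟩

end CornerWave.WaterWave

theorem mainTheorem3 {T : ℝ} (W : CornerWave.WaterWave T) (t : ℝ) (ht : t ∈ Set.Icc 0 T)
    -- the Riemann mapping and its derivative `Φ_z`, continuous up to the boundary
    (Φ Φz : ℂ → ℂ) (hΦ : CornerWave.IsRiemannMap (W.Ω t) (W.z t) Φ)
    (hΦz : ∀ w ∈ W.Ω t, HasDerivAt Φ (Φz w) w) (hΦz_cont : ContinuousOn Φz (closure (W.Ω t)))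
    -- `Z` is absolutely continuous
    (hZ : AbsolutelyContinuousOnInterval (W.Z t Φ) (-1) 1) :
    -- the formula for `A₁` and the bound `A₁ ≥ 1`, wherever `Z_{,α'}` is finite
    (∀ x ∈ CornerWave.I, W.IsRegularPoint t (W.hinv t Φ x) → Φz (W.Z t Φ x) ≠ 0 →
      HasDerivWithinAt (W.Z t Φ) (1 / Φz (W.Z t Φ x)) CornerWave.I x ∧
      CornerWave.HilbertExists (W.ZtbarDeriv t Φ) x ∧
      CornerWave.HilbertExists (fun y => W.Zt t Φ y * W.ZtbarDeriv t Φ y) x ∧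
      W.A₁ t Φ x = 1 + (-CornerWave.hilbertComm (W.Zt t Φ) (W.ZtbarDeriv t Φ) x).im ∧
      MeasureTheory.IntegrableOn (fun y => ‖W.Zt t Φ x - W.Zt t Φ y‖ ^ 2 /
        Real.sin (Real.pi / 2 * (x - y)) ^ 2) CornerWave.I ∧
      (-CornerWave.hilbertComm (W.Zt t Φ) (W.ZtbarDeriv t Φ) x).im =
        Real.pi / 8 * ∫ y in CornerWave.I, ‖W.Zt t Φ x - W.Zt t Φ y‖ ^ 2 /
          Real.sin (Real.pi / 2 * (x - y)) ^ 2 ∧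
      1 ≤ W.A₁ t Φ x) ∧
    -- the formula for the Taylor coefficient, and the degenerate Taylor stability criterion
    (∀ α ∈ CornerWave.I, W.IsRegularPoint t α →
      0 ≤ -W.dPdn t α ∧
      -W.dPdn t α = ‖W.zα t α‖ * W.a t α ∧
      W.gradP t (W.z t α) = (W.dPdn t α : ℂ) * W.normal t α ∧
      (Φz (W.z t α) ≠ 0 →
        -W.dPdn t α = W.A₁ t Φ (W.h t Φ α) / ‖W.Zα t Φ (W.h t Φ α)‖ ∧ 0 < -W.dPdn t α)) ∧
    -- if `A₁` is bounded, then `∇P` vanishes exactly where the Riemann mapping degenerates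
    ((∃ C : ℝ, ∀ x ∈ CornerWave.I, W.IsRegularPoint t (W.hinv t Φ x) → Φz (W.Z t Φ x) ≠ 0 →
        W.A₁ t Φ x ≤ C) →
      ∀ α ∈ CornerWave.I, W.gradP t (W.z t α) = 0 ↔ Φz (W.z t α) = 0) ∧
    -- degeneracy at non-right angles at the walls; `d` points along the surface away from the wall
    (∀ σ ∈ ({-1, 1} : Set ℝ), ∀ d : ℂ, d ≠ 0 →
      HasDerivWithinAt (W.z t) (-(σ : ℂ) * d) CornerWave.I σ →
      (InnerProductGeometry.angle d (-Complex.I) ≠ Real.pi / 2 →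
        Φz (W.z t σ) = 0 ∧ W.gradP t (W.z t σ) = 0 ∧ W.dPdn t σ = 0) ∧
      (InnerProductGeometry.angle d (-Complex.I) = Real.pi / 2 →
        (∃ δ > 0, CornerWave.IsC1HolderArc (W.z t)
          (CornerWave.I ∩ Set.Icc (σ - δ) (σ + δ))) →
        Φz (W.z t σ) ≠ 0 ∧ W.gradP t (W.z t σ) ≠ 0 ∧ 0 < -W.dPdn t σ)) ∧
    -- degeneracy at angled crests in the middle of the surface, where two arcs meet at an angle
    -- other than `π`
    (∀ α ∈ Set.Ioo (-1 : ℝ) 1, ∀ dl dr : ℂ, dl ≠ 0 → dr ≠ 0 →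
      HasDerivWithinAt (W.z t) dl (Set.Iic α) α → HasDerivWithinAt (W.z t) dr (Set.Ici α) α →
      (InnerProductGeometry.angle (-dl) dr ≠ Real.pi →
        Φz (W.z t α) = 0 ∧ W.gradP t (W.z t α) = 0) ∧
      (InnerProductGeometry.angle (-dl) dr = Real.pi →
        (∃ δ > 0, CornerWave.IsC1HolderArc (W.z t) (Set.Icc (α - δ) α) ∧
          CornerWave.IsC1HolderArc (W.z t) (Set.Icc α (α + δ))) →
        Φz (W.z t α) ≠ 0 ∧ W.gradP t (W.z t α) ≠ 0)) := by
  obtain ⟨S, H⟩ := CornerWave.WaterWave.exists_stripData ht hΦ hΦz hΦz_cont hZ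
  have hone : ∀ α, W.IsRegularPoint t α → Φz (W.z t α) ≠ 0 → 1 ≤ W.A₁ t Φ (W.h t Φ α) :=
    fun α hα h0 => by
      rw [CornerWave.WaterWave.A₁_eq_integral ht hΦ hΦz hΦz_cont H hα h0]
      exact StripWave.StripData.one_le_coeff
  refine ⟨?_, ?_, ?_, ?_, ?_⟩
  · intro x hx hreg h0
    have hα := W.hinv_mem ht hΦ hx
    have hhx := W.h_hinv ht hΦ hx
    have h1 := CornerWave.WaterWave.hasDerivWithinAt_Z ht hΦ hΦz hΦz_cont H hα h0
    have h2 := CornerWave.WaterWave.hilbert_statement ht hΦ hΦz hΦz_cont H hα h0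
    have h3 := CornerWave.WaterWave.A₁_eq_integral ht hΦ hΦz hΦz_cont H hreg h0
    have h4 := hone _ hreg h0
    rw [hhx] at h1 h2 h3 h4
    obtain ⟨a, b, c, e⟩ := h2
    obtain ⟨u, v⟩ := CornerWave.WaterWave.setIntegral_eq ht hΦ hx c
    refine ⟨by rwa [one_div], a, b, by rw [h3, e], u, by rw [e, v], h4⟩
  · intro α hα hreg
    have h1 := CornerWave.WaterWave.neg_dPdn_eq ht hΦ hΦz hΦz_cont H hreg
    have hz : ‖W.zα t α‖ ≠ 0 := by simpa using hreg.2.2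
    refine ⟨by rw [h1]; exact norm_nonneg _, ?_,
      CornerWave.WaterWave.gradP_eq ht hΦ hΦz hΦz_cont H hreg, fun h0 => ?_⟩
    · rw [CornerWave.WaterWave.a]
      field_simp
    · obtain ⟨h2, h3⟩ := CornerWave.WaterWave.A₁_eq ht hΦ hΦz hΦz_cont H hreg h0
      have h4 : 0 < ‖Φz (W.z t α)‖ := norm_pos_iff.2 h0
      rw [h1, h3, norm_inv, div_inv_eq_mul, h2, ← h2]
      exact ⟨rfl, mul_pos (zero_lt_one.trans_le (hone α hreg h0)) h4⟩
  · rintro ⟨C, hC⟩ α hα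
    refine ⟨fun h0 => ?_, fun h0 =>
      CornerWave.WaterWave.gradP_eq_zero_of_bounded ht hΦ hΦz hΦz_cont H hC hα h0⟩
    have := CornerWave.WaterWave.norm_Φz_le ht hΦ hΦz hΦz_cont H hα
    rw [h0, norm_zero] at this
    exact norm_le_zero_iff.1 this
  · intro σ hσ d hd0 hd
    exact CornerWave.WaterWave.corner_statement ht hΦ hΦz hΦz_cont H hσ hd0 hd
  · intro α hα dl dr hdl0 hdr0 hdl hdr
    exact CornerWave.WaterWave.crest_statement ht hΦ hΦz hΦz_cont H hα hdl0 hdr0 hdl hdr
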